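/- Let $V$ be a finite-dimensional real vector space with a lattice $\Lambda\subset V$, let $G=\hom(\Lambda,S^1)$ be the compact torus with character group $\Lambda$ and Lie algebra $\mathfrak g=V^*$; $e^x\in G$ ($x\in\mathfrak g$) is the character $\lambda\mapsto e^{i\langle \lambda,x\rangle}$. Let $X$ be a finite sequence of non-zero elements of $\Lambda$, and $M_X=\bigoplus_{a\in X}L_a$, where $L_a=\mathbb C$ with $G$ acting through the character $a$. For $x\in \mathfrak g$ let $v_x$ be the vector field $v_x(z)=\frac{d}{d\epsilon}\exp(-\epsilon x)z|_{\epsilon=0}$ on $M_X$ and $\iota_x$ the contraction by $v_x$. *Cohomology.* Let $\mathcal A^{\infty,m}_{G,c}(M_X)$ be the space of smooth maps $\alpha$ from $\mathfrak g$ to complex $G$-invariant differential forms on $M_X$, with the supports of all $\alpha(x)$ contained in one compact set, such that every derivative (in $x$ and $z$) of the coefficients of $\alpha(x)$ has at most polynomial growth in $x$, uniformly in $z$. With $D\alpha(x)=d\alpha(x)-\iota_x\alpha(x)$, let $$\mathcal H^{\infty,m}_{G,c}(M_X)=\{\alpha\in \mathcal A^{\infty,m}_{G,c}(M_X): D\alpha=0\}/(D\nu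 : \nu\in\mathcal A^{\infty,m}_{G,c}(M_X)).$$ *Thom class.* $\mathrm{Thom}(M_X)$ is the class of an equivariantly closed form $\tau(x)$ with compact support, $G$-invariant and depending polynomially on $x$, with $\int_{M_X}\tau(x)=1$ for all $x$, where $M_X$ has the orientation given by its complex structure. *Chern character.* Let $\mathcal E^{\pm}$ be $G$-equivariant complex vector bundles on $M_X$ and $\Sigma:\mathcal E^+\to\mathcal E^-$ a $G$-equivariant morphism whose support (the set of points where it is not invertible) is compact. Choose an open neighborhood $U$ of the support with compact closure, $G$-invariant Hermitian structures on $\mathcal E^\pm$ for which $\Sigma$ is an isometry outside $U$, and $G$-invariant Hermitian connections $\nabla^\pm$ with $\nabla^-\circ\Sigma=\Sigma\circ\nabla^+$ outside $U$. Let $F^\pm$ be their curvatures and $j^\pm(x)=\mathcal L_x-\nabla^{\pm}_{v_x}$ their moments. Then $\mathrm{ch}(\Sigma)$ is the class of $\mathrm{Tr}(e^{j^+(x)+F^+})-\mathrm{Tr}(e^{j^-(x)+F^-})$. *Bott symbol.* For a $G$-invariant Hermitian structure on $M_X$, $\mathrm{Bott}(M_X)$ is given by the morphism $c(z)=m(z)-m(z)^*$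 from $M_X\times\bigwedge^{\rm even}M_X$ to $M_X\times\bigwedge^{\rm odd}M_X$, where $m(z)\omega=z\wedge\omega$ and $m(z)^*$ is the adjoint for the induced Hermitian structure. **Proposition.** Such data $(U,\nabla^\pm,\dots)$ for $\mathrm{Bott}(M_X)$ and such forms $\tau$ exist. For every choice of the $G$-invariant Hermitian structure on $M_X$, of these data and of $\tau$, the Chern character form of $\mathrm{Bott}(M_X)$ and the form $(2i\pi)^{|X|}\prod_{a\in X}\frac{e^{i\langle a,x\rangle}-1}{i\langle a,x\rangle}\,\tau(x)$ are closed elements of $\mathcal A^{\infty,m}_{G,c}(M_X)$, and they have the same class: $$\mathrm{ch}(\mathrm{Bott}(M_X))(x)=(2i\pi)^{|X|}\prod_{a\in X}\frac{e^{i\langle a,x\rangle}-1}{i\langle a,x\rangle}\,\mathrm{Thom}(M_X)(x)\quad\text{in }\mathcal H^{\infty,m}_{G,c}(M_X).$$ That is, the difference of the two forms is $D\nu$ with a compactly supported $\nu$ of moderate growth. Here $(e^{i\theta}-1)/(i\theta)$ is the entire function, equal to $1$ at $\theta=0$. -/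

import Mathlib

open scoped ContDiff ComplexOrder Matrix

noncomputable section

namespace EquivCoh

variable {V : Type*} [NormedAddCommGroup V] [NormedSpace ℝ V] {Λ : Submodule ℤ V} {n : ℕ}

/-! ### The torus and its linear representations

`Λ` is a lattice in `V`, the torus is the group `G = AddChar Λ Circle` of characters of `Λ`, and its
Lie algebra is the dual `𝔤 = StrongDual ℝ V` of `V`; `x : 𝔤` exponentiates to the character
`a ↦ exp (i ⟨a, x⟩)`.  A finite family `w : p → Λ` of weights gives the representation
`⨁ i, L_{w i}` of `G` on `p → ℂ`. For `p = Fin n` and `w = X` this is `M_X`, with underlying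
space `Fin n → ℂ`. -/

/-- The action of `g ∈ G` on `⨁ i, L_{w i}`. -/
def grpAct {p : Type*} [DecidableEq p] (w : p → Λ) (g : AddChar Λ Circle) : Matrix p p ℂ :=
  Matrix.diagonal fun i => (g (w i) : ℂ)

/-- The infinitesimal action of `x ∈ 𝔤` on `⨁ i, L_{w i}`. -/
def lieAct {p : Type*} [DecidableEq p] (w : p → Λ) (x : StrongDual ℝ V) : Matrix p p ℂ :=
  Matrix.diagonal fun i => Complex.I * ((x (w i : V) : ℝ) : ℂ)

/-- The action of `g ∈ G` on the real manifold `M_X`. -/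
def act (X : Fin n → Λ) (g : AddChar Λ Circle) : (Fin n → ℂ) →L[ℝ] (Fin n → ℂ) :=
  ContinuousLinearMap.pi fun i =>
    (g (X i) : ℂ) • (ContinuousLinearMap.proj i : (Fin n → ℂ) →L[ℝ] ℂ)

/-- The vector field `v_x = d/dε exp(-εx) z |_{ε = 0}` on `M_X`. -/
def vecField (X : Fin n → Λ) (x : StrongDual ℝ V) (z : Fin n → ℂ) : Fin n → ℂ :=
  -(lieAct X x *ᵥ z)

/-! ### The Cartan complex with moderate growth -/

/-- Complex differential forms on `M_X` (all degrees together) depending on `x ∈ 𝔤`: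
`α x k` is the component of degree `k` of `α(x)`. -/
def EquivForm (V : Type*) [NormedAddCommGroup V] [NormedSpace ℝ V] (n : ℕ) : Type _ :=
  StrongDual ℝ V → ∀ k : ℕ, (Fin n → ℂ) → (Fin n → ℂ) [⋀^Fin k]→L[ℝ] ℂ

instance : AddCommGroup (EquivForm V n) :=
  inferInstanceAs (AddCommGroup
    (StrongDual ℝ V → ∀ k : ℕ, (Fin n → ℂ) → (Fin n → ℂ) [⋀^Fin k]→L[ℝ] ℂ))

instance : Module ℂ (EquivForm V n) where
  smul c α := fun x k z => c • α x k z
  one_smul α := by funext x k z; exact one_smul ℂ (α x k z)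
  mul_smul c d α := by funext x k z; exact mul_smul c d (α x k z)
  smul_zero c := by
    funext x k z
    change c • (0 : (Fin n → ℂ) [⋀^Fin k]→L[ℝ] ℂ) = 0
    ext; simp
  smul_add c α β := by funext x k z; exact smul_add c (α x k z) (β x k z)
  add_smul c d α := by funext x k z; exact add_smul c d (α x k z)
  zero_smul α := by funext x k z; exact zero_smul ℂ (α x k z)

@[simp] theorem EquivForm.zero_apply (x : StrongDual ℝ V) (k : ℕ) :
    (0 : EquivForm V n) x k = 0 := rfl

@[simp] theorem EquivForm.add_apply (α β : EquivForm V n) (x : StrongDual ℝ V) (k : ℕ) :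
    (α + β) x k = α x k + β x k := rfl

@[simp] theorem EquivForm.smul_apply (c : ℂ) (α : EquivForm V n) (x : StrongDual ℝ V) (k : ℕ) :
    (c • α) x k = c • α x k := rfl

/-- The equivariant differential `(Dα)(x) = d(α(x)) - ι_x (α(x))`. -/
def equivD (X : Fin n → Λ) (α : EquivForm V n) : EquivForm V n := fun x k z =>
  match k with
  | 0 => -(α x 1 z).curryLeft (vecField X x z)
  | k + 1 => extDeriv (α x k) z - (α x (k + 2) z).curryLeft (vecField X x z)

theorem equivD_succ (X : Fin n → Λ) (α : EquivForm V n) (x : StrongDual ℝ V) (k : ℕ)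
    (z : Fin n → ℂ) : equivD X α x (k + 1) z =
      extDeriv (α x k) z - (α x (k + 2) z).curryLeft (vecField X x z) := rfl

/-- `α(x)` is a `G`-invariant form for every `x`
(this is equivariance of `α`, since `G` is abelian). -/
def IsInvariant (X : Fin n → Λ) (α : EquivForm V n) : Prop :=
  ∀ (g : AddChar Λ Circle) (x : StrongDual ℝ V) (k : ℕ) (z : Fin n → ℂ),
    (α x k (act X g z)).compContinuousLinearMap (act X g) = α x k z

/-- Equivariant forms `α : 𝔤 → 𝒜_c(M_X)` which are smooth and of moderate growth: the supports of
all the `α(x)` lie in one compact set, and every derivative of the coefficients (in `x` and `z`)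
grows at most polynomially in `x` (temperate growth in `(x, z)` amounts to this, as `z` stays in a
compact set). -/
def moderateForms (X : Fin n → Λ) : Submodule ℂ (EquivForm V n) where
  carrier := {α |
    (∀ k, Function.HasTemperateGrowth
      fun q : StrongDual ℝ V × (Fin n → ℂ) => α q.1 k q.2) ∧
    (∃ K : Set (Fin n → ℂ), IsCompact K ∧ ∀ x k, ∀ z ∉ K, α x k z = 0) ∧
    IsInvariant X α}
  zero_mem' := by
    refine ⟨fun k => ?_, ⟨∅, isCompact_empty, fun _ _ _ _ => rfl⟩, fun g x k z => ?_⟩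
    · exact Function.HasTemperateGrowth.zero
    · ext; simp
  add_mem' := by
    rintro α β ⟨h1, ⟨K, hK, h2⟩, h3⟩ ⟨h1', ⟨K', hK', h2'⟩, h3'⟩
    refine ⟨fun k => (h1 k).add (h1' k), ⟨K ∪ K', hK.union hK', fun x k z hz => ?_⟩,
      fun g x k z => ?_⟩
    · simp only [Set.mem_union, not_or] at hz
      simp [h2 x k z hz.1, h2' x k z hz.2]
    · have e1 := h3 g x k z
      have e2 := h3' g x k z
      ext v
      have e1 := congrArg (fun f => f v) e1
      have e2 := congrArg (fun f => f v) e2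
      simp only [ContinuousAlternatingMap.compContinuousLinearMap_apply] at e1 e2 ⊢
      simp [e1, e2]
  smul_mem' := by
    rintro c α ⟨h1, ⟨K, hK, h2⟩, h3⟩
    refine ⟨fun k => ?_, ⟨K, hK, fun x k z hz => by
      rw [EquivForm.smul_apply, Pi.smul_apply, h2 x k z hz]; ext; simp⟩, fun g x k z => ?_⟩
    · exact (Function.HasTemperateGrowth.const c).smul (h1 k)
    · have e1 := h3 g x k z
      ext v
      have e1 := congrArg (fun f => f v) e1
      simp only [ContinuousAlternatingMap.compContinuousLinearMap_apply] at e1 ⊢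
      simp [e1]

theorem moderateForms_differentiableAt {X : Fin n → Λ} {α : EquivForm V n}
    (h : α ∈ moderateForms X) (x : StrongDual ℝ V) (k : ℕ) (z : Fin n → ℂ) :
    DifferentiableAt ℝ (α x k) z := by
  have h1 : ContDiff ℝ ∞ fun z => α x k z :=
    (h.1 k).1.comp (contDiff_const.prodMk contDiff_id)
  exact h1.differentiable (by simp) z

theorem equivD_zero (X : Fin n → Λ) : equivD X (0 : EquivForm V n) = 0 := by
  funext x k z
  rcases k with _ | k
  · ext; simp [equivD]
  · have : extDeriv ((0 : EquivForm V n) x k) z = 0 := by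
      simpa using extDeriv_smul (x := z) (0 : ℝ) ((0 : EquivForm V n) x k)
    simp only [equivD, this]
    ext; simp

theorem equivD_add {X : Fin n → Λ} {α β : EquivForm V n} (hα : α ∈ moderateForms X)
    (hβ : β ∈ moderateForms X) : equivD X (α + β) = equivD X α + equivD X β := by
  funext x k z
  rcases k with _ | k
  · ext; simp [equivD]; ring
  · have := extDeriv_add (moderateForms_differentiableAt hα x k z)
      (moderateForms_differentiableAt hβ x k z)
    rw [EquivForm.add_apply, Pi.add_apply, equivD_succ, equivD_succ, equivD_succ,
      EquivForm.add_apply, this]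
    ext; simp; ring

theorem extDeriv_complex_smul {k : ℕ} (c : ℂ)
    {α : (Fin n → ℂ) → (Fin n → ℂ) [⋀^Fin k]→L[ℝ] ℂ} {z : Fin n → ℂ}
    (h : DifferentiableAt ℝ α z) : extDeriv (c • α) z = c • extDeriv α z := by
  ext v
  have h' : DifferentiableAt ℝ (c • α) z := h.const_smul c
  rw [extDeriv_apply h', ContinuousAlternatingMap.smul_apply, extDeriv_apply h, Finset.smul_sum]
  refine Finset.sum_congr rfl fun i _ => ?_
  have hd : DifferentiableAt ℝ (fun y => α y (i.removeNth v)) z := by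
    have := h.hasFDerivAt
    fun_prop
  have : fderiv ℝ (fun y => (c • α) y (i.removeNth v)) z =
      c • fderiv ℝ (fun y => α y (i.removeNth v)) z :=
    fderiv_const_smul hd c
  rw [this, _root_.smul_apply, smul_comm]

theorem equivD_smul {X : Fin n → Λ} (c : ℂ) {α : EquivForm V n} (hα : α ∈ moderateForms X) :
    equivD X (c • α) = c • equivD X α := by
  funext x k z
  rcases k with _ | k
  · ext; simp [equivD]
  · have := extDeriv_complex_smul c (moderateForms_differentiableAt hα x k z)
    rw [EquivForm.smul_apply, Pi.smul_apply, equivD_succ, equivD_succ,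
      EquivForm.smul_apply, this]
    ext; simp [mul_sub]

/-- The equivariantly closed forms of moderate growth with compact support. -/
def closedForms (X : Fin n → Λ) : Submodule ℂ (EquivForm V n) where
  carrier := {α | α ∈ moderateForms X ∧ equivD X α = 0}
  zero_mem' := ⟨zero_mem _, equivD_zero X⟩
  add_mem' := fun ⟨h1, h2⟩ ⟨h1', h2'⟩ =>
    ⟨add_mem h1 h1', by rw [equivD_add h1 h1', h2, h2', add_zero]⟩
  smul_mem' := fun c _ ⟨h1, h2⟩ =>
    ⟨Submodule.smul_mem _ c h1, by rw [equivD_smul c h1, h2, smul_zero]⟩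

/-- The forms `D ν` with `ν` of moderate growth with compact support. -/
def exactForms (X : Fin n → Λ) : Submodule ℂ (EquivForm V n) where
  carrier := {α | ∃ ν ∈ moderateForms X, equivD X ν = α}
  zero_mem' := ⟨0, zero_mem _, equivD_zero X⟩
  add_mem' := fun ⟨ν, h, e⟩ ⟨ν', h', e'⟩ =>
    ⟨ν + ν', add_mem h h', by rw [equivD_add h h', e, e']⟩
  smul_mem' := fun c _ ⟨ν, h, e⟩ =>
    ⟨c • ν, Submodule.smul_mem _ c h, by rw [equivD_smul c h, e]⟩

/-- The cohomology `ℋ^{∞,m}_{G,c}(M_X)` with compact support and moderate growth. -/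
abbrev ModerateCohomology (X : Fin n → Λ) : Type _ :=
  closedForms X ⧸ (exactForms X).submoduleOf (closedForms X)

/-- The class in `ℋ^{∞,m}_{G,c}(M_X)` of a closed form. -/
def cohClass (X : Fin n → Λ) (α : EquivForm V n) (h : α ∈ closedForms X) :
    ModerateCohomology X :=
  Submodule.Quotient.mk ⟨α, h⟩

/-! ### Thom forms -/

/-- The real frame `e₀, i e₀, e₁, i e₁, …` of `ℂⁿ`, positive for the complex orientation. -/
def realFrame (n : ℕ) (j : Fin (2 * n)) : Fin n → ℂ :=
  Pi.single ⟨j.1 / 2, by omega⟩ (if j.1 % 2 = 0 then 1 else Complex.I)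

/-- The integral over `M_X`, with its complex orientation, of a differential form
of top degree `2n`. -/
def integralForm (α : (Fin n → ℂ) → (Fin n → ℂ) [⋀^Fin (2 * n)]→L[ℝ] ℂ) : ℂ :=
  ∫ z, α z (realFrame n)

/-- `τ` represents the Thom class of `M_X`: it is an invariant equivariantly closed form
`∑ l, P_l(x) β_l`, with polynomials `P_l` on `𝔤` and compactly supported smooth forms `β_l`, whose
equivariant integral is identically `1`. -/
structure IsThomForm (X : Fin n → Λ) (τ : EquivForm V n) : Prop where
  polynomial : ∃ (m : ℕ) (P : Fin m → MvPolynomial V ℂ)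
    (β : Fin m → ∀ k : ℕ, (Fin n → ℂ) → (Fin n → ℂ) [⋀^Fin k]→L[ℝ] ℂ),
    (∀ l k, ContDiff ℝ ∞ (β l k) ∧ HasCompactSupport (β l k)) ∧
    ∀ x k z, τ x k z = ∑ l, MvPolynomial.eval (fun v : V => ((x v : ℝ) : ℂ)) (P l) • β l k z
  invariant : IsInvariant X τ
  closed : equivD X τ = 0
  integral_eq_one : ∀ x, integralForm (τ x (2 * n)) = 1

/-! ### Exterior products and matrices of forms at a point -/

/-- The exterior product of alternating forms,
`(α ∧ β)(v) = 1/(k! l!) ∑ σ, sign σ α(v_{σ 1}, …, v_{σ k}) β(v_{σ (k+1)}, …, v_{σ (k+l)})`. -/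
def wedge {k l m : ℕ} (h : k + l = m) (α : (Fin n → ℂ) [⋀^Fin k]→L[ℝ] ℂ)
    (β : (Fin n → ℂ) [⋀^Fin l]→L[ℝ] ℂ) : (Fin n → ℂ) [⋀^Fin m]→L[ℝ] ℂ :=
  ((k.factorial * l.factorial : ℕ) : ℝ)⁻¹ •
    ContinuousMultilinearMap.alternatization
      { toMultilinearMap :=
          ((LinearMap.mul' ℝ ℂ).compMultilinearMap
            (MultilinearMap.domCoprod α.toMultilinearMap β.toMultilinearMap)).domDomCongr
              (finSumFinEquiv.trans (finCongr h))
        cont := by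
          have : Continuous fun v : Fin m → Fin n → ℂ =>
              α (fun i => v (Fin.cast h (Fin.castAdd l i))) *
                β (fun j => v (Fin.cast h (Fin.natAdd k j))) := by
            refine (α.cont.comp ?_).mul (β.cont.comp ?_) <;> fun_prop
          exact this }

theorem wedge_apply {k l m : ℕ} (h : k + l = m) (α : (Fin n → ℂ) [⋀^Fin k]→L[ℝ] ℂ)
    (β : (Fin n → ℂ) [⋀^Fin l]→L[ℝ] ℂ) (v : Fin m → Fin n → ℂ) :
    wedge h α β v = ((k.factorial * l.factorial : ℕ) : ℝ)⁻¹ •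
      ∑ s : Equiv.Perm (Fin m), Equiv.Perm.sign s •
        (α (fun i => v (s (Fin.cast h (Fin.castAdd l i)))) *
          β (fun j => v (s (Fin.cast h (Fin.natAdd k j))))) := by
  rw [wedge, ContinuousAlternatingMap.smul_apply,
    ContinuousMultilinearMap.alternatization_apply_apply]
  rfl

/-- Elements `∑ k, α k` of the exterior algebra of the complexified cotangent space. -/
abbrev MixedForm (n : ℕ) : Type := ∀ k : ℕ, (Fin n → ℂ) [⋀^Fin k]→L[ℝ] ℂ

/-- The exterior product of forms of mixed degree. -/
def mixedWedge (α β : MixedForm n) : MixedForm n := fun k =>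
  ∑ q ∈ (Finset.HasAntidiagonal.antidiagonal k).attach,
    wedge (Finset.HasAntidiagonal.mem_antidiagonal.1 q.2) (α q.1.1) (β q.1.2)

/-- The powers of a square matrix with entries in the exterior algebra. -/
def formMatrixPow {p : Type*} [Fintype p] [DecidableEq p] (Ω : p → p → MixedForm n) :
    ℕ → p → p → MixedForm n
  | 0, i, j, 0 => ContinuousAlternatingMap.constOfIsEmpty ℝ (Fin n → ℂ) (Fin 0)
      (if i = j then 1 else 0)
  | 0, _, _, _ + 1 => 0
  | m + 1, i, j, k => ∑ r, mixedWedge (Ω i r) (formMatrixPow Ω m r j) k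

/-- The trace `Tr (e^Ω)`. -/
def traceExp {p : Type*} [Fintype p] [DecidableEq p] (Ω : p → p → MixedForm n) : MixedForm n :=
  fun k => ∑' m : ℕ, ((m.factorial : ℝ)⁻¹) • ∑ i, formMatrixPow Ω m i i k

/-! ### Hermitian metrics, connections, Chern characters

These are for the equivariant vector bundle `M_X × ⨁ i, L_{w i}` over `M_X`. -/

/-- The derivative at `z` in the direction `v` of a matrix valued function. -/
def matDeriv {p q : Type*} (f : (Fin n → ℂ) → Matrix p q ℂ) (z v : Fin n → ℂ) : Matrix p q ℂ :=
  Matrix.of fun i j => fderiv ℝ (fun y => f y i j) z v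

/-- A smooth `G`-invariant Hermitian structure `⟨u, u'⟩_z = uᴴ (h z) u'`. -/
structure InvMetric {p : Type*} [Fintype p] [DecidableEq p] (X : Fin n → Λ) (w : p → Λ) where
  h : (Fin n → ℂ) → Matrix p p ℂ
  smooth : ∀ i j, ContDiff ℝ ∞ fun z => h z i j
  posDef : ∀ z, (h z).PosDef
  invariant : ∀ g z, (grpAct w g)ᴴ * h (act X g z) * grpAct w g = h z

/-- A smooth `G`-invariant connection `∇ = d + A` which is Hermitian with respect to `h`. -/
structure InvConnection {p : Type*} [Fintype p] [DecidableEq p] (X : Fin n → Λ) (w : p → Λ)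
    (h : InvMetric X w) where
  A : (Fin n → ℂ) → (Fin n → ℂ) →ₗ[ℝ] Matrix p p ℂ
  smooth : ∀ v i j, ContDiff ℝ ∞ fun z => A z v i j
  invariant : ∀ g z v, A (act X g z) (act X g v) * grpAct w g = grpAct w g * A z v
  hermitian : ∀ z v, matDeriv h.h z v = (A z v)ᴴ * h.h z + h.h z * A z v

section Curvature

variable {p : Type*} [Fintype p] [DecidableEq p]

/-- The moment `j(x) = ℒ_x - ∇_{v_x}` of `∇ = d + A`. On sections
`ℒ_x s = v_x s + (infinitesimal action of x) s`, so `d` cancels. -/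
def moment (X : Fin n → Λ) (w : p → Λ) (A : (Fin n → ℂ) → (Fin n → ℂ) →ₗ[ℝ] Matrix p p ℂ)
    (x : StrongDual ℝ V) (z : Fin n → ℂ) : Matrix p p ℂ :=
  lieAct w x - A z (vecField X x z)

/-- The entries of the connection form, as differential `1`-forms. -/
def entryForm (A : (Fin n → ℂ) → (Fin n → ℂ) →ₗ[ℝ] Matrix p p ℂ) (i j : p) (z : Fin n → ℂ) :
    (Fin n → ℂ) [⋀^Fin 1]→L[ℝ] ℂ :=
  ContinuousAlternatingMap.ofSubsingleton ℝ (Fin n → ℂ) ℂ (0 : Fin 1)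
    (LinearMap.toContinuousLinearMap (Matrix.entryLinearMap ℝ ℂ i j ∘ₗ A z))

/-- The entries of the curvature `F = dA + A ∧ A`. -/
def curvature (A : (Fin n → ℂ) → (Fin n → ℂ) →ₗ[ℝ] Matrix p p ℂ) (i j : p) (z : Fin n → ℂ) :
    (Fin n → ℂ) [⋀^Fin 2]→L[ℝ] ℂ :=
  extDeriv (entryForm A i j) z +
    ∑ r, wedge (by norm_num) (entryForm A i r z) (entryForm A r j z)

/-- The equivariant curvature `j(x) + F`. -/
def equivCurvature (X : Fin n → Λ) (w : p → Λ)
    (A : (Fin n → ℂ) → (Fin n → ℂ) →ₗ[ℝ] Matrix p p ℂ) (x : StrongDual ℝ V) (z : Fin n → ℂ)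
    (i j : p) : MixedForm n
  | 0 => ContinuousAlternatingMap.constOfIsEmpty ℝ (Fin n → ℂ) (Fin 0) (moment X w A x z i j)
  | 2 => curvature A i j z
  | _ => 0

/-- The equivariant Chern character form `ch(ℰ, ∇)(x) = Tr (e^{j(x) + F})`. -/
def chernForm (X : Fin n → Λ) (w : p → Λ)
    (A : (Fin n → ℂ) → (Fin n → ℂ) →ₗ[ℝ] Matrix p p ℂ) : EquivForm V n :=
  fun x k z => traceExp (equivCurvature X w A x z) k

end Curvature

/-! ### Morphisms of trivial equivariant bundles and adapted connections -/

/-- The support of a bundle morphism: the points where it is not invertible. -/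
def morphismSupport {p q : Type*} [Fintype p] (Sig : (Fin n → ℂ) → Matrix q p ℂ) :
    Set (Fin n → ℂ) :=
  {z | ¬ Function.Bijective (Sig z).mulVec}

/-- The choices made in the construction of the Chern character of a `G`-equivariant morphism
`Σ : ℰ⁺ → ℰ⁻` with compact support, where `ℰ⁺ = M_X × ⨁ i, L_{w i}` and
`ℰ⁻ = M_X × ⨁ i, L_{w' i}`: a relatively compact neighborhood `U` of the support of `Σ`, invariant
Hermitian structures for which `Σ` is an isometry outside `U`, and
invariant Hermitian connections with `∇⁻ ∘ Σ = Σ ∘ ∇⁺` outside `U`. -/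
structure AdaptedPair {p q : Type*} [Fintype p] [DecidableEq p] [Fintype q] [DecidableEq q]
    (X : Fin n → Λ) (w : p → Λ) (w' : q → Λ) (Sig : (Fin n → ℂ) → Matrix q p ℂ) where
  U : Set (Fin n → ℂ)
  isOpen : IsOpen U
  support_subset : morphismSupport Sig ⊆ U
  isCompact : IsCompact (closure U)
  hPlus : InvMetric X w
  hMinus : InvMetric X w'
  isometry : ∀ z ∉ U, (Sig z)ᴴ * hMinus.h z * Sig z = hPlus.h z
  conPlus : InvConnection X w hPlus
  conMinus : InvConnection X w' hMinus
  adapted : ∀ z ∉ U, ∀ v, matDeriv Sig z v + conMinus.A z v * Sig z = Sig z * conPlus.A z v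

/-- The form `ch(ℰ⁺, ∇⁺) - ch(ℰ⁻, ∇⁻)`, which represents `ch(Σ)`. -/
def AdaptedPair.ch {p q : Type*} [Fintype p] [DecidableEq p] [Fintype q] [DecidableEq q]
    {X : Fin n → Λ} {w : p → Λ} {w' : q → Λ} {Sig : (Fin n → ℂ) → Matrix q p ℂ}
    (P : AdaptedPair X w w' Sig) : EquivForm V n :=
  chernForm X w P.conPlus.A - chernForm X w' P.conMinus.A

/-! ### The Bott symbol

The exterior algebra `⋀ M_X` has the basis `e_S = e_{s₁} ∧ ⋯ ∧ e_{s_k}` (`s₁ < ⋯ < s_k`) indexed by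
the subsets `S = {s₁, …, s_k}` of `Fin n`, and `e_S` has weight `∑ a ∈ S, X a`. -/

/-- Exterior multiplication `m(z) : α ↦ z ∧ α` on `⋀ M_X`. -/
def extMul (z : Fin n → ℂ) : Matrix (Finset (Fin n)) (Finset (Fin n)) ℂ :=
  Matrix.of fun T S => ∑ i, if i ∉ S ∧ T = insert i S then
    (-1) ^ (S.filter (· < i)).card * z i else 0

/-- Contraction on `⋀ M_X` with the linear form `φ` on `M_X`. -/
def intMul (φ : Fin n → ℂ) : Matrix (Finset (Fin n)) (Finset (Fin n)) ℂ :=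
  Matrix.of fun T S => ∑ i, if i ∈ S ∧ T = S.erase i then
    (-1) ^ (S.filter (· < i)).card * φ i else 0

/-- The Clifford multiplication `c(z) = m(z) - m(z)^*` for the Hermitian structure
`⟨u, u'⟩ = uᴴ H u'` on `M_X`: the adjoint of `m(z)` for the induced Hermitian structure on `⋀ M_X`
is the contraction with the linear form `⟨z, ·⟩`. -/
def clifford (H : Matrix (Fin n) (Fin n) ℂ) (z : Fin n → ℂ) :
    Matrix (Finset (Fin n)) (Finset (Fin n)) ℂ :=
  extMul z - intMul (star z ᵥ* H)

/-- Indices of the basis of `⋀^{even} M_X`. -/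
abbrev EvenIdx (n : ℕ) : Type := {S : Finset (Fin n) // Even S.card}

/-- Indices of the basis of `⋀^{odd} M_X`. -/
abbrev OddIdx (n : ℕ) : Type := {S : Finset (Fin n) // Odd S.card}

/-- The weights of `⋀^{even} M_X`. -/
def evenWeight (X : Fin n → Λ) (S : EvenIdx n) : Λ := ∑ i ∈ S.1, X i

/-- The weights of `⋀^{odd} M_X`. -/
def oddWeight (X : Fin n → Λ) (S : OddIdx n) : Λ := ∑ i ∈ S.1, X i

/-- The Bott symbol `c(z) : ⋀^{even} M_X → ⋀^{odd} M_X`. -/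
def bottSymbol (H : Matrix (Fin n) (Fin n) ℂ) (z : Fin n → ℂ) :
    Matrix (OddIdx n) (EvenIdx n) ℂ :=
  (clifford H z).submatrix Subtype.val Subtype.val

/-- The data defining the Chern character of the Bott symbol of `M_X`. -/
abbrev BottPair (X : Fin n → Λ) (H : Matrix (Fin n) (Fin n) ℂ) : Type _ :=
  AdaptedPair X (evenWeight X) (oddWeight X) (bottSymbol H)

/-! ### The proportionality factor -/

/-- The entire function `(e^{iθ} - 1) / (iθ)` of `θ`. -/
def expQuotient (θ : ℝ) : ℂ :=
  if θ = 0 then 1 else (Complex.exp (Complex.I * θ) - 1) / (Complex.I * θ)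

/-- The form `(2iπ)^{|X|} ∏ a ∈ X, (e^{i⟨a,x⟩} - 1) / (i⟨a,x⟩) · τ(x)`. -/
def bottThomForm (X : Fin n → Λ) (τ : EquivForm V n) : EquivForm V n := fun x k z =>
  ((2 * Complex.I * Real.pi) ^ n * ∏ a, expQuotient (x (X a : V))) • τ x k z

end EquivCoh

end

open EquivCoh

/-!
The forms on the two sides are closed, and a closed equivariant form with compact support on a
representation space is determined up to exact forms by its integral. So it suffices to compute the
integral of the Chern character, and this follows from its value at the fixed point `0`.

*Closed forms and their integrals.* For closed forms `α`, `τ` the form `α(u) ∧ τ(v)` on the product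
of two copies of `M_X` is pulled back by the rotation
`(z, w) ↦ (u, v) = ((1 - s) z + s w, (1 - s) w - s z)`, which commutes with the diagonal action of
the torus, and integrated over `s ∈ [0, 1]` and over `w`. By Stokes' theorem the Cartan differential
of the result is the difference of the boundary terms: at `s = 0` it is `(∫ τ) α`, at `s = 1` it is
`(∫ α) τ` pulled back by `z ↦ -z`. This is `exists_rotation_primitive`. The rotations for
`s ∈ [0, 1]` are uniformly invertible, so the primitive has compact support, and differentiation
under the integral shows that it has moderate growth. There are two consequences. A closed form with
vanishing integral is exact, by comparison with a Thom form
(`mem_exactForms_of_integral_eq_zero`); and since the component of degree `0` of a form `D ν`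
vanishes at the origin, the values of closed forms at the origin are proportional to their integrals
(`apply_zero_eq_integralForm_mul`).

*The Thom form.* On a plane of weight `θ` it is `d (f(|z|²) dφ) + θ f(|z|²)`, where `φ` is the polar
angle and `f` is a profile with compact support and `f(0) = -1 / 2π`, so that the integral is `1`;
on `M_X` the product of these forms is taken (`thomForm`). Its value at the origin
is `∏ a, -⟨a, x⟩ / 2π`.

*The Chern character form.* Matrices of forms of mixed degree are a finite-dimensional algebra, so
`Tr e^Ω` makes sense for the equivariant curvature `Ω = j(x) + F`, and the Bianchi identity
(`cartanM_curvM`) gives closedness (`equivD_chernForm`). Where the two bundles are identified by a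
parallel isometry the two traces agree, so the difference has compact support
(`AdaptedPair.ch_eq_zero`). The moment `j(x)` is skew-Hermitian and linear in `x`; hence
`e^{s j(x)}` is bounded, the nilpotent part `F` changes the bound by a factor independent of `x`
(`norm_exp_curvM_le`), and Duhamel's formula propagates polynomial bounds to all derivatives
(`polyBdd_iteratedFDeriv_exp`). This is moderate growth (`AdaptedPair.ch_mem_closedForms`).

*Comparison.* At the origin the Chern character of the Bott symbol is the alternating character of
the exterior algebra, `∏ a, (1 - e^{i⟨a, x⟩})` (`zeroPart_ch_zero`). Dividing by the value of the
Thom form gives the integral `(2iπ)ⁿ ∏ a, (e^{i⟨a, x⟩} - 1) / (i⟨a, x⟩)` where no weight vanishes.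
These `x` are dense because the weights are non-zero, and both sides are continuous
(`integralForm_ch`).

*Existence of adapted data.* The Clifford relation `c(z)² = -H(z, z)` (`clifford_mul_self`) shows
that the Bott symbol `Σ` is invertible outside the origin. With an invariant cutoff `χ` which is
positive at the origin, the metric `h = Σᴴ Σ + χ` on the even part makes `Σ` an isometry where `χ`
vanishes, and the trivial connection on the odd part corresponds there to the Hermitian connection
`½ h⁻¹ (dh + Σᴴ dΣ - (dΣ)ᴴ Σ)`, which is defined everywhere (`nonempty_adaptedPair`,
`nonempty_bottPair`).
-/

open scoped ContDiff ComplexOrder Matrix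

noncomputable section

namespace EquivCoh

variable {E : Type*} [NormedAddCommGroup E] [NormedSpace ℝ E]
variable {E' : Type*} [NormedAddCommGroup E'] [NormedSpace ℝ E']

/-! ### The exterior product of alternating forms on a normed space -/

/-- The permutation of `Fin (m + 1)` that sends `i` to `0` and acts as `e` on the other points. -/
def insertPerm {m : ℕ} (q : Fin (m + 1) × Equiv.Perm (Fin m)) : Equiv.Perm (Fin (m + 1)) :=
  Equiv.Perm.decomposeFin.symm (0, q.2) * q.1.cycleRange

theorem insertPerm_self {m : ℕ} (i : Fin (m + 1)) (e : Equiv.Perm (Fin m)) :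
    insertPerm (i, e) i = 0 := by
  simp [insertPerm]

theorem insertPerm_succAbove {m : ℕ} (i : Fin (m + 1)) (e : Equiv.Perm (Fin m)) (j : Fin m) :
    insertPerm (i, e) (i.succAbove j) = (e j).succ := by
  simp [insertPerm, Fin.cycleRange_succAbove]

theorem sign_insertPerm {m : ℕ} (i : Fin (m + 1)) (e : Equiv.Perm (Fin m)) :
    Equiv.Perm.sign (insertPerm (i, e)) = (-1) ^ (i : ℕ) * Equiv.Perm.sign e := by
  simp [insertPerm, Fin.sign_cycleRange, mul_comm]

theorem insertPerm_bijective (m : ℕ) : Function.Bijective (insertPerm (m := m)) := by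
  rw [Fintype.bijective_iff_injective_and_card]
  constructor
  · rintro ⟨i, e⟩ ⟨i', e'⟩ h
    have hi : i = i' := by
      apply (insertPerm (i', e')).injective
      rw [insertPerm_self, ← h, insertPerm_self]
    subst hi
    have := mul_right_cancel h
    have := Equiv.Perm.decomposeFin.symm.injective this
    simpa using this
  · simp [Fintype.card_perm, Nat.factorial_succ]

/-- A permutation of `Fin (m + 1)` is determined by the preimage of `0` and a permutation of the
other points. -/
theorem sum_perm_succ {M : Type*} [AddCommMonoid M] {m : ℕ} (f : Equiv.Perm (Fin (m + 1)) → M) :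
    ∑ s, f s = ∑ i : Fin (m + 1), ∑ e : Equiv.Perm (Fin m), f (insertPerm (i, e)) := by
  rw [← Fintype.sum_prod_type']
  exact (Fintype.sum_bijective _ (insertPerm_bijective m) _ _ fun _ => rfl).symm

/-- The exterior product of alternating forms on a normed space, normalized as `wedge`. -/
def extProd {k l m : ℕ} (h : k + l = m) (α : E [⋀^Fin k]→L[ℝ] ℂ) (β : E [⋀^Fin l]→L[ℝ] ℂ) :
    E [⋀^Fin m]→L[ℝ] ℂ :=
  ((k.factorial * l.factorial : ℕ) : ℝ)⁻¹ •
    ContinuousMultilinearMap.alternatization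
      { toMultilinearMap :=
          ((LinearMap.mul' ℝ ℂ).compMultilinearMap
            (MultilinearMap.domCoprod α.toMultilinearMap β.toMultilinearMap)).domDomCongr
              (finSumFinEquiv.trans (finCongr h))
        cont := by
          have : Continuous fun v : Fin m → E =>
              α (fun i => v (Fin.cast h (Fin.castAdd l i))) *
                β (fun j => v (Fin.cast h (Fin.natAdd k j))) := by
            refine (α.cont.comp ?_).mul (β.cont.comp ?_) <;> fun_prop
          exact this }

theorem extProd_apply {k l m : ℕ} (h : k + l = m) (α : E [⋀^Fin k]→L[ℝ] ℂ)
    (β : E [⋀^Fin l]→L[ℝ] ℂ) (v : Fin m → E) :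
    extProd h α β v = ((k.factorial * l.factorial : ℕ) : ℝ)⁻¹ •
      ∑ s : Equiv.Perm (Fin m), Equiv.Perm.sign s •
        (α (fun i => v (s (Fin.cast h (Fin.castAdd l i)))) *
          β (fun j => v (s (Fin.cast h (Fin.natAdd k j))))) := by
  rw [extProd, ContinuousAlternatingMap.smul_apply,
    ContinuousMultilinearMap.alternatization_apply_apply]
  rfl

theorem extProd_add_left {k l m : ℕ} (h : k + l = m) (α α' : E [⋀^Fin k]→L[ℝ] ℂ)
    (β : E [⋀^Fin l]→L[ℝ] ℂ) : extProd h (α + α') β = extProd h α β + extProd h α' β := by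
  ext v
  simp only [extProd_apply, ContinuousAlternatingMap.add_apply, add_mul, smul_add,
    Finset.sum_add_distrib]

theorem extProd_add_right {k l m : ℕ} (h : k + l = m) (α : E [⋀^Fin k]→L[ℝ] ℂ)
    (β β' : E [⋀^Fin l]→L[ℝ] ℂ) : extProd h α (β + β') = extProd h α β + extProd h α β' := by
  ext v
  simp only [extProd_apply, ContinuousAlternatingMap.add_apply, mul_add, smul_add,
    Finset.sum_add_distrib]

theorem extProd_smul_left {k l m : ℕ} (h : k + l = m) (c : ℂ) (α : E [⋀^Fin k]→L[ℝ] ℂ)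
    (β : E [⋀^Fin l]→L[ℝ] ℂ) : extProd h (c • α) β = c • extProd h α β := by
  ext v
  simp only [extProd_apply, ContinuousAlternatingMap.smul_apply, smul_eq_mul, Complex.real_smul,
    Units.smul_def, zsmul_eq_mul, Finset.mul_sum]
  exact Finset.sum_congr rfl fun s _ => by ring

theorem extProd_smul_right {k l m : ℕ} (h : k + l = m) (c : ℂ) (α : E [⋀^Fin k]→L[ℝ] ℂ)
    (β : E [⋀^Fin l]→L[ℝ] ℂ) : extProd h α (c • β) = c • extProd h α β := by
  ext v
  simp only [extProd_apply, ContinuousAlternatingMap.smul_apply, smul_eq_mul, Complex.real_smul,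
    Units.smul_def, zsmul_eq_mul, Finset.mul_sum]
  exact Finset.sum_congr rfl fun s _ => by ring

/-- The contribution of the permutations that place the first vector among the arguments of the
left factor. -/
def headLeft {k l m : ℕ} (h : k + l = m + 1) (α : E [⋀^Fin k]→L[ℝ] ℂ)
    (β : E [⋀^Fin l]→L[ℝ] ℂ) (u : E) : E [⋀^Fin m]→L[ℝ] ℂ :=
  match k, h, α with
  | 0, _, _ => 0
  | _ + 1, h, α => extProd (by omega) (α.curryLeft u) β

/-- The contribution of the permutations that place the first vector among the arguments of the
right factor. -/
def headRight {k l m : ℕ} (h : k + l = m + 1) (α : E [⋀^Fin k]→L[ℝ] ℂ)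
    (β : E [⋀^Fin l]→L[ℝ] ℂ) (u : E) : E [⋀^Fin m]→L[ℝ] ℂ :=
  match l, h, β with
  | 0, _, _ => 0
  | _ + 1, h, β => extProd (by omega) α (β.curryLeft u)

theorem sum_insert_left {k l m : ℕ} (h : k + l = m + 1) (α : E [⋀^Fin k]→L[ℝ] ℂ)
    (β : E [⋀^Fin l]→L[ℝ] ℂ) (u : E) (v : Fin m → E) :
    (((k.factorial * l.factorial : ℕ) : ℝ)⁻¹ • ∑ i : Fin k, ∑ e : Equiv.Perm (Fin m),
      Equiv.Perm.sign (insertPerm (Fin.cast h (Fin.castAdd l i), e)) •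
        (α (fun a => (Matrix.vecCons u v : Fin (m + 1) → E)
            (insertPerm (Fin.cast h (Fin.castAdd l i), e) (Fin.cast h (Fin.castAdd l a)))) *
          β (fun a => (Matrix.vecCons u v : Fin (m + 1) → E)
            (insertPerm (Fin.cast h (Fin.castAdd l i), e) (Fin.cast h (Fin.natAdd k a)))))) =
      headLeft h α β u v := by
  rcases k with _ | k
  · simp [headLeft]
  have h' : k + l = m := by omega
  have key : ∀ i : Fin (k + 1), ∀ e : Equiv.Perm (Fin m),
      Equiv.Perm.sign (insertPerm (Fin.cast h (Fin.castAdd l i), e)) •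
        (α (fun a => (Matrix.vecCons u v : Fin (m + 1) → E)
            (insertPerm (Fin.cast h (Fin.castAdd l i), e) (Fin.cast h (Fin.castAdd l a)))) *
          β (fun a => (Matrix.vecCons u v : Fin (m + 1) → E)
            (insertPerm (Fin.cast h (Fin.castAdd l i), e) (Fin.cast h (Fin.natAdd (k + 1) a))))) =
      Equiv.Perm.sign e • (α.curryLeft u (fun a => v (e (Fin.cast h' (Fin.castAdd l a)))) *
          β (fun a => v (e (Fin.cast h' (Fin.natAdd k a))))) := by
    intro i e
    have e1 : (fun a : Fin (k + 1) => (Matrix.vecCons u v : Fin (m + 1) → E)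
            (insertPerm (Fin.cast h (Fin.castAdd l i), e) (Fin.cast h (Fin.castAdd l a)))) =
        i.insertNth u (fun a => v (e (Fin.cast h' (Fin.castAdd l a)))) := by
      symm
      rw [Fin.insertNth_eq_iff]
      constructor
      · rw [insertPerm_self]; rfl
      · funext a
        have : Fin.cast h (Fin.castAdd l (i.succAbove a)) =
            (Fin.cast h (Fin.castAdd l i)).succAbove (Fin.cast h' (Fin.castAdd l a)) := by
          ext
          simp only [Fin.succAbove, Fin.val_cast, Fin.val_castAdd, Fin.lt_def, Fin.val_castSucc]
          split_ifs <;> simp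
        rw [Fin.removeNth, this, insertPerm_succAbove]
        rfl
    have e2 : (fun a : Fin l => (Matrix.vecCons u v : Fin (m + 1) → E)
            (insertPerm (Fin.cast h (Fin.castAdd l i), e) (Fin.cast h (Fin.natAdd (k + 1) a)))) =
        (fun a => v (e (Fin.cast h' (Fin.natAdd k a)))) := by
      funext a
      have : Fin.cast h (Fin.natAdd (k + 1) a) =
            (Fin.cast h (Fin.castAdd l i)).succAbove (Fin.cast h' (Fin.natAdd k a)) := by
        ext
        have := i.2
        simp only [Fin.succAbove, Fin.val_cast, Fin.val_castAdd, Fin.lt_def, Fin.val_castSucc,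
          Fin.val_natAdd]
        split_ifs
        · simp; omega
        · simp; omega
      rw [this, insertPerm_succAbove]
      rfl
    rw [e1, e2, ContinuousAlternatingMap.map_insertNth, sign_insertPerm,
      ContinuousAlternatingMap.curryLeft_apply_apply]
    rcases neg_one_pow_eq_or ℤ (i : ℕ) with hs | hs <;>
    rcases neg_one_pow_eq_or ℤˣ (i : ℕ) with hs' | hs' <;>
    · first
      | (simp [hs, hs']; done)
      | (exfalso
         have := congrArg (fun t : ℤˣ => (t : ℤ)) hs'
         simp [hs] at this
         try omega)
  simp only [key, Finset.sum_const, Finset.card_univ, Fintype.card_fin]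
  rw [headLeft, extProd_apply, ← Nat.cast_smul_eq_nsmul ℝ, smul_smul]
  congr 1
  rw [Nat.factorial_succ]
  push_cast
  field_simp

theorem sum_insert_right {k l m : ℕ} (h : k + l = m + 1) (α : E [⋀^Fin k]→L[ℝ] ℂ)
    (β : E [⋀^Fin l]→L[ℝ] ℂ) (u : E) (v : Fin m → E) :
    (((k.factorial * l.factorial : ℕ) : ℝ)⁻¹ • ∑ i : Fin l, ∑ e : Equiv.Perm (Fin m),
      Equiv.Perm.sign (insertPerm (Fin.cast h (Fin.natAdd k i), e)) •
        (α (fun a => (Matrix.vecCons u v : Fin (m + 1) → E)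
            (insertPerm (Fin.cast h (Fin.natAdd k i), e) (Fin.cast h (Fin.castAdd l a)))) *
          β (fun a => (Matrix.vecCons u v : Fin (m + 1) → E)
            (insertPerm (Fin.cast h (Fin.natAdd k i), e) (Fin.cast h (Fin.natAdd k a)))))) =
      (-1 : ℂ) ^ k • headRight h α β u v := by
  rcases l with _ | l
  · simp [headRight]
  have h' : k + l = m := by omega
  have key : ∀ i : Fin (l + 1), ∀ e : Equiv.Perm (Fin m),
      Equiv.Perm.sign (insertPerm (Fin.cast h (Fin.natAdd k i), e)) •
        (α (fun a => (Matrix.vecCons u v : Fin (m + 1) → E)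
            (insertPerm (Fin.cast h (Fin.natAdd k i), e) (Fin.cast h (Fin.castAdd (l + 1) a)))) *
          β (fun a => (Matrix.vecCons u v : Fin (m + 1) → E)
            (insertPerm (Fin.cast h (Fin.natAdd k i), e) (Fin.cast h (Fin.natAdd k a))))) =
      (-1 : ℂ) ^ k • (Equiv.Perm.sign e • (α (fun a => v (e (Fin.cast h' (Fin.castAdd l a)))) *
          β.curryLeft u (fun a => v (e (Fin.cast h' (Fin.natAdd k a)))))) := by
    intro i e
    have e1 : (fun a : Fin (l + 1) => (Matrix.vecCons u v : Fin (m + 1) → E)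
            (insertPerm (Fin.cast h (Fin.natAdd k i), e) (Fin.cast h (Fin.natAdd k a)))) =
        i.insertNth u (fun a => v (e (Fin.cast h' (Fin.natAdd k a)))) := by
      symm
      rw [Fin.insertNth_eq_iff]
      constructor
      · rw [insertPerm_self]; rfl
      · funext a
        have : Fin.cast h (Fin.natAdd k (i.succAbove a)) =
            (Fin.cast h (Fin.natAdd k i)).succAbove (Fin.cast h' (Fin.natAdd k a)) := by
          ext
          simp only [Fin.succAbove, Fin.val_cast, Fin.val_natAdd, Fin.lt_def, Fin.val_castSucc]
          split_ifs <;> simp <;> omega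
        rw [Fin.removeNth, this, insertPerm_succAbove]
        rfl
    have e2 : (fun a : Fin k => (Matrix.vecCons u v : Fin (m + 1) → E)
            (insertPerm (Fin.cast h (Fin.natAdd k i), e) (Fin.cast h (Fin.castAdd (l + 1) a)))) =
        (fun a => v (e (Fin.cast h' (Fin.castAdd l a)))) := by
      funext a
      have : Fin.cast h (Fin.castAdd (l + 1) a) =
            (Fin.cast h (Fin.natAdd k i)).succAbove (Fin.cast h' (Fin.castAdd l a)) := by
        ext
        have := a.2
        simp only [Fin.succAbove, Fin.val_cast, Fin.val_castAdd, Fin.lt_def, Fin.val_castSucc,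
          Fin.val_natAdd]
        split_ifs
        · simp
        · omega
      rw [this, insertPerm_succAbove]
      rfl
    rw [e1, e2, ContinuousAlternatingMap.map_insertNth, sign_insertPerm,
      ContinuousAlternatingMap.curryLeft_apply_apply]
    have hs : ((-1 : ℤˣ) ^ ((Fin.cast h (Fin.natAdd k i) : Fin (m + 1)) : ℕ)) =
        (-1) ^ k * (-1) ^ (i : ℕ) := by simp [pow_add]
    rw [hs]
    rcases Nat.even_or_odd k with hk | hk <;> rcases Nat.even_or_odd (i : ℕ) with hi | hi <;>
      simp [hk.neg_one_pow, hi.neg_one_pow]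
  -- Each of the `l` positions in the right factor gives the same sum, and `l / l! = 1 / (l - 1)!`.
  simp only [key, Finset.sum_const, Finset.card_univ, Fintype.card_fin, ← Finset.smul_sum]
  rw [headRight, extProd_apply, ← Nat.cast_smul_eq_nsmul ℝ, smul_smul, smul_comm ((-1 : ℂ) ^ k)]
  congr 1
  rw [Nat.factorial_succ]
  push_cast
  field_simp

/-- Contraction is an antiderivation, for homogeneous forms. The terms of smaller degree are
`headLeft` and `headRight`, so that the cases `k = 0` and `l = 0` are covered. -/
theorem extProd_curryLeft {k l m : ℕ} (h : k + l = m + 1) (α : E [⋀^Fin k]→L[ℝ] ℂ)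
    (β : E [⋀^Fin l]→L[ℝ] ℂ) (u : E) :
    (extProd h α β).curryLeft u = headLeft h α β u + (-1 : ℂ) ^ k • headRight h α β u := by
  ext v
  rw [ContinuousAlternatingMap.curryLeft_apply_apply, extProd_apply, sum_perm_succ,
    ContinuousAlternatingMap.add_apply, ContinuousAlternatingMap.smul_apply,
    ← sum_insert_left h α β u v, ← sum_insert_right h α β u v, ← smul_add]
  congr 1
  rw [← (finCongr h).sum_comp, Fin.sum_univ_add]
  rfl

variable {E : Type*} [NormedAddCommGroup E] [NormedSpace ℝ E]
variable {E' : Type*} [NormedAddCommGroup E'] [NormedSpace ℝ E']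

/-! ### The algebra of forms of mixed degree -/

/-- Complex alternating forms of mixed degree on a normed space, with the exterior product as
multiplication; for `Fin n → ℂ` this is the type `MixedForm n`. -/
def MForm (E : Type*) [NormedAddCommGroup E] [NormedSpace ℝ E] : Type _ :=
  ∀ k : ℕ, E [⋀^Fin k]→L[ℝ] ℂ

namespace MForm

instance : AddCommGroup (MForm E) := inferInstanceAs (AddCommGroup (∀ k : ℕ, E [⋀^Fin k]→L[ℝ] ℂ))

instance : Module ℂ (MForm E) where
  smul c α := fun k => c • α k
  one_smul α := by funext k; exact one_smul ℂ (α k)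
  mul_smul c d α := by funext k; exact mul_smul c d (α k)
  smul_zero c := by
    funext k
    change c • (0 : E [⋀^Fin k]→L[ℝ] ℂ) = 0
    ext; simp
  smul_add c α β := by funext k; exact smul_add c (α k) (β k)
  add_smul c d α := by funext k; exact add_smul c d (α k)
  zero_smul α := by funext k; exact zero_smul ℂ (α k)

instance : One (MForm E) where
  one := fun k => match k with
    | 0 => ContinuousAlternatingMap.constOfIsEmpty ℝ E (Fin 0) 1
    | _ + 1 => 0

instance : Mul (MForm E) where
  mul α β := fun k => ∑ q ∈ (Finset.HasAntidiagonal.antidiagonal k).attach,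
    extProd (Finset.HasAntidiagonal.mem_antidiagonal.1 q.2) (α q.1.1) (β q.1.2)

@[ext] theorem ext {α β : MForm E} (h : ∀ k, α k = β k) : α = β := funext h

@[simp] theorem zero_apply (k : ℕ) : (0 : MForm E) k = 0 := rfl
@[simp] theorem add_apply (α β : MForm E) (k : ℕ) : (α + β) k = α k + β k := rfl
@[simp] theorem sub_apply (α β : MForm E) (k : ℕ) : (α - β) k = α k - β k := rfl
@[simp] theorem neg_apply (α : MForm E) (k : ℕ) : (-α) k = -α k := rfl
@[simp] theorem smul_apply (c : ℂ) (α : MForm E) (k : ℕ) : (c • α) k = c • α k := rfl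

/-- The evaluation of a form of mixed degree in a given degree. -/
def evalHom (k : ℕ) : MForm E →ₗ[ℂ] E [⋀^Fin k]→L[ℝ] ℂ where
  toFun α := α k
  map_add' _ _ := rfl
  map_smul' _ _ := rfl

theorem sum_apply {ι : Type*} (s : Finset ι) (f : ι → MForm E) (k : ℕ) :
    (∑ i ∈ s, f i) k = ∑ i ∈ s, f i k := map_sum (evalHom k) f s

/-- The exterior product of two homogeneous components, extended by `0` to all degrees so that it
can be summed over arbitrary pairs. -/
def term (α β : MForm E) (m : ℕ) (q : ℕ × ℕ) : E [⋀^Fin m]→L[ℝ] ℂ :=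
  if h : q.1 + q.2 = m then extProd h (α q.1) (β q.2) else 0

theorem mul_apply (α β : MForm E) (k : ℕ) :
    (α * β) k = ∑ q ∈ Finset.HasAntidiagonal.antidiagonal k, term α β k q := by
  rw [← Finset.sum_attach]
  refine Finset.sum_congr rfl fun q _ => ?_
  rw [term, dif_pos (Finset.HasAntidiagonal.mem_antidiagonal.1 q.2)]

protected theorem add_mul (α α' β : MForm E) : (α + α') * β = α * β + α' * β := by
  ext1 k
  simp only [mul_apply, add_apply, ← Finset.sum_add_distrib]
  refine Finset.sum_congr rfl fun q _ => ?_
  unfold term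
  split_ifs
  · exact extProd_add_left _ _ _ _
  · simp

protected theorem mul_add (α β β' : MForm E) : α * (β + β') = α * β + α * β' := by
  ext1 k
  simp only [mul_apply, add_apply, ← Finset.sum_add_distrib]
  refine Finset.sum_congr rfl fun q _ => ?_
  unfold term
  split_ifs
  · exact extProd_add_right _ _ _ _
  · simp

protected theorem smul_mul (c : ℂ) (α β : MForm E) : (c • α) * β = c • (α * β) := by
  ext1 k
  simp only [mul_apply, smul_apply, Finset.smul_sum]
  refine Finset.sum_congr rfl fun q _ => ?_
  unfold term
  split_ifs
  · exact extProd_smul_left _ _ _ _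
  · simp

protected theorem mul_smul' (c : ℂ) (α β : MForm E) : α * (c • β) = c • (α * β) := by
  ext1 k
  simp only [mul_apply, smul_apply, Finset.smul_sum]
  refine Finset.sum_congr rfl fun q _ => ?_
  unfold term
  split_ifs
  · exact extProd_smul_right _ _ _ _
  · simp

/-- Contraction with a vector. -/
def contr (u : E) : MForm E →ₗ[ℂ] MForm E where
  toFun α := fun k => (α (k + 1)).curryLeft u
  map_add' α β := by ext k w; rfl
  map_smul' c α := by ext k w; rfl

theorem contr_apply (u : E) (α : MForm E) (k : ℕ) : contr u α k = (α (k + 1)).curryLeft u := rfl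

/-- The grading involution `α ↦ (-1) ^ deg α • α`. -/
def invol : MForm E →ₗ[ℂ] MForm E where
  toFun α := fun k => (-1 : ℂ) ^ k • α k
  map_add' α β := funext fun k => smul_add ((-1 : ℂ) ^ k) (α k) (β k)
  map_smul' c α := funext fun k => smul_comm ((-1 : ℂ) ^ k) c (α k)

theorem invol_apply (α : MForm E) (k : ℕ) : invol α k = (-1 : ℂ) ^ k • α k := rfl

/-- The component of degree `0`, as a number. -/
def zeroPart : MForm E →ₗ[ℂ] ℂ where
  toFun α := α 0 0
  map_add' _ _ := rfl
  map_smul' _ _ := rfl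

theorem zeroPart_def (α : MForm E) : zeroPart α = α 0 0 := rfl

theorem apply_zero_eq_iff {α β : MForm E} : α 0 = β 0 ↔ zeroPart α = zeroPart β := by
  refine ⟨fun h => by rw [zeroPart_def, zeroPart_def, h], fun h => ?_⟩
  ext v
  rw [Subsingleton.elim v 0]
  exact h

/-- Together with `apply_zero_eq_iff` this allows identities between forms to be proved by induction
on the degree, by contraction with vectors. -/
theorem apply_succ_eq_iff {α β : MForm E} {k : ℕ} :
    α (k + 1) = β (k + 1) ↔ ∀ u, contr u α k = contr u β k := by
  refine ⟨fun h u => by rw [contr_apply, contr_apply, h], fun h => ?_⟩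
  ext v
  have := congrArg (fun f => f (Matrix.vecTail v)) (h (v 0))
  simp only [contr_apply, ContinuousAlternatingMap.curryLeft_apply_apply] at this
  have hv : Matrix.vecCons (v 0) (Matrix.vecTail v) = v := Matrix.cons_head_tail v
  rwa [hv] at this

/-- Contraction is an antiderivation. -/
theorem contr_mul (u : E) (α β : MForm E) :
    contr u (α * β) = contr u α * β + invol α * contr u β := by
  ext1 k
  have h1 : ∀ q ∈ Finset.HasAntidiagonal.antidiagonal (k + 1), (term α β (k + 1) q).curryLeft u =
      (if h : q.1 + q.2 = k + 1 then headLeft h (α q.1) (β q.2) u else 0) +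
      (if h : q.1 + q.2 = k + 1 then (-1 : ℂ) ^ q.1 • headRight h (α q.1) (β q.2) u else 0) := by
    intro q hq
    have hq := Finset.HasAntidiagonal.mem_antidiagonal.1 hq
    rw [term, dif_pos hq, dif_pos hq, dif_pos hq, extProd_curryLeft]
  have h0 : contr u (α * β) k = ∑ q ∈ Finset.HasAntidiagonal.antidiagonal (k + 1),
      (term α β (k + 1) q).curryLeft u := by
    rw [contr_apply, mul_apply]
    ext v
    simp [ContinuousAlternatingMap.curryLeft_apply_apply]
  rw [h0, Finset.sum_congr rfl h1, Finset.sum_add_distrib, Finset.Nat.sum_antidiagonal_succ,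
    Finset.Nat.sum_antidiagonal_succ', add_apply, mul_apply, mul_apply]
  congr 1
  · rw [dif_pos (by simp)]
    simp only [headLeft, zero_add]
    refine Finset.sum_congr rfl fun q hq => ?_
    have hq := Finset.HasAntidiagonal.mem_antidiagonal.1 hq
    rw [dif_pos (by omega), term, dif_pos hq]
    rfl
  · rw [dif_pos (by simp)]
    simp only [headRight]
    rw [show (-1 : ℂ) ^ (k + 1) • (0 : E [⋀^Fin k]→L[ℝ] ℂ) = 0 by ext; simp, zero_add]
    refine Finset.sum_congr rfl fun q hq => ?_
    have hq := Finset.HasAntidiagonal.mem_antidiagonal.1 hq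
    rw [dif_pos (by omega), term, dif_pos hq, invol_apply, extProd_smul_left]
    rfl

theorem zeroPart_mul (α β : MForm E) : zeroPart (α * β) = zeroPart α * zeroPart β := by
  rw [zeroPart_def, mul_apply]
  rw [Finset.HasAntidiagonal.antidiagonal_zero, Finset.sum_singleton]
  change extProd (zero_add 0) (α 0) (β 0) 0 = _
  rw [extProd_apply]
  simp [zeroPart_def]
  congr 2 <;> exact Subsingleton.elim _ _

theorem zeroPart_one : zeroPart (1 : MForm E) = 1 := rfl

theorem contr_one (u : E) : contr u (1 : MForm E) = 0 := by
  ext k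
  rfl

theorem zeroPart_invol (α : MForm E) : zeroPart (invol α) = zeroPart α := by
  simp [zeroPart_def, invol_apply]

theorem contr_invol (u : E) (α : MForm E) : contr u (invol α) = -invol (contr u α) := by
  ext k v
  simp [contr_apply, invol_apply, pow_succ]

theorem invol_invol (α : MForm E) : invol (invol α) = α := by
  ext k v
  simp [invol_apply, ← mul_assoc, ← mul_pow]

theorem invol_one : invol (1 : MForm E) = 1 := by
  ext k v
  rcases k with _ | k
  · simp [invol_apply]
  · simp [invol_apply, show (1 : MForm E) (k + 1) = 0 from rfl]

theorem invol_mul (α β : MForm E) : invol (α * β) = invol α * invol β := by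
  suffices h : ∀ (k : ℕ) (α β : MForm E), invol (α * β) k = (invol α * invol β) k from
    ext fun k => h k α β
  intro k
  induction k with
  | zero =>
    intro α β
    rw [apply_zero_eq_iff, zeroPart_invol, zeroPart_mul, zeroPart_mul, zeroPart_invol,
      zeroPart_invol]
  | succ k ih =>
    intro α β
    rw [apply_succ_eq_iff]
    intro u
    have e : (invol α * invol (contr u β)) = -(invol α * ((-1 : ℂ) • invol (contr u β))) := by
      rw [MForm.mul_smul', neg_smul, one_smul, neg_neg]
    rw [contr_invol, contr_mul, contr_mul, contr_invol, contr_invol, map_add, neg_apply, add_apply,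
      add_apply, ih, ih]
    have e1 : -invol (contr u α) * invol β = -(invol (contr u α) * invol β) := by
      rw [← neg_one_smul ℂ (invol (contr u α)), MForm.smul_mul, neg_one_smul]
    have e2 : invol (invol α) * -invol (contr u β) = -(invol (invol α) * invol (contr u β)) := by
      rw [← neg_one_smul ℂ (invol (contr u β)), MForm.mul_smul', neg_one_smul]
    rw [e1, e2, neg_add]
    rfl

protected theorem mul_assoc (α β γ : MForm E) : α * β * γ = α * (β * γ) := by
  suffices h : ∀ (k : ℕ) (α β γ : MForm E), (α * β * γ) k = (α * (β * γ)) k from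
    ext fun k => h k α β γ
  intro k
  induction k with
  | zero =>
    intro α β γ
    simp only [apply_zero_eq_iff, zeroPart_mul, mul_assoc]
  | succ k ih =>
    intro α β γ
    rw [apply_succ_eq_iff]
    intro u
    simp only [contr_mul, MForm.add_mul, MForm.mul_add, add_apply, ih, invol_mul, add_assoc]

protected theorem one_mul (α : MForm E) : 1 * α = α := by
  suffices h : ∀ (k : ℕ) (α : MForm E), (1 * α) k = α k from ext fun k => h k α
  intro k
  induction k with
  | zero => intro α; rw [apply_zero_eq_iff, zeroPart_mul, zeroPart_one, one_mul]
  | succ k ih =>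
    intro α
    rw [apply_succ_eq_iff]
    intro u
    have : (0 : MForm E) * α = 0 := by
      have := MForm.smul_mul 0 (0 : MForm E) α
      simpa using this
    rw [contr_mul, contr_one, invol_one, this, zero_add, ih]

protected theorem mul_one (α : MForm E) : α * 1 = α := by
  suffices h : ∀ (k : ℕ) (α : MForm E), (α * 1) k = α k from ext fun k => h k α
  intro k
  induction k with
  | zero => intro α; rw [apply_zero_eq_iff, zeroPart_mul, zeroPart_one, mul_one]
  | succ k ih =>
    intro α
    rw [apply_succ_eq_iff]
    intro u
    have : invol α * (0 : MForm E) = 0 := by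
      have := MForm.mul_smul' 0 (invol α) (0 : MForm E)
      simpa using this
    rw [contr_mul, contr_one, this, add_zero, ih]

instance : Ring (MForm E) where
  left_distrib := MForm.mul_add
  right_distrib := MForm.add_mul
  zero_mul α := by simpa using MForm.smul_mul 0 (0 : MForm E) α
  mul_zero α := by simpa using MForm.mul_smul' 0 α (0 : MForm E)
  mul_assoc := MForm.mul_assoc
  one_mul := MForm.one_mul
  mul_one := MForm.mul_one
  neg_add_cancel := neg_add_cancel
  zsmul := fun n α => n • α
  zsmul_zero' := zero_zsmul
  zsmul_succ' n α := SubNegMonoid.zsmul_succ' n α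
  zsmul_neg' n α := SubNegMonoid.zsmul_neg' n α

instance : Algebra ℂ (MForm E) := Algebra.ofModule MForm.smul_mul fun c α β => MForm.mul_smul' c α β

/-- The grading involution is multiplicative. -/
def involHom : MForm E →ₐ[ℂ] MForm E :=
  AlgHom.ofLinearMap invol invol_one invol_mul

/-- The component of degree `0` is multiplicative. -/
def zeroHom : MForm E →ₐ[ℂ] ℂ :=
  AlgHom.ofLinearMap zeroPart zeroPart_one zeroPart_mul

theorem zeroHom_apply (α : MForm E) : zeroHom α = zeroPart α := rfl

/-- Forms of even degree are central, and forms of odd degree commute with all forms up to the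
grading involution. -/
theorem graded_comm (α β : MForm E) :
    (invol α = α → α * β = β * α) ∧ (invol α = -α → α * β = invol β * α) := by
  suffices h : ∀ (k : ℕ) (α β : MForm E), (invol α = α → (α * β) k = (β * α) k) ∧
      (invol α = -α → (α * β) k = (invol β * α) k) from
    ⟨fun ha => ext fun k => (h k α β).1 ha, fun ha => ext fun k => (h k α β).2 ha⟩
  intro k
  induction k with
  | zero =>
    intro α β
    constructor
    · intro _
      rw [apply_zero_eq_iff, zeroPart_mul, zeroPart_mul, mul_comm]
    · intro h
      rw [apply_zero_eq_iff, zeroPart_mul, zeroPart_mul, zeroPart_invol, mul_comm]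
  | succ k ih =>
    intro α β
    have hc : ∀ u, invol (contr u α) = -contr u (invol α) := fun u => by rw [contr_invol, neg_neg]
    constructor
    · intro ha
      rw [apply_succ_eq_iff]
      intro u
      have h1 : invol (contr u α) = -contr u α := by rw [hc, ha]
      rw [contr_mul, contr_mul, add_apply, add_apply, ha, (ih _ _).1 ha, (ih _ _).2 h1, add_comm]
    · intro ha
      rw [apply_succ_eq_iff]
      intro u
      have h1 : invol (contr u α) = contr u α := by rw [hc, ha, map_neg, neg_neg]
      rw [contr_mul, contr_mul, add_apply, add_apply, ha, invol_invol, (ih _ _).1 h1, neg_mul,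
        contr_invol, neg_mul, neg_apply, (ih _ _).2 ha, neg_apply, add_comm]

theorem commute_of_even {α : MForm E} (h : invol α = α) (β : MForm E) : α * β = β * α :=
  (graded_comm α β).1 h

theorem contr_contr_self (u : E) (α : MForm E) : contr u (contr u α) = 0 := by
  ext1 k
  rw [contr_apply, contr_apply]
  exact ContinuousAlternatingMap.curryLeft_same _ _

theorem contr_add_vec (u v : E) (α : MForm E) : contr (u + v) α = contr u α + contr v α := by
  ext1 k
  simp [contr_apply]

theorem contr_smul_vec (c : ℝ) (u : E) (α : MForm E) : contr (c • u) α = (c : ℂ) • contr u α := by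
  ext k w
  simp [contr_apply]

theorem contr_anticomm (u v : E) (α : MForm E) : contr u (contr v α) = -contr v (contr u α) := by
  have h := contr_contr_self (u + v) α
  simp only [contr_add_vec, map_add, contr_contr_self, zero_add, add_zero] at h
  exact eq_neg_of_add_eq_zero_right h

/-- The pullback by a linear map. -/
def pull (f : E' →L[ℝ] E) : MForm E →ₗ[ℂ] MForm E' where
  toFun α := fun k => (α k).compContinuousLinearMap f
  map_add' _ _ := rfl
  map_smul' _ _ := rfl

theorem pull_apply (f : E' →L[ℝ] E) (α : MForm E) (k : ℕ) :
    pull f α k = (α k).compContinuousLinearMap f := rfl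

theorem contr_pull (f : E' →L[ℝ] E) (u : E') (α : MForm E) :
    contr u (pull f α) = pull f (contr (f u) α) := by
  ext1 k
  simp only [contr_apply, pull_apply]
  exact ContinuousAlternatingMap.curryLeft_compContinuousLinearMap _ _ _

theorem zeroPart_pull (f : E' →L[ℝ] E) (α : MForm E) : zeroPart (pull f α) = zeroPart α := by
  rw [zeroPart_def, zeroPart_def, pull_apply,
    ContinuousAlternatingMap.compContinuousLinearMap_apply]
  exact congrArg _ (Subsingleton.elim _ _)

theorem pull_invol (f : E' →L[ℝ] E) (α : MForm E) : pull f (invol α) = invol (pull f α) := rfl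

theorem pull_mul (f : E' →L[ℝ] E) (α β : MForm E) : pull f (α * β) = pull f α * pull f β := by
  suffices h : ∀ (k : ℕ) (α β : MForm E), pull f (α * β) k = (pull f α * pull f β) k from
    ext fun k => h k α β
  intro k
  induction k with
  | zero => intro α β; simp only [apply_zero_eq_iff, zeroPart_pull, zeroPart_mul]
  | succ k ih =>
    intro α β
    rw [apply_succ_eq_iff]
    intro u
    rw [contr_pull, contr_mul, contr_mul, contr_pull, contr_pull, map_add, add_apply, add_apply,
      ih, ih, pull_invol]

theorem pull_one (f : E' →L[ℝ] E) : pull f (1 : MForm E) = 1 := by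
  ext k v
  rcases k with _ | k <;> rfl

theorem pull_pull {E'' : Type*} [NormedAddCommGroup E''] [NormedSpace ℝ E''] (g : E'' →L[ℝ] E')
    (f : E' →L[ℝ] E) (α : MForm E) : pull g (pull f α) = pull (f.comp g) α := rfl

end MForm

variable {E : Type*} [NormedAddCommGroup E] [NormedSpace ℝ E]
variable {E' : Type*} [NormedAddCommGroup E'] [NormedSpace ℝ E']
variable {B : Type*} [NormedAddCommGroup B] [NormedSpace ℝ B]

/-! ### Differential calculus of form-valued functions -/

instance [FiniteDimensional ℝ E] (k : ℕ) : FiniteDimensional ℝ (E [⋀^Fin k]→L[ℝ] ℂ) :=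
  FiniteDimensional.of_injective
    (V₂ := MultilinearMap ℝ (fun _ : Fin k => E) ℂ)
    { toFun := fun f => f.toMultilinearMap
      map_add' := fun _ _ => rfl
      map_smul' := fun _ _ => rfl }
    (fun f g h => by ext v; exact congrArg (fun f => f v) h)

theorem coe_smul_form {k : ℕ} (c : ℝ) (α : E [⋀^Fin k]→L[ℝ] ℂ) : (c : ℂ) • α = c • α := by
  ext
  simp

/-- A form on a finite-dimensional space depends continuously and linearly on its values. -/
theorem exists_form_eq_sum [FiniteDimensional ℝ E] (k : ℕ) :
    ∃ (m : ℕ) (b : Fin m → Fin k → E) (l : Fin m → ℂ →L[ℝ] E [⋀^Fin k]→L[ℝ] ℂ),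
      ∀ α : E [⋀^Fin k]→L[ℝ] ℂ, α = ∑ i, l i (α (b i)) := by
  classical
  let bs := Module.finBasis ℝ E
  let Φ : (E [⋀^Fin k]→L[ℝ] ℂ) →ₗ[ℝ] ((Fin k → Fin (Module.finrank ℝ E)) → ℂ) :=
    { toFun := fun α s => α (fun i => bs (s i))
      map_add' := fun _ _ => rfl
      map_smul' := fun _ _ => rfl }
  have hΦ : Function.Injective Φ := by
    intro α β h
    have : α.toMultilinearMap = β.toMultilinearMap :=
      Module.Basis.ext_multilinear (fun _ => bs) fun s => congrFun h s
    ext v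
    exact congrArg (fun f => f v) this
  obtain ⟨Ψ, hΨ⟩ := LinearMap.exists_leftInverse_of_injective Φ (LinearMap.ker_eq_bot.2 hΦ)
  let e := Fintype.equivFin (Fin k → Fin (Module.finrank ℝ E))
  refine ⟨_, fun i j => bs (e.symm i j), fun i => LinearMap.toContinuousLinearMap
    (Ψ ∘ₗ LinearMap.single ℝ (fun _ => ℂ) (e.symm i)), fun α => ?_⟩
  have h1 : Ψ (Φ α) = α := congrArg (fun f => f α) hΨ
  have h2 : Φ α = ∑ s, Pi.single s (Φ α s) := (Finset.univ_sum_single (Φ α)).symm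
  conv_lhs => rw [← h1, h2, map_sum, ← e.symm.sum_comp]
  rfl

/-- The exterior product as a continuous bilinear map. -/
def extProdL [FiniteDimensional ℝ E] {k l m : ℕ} (h : k + l = m) :
    (E [⋀^Fin k]→L[ℝ] ℂ) →L[ℝ] (E [⋀^Fin l]→L[ℝ] ℂ) →L[ℝ] (E [⋀^Fin m]→L[ℝ] ℂ) :=
  LinearMap.toContinuousBilinearMap (LinearMap.mk₂ ℝ (extProd h)
    (extProd_add_left h) (fun c α β => by
      rw [← coe_smul_form, ← coe_smul_form, extProd_smul_left]) (extProd_add_right h)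
    (fun c α β => by
      rw [← coe_smul_form, ← coe_smul_form, extProd_smul_right]))

theorem extProdL_apply [FiniteDimensional ℝ E] {k l m : ℕ} (h : k + l = m)
    (α : E [⋀^Fin k]→L[ℝ] ℂ) (β : E [⋀^Fin l]→L[ℝ] ℂ) : extProdL h α β = extProd h α β := by
  simp [extProdL]

/-- Contraction as a continuous bilinear map. -/
def contrL (E : Type*) [NormedAddCommGroup E] [NormedSpace ℝ E] (k : ℕ) :
    (E [⋀^Fin (k + 1)]→L[ℝ] ℂ) →L[ℝ] E →L[ℝ] E [⋀^Fin k]→L[ℝ] ℂ :=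
  ContinuousAlternatingMap.curryLeftLI.toContinuousLinearMap

namespace MForm

/-- All components of a form-valued function are differentiable at a point. -/
def DiffAt (ξ : B → MForm E) (b : B) : Prop := ∀ k, DifferentiableAt ℝ (fun y => ξ y k) b

/-- All components of a form-valued function are smooth. -/
def Smooth (ξ : B → MForm E) : Prop := ∀ k, ContDiff ℝ ∞ (fun y => ξ y k)

/-- All components of a form-valued function have temperate growth. -/
def Temperate (ξ : B → MForm E) : Prop := ∀ k, Function.HasTemperateGrowth (fun y => ξ y k)

/-- The directional derivative of a form-valued function, componentwise. -/
def pd (ξ : B → MForm E) (b v : B) : MForm E := fun k => fderiv ℝ (fun y => ξ y k) b v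

theorem pd_apply (ξ : B → MForm E) (b v : B) (k : ℕ) :
    pd ξ b v k = fderiv ℝ (fun y => ξ y k) b v := rfl

theorem Smooth.diffAt {ξ : B → MForm E} (h : Smooth ξ) (b : B) : DiffAt ξ b :=
  fun k => (h k).differentiable (by simp) b

theorem Temperate.smooth {ξ : B → MForm E} (h : Temperate ξ) : Smooth ξ := fun k => (h k).1

/-- A linear map between forms of mixed degree each of whose components only depends on one
component of the argument.  Such maps commute with derivatives and integrals. -/
def IsDeg (L : MForm E →ₗ[ℂ] MForm E') : Prop :=
  ∀ k, ∃ (d : ℕ) (l : (E [⋀^Fin d]→L[ℝ] ℂ) →L[ℝ] (E' [⋀^Fin k]→L[ℝ] ℂ)), ∀ α, L α k = l (α d)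

theorem isDeg_contr (u : E) : IsDeg (contr u) := fun k =>
  ⟨k + 1, (contrL E k).flip u, fun _ => rfl⟩

theorem isDeg_invol : IsDeg (invol : MForm E →ₗ[ℂ] MForm E) := fun k =>
  ⟨k, (-1 : ℂ) ^ k • ContinuousLinearMap.id ℝ _, fun _ => rfl⟩

theorem isDeg_pull (f : E' →L[ℝ] E) : IsDeg (pull f) := fun k =>
  ⟨k, ContinuousAlternatingMap.compContinuousLinearMapCLM f, fun _ => rfl⟩

theorem isDeg_id : IsDeg (LinearMap.id : MForm E →ₗ[ℂ] MForm E) := fun k =>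
  ⟨k, ContinuousLinearMap.id ℝ _, fun _ => rfl⟩

theorem IsDeg.comp {E'' : Type*} [NormedAddCommGroup E''] [NormedSpace ℝ E'']
    {L : MForm E' →ₗ[ℂ] MForm E''} {M : MForm E →ₗ[ℂ] MForm E'} (hL : IsDeg L) (hM : IsDeg M) :
    IsDeg (L ∘ₗ M) := by
  intro k
  obtain ⟨d, l, h⟩ := hL k
  obtain ⟨d', l', h'⟩ := hM d
  exact ⟨d', l.comp l', fun α => by rw [LinearMap.comp_apply, h, h']; rfl⟩

theorem IsDeg.diffAt {L : MForm E →ₗ[ℂ] MForm E'} (hL : IsDeg L) {ξ : B → MForm E} {b : B}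
    (h : DiffAt ξ b) : DiffAt (fun y => L (ξ y)) b := by
  intro k
  obtain ⟨d, l, hl⟩ := hL k
  simp only [hl]
  exact l.differentiableAt.comp b (h d)

theorem IsDeg.smooth {L : MForm E →ₗ[ℂ] MForm E'} (hL : IsDeg L) {ξ : B → MForm E}
    (h : Smooth ξ) : Smooth (fun y => L (ξ y)) := by
  intro k
  obtain ⟨d, l, hl⟩ := hL k
  simp only [hl]
  exact l.contDiff.comp (h d)

theorem IsDeg.temperate {L : MForm E →ₗ[ℂ] MForm E'} (hL : IsDeg L) {ξ : B → MForm E}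
    (h : Temperate ξ) : Temperate (fun y => L (ξ y)) := by
  intro k
  obtain ⟨d, l, hl⟩ := hL k
  simp only [hl]
  exact l.hasTemperateGrowth.comp (h d)

theorem IsDeg.pd {L : MForm E →ₗ[ℂ] MForm E'} (hL : IsDeg L) {ξ : B → MForm E} {b : B}
    (h : DiffAt ξ b) (v : B) : pd (fun y => L (ξ y)) b v = L (pd ξ b v) := by
  ext1 k
  obtain ⟨d, l, hl⟩ := hL k
  rw [pd_apply, hl, pd_apply]
  simp only [hl]
  have := (l.hasFDerivAt.comp b (h d).hasFDerivAt).fderiv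
  exact congrArg (fun f => f v) this

theorem DiffAt.add {ξ η : B → MForm E} {b : B} (h : DiffAt ξ b) (h' : DiffAt η b) :
    DiffAt (fun y => ξ y + η y) b := fun k => (h k).add (h' k)

theorem DiffAt.neg {ξ : B → MForm E} {b : B} (h : DiffAt ξ b) :
    DiffAt (fun y => -ξ y) b := fun k => DifferentiableAt.neg (h k)

theorem DiffAt.const (α : MForm E) (b : B) : DiffAt (fun _ => α) b :=
  fun _ => differentiableAt_const _

theorem DiffAt.smul {f : B → ℂ} {ξ : B → MForm E} {b : B} (hf : DifferentiableAt ℝ f b)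
    (h : DiffAt ξ b) : DiffAt (fun y => f y • ξ y) b := fun k => hf.smul (h k)

theorem DiffAt.sum {ι : Type*} {s : Finset ι} {ξ : ι → B → MForm E} {b : B}
    (h : ∀ i ∈ s, DiffAt (ξ i) b) : DiffAt (fun y => ∑ i ∈ s, ξ i y) b := fun k => by
  simp only [sum_apply]
  exact DifferentiableAt.fun_sum fun i hi => h i hi k

theorem Smooth.add {ξ η : B → MForm E} (h : Smooth ξ) (h' : Smooth η) :
    Smooth (fun y => ξ y + η y) := fun k => (h k).add (h' k)

theorem Smooth.sub {ξ η : B → MForm E} (h : Smooth ξ) (h' : Smooth η) :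
    Smooth (fun y => ξ y - η y) := fun k => (h k).sub (h' k)

theorem Smooth.const (α : MForm E) : Smooth (fun _ : B => α) := fun _ => contDiff_const

theorem Smooth.smul {f : B → ℂ} {ξ : B → MForm E} (hf : ContDiff ℝ ∞ f) (h : Smooth ξ) :
    Smooth (fun y => f y • ξ y) := fun k => hf.smul (h k)

theorem Smooth.sum {ι : Type*} {s : Finset ι} {ξ : ι → B → MForm E}
    (h : ∀ i ∈ s, Smooth (ξ i)) : Smooth (fun y => ∑ i ∈ s, ξ i y) := fun k => by
  simp only [sum_apply]
  exact ContDiff.sum fun i hi => h i hi k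

theorem Smooth.comp {B' : Type*} [NormedAddCommGroup B'] [NormedSpace ℝ B'] {ξ : B → MForm E}
    (h : Smooth ξ) {f : B' → B} (hf : ContDiff ℝ ∞ f) : Smooth (fun y => ξ (f y)) :=
  fun k => (h k).comp hf

theorem Temperate.comp {B' : Type*} [NormedAddCommGroup B'] [NormedSpace ℝ B'] {ξ : B → MForm E}
    (h : Temperate ξ) {f : B' → B} (hf : f.HasTemperateGrowth) : Temperate (fun y => ξ (f y)) :=
  fun k => (h k).comp hf

section Mul

variable [FiniteDimensional ℝ E]

/-- `term` as a function of its two homogeneous arguments. -/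
def termL (m : ℕ) (q : ℕ × ℕ) :
    (E [⋀^Fin q.1]→L[ℝ] ℂ) →L[ℝ] (E [⋀^Fin q.2]→L[ℝ] ℂ) →L[ℝ] (E [⋀^Fin m]→L[ℝ] ℂ) :=
  if h : q.1 + q.2 = m then extProdL h else 0

theorem termL_apply (m : ℕ) (q : ℕ × ℕ) (α β : MForm E) :
    term α β m q = termL m q (α q.1) (β q.2) := by
  unfold term termL
  split_ifs with h
  · rw [extProdL_apply]
  · rfl

theorem DiffAt.mul {ξ η : B → MForm E} {b : B} (h : DiffAt ξ b) (h' : DiffAt η b) :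
    DiffAt (fun y => ξ y * η y) b := by
  intro k
  simp only [mul_apply, termL_apply]
  exact DifferentiableAt.fun_sum fun q _ =>
    ((termL k q).hasFDerivAt_of_bilinear (h q.1).hasFDerivAt (h' q.2).hasFDerivAt).differentiableAt

theorem Smooth.mul {ξ η : B → MForm E} (h : Smooth ξ) (h' : Smooth η) :
    Smooth (fun y => ξ y * η y) := by
  intro k
  simp only [mul_apply, termL_apply]
  exact ContDiff.sum fun q _ =>
    (termL (E := E) k q).isBoundedBilinearMap.contDiff.comp ((h q.1).prodMk (h' q.2))

theorem Temperate.mul {ξ η : B → MForm E} (h : Temperate ξ) (h' : Temperate η) :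
    Temperate (fun y => ξ y * η y) := by
  intro k
  simp only [mul_apply, termL_apply]
  exact Function.HasTemperateGrowth.sum fun q _ =>
    (termL k q).bilinear_hasTemperateGrowth (h q.1) (h' q.2)

theorem pd_mul {ξ η : B → MForm E} {b : B} (h : DiffAt ξ b) (h' : DiffAt η b) (v : B) :
    pd (fun y => ξ y * η y) b v = pd ξ b v * η b + ξ b * pd η b v := by
  ext1 k
  rw [pd_apply, add_apply, mul_apply, mul_apply]
  simp only [mul_apply, termL_apply]
  rw [(HasFDerivAt.fun_sum fun q _ => (termL k q).hasFDerivAt_of_bilinear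
    (h q.1).hasFDerivAt (h' q.2).hasFDerivAt).fderiv, ← Finset.sum_add_distrib]
  simp [pd_apply, add_comm]

end Mul

/-- Contraction with a varying vector. -/
theorem Temperate.contr {ξ : B → MForm E} {u : B → E} (h : Temperate ξ)
    (hu : u.HasTemperateGrowth) : Temperate (fun y => MForm.contr (u y) (ξ y)) := fun k =>
  (contrL E k).bilinear_hasTemperateGrowth (h (k + 1)) hu

theorem Smooth.contr {ξ : B → MForm E} {u : B → E} (h : Smooth ξ) (hu : ContDiff ℝ ∞ u) :
    Smooth (fun y => MForm.contr (u y) (ξ y)) := fun k =>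
  (contrL E k).isBoundedBilinearMap.contDiff.comp ((h (k + 1)).prodMk hu)

/-! ### The exterior derivative of forms of mixed degree -/

/-- The exterior derivative. -/
def extD (ξ : E → MForm E) (z : E) : MForm E := fun k => match k with
  | 0 => 0
  | k + 1 => extDeriv (fun y => ξ y k) z

theorem extD_zero_apply (ξ : E → MForm E) (z : E) : extD ξ z 0 = 0 := rfl

theorem extD_succ (ξ : E → MForm E) (z : E) (k : ℕ) :
    extD ξ z (k + 1) = extDeriv (fun y => ξ y k) z := rfl

theorem zeroPart_extD (ξ : E → MForm E) (z : E) : zeroPart (extD ξ z) = 0 := rfl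

theorem extD_congr {ξ η : E → MForm E} {z : E} (h : ∀ᶠ y in nhds z, ξ y = η y) :
    extD ξ z = extD η z := by
  ext1 k
  rcases k with _ | k
  · rfl
  · exact Filter.EventuallyEq.extDeriv_eq (h.mono fun y hy => congrFun hy k)

theorem Smooth.extD {ξ : E → MForm E} (h : Smooth ξ) : Smooth (extD ξ) := by
  intro k
  rcases k with _ | k
  · exact contDiff_const
  · have : ContDiff ℝ ∞ (fderiv ℝ (fun y => ξ y k)) := (h k).fderiv_right (by simp)
    exact (ContinuousAlternatingMap.alternatizeUncurryFinCLM ℝ E ℂ).contDiff.comp this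

/-- The Cartan formula for the Lie derivative along a constant vector field. -/
theorem contr_extD {ξ : E → MForm E} {z : E} (h : DiffAt ξ z) (u : E) :
    contr u (extD ξ z) = pd ξ z u - extD (fun y => contr u (ξ y)) z := by
  ext k v
  rcases k with _ | k
  · rw [contr_apply, extD_succ, ContinuousAlternatingMap.curryLeft_apply_apply,
      sub_apply, extD_zero_apply, sub_zero, extDeriv,
      ContinuousAlternatingMap.alternatizeUncurryFin_apply]
    simp [pd_apply]
  · have hd : HasFDerivAt (fun y => contr u (ξ y) k)
        (((contrL E k).flip u).comp (fderiv ℝ (fun y => ξ y (k + 1)) z)) z :=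
      ((contrL E k).flip u).hasFDerivAt.comp z (h (k + 1)).hasFDerivAt
    rw [contr_apply, extD_succ, ContinuousAlternatingMap.curryLeft_apply_apply,
      sub_apply, ContinuousAlternatingMap.sub_apply, extD_succ, extDeriv, extDeriv,
      ContinuousAlternatingMap.alternatizeUncurryFin_apply, hd.fderiv,
      ContinuousAlternatingMap.alternatizeUncurryFin_apply, Fin.sum_univ_succ, sub_eq_add_neg,
      ← Finset.sum_neg_distrib]
    congr 1
    · simp only [Fin.val_zero, pow_zero, one_smul, Matrix.cons_val_zero, pd_apply]
      congr 1
    · refine Finset.sum_congr rfl fun i _ => ?_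
      have e : i.succ.removeNth (Matrix.vecCons u v : Fin (k + 2) → E) =
          Matrix.vecCons u (i.removeNth v) := by
        funext j
        refine Fin.cases ?_ (fun j => ?_) j
        · simp [Fin.removeNth]
        · simp [Fin.removeNth]
      rw [e, Matrix.cons_val_succ, Fin.val_succ, pow_succ, mul_neg_one, neg_smul]
      rfl

theorem extD_add {ξ η : E → MForm E} {z : E} (h : DiffAt ξ z) (h' : DiffAt η z) :
    extD (fun y => ξ y + η y) z = extD ξ z + extD η z := by
  ext1 k
  rcases k with _ | k
  · simp [extD_zero_apply]
  · exact extDeriv_add (h k) (h' k)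

theorem extD_smul (c : ℂ) {ξ : E → MForm E} {z : E} (h : DiffAt ξ z) :
    extD (fun y => c • ξ y) z = c • extD ξ z := by
  ext1 k
  rcases k with _ | k
  · ext; simp [extD_zero_apply]
  · rw [smul_apply, extD_succ, extD_succ, extDeriv, extDeriv]
    have : fderiv ℝ (fun y => (c • ξ y) k) z = c • fderiv ℝ (fun y => ξ y k) z :=
      fderiv_const_smul (h k) c
    rw [this, ContinuousAlternatingMap.alternatizeUncurryFin_smul]

theorem extD_neg {ξ : E → MForm E} {z : E} (h : DiffAt ξ z) :
    extD (fun y => -ξ y) z = -extD ξ z := by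
  have := extD_smul (-1) h
  simpa using this

theorem extD_sub {ξ η : E → MForm E} {z : E} (h : DiffAt ξ z) (h' : DiffAt η z) :
    extD (fun y => ξ y - η y) z = extD ξ z - extD η z := by
  simp only [sub_eq_add_neg]
  rw [extD_add h h'.neg, extD_neg h']

theorem extD_const (α : MForm E) (z : E) : extD (fun _ => α) z = 0 := by
  ext1 k
  rcases k with _ | k
  · rfl
  · ext v
    simp [extD_succ, extDeriv, ContinuousAlternatingMap.alternatizeUncurryFin_apply]

theorem extD_sum {ι : Type*} {s : Finset ι} {ξ : ι → E → MForm E} {z : E}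
    (h : ∀ i ∈ s, DiffAt (ξ i) z) :
    extD (fun y => ∑ i ∈ s, ξ i y) z = ∑ i ∈ s, extD (ξ i) z := by
  classical
  induction s using Finset.induction_on with
  | empty => simpa using extD_const (0 : MForm E) z
  | insert a s ha ih =>
    simp only [Finset.sum_insert ha]
    have h1 := h a (Finset.mem_insert_self a s)
    have h2 : ∀ i ∈ s, DiffAt (ξ i) z := fun i hi => h i (Finset.mem_insert_of_mem hi)
    rw [extD_add h1 (DiffAt.sum h2), ih h2]

theorem extD_invol {ξ : E → MForm E} {z : E} (h : DiffAt ξ z) :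
    extD (fun y => invol (ξ y)) z = -invol (extD ξ z) := by
  ext1 k
  rcases k with _ | k
  · ext; simp [extD_zero_apply, invol_apply]
  · have : fderiv ℝ (fun y => invol (ξ y) k) z = (-1 : ℂ) ^ k • fderiv ℝ (fun y => ξ y k) z :=
      fderiv_const_smul (h k) ((-1 : ℂ) ^ k)
    rw [neg_apply, invol_apply, extD_succ, extD_succ, extDeriv, extDeriv, this,
      ContinuousAlternatingMap.alternatizeUncurryFin_smul]
    ext
    simp [pow_succ]

/-- The exterior derivative is an antiderivation. -/
theorem extD_mul [FiniteDimensional ℝ E] {ξ η : E → MForm E} {z : E} (h : DiffAt ξ z)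
    (h' : DiffAt η z) :
    extD (fun y => ξ y * η y) z = extD ξ z * η z + invol (ξ z) * extD η z := by
  suffices H : ∀ (k : ℕ) (ξ η : E → MForm E), DiffAt ξ z → DiffAt η z →
      extD (fun y => ξ y * η y) z k = (extD ξ z * η z + invol (ξ z) * extD η z) k from
    ext fun k => H k ξ η h h'
  intro k
  induction k with
  | zero =>
    intro ξ η h h'
    rw [apply_zero_eq_iff, map_add, zeroPart_mul, zeroPart_mul, zeroPart_extD, zeroPart_extD,
      zeroPart_extD]
    simp
  | succ k ih =>
    intro ξ η h h'
    rw [apply_succ_eq_iff]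
    intro u
    have hu : DiffAt (fun y => contr u (ξ y)) z := (isDeg_contr u).diffAt h
    have hu' : DiffAt (fun y => contr u (η y)) z := (isDeg_contr u).diffAt h'
    have hi : DiffAt (fun y => invol (ξ y)) z := isDeg_invol.diffAt h
    rw [contr_extD (h.mul h'), sub_apply]
    simp only [contr_mul, map_add]
    rw [extD_add (hu.mul h') (hi.mul hu'), add_apply, ih _ _ hu h', ih _ _ hi hu', pd_mul h h',
      contr_extD h, contr_extD h', extD_invol h, contr_invol, invol_invol]
    simp only [add_apply, sub_mul, mul_sub, sub_apply, neg_mul, neg_apply]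
    abel

/-- The exterior derivative squares to zero. -/
theorem extD_extD {ξ : E → MForm E} (h : Smooth ξ) (z : E) : extD (extD ξ) z = 0 := by
  ext1 k
  rcases k with _ | _ | k
  · rfl
  · ext v
    simp [extD_succ, extDeriv, extD_zero_apply,
      ContinuousAlternatingMap.alternatizeUncurryFin_apply]
  · have := extDeriv_extDeriv (h k) (by simpa using ENat.LEInfty.out)
    exact congrFun this z

/-- The exterior derivative commutes with pullbacks. -/
theorem extD_pull {ξ : E → MForm E} {f : E' → E} (hf : ContDiff ℝ ∞ f) {z : E'}
    (h : DiffAt ξ (f z)) :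
    extD (fun y => pull (fderiv ℝ f y) (ξ (f y))) z = pull (fderiv ℝ f z) (extD ξ (f z)) := by
  ext1 k
  rcases k with _ | k
  · rfl
  · exact extDeriv_pullback (h k) (hf.contDiffAt (x := z)) (by simpa using ENat.LEInfty.out)

theorem temperate_of_apply [FiniteDimensional ℝ E] {k : ℕ} {g : B → E [⋀^Fin k]→L[ℝ] ℂ}
    (h : ∀ v, (fun y => g y v).HasTemperateGrowth) : g.HasTemperateGrowth := by
  obtain ⟨m, b, l, hl⟩ := exists_form_eq_sum (E := E) k
  have : g = fun y => ∑ i, l i (g y (b i)) := funext fun y => hl (g y)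
  rw [this]
  exact Function.HasTemperateGrowth.sum fun i _ => (l i).hasTemperateGrowth.comp (h (b i))

theorem contDiff_of_apply [FiniteDimensional ℝ E] {k : ℕ} {g : B → E [⋀^Fin k]→L[ℝ] ℂ}
    (h : ∀ v, ContDiff ℝ ∞ (fun y => g y v)) : ContDiff ℝ ∞ g := by
  obtain ⟨m, b, l, hl⟩ := exists_form_eq_sum (E := E) k
  have : g = fun y => ∑ i, l i (g y (b i)) := funext fun y => hl (g y)
  rw [this]
  exact ContDiff.sum fun i _ => (l i).contDiff.comp (h (b i))

theorem temperate_apply {k : ℕ} {g : B → E [⋀^Fin k]→L[ℝ] ℂ} {u : Fin k → B → E}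
    (h : g.HasTemperateGrowth) (hu : ∀ i, (u i).HasTemperateGrowth) :
    (fun y => g y (fun i => u i y)).HasTemperateGrowth := by
  induction k with
  | zero =>
    let l : (E [⋀^Fin 0]→L[ℝ] ℂ) →L[ℝ] ℂ :=
      (ContinuousAlternatingMap.constOfIsEmptyLIE ℝ E ℂ (Fin 0)).symm.toContinuousLinearEquiv
    have : (fun y => g y (fun i => u i y)) = fun y => l (g y) := by
      funext y
      exact congrArg _ (Subsingleton.elim _ _)
    rw [this]
    exact l.hasTemperateGrowth.comp h
  | succ k ih =>
    have h1 : (fun y => (g y).curryLeft (u 0 y)).HasTemperateGrowth :=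
      (contrL E k).bilinear_hasTemperateGrowth h (hu 0)
    have := ih h1 (u := fun i => u i.succ) fun i => hu i.succ
    convert this using 2 with y
    rw [ContinuousAlternatingMap.curryLeft_apply_apply]
    congr 1
    funext i
    refine Fin.cases rfl (fun i => rfl) i

/-- Pullbacks of forms of temperate growth by linear maps of temperate growth. -/
theorem Temperate.pull [FiniteDimensional ℝ E'] {ξ : B → MForm E}
    {f : B → E' →L[ℝ] E} (h : Temperate ξ) (hf : ∀ u, (fun y => f y u).HasTemperateGrowth) :
    Temperate (fun y => MForm.pull (f y) (ξ y)) := fun k =>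
  temperate_of_apply fun v =>
    temperate_apply (g := fun y => ξ y k) (u := fun i y => f y (v i)) (h k) fun i => hf (v i)

end MForm

/-! ### Integrals depending on parameters -/

section Slices

variable {B : Type*} [NormedAddCommGroup B] [NormedSpace ℝ B]
variable {Y : Type*} [NormedAddCommGroup Y] [NormedSpace ℝ Y]
variable {F : Type*} [NormedAddCommGroup F] [NormedSpace ℝ F]

theorem iteratedFDeriv_slice {g : B × Y → F} (hg : ContDiff ℝ ∞ g) (m : ℕ) (b : B) (y : Y) :
    iteratedFDeriv ℝ m (fun b => g (b, y)) b =
      (iteratedFDeriv ℝ m g (b, y)).compContinuousLinearMap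
        fun _ => ContinuousLinearMap.inl ℝ B Y := by
  have h1 : (fun b => g (b, y)) =
      (fun q => g (q + (0, y))) ∘ (ContinuousLinearMap.inl ℝ B Y) := by
    funext b
    simp
  have h2 : ContDiff ℝ ∞ (fun q => g (q + (0, y))) := hg.comp (contDiff_id.add contDiff_const)
  rw [h1, ContinuousLinearMap.iteratedFDeriv_comp_right _ h2 _ (mod_cast le_top),
    iteratedFDeriv_comp_add_right]
  simp

theorem norm_iteratedFDeriv_slice_le {g : B × Y → F} (hg : ContDiff ℝ ∞ g) (m : ℕ) (b : B) (y : Y) :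
    ‖iteratedFDeriv ℝ m (fun b => g (b, y)) b‖ ≤ ‖iteratedFDeriv ℝ m g (b, y)‖ := by
  rw [iteratedFDeriv_slice hg]
  refine (ContinuousMultilinearMap.norm_compContinuousLinearMap_le _ _).trans ?_
  refine mul_le_of_le_one_right (norm_nonneg _) ?_
  exact Finset.prod_le_one (fun _ _ => norm_nonneg _) fun _ _ =>
    ContinuousLinearMap.norm_inl_le_one ℝ B Y

theorem contDiff_slice {g : B × Y → F} (hg : ContDiff ℝ ∞ g) (m : ℕ) :
    ContDiff ℝ ∞ fun q : B × Y => iteratedFDeriv ℝ m (fun b => g (b, q.2)) q.1 := by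
  have : (fun q : B × Y => iteratedFDeriv ℝ m (fun b => g (b, q.2)) q.1) = fun q =>
      ContinuousMultilinearMap.compContinuousLinearMapL
        (fun _ : Fin m => ContinuousLinearMap.inl ℝ B Y) (iteratedFDeriv ℝ m g q) := by
    funext q
    rw [iteratedFDeriv_slice hg]
    rfl
  rw [this]
  exact (ContinuousLinearMap.contDiff _).comp (hg.iteratedFDeriv_right (m := ∞) le_rfl)

theorem fderiv_slice {g : B × Y → F} (hg : ContDiff ℝ 1 g) (b : B) (y : Y) :
    (fderiv ℝ g (b, y)).comp (ContinuousLinearMap.inl ℝ B Y) = fderiv ℝ (fun b => g (b, y)) b :=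
  (((hg.differentiable (by simp) (b, y)).hasFDerivAt).comp b
    (hasFDerivAt_prodMk_left b y)).fderiv.symm

end Slices

section ParamIntegral

open MeasureTheory

variable {B : Type*} [NormedAddCommGroup B] [NormedSpace ℝ B] [FiniteDimensional ℝ B]
variable {Y : Type*} [NormedAddCommGroup Y] [NormedSpace ℝ Y]
  [MeasurableSpace Y] [BorelSpace Y]
variable {F : Type*} [NormedAddCommGroup F] [NormedSpace ℝ F]
variable (μ : Measure Y) [IsFiniteMeasureOnCompacts μ] {K : Set Y}

theorem hasFDerivAt_setIntegral {g : B × Y → F} (hg : ContDiff ℝ 1 g) (hK : IsCompact K) (b : B) :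
    HasFDerivAt (fun b => ∫ y in K, g (b, y) ∂μ)
      (∫ y in K, (fderiv ℝ g (b, y)).comp (ContinuousLinearMap.inl ℝ B Y) ∂μ) b := by
  have hc : Continuous (fun q : B × Y => (fderiv ℝ g q).comp (ContinuousLinearMap.inl ℝ B Y)) :=
    (hg.continuous_fderiv (by simp)).clm_comp continuous_const
  obtain ⟨C, hC⟩ :=
    ((isCompact_closedBall b 1).prod hK).exists_bound_of_continuousOn hc.continuousOn
  refine hasFDerivAt_integral_of_dominated_of_fderiv_le (𝕜 := ℝ) (μ := μ.restrict K)
    (F := fun b y => g (b, y))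
    (F' := fun b y => (fderiv ℝ g (b, y)).comp (ContinuousLinearMap.inl ℝ B Y))
    (s := Metric.closedBall b 1)
    (bound := fun _ => C) (Metric.closedBall_mem_nhds b one_pos)
    (Filter.Eventually.of_forall fun x => ((hg.continuous.comp
      (Continuous.prodMk_right x)).continuousOn.integrableOn_compact hK).aestronglyMeasurable)
    ((hg.continuous.comp (Continuous.prodMk_right b)).continuousOn.integrableOn_compact hK)
    ((hc.comp (Continuous.prodMk_right b)).continuousOn.integrableOn_compact
      hK).aestronglyMeasurable ?_ (continuousOn_const.integrableOn_compact hK) ?_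
  · filter_upwards [ae_restrict_mem hK.measurableSet] with y hy x hx
    exact hC (x, y) ⟨hx, hy⟩
  · refine Filter.Eventually.of_forall fun y x _ => ?_
    have h1 : HasFDerivAt g (fderiv ℝ g (x, y)) (x, y) :=
      (hg.differentiable (by simp) (x, y)).hasFDerivAt
    exact h1.comp x (hasFDerivAt_prodMk_left x y)

theorem fderiv_setIntegral {g : B × Y → F} (hg : ContDiff ℝ 1 g) (hK : IsCompact K) (b : B) :
    fderiv ℝ (fun b => ∫ y in K, g (b, y) ∂μ) b =
      ∫ y in K, fderiv ℝ (fun b => g (b, y)) b ∂μ := by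
  rw [(hasFDerivAt_setIntegral μ hg hK b).fderiv]
  simp only [fderiv_slice hg]

theorem fderiv_setIntegral_apply [CompleteSpace F] {g : B × Y → F} (hg : ContDiff ℝ 1 g)
    (hK : IsCompact K) (b v : B) :
    fderiv ℝ (fun b => ∫ y in K, g (b, y) ∂μ) b v =
      ∫ y in K, fderiv ℝ (fun b => g (b, y)) b v ∂μ := by
  rw [fderiv_setIntegral μ hg hK]
  have hc : Continuous (fun y : Y => fderiv ℝ (fun b => g (b, y)) b) := by
    simp only [← fderiv_slice hg]
    exact ((hg.continuous_fderiv (by simp)).clm_comp continuous_const).comp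
      (Continuous.prodMk_right b)
  exact (ContinuousLinearMap.integral_apply (hc.continuousOn.integrableOn_compact hK) v)

theorem iteratedFDeriv_setIntegral [CompleteSpace F] {g : B × Y → F} (hg : ContDiff ℝ ∞ g)
    (hK : IsCompact K)
    (m : ℕ) : iteratedFDeriv ℝ m (fun b => ∫ y in K, g (b, y) ∂μ) =
      fun b => ∫ y in K, iteratedFDeriv ℝ m (fun b => g (b, y)) b ∂μ := by
  induction m with
  | zero =>
    funext b
    ext v
    have hc : Continuous fun y => iteratedFDeriv ℝ 0 (fun b => g (b, y)) b :=
      (contDiff_slice hg 0).continuous.comp (Continuous.prodMk_right b)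
    rw [iteratedFDeriv_zero_apply, ContinuousMultilinearMap.integral_apply
      (hc.continuousOn.integrableOn_compact hK)]
    simp
  | succ m ih =>
    funext b
    have hg1 : ContDiff ℝ 1 fun q : B × Y => iteratedFDeriv ℝ m (fun b => g (b, q.2)) q.1 :=
      (contDiff_slice hg m).of_le (by simp)
    have hs : Continuous fun y => iteratedFDeriv ℝ (m + 1) (fun b => g (b, y)) b :=
      (contDiff_slice hg (m + 1)).continuous.comp (Continuous.prodMk_right b)
    ext v
    have hd : Continuous fun y =>
        fderiv ℝ (iteratedFDeriv ℝ m fun b => g (b, y)) b (v 0) := by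
      have h1 := ((hg1.continuous_fderiv (by simp)).clm_comp
        (continuous_const (y := ContinuousLinearMap.inl ℝ B Y))).comp (Continuous.prodMk_right b)
      refine (h1.clm_apply (continuous_const (y := v 0))).congr fun y => ?_
      exact congrArg (fun f => f (v 0)) (fderiv_slice hg1 b y)
    rw [iteratedFDeriv_succ_apply_left, ih, fderiv_setIntegral_apply μ hg1 hK,
      ContinuousMultilinearMap.integral_apply (hd.continuousOn.integrableOn_compact hK),
      ContinuousMultilinearMap.integral_apply (hs.continuousOn.integrableOn_compact hK)]
    rfl

theorem contDiff_setIntegral [CompleteSpace F] {g : B × Y → F} (hg : ContDiff ℝ ∞ g)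
    (hK : IsCompact K) :
    ContDiff ℝ ∞ (fun b => ∫ y in K, g (b, y) ∂μ) := by
  refine contDiff_of_differentiable_iteratedFDeriv fun m _ => ?_
  rw [iteratedFDeriv_setIntegral μ hg hK]
  intro b
  exact (hasFDerivAt_setIntegral μ ((contDiff_slice hg m).of_le (by simp)) hK b).differentiableAt

theorem norm_iteratedFDeriv_setIntegral_le [CompleteSpace F] {g : B × Y → F} (hg : ContDiff ℝ ∞ g)
    (hK : IsCompact K) (m : ℕ) (b : B) {C : ℝ}
    (hC : ∀ y ∈ K, ‖iteratedFDeriv ℝ m (fun b => g (b, y)) b‖ ≤ C) :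
    ‖iteratedFDeriv ℝ m (fun b => ∫ y in K, g (b, y) ∂μ) b‖ ≤ C * μ.real K := by
  rw [iteratedFDeriv_setIntegral μ hg hK]
  exact norm_setIntegral_le_of_norm_le_const hK.measure_lt_top hC

/-- The integral of a function of temperate growth over a compact set of some of the variables has
temperate growth in the others. -/
theorem temperate_setIntegral [CompleteSpace F] {g : B × Y → F} (hg : g.HasTemperateGrowth)
    (hK : IsCompact K) :
    (fun b => ∫ y in K, g (b, y) ∂μ).HasTemperateGrowth := by
  refine ⟨contDiff_setIntegral μ hg.1 hK, fun m => ?_⟩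
  obtain ⟨k, C, h⟩ := hg.2 m
  obtain ⟨R, hR⟩ := hK.isBounded.exists_norm_le
  have hC : 0 ≤ C := by simpa using (norm_nonneg _).trans (h 0)
  refine ⟨k, C * (1 + |R|) ^ k * μ.real K, fun b => ?_⟩
  have := norm_iteratedFDeriv_setIntegral_le μ hg.1 hK m b
    (C := C * (1 + |R|) ^ k * (1 + ‖b‖) ^ k) fun y hy => by
      refine (norm_iteratedFDeriv_slice_le hg.1 m b y).trans ((h _).trans ?_)
      rw [mul_assoc, ← mul_pow]
      have h1 : ‖(b, y)‖ ≤ ‖b‖ + |R| := by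
        rw [Prod.norm_def]
        exact max_le (by simp) (((hR y hy).trans (le_abs_self R)).trans (by simp))
      gcongr
      nlinarith [norm_nonneg b, abs_nonneg R]
  calc _ ≤ _ := this
    _ = _ := by ring

end ParamIntegral

variable {E : Type*} [NormedAddCommGroup E] [NormedSpace ℝ E]
variable {E' : Type*} [NormedAddCommGroup E'] [NormedSpace ℝ E']

namespace MForm

/-! ### Iterated contractions -/

/-- The contraction with the vectors of a list, the head of the list first. -/
def contrs : List E → MForm E →ₗ[ℂ] MForm E
  | [] => LinearMap.id
  | u :: L => contrs L ∘ₗ contr u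

@[simp] theorem contrs_nil (α : MForm E) : contrs [] α = α := rfl

@[simp] theorem contrs_cons (u : E) (L : List E) (α : MForm E) :
    contrs (u :: L) α = contrs L (contr u α) := rfl

theorem contrs_append (L L' : List E) (α : MForm E) :
    contrs (L ++ L') α = contrs L' (contrs L α) := by
  induction L generalizing α with
  | nil => rfl
  | cons u L ih => exact ih _

theorem isDeg_contrs (L : List E) : IsDeg (contrs L) := by
  induction L with
  | nil => exact isDeg_id
  | cons u L ih => exact ih.comp (isDeg_contr u)

/-- Contractions anticommute. -/
theorem contr_contrs (u : E) (L : List E) (α : MForm E) :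
    contr u (contrs L α) = (-1 : ℂ) ^ L.length • contrs L (contr u α) := by
  induction L generalizing α with
  | nil => simp
  | cons a L ih =>
    rw [contrs_cons, ih, contr_anticomm, map_neg, contrs_cons, List.length_cons, pow_succ]
    simp

theorem contrs_contr_mem {u : E} {L : List E} (h : u ∈ L) (α : MForm E) :
    contrs L (contr u α) = 0 := by
  induction L generalizing α with
  | nil => simp at h
  | cons a L ih =>
    rw [contrs_cons]
    rcases List.mem_cons.1 h with rfl | h
    · rw [contr_contr_self, map_zero]
    · rw [contr_anticomm, map_neg, ih h, neg_zero]

/-- Contraction with a vector in the span of a list vanishes after contraction with the list. -/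
theorem contrs_contr_span {u : E} {L : List E} (h : u ∈ Submodule.span ℝ {v | v ∈ L})
    (α : MForm E) : contrs L (contr u α) = 0 := by
  induction h using Submodule.span_induction with
  | mem v hv => exact contrs_contr_mem hv α
  | zero =>
    have : contr (0 : E) α = 0 := by simpa using contr_smul_vec 0 (0 : E) α
    rw [this, map_zero]
  | add v w _ _ hv hw => rw [contr_add_vec, map_add, hv, hw, add_zero]
  | smul c v _ hv => rw [contr_smul_vec, map_smul, hv, smul_zero]

theorem contrs_pull (f : E' →L[ℝ] E) (L : List E') (α : MForm E) :
    contrs L (pull f α) = pull f (contrs (L.map f) α) := by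
  induction L generalizing α with
  | nil => rfl
  | cons u L ih => rw [contrs_cons, contr_pull, ih]; rfl

/-- Evaluation of a form on a frame as an iterated contraction. -/
theorem contrs_apply_ofFn {m : ℕ} (b : Fin m → E) (α : MForm E) :
    zeroPart (contrs (List.ofFn b) α) = α m b := by
  induction m generalizing α with
  | zero => rw [List.ofFn_zero, contrs_nil, zeroPart_def]; exact congrArg _ (Subsingleton.elim _ _)
  | succ m ih =>
    rw [List.ofFn_succ, contrs_cons, ih, contr_apply,
      ContinuousAlternatingMap.curryLeft_apply_apply]
    congr 1
    funext i
    exact Fin.cases rfl (fun i => rfl) i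

theorem contr_pull_eq_zero {f : E' →L[ℝ] E} {u : E'} (h : f u = 0) (α : MForm E) :
    contr u (pull f α) = 0 := by
  have h0 : contr (0 : E) α = 0 := by simpa using contr_smul_vec 0 (0 : E) α
  rw [contr_pull, h, h0, map_zero]

theorem contrs_mul_left {L : List E} {α : MForm E} (h : ∀ u ∈ L, contr u α = 0) (β : MForm E) :
    contrs L (β * α) = contrs L β * α := by
  induction L generalizing β with
  | nil => rfl
  | cons u L ih =>
    rw [contrs_cons, contr_mul, h u (by simp), mul_zero, add_zero,
      ih (fun v hv => h v (by simp [hv]))]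
    rfl

theorem contrs_mul_right {L : List E} {α : MForm E} (h : ∀ u ∈ L, contr u α = 0)
    (hL : Even L.length) (β : MForm E) : contrs L (α * β) = α * contrs L β := by
  have key : ∀ (L : List E) (α β : MForm E), (∀ u ∈ L, contr u α = 0) →
      contrs L (α * β) = (invol^[L.length] α) * contrs L β := by
    intro L
    induction L with
    | nil => intro α β _; rfl
    | cons u L ih =>
      intro α β h
      rw [contrs_cons, contr_mul, h u (by simp), zero_mul, zero_add, ih]
      · rfl
      · intro v hv
        rw [contr_invol, h v (by simp [hv]), map_zero, neg_zero]
  rw [key L α β h]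
  obtain ⟨m, hm⟩ := hL
  have : ∀ m, invol^[m + m] α = α := by
    intro m
    induction m with
    | zero => rfl
    | succ m ih =>
      rw [show m + 1 + (m + 1) = m + m + 1 + 1 by ring, Function.iterate_succ_apply',
        Function.iterate_succ_apply', invol_invol, ih]
  rw [hm, this]

/-- The pullback by the zero map keeps the component of degree `0` only. -/
theorem pull_zero (α : MForm E) : pull (0 : E' →L[ℝ] E) α = zeroPart α • 1 := by
  ext1 k
  rcases k with _ | k
  · rw [apply_zero_eq_iff, zeroPart_pull, map_smul, zeroPart_one, smul_eq_mul, mul_one]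
  · rw [apply_succ_eq_iff]
    intro u
    rw [contr_pull_eq_zero (by simp), map_smul, contr_one, smul_zero]

theorem pull_id (α : MForm E) : pull (ContinuousLinearMap.id ℝ E) α = α := rfl

/-! ### The Cartan differential -/

/-- The differential `d - ι_v` for a vector field `v`. -/
def cartanD (v : E → E) (ξ : E → MForm E) (z : E) : MForm E := extD ξ z - contr (v z) (ξ z)

/-- The Cartan differential is an antiderivation. -/
theorem cartanD_mul [FiniteDimensional ℝ E] (v : E → E) {ξ η : E → MForm E} {z : E}
    (h : DiffAt ξ z) (h' : DiffAt η z) : cartanD v (fun y => ξ y * η y) z =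
      cartanD v ξ z * η z + invol (ξ z) * cartanD v η z := by
  rw [cartanD, extD_mul h h', contr_mul, cartanD, cartanD]
  simp only [sub_mul, mul_sub]
  abel

/-- The Cartan differential commutes with the pullback by a map that relates the vector fields. -/
theorem cartanD_pull {v : E → E} {v' : E' → E'} {ξ : E → MForm E} {f : E' → E}
    (hf : ContDiff ℝ ∞ f) {z : E'} (h : DiffAt ξ (f z)) (hv : fderiv ℝ f z (v' z) = v (f z)) :
    cartanD v' (fun y => pull (fderiv ℝ f y) (ξ (f y))) z =
      pull (fderiv ℝ f z) (cartanD v ξ (f z)) := by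
  rw [cartanD, extD_pull hf h, contr_pull, hv, cartanD, map_sub]

end MForm

/-! ### Integration along the fibre -/

section FibreIntegral

open MeasureTheory

variable {Z : Type*} [NormedAddCommGroup Z] [NormedSpace ℝ Z]
variable {F : Type*} [NormedAddCommGroup F] [NormedSpace ℝ F]

theorem isCompact_slab [FiniteDimensional ℝ Z] (R : ℝ) :
    IsCompact (Set.Icc (0 : ℝ) 1 ×ˢ Metric.closedBall (0 : Z) R) :=
  isCompact_Icc.prod (isCompact_closedBall 0 R)

theorem fderiv_eq_zero_of_closedBall {f : Z → F} {R : ℝ} (hf : ∀ w, R < ‖w‖ → f w = 0) {w : Z}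
    (hw : w ∉ Metric.closedBall (0 : Z) R) : fderiv ℝ f w = 0 := by
  have : f =ᶠ[nhds w] fun _ => 0 := by
    filter_upwards [Metric.isClosed_closedBall.isOpen_compl.mem_nhds hw] with y hy
    exact hf y (by simpa using hy)
  rw [this.fderiv_eq]
  simp

theorem fderiv_slab_snd {f : ℝ × Z → F} (hf : ContDiff ℝ 1 f) (s : ℝ) (w u : Z) :
    fderiv ℝ f (s, w) (0, u) = fderiv ℝ (fun w => f (s, w)) w u := by
  have := ((hf.differentiable (by simp) (s, w)).hasFDerivAt).comp w (hasFDerivAt_prodMk_right s w)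
  exact (congrArg (fun l => l u) this.fderiv).symm

variable [FiniteDimensional ℝ Z] [MeasurableSpace Z] [BorelSpace Z]
  (μ : Measure Z) [μ.IsAddHaarMeasure]

theorem integral_fderiv_closedBall [CompleteSpace F] {f : Z → F} (hf : ContDiff ℝ 1 f) {R : ℝ}
    (h0 : ∀ w, R < ‖w‖ → f w = 0) (u : Z) :
    ∫ w in Metric.closedBall (0 : Z) R, fderiv ℝ f w u ∂μ = 0 := by
  have hs : HasCompactSupport f := by
    refine HasCompactSupport.intro (isCompact_closedBall (0 : Z) R) fun w hw => ?_
    exact h0 w (by simpa using hw)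
  have hs' : HasCompactSupport fun w => fderiv ℝ f w u := hs.fderiv_apply (𝕜 := ℝ) u
  have hc : Continuous fun w => fderiv ℝ f w u :=
    (hf.continuous_fderiv (by simp)).clm_apply continuous_const
  rw [setIntegral_eq_integral_of_forall_compl_eq_zero fun w hw => by
    rw [fderiv_eq_zero_of_closedBall h0 hw]; rfl]
  have := integral_smul_fderiv_eq_neg_fderiv_smul_of_integrable (μ := μ) (𝕜 := ℝ)
    (f := fun _ : Z => (1 : ℝ)) (g := f) (v := u) (by simp)
    (by simpa using hc.integrable_of_hasCompactSupport hs')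
    (by simpa using hf.continuous.integrable_of_hasCompactSupport hs)
    (fun _ _ => differentiableAt_const _) (fun x _ => hf.differentiable (by simp) x)
  simpa using this

/-- The integral over a slab of a derivative in the direction of the fibre vanishes. -/
theorem integral_slab_snd [CompleteSpace F] {f : ℝ × Z → F} (hf : ContDiff ℝ 1 f) {R : ℝ}
    (h0 : ∀ s ∈ Set.Icc (0 : ℝ) 1, ∀ w, R < ‖w‖ → f (s, w) = 0) (u : Z) :
    ∫ q in Set.Icc (0 : ℝ) 1 ×ˢ Metric.closedBall (0 : Z) R, fderiv ℝ f q (0, u)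
      ∂((volume : Measure ℝ).prod μ) = 0 := by
  have hc : Continuous fun q => fderiv ℝ f q (0, u) :=
    (hf.continuous_fderiv (by simp)).clm_apply continuous_const
  rw [setIntegral_prod _ (hc.continuousOn.integrableOn_compact (isCompact_slab R))]
  refine setIntegral_eq_zero_of_forall_eq_zero fun s hs => ?_
  simp only [fderiv_slab_snd hf]
  exact integral_fderiv_closedBall μ
    (hf.comp (contDiff_const.prodMk contDiff_id)) (h0 s hs) u

/-- The integral over a slab of the derivative in the direction of the base. -/
theorem integral_slab_fst [CompleteSpace F] {f : ℝ × Z → F} (hf : ContDiff ℝ 1 f) (R : ℝ) :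
    ∫ q in Set.Icc (0 : ℝ) 1 ×ˢ Metric.closedBall (0 : Z) R, fderiv ℝ f q (1, 0)
      ∂((volume : Measure ℝ).prod μ) =
    ∫ w in Metric.closedBall (0 : Z) R, (f (1, w) - f (0, w)) ∂μ := by
  have hc : Continuous fun q => fderiv ℝ f q (1, 0) :=
    (hf.continuous_fderiv (by simp)).clm_apply continuous_const
  have hc' : Continuous fun q : Z × ℝ => fderiv ℝ f q.swap (1, 0) := hc.comp continuous_swap
  rw [← setIntegral_prod_swap, setIntegral_prod _ (hc'.continuousOn.integrableOn_compact
    ((isCompact_closedBall 0 R).prod isCompact_Icc))]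
  refine setIntegral_congr_fun Metric.isClosed_closedBall.measurableSet fun w _ => ?_
  have hd : ∀ s, HasDerivAt (fun s => f (s, w)) (fderiv ℝ f (s, w) (1, 0)) s := by
    intro s
    have := ((hf.differentiable (by simp) (s, w)).hasFDerivAt).comp_hasDerivAt s
      ((hasDerivAt_id s).prodMk (hasDerivAt_const s w))
    exact this
  change ∫ s in Set.Icc (0 : ℝ) 1, fderiv ℝ f (s, w) (1, 0) = _
  rw [integral_Icc_eq_integral_Ioc, ← intervalIntegral.integral_of_le zero_le_one,
    intervalIntegral.integral_eq_sub_of_hasDerivAt (fun s _ => hd s)]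
  exact (hc.comp (Continuous.prodMk_left w)).intervalIntegrable _ _

end FibreIntegral

/-! ### Integration over the interval times the fibre -/

section FibreHomotopy

open MeasureTheory MForm

variable {Z : Type*} [NormedAddCommGroup Z] [NormedSpace ℝ Z]

/-- The inclusion of the tangent space of the base into that of `ℝ × (base × fibre)`. -/
def baseIncl (Z : Type*) [NormedAddCommGroup Z] [NormedSpace ℝ Z] : Z →L[ℝ] ℝ × (Z × Z) :=
  (ContinuousLinearMap.inr ℝ ℝ (Z × Z)).comp (ContinuousLinearMap.inl ℝ Z Z)

theorem baseIncl_apply (u : Z) : baseIncl Z u = (0, (u, 0)) := rfl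

/-- The linear part of the inclusion of the fibre over a base point. -/
def fibreIncl (Z : Type*) [NormedAddCommGroup Z] [NormedSpace ℝ Z] :
    ℝ × Z →L[ℝ] ℝ × (Z × Z) :=
  (ContinuousLinearMap.id ℝ ℝ).prodMap (ContinuousLinearMap.inr ℝ Z Z)

theorem hasFDerivAt_fibre (z : Z) (q : ℝ × Z) :
    HasFDerivAt (fun q : ℝ × Z => (q.1, (z, q.2))) (fibreIncl Z) q := by
  have : (fun q : ℝ × Z => (q.1, (z, q.2))) = fun q => fibreIncl Z q + (0, (z, 0)) := by
    funext q
    ext <;> simp [fibreIncl]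
  rw [this]
  exact (fibreIncl Z).hasFDerivAt.add_const _

theorem contDiff_fibre (z : Z) : ContDiff ℝ ∞ (fun q : ℝ × Z => (q.1, (z, q.2))) :=
  contDiff_fst.prodMk (contDiff_const.prodMk contDiff_snd)

theorem hasFDerivAt_base (s : ℝ) (w : Z) (z : Z) :
    HasFDerivAt (fun z : Z => ((s, (z, w)) : ℝ × (Z × Z))) (baseIncl Z) z := by
  have : (fun z : Z => ((s, (z, w)) : ℝ × (Z × Z))) = fun z => baseIncl Z z + (s, (0, w)) := by
    funext z
    simp [baseIncl]
  rw [this]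
  exact (baseIncl Z).hasFDerivAt.add_const _

theorem contDiff_base (s : ℝ) (w : Z) :
    ContDiff ℝ ∞ (fun z : Z => ((s, (z, w)) : ℝ × (Z × Z))) :=
  contDiff_const.prodMk (contDiff_id.prodMk contDiff_const)

theorem pd_fibre {ξ : ℝ × (Z × Z) → MForm Z} (h : Smooth ξ) (z : Z) (q v : ℝ × Z) (k : ℕ) :
    fderiv ℝ (fun q : ℝ × Z => ξ (q.1, (z, q.2)) k) q v =
      pd ξ (q.1, (z, q.2)) (fibreIncl Z v) k := by
  have := (h.diffAt (q.1, (z, q.2)) k).hasFDerivAt.comp q (hasFDerivAt_fibre z q)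
  exact congrArg (fun l => l v) this.fderiv

section Slab

variable [MeasurableSpace Z] (μ : Measure Z) (R : ℝ)

/-- The integral of a form-valued function over `[0, 1] × ball R`, componentwise. -/
def slabInt (ψ : ℝ × Z → MForm Z) : MForm Z := fun k =>
  ∫ q in Set.Icc (0 : ℝ) 1 ×ˢ Metric.closedBall (0 : Z) R, ψ q k ∂((volume : Measure ℝ).prod μ)

theorem slabInt_apply (ψ : ℝ × Z → MForm Z) (k : ℕ) : slabInt μ R ψ k =
    ∫ q in Set.Icc (0 : ℝ) 1 ×ˢ Metric.closedBall (0 : Z) R, ψ q k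
      ∂((volume : Measure ℝ).prod μ) := rfl

theorem slabInt_smul (c : ℂ) (ψ : ℝ × Z → MForm Z) :
    slabInt μ R (fun q => c • ψ q) = c • slabInt μ R ψ := by
  ext1 k
  exact integral_smul c _

end Slab

variable [FiniteDimensional ℝ Z] [MeasurableSpace Z] [BorelSpace Z]
  (μ : Measure Z) [μ.IsAddHaarMeasure] (R : ℝ)

theorem integrable_slab {ψ : ℝ × Z → MForm Z} (h : Smooth ψ) (k : ℕ) :
    IntegrableOn (fun q => ψ q k) (Set.Icc (0 : ℝ) 1 ×ˢ Metric.closedBall (0 : Z) R)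
      ((volume : Measure ℝ).prod μ) :=
  (h k).continuous.continuousOn.integrableOn_compact (isCompact_slab R)

theorem slabInt_sub {ψ φ : ℝ × Z → MForm Z} (h : Smooth ψ) (h' : Smooth φ) :
    slabInt μ R (fun q => ψ q - φ q) = slabInt μ R ψ - slabInt μ R φ := by
  ext1 k
  exact integral_sub (integrable_slab μ R h k) (integrable_slab μ R h' k)

theorem IsDeg_slabInt {L : MForm Z →ₗ[ℂ] MForm Z} (hL : IsDeg L) {ψ : ℝ × Z → MForm Z}
    (h : Smooth ψ) : L (slabInt μ R ψ) = slabInt μ R (fun q => L (ψ q)) := by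
  ext1 k
  obtain ⟨d, l, hl⟩ := hL k
  rw [hl, slabInt_apply, slabInt_apply]
  simp only [hl]
  exact (l.integral_comp_comm (integrable_slab μ R h d)).symm

theorem slabInt_pd_fibre {ξ : ℝ × (Z × Z) → MForm Z} (h : Smooth ξ)
    (h0 : ∀ s ∈ Set.Icc (0 : ℝ) 1, ∀ z w, R < ‖w‖ → ξ (s, (z, w)) = 0) (z u : Z) :
    slabInt μ R (fun q => pd ξ (q.1, (z, q.2)) (0, (0, u))) = 0 := by
  ext1 k
  have := integral_slab_snd μ (((h k).comp (contDiff_fibre z)).of_le (by simp)) (R := R)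
    (fun s hs w hw => congrFun (h0 s hs z w hw) k) u
  rw [slabInt_apply, MForm.zero_apply, ← this]
  congr 1
  funext q
  exact (pd_fibre h z q (0, u) k).symm

/-- The fundamental theorem of calculus in the base direction of the slab. -/
theorem slabInt_pd_base {ξ : ℝ × (Z × Z) → MForm Z} (h : Smooth ξ) (z : Z) (k : ℕ) :
    slabInt μ R (fun q => pd ξ (q.1, (z, q.2)) (1, 0)) k =
      ∫ w in Metric.closedBall (0 : Z) R, (ξ (1, (z, w)) k - ξ (0, (z, w)) k) ∂μ := by
  have := integral_slab_fst μ (((h k).comp (contDiff_fibre z)).of_le (by simp)) R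
  rw [slabInt_apply]
  refine Eq.trans ?_ this
  congr 1
  funext q
  exact (pd_fibre h z q (1, 0) k).symm

theorem _root_.EquivCoh.MForm.Smooth.pd {B E : Type*} [NormedAddCommGroup B] [NormedSpace ℝ B]
    [NormedAddCommGroup E]
    [NormedSpace ℝ E] {ξ : B → MForm E} (h : Smooth ξ) (v : B) : Smooth (fun y => pd ξ y v) :=
  fun k => ((h k).fderiv_right (m := ∞) (by simp)).clm_apply contDiff_const

/-- Contraction with fibre directions commutes with the exterior derivative up to sign, after
integration over the fibre. -/
theorem slabInt_extD_contrs {L : List (ℝ × (Z × Z))} (hL : ∀ u ∈ L, ∃ w, u = (0, (0, w)))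
    {β : ℝ × (Z × Z) → MForm (ℝ × (Z × Z))} (h : Smooth β)
    (h0 : ∀ s ∈ Set.Icc (0 : ℝ) 1, ∀ z w, R < ‖w‖ → β (s, (z, w)) = 0) (z : Z) :
    slabInt μ R (fun q => pull (baseIncl Z) (extD (fun t => contrs L (β t)) (q.1, (z, q.2)))) =
      (-1 : ℂ) ^ L.length • slabInt μ R
        (fun q => pull (baseIncl Z) (contrs L (extD β (q.1, (z, q.2))))) := by
  induction L generalizing β with
  | nil => simp
  | cons u L ih =>
    obtain ⟨w, rfl⟩ := hL u (by simp)
    set u : ℝ × (Z × Z) := (0, (0, w))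
    have hL' : ∀ u ∈ L, ∃ w, u = (0, (0, w)) :=
      fun v hv => hL v (List.mem_cons_of_mem _ hv)
    have hdeg : IsDeg (pull (baseIncl Z) ∘ₗ contrs L) := (isDeg_pull _).comp (isDeg_contrs L)
    have h1 : Smooth (fun t => contr u (β t)) := (isDeg_contr u).smooth h
    have e1 := ih hL' h1 (fun s hs z w hw => by rw [h0 s hs z w hw, map_zero])
    have e2 : ∀ q : ℝ × Z, pull (baseIncl Z) (contrs L (extD (fun t => contr u (β t))
        (q.1, (z, q.2)))) =
        pd (fun t => (pull (baseIncl Z) ∘ₗ contrs L) (β t)) (q.1, (z, q.2)) u -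
        pull (baseIncl Z) (contrs (u :: L) (extD β (q.1, (z, q.2)))) := by
      intro q
      rw [hdeg.pd (h.diffAt _), contrs_cons, contr_extD (h.diffAt _), map_sub, map_sub,
        LinearMap.comp_apply, sub_sub_cancel]
    have hs1 : Smooth fun q : ℝ × Z =>
        pd (fun t => (pull (baseIncl Z) ∘ₗ contrs L) (β t)) (q.1, (z, q.2)) u :=
      ((hdeg.smooth h).pd u).comp (contDiff_fibre z)
    have hs2 : Smooth fun q : ℝ × Z =>
        pull (baseIncl Z) (contrs (u :: L) (extD β (q.1, (z, q.2)))) :=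
      ((isDeg_pull _).comp (isDeg_contrs (u :: L))).smooth (h.extD.comp (contDiff_fibre z))
    simp only [contrs_cons] at e1 ⊢
    simp only [contrs_cons] at e2 hs2
    rw [e1]
    simp only [e2]
    rw [slabInt_sub μ R hs1 hs2, slabInt_pd_fibre μ R (hdeg.smooth h)
      (fun s hs z w hw => by rw [h0 s hs z w hw, map_zero]) z w, zero_sub, List.length_cons,
      pow_succ]
    simp

theorem clm_fderiv_setIntegral {B Y F G : Type*} [NormedAddCommGroup B] [NormedSpace ℝ B]
    [FiniteDimensional ℝ B] [NormedAddCommGroup Y] [NormedSpace ℝ Y] [FiniteDimensional ℝ Y]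
    [MeasurableSpace Y] [BorelSpace Y]
    [NormedAddCommGroup F] [NormedSpace ℝ F] [CompleteSpace F] [NormedAddCommGroup G]
    [NormedSpace ℝ G] [CompleteSpace G] (μ : Measure Y) [IsFiniteMeasureOnCompacts μ]
    {g : B × Y → F} (hg : ContDiff ℝ 1 g) {K : Set Y} (hK : IsCompact K)
    (L : (B →L[ℝ] F) →L[ℝ] G) (b : B) :
    L (fderiv ℝ (fun b => ∫ y in K, g (b, y) ∂μ) b) =
      ∫ y in K, L (fderiv ℝ (fun b => g (b, y)) b) ∂μ := by
  rw [fderiv_setIntegral μ hg hK b]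
  have hc : Continuous fun y => fderiv ℝ (fun b => g (b, y)) b := by
    refine (((hg.continuous_fderiv (by simp)).clm_comp
      (continuous_const (y := ContinuousLinearMap.inl ℝ B Y))).comp
      (Continuous.prodMk_right b)).congr fun y => ?_
    exact fderiv_slice hg b y
  exact (L.integral_comp_comm (hc.continuousOn.integrableOn_compact hK)).symm

/-- The exterior derivative on the base of an integral over the fibres. -/
theorem extD_slabInt {ξ : ℝ × (Z × Z) → MForm (ℝ × (Z × Z))} (h : Smooth ξ) (z : Z) :
    extD (fun z => slabInt μ R fun q => pull (baseIncl Z) (ξ (q.1, (z, q.2)))) z =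
      slabInt μ R fun q => pull (baseIncl Z) (extD ξ (q.1, (z, q.2))) := by
  have hd : ∀ q : ℝ × Z, pull (baseIncl Z) (extD ξ (q.1, (z, q.2))) =
      extD (fun z => pull (baseIncl Z) (ξ (q.1, (z, q.2)))) z := by
    intro q
    have := extD_pull (contDiff_base q.1 q.2) (z := z) (h.diffAt _)
    simp only [(hasFDerivAt_base q.1 q.2 _).fderiv] at this
    exact this.symm
  simp only [hd]
  ext1 k
  rcases k with _ | k
  · rw [slabInt_apply]
    simp [extD_zero_apply]
  have hg : ContDiff ℝ ∞ fun p : Z × (ℝ × Z) =>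
      pull (baseIncl Z) (ξ (p.2.1, (p.1, p.2.2))) k :=
    ((isDeg_pull _).smooth h k).comp
      (contDiff_snd.fst.prodMk (contDiff_fst.prodMk contDiff_snd.snd))
  have hg1 := hg.of_le (m := 1) (by simp)
  exact clm_fderiv_setIntegral ((volume : Measure ℝ).prod μ) hg1 (isCompact_slab R)
    (ContinuousAlternatingMap.alternatizeUncurryFinCLM ℝ Z ℂ) z

/-- Stokes' theorem along the fibres of `ℝ × (base × fibre) → base` over `[0, 1] × fibre`, for a
closed form for the Cartan differential with compact support in the fibre direction. -/
theorem cartanD_slabInt {L : List (ℝ × (Z × Z))} (hL : ∀ u ∈ L, ∃ w, u = (0, (0, w)))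
    (hspan : ∀ w : Z, ((0, (0, w)) : ℝ × (Z × Z)) ∈ Submodule.span ℝ {v | v ∈ L})
    (heven : Even L.length)
    {β : ℝ × (Z × Z) → MForm (ℝ × (Z × Z))} (h : Smooth β)
    (h0 : ∀ s ∈ Set.Icc (0 : ℝ) 1, ∀ z w, R < ‖w‖ → β (s, (z, w)) = 0)
    {v : Z → Z}
    (hβ : ∀ t, cartanD (fun t => (0, (v t.2.1, v t.2.2))) β t = 0) (z : Z) (k : ℕ) :
    cartanD v (fun z => slabInt μ R fun q =>
      pull (baseIncl Z) (contrs ((1, 0) :: L) (β (q.1, (z, q.2))))) z k =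
    ∫ w in Metric.closedBall (0 : Z) R, (pull (baseIncl Z) (contrs L (β (1, (z, w)))) k -
      pull (baseIncl Z) (contrs L (β (0, (z, w)))) k) ∂μ := by
  set e : ℝ × (Z × Z) := (1, 0)
  have hdeg : IsDeg (pull (baseIncl Z) ∘ₗ contrs L) := (isDeg_pull _).comp (isDeg_contrs L)
  have hdeg' : IsDeg (pull (baseIncl Z) ∘ₗ contrs (e :: L)) :=
    (isDeg_pull _).comp (isDeg_contrs _)
  have h1 : Smooth (fun t => contr e (β t)) := (isDeg_contr e).smooth h
  have hs1 : Smooth fun q : ℝ × Z =>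
      pd (fun t => (pull (baseIncl Z) ∘ₗ contrs L) (β t)) (q.1, (z, q.2)) e :=
    ((hdeg.smooth h).pd e).comp (contDiff_fibre z)
  have hs2 : Smooth fun q : ℝ × Z =>
      pull (baseIncl Z) (contrs (e :: L) (extD β (q.1, (z, q.2)))) :=
    hdeg'.smooth (h.extD.comp (contDiff_fibre z))
  have hs3 : Smooth fun q : ℝ × Z =>
      pull (baseIncl Z) (contrs (e :: L) (β (q.1, (z, q.2)))) :=
    hdeg'.smooth (h.comp (contDiff_fibre z))
  -- The Lie derivative in the direction `e` of the parameter is a sum of two terms. The one with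
  -- `extD β` is cancelled by the contraction with `v` below, since `β` is closed.
  have hd : extD (fun z => slabInt μ R fun q =>
      pull (baseIncl Z) (contrs (e :: L) (β (q.1, (z, q.2))))) z =
      slabInt μ R (fun q => pd (fun t => (pull (baseIncl Z) ∘ₗ contrs L) (β t))
        (q.1, (z, q.2)) e) -
      slabInt μ R fun q => pull (baseIncl Z) (contrs (e :: L) (extD β (q.1, (z, q.2)))) := by
    rw [extD_slabInt μ R ((isDeg_contrs (e :: L)).smooth h) z]
    simp only [contrs_cons] at hs2 ⊢
    rw [slabInt_extD_contrs μ R hL h1 (fun s hs z w hw => by rw [h0 s hs z w hw, map_zero]) z,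
      heven.neg_one_pow, one_smul, ← slabInt_sub μ R hs1 hs2]
    congr 1
    funext q
    rw [hdeg.pd (h.diffAt _), contr_extD (h.diffAt _), map_sub, map_sub,
      LinearMap.comp_apply, sub_sub_cancel]
  have hc : contr (v z) (slabInt μ R fun q =>
      pull (baseIncl Z) (contrs (e :: L) (β (q.1, (z, q.2))))) =
      -slabInt μ R fun q => pull (baseIncl Z) (contrs (e :: L) (extD β (q.1, (z, q.2)))) := by
    rw [IsDeg_slabInt μ R (isDeg_contr (v z)) hs3, ← neg_one_smul ℂ, ← slabInt_smul]
    congr 1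
    funext q
    have hq := hβ (q.1, (z, q.2))
    rw [cartanD, sub_eq_zero] at hq
    rw [hq, contr_pull, contr_contrs, List.length_cons, heven.add_one.neg_one_pow, map_smul]
    have : ((0, (v z, v q.2)) : ℝ × (Z × Z)) = baseIncl Z (v z) + (0, (0, v q.2)) := by
      simp [baseIncl]
    -- The fibre component of the vector field is in the span of `L`.
    rw [this, contr_add_vec, map_add (contrs _), contrs_contr_span (L := e :: L)
      (Submodule.span_mono (fun _ => List.mem_cons_of_mem e) (hspan (v q.2))), add_zero]
  rw [cartanD, hd, hc, sub_neg_eq_add, sub_add_cancel]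
  exact slabInt_pd_base μ R (hdeg.smooth h) z k

end FibreHomotopy

/-! ### The rotation homotopy -/

theorem temperate_prodMk {B F G : Type*} [NormedAddCommGroup B] [NormedSpace ℝ B]
    [NormedAddCommGroup F] [NormedSpace ℝ F] [NormedAddCommGroup G] [NormedSpace ℝ G]
    {f : B → F} {g : B → G} (hf : f.HasTemperateGrowth) (hg : g.HasTemperateGrowth) :
    (fun y => (f y, g y)).HasTemperateGrowth := by
  have : (fun y => (f y, g y)) = ContinuousLinearMap.inl ℝ F G ∘ f +
      ContinuousLinearMap.inr ℝ F G ∘ g := by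
    funext y
    simp
  rw [this]
  exact ((ContinuousLinearMap.inl ℝ F G).hasTemperateGrowth.comp hf).add
    ((ContinuousLinearMap.inr ℝ F G).hasTemperateGrowth.comp hg)

section Rotation

open MForm

variable {Z : Type*} [NormedAddCommGroup Z] [NormedSpace ℝ Z]

/-- The first component of the rotation-like homotopy on pairs `(z, w)`; it moves from `z`
to `w`. -/
def rotFst (t : ℝ × (Z × Z)) : Z := (1 - t.1) • t.2.1 + t.1 • t.2.2

/-- The second component of the rotation-like homotopy on pairs `(z, w)`; it moves from `w`
to `-z`. -/
def rotSnd (t : ℝ × (Z × Z)) : Z := (1 - t.1) • t.2.2 - t.1 • t.2.1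

/-- The derivative of `rotFst`. -/
def rotFstD (t : ℝ × (Z × Z)) : ℝ × (Z × Z) →L[ℝ] Z :=
  (1 - t.1) • (ContinuousLinearMap.fst ℝ Z Z ∘L ContinuousLinearMap.snd ℝ ℝ (Z × Z)) +
  t.1 • (ContinuousLinearMap.snd ℝ Z Z ∘L ContinuousLinearMap.snd ℝ ℝ (Z × Z)) +
  (ContinuousLinearMap.fst ℝ ℝ (Z × Z)).smulRight (t.2.2 - t.2.1)

/-- The derivative of `rotSnd`. -/
def rotSndD (t : ℝ × (Z × Z)) : ℝ × (Z × Z) →L[ℝ] Z :=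
  (1 - t.1) • (ContinuousLinearMap.snd ℝ Z Z ∘L ContinuousLinearMap.snd ℝ ℝ (Z × Z)) -
  t.1 • (ContinuousLinearMap.fst ℝ Z Z ∘L ContinuousLinearMap.snd ℝ ℝ (Z × Z)) -
  (ContinuousLinearMap.fst ℝ ℝ (Z × Z)).smulRight (t.2.2 + t.2.1)

theorem rotFstD_apply (t u : ℝ × (Z × Z)) :
    rotFstD t u = (1 - t.1) • u.2.1 + t.1 • u.2.2 + u.1 • (t.2.2 - t.2.1) := by
  simp [rotFstD]

theorem rotSndD_apply (t u : ℝ × (Z × Z)) :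
    rotSndD t u = (1 - t.1) • u.2.2 - t.1 • u.2.1 - u.1 • (t.2.2 + t.2.1) := by
  simp [rotSndD]

theorem hasFDerivAt_rotFst (t : ℝ × (Z × Z)) : HasFDerivAt rotFst (rotFstD t) t := by
  have h1 : HasFDerivAt (fun t : ℝ × (Z × Z) => t.1) (ContinuousLinearMap.fst ℝ ℝ (Z × Z)) t :=
    hasFDerivAt_fst
  have h2 : HasFDerivAt (fun t : ℝ × (Z × Z) => t.2.1)
    (ContinuousLinearMap.fst ℝ Z Z ∘L ContinuousLinearMap.snd ℝ ℝ (Z × Z)) t :=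
    hasFDerivAt_fst.comp t hasFDerivAt_snd
  have h3 : HasFDerivAt (fun t : ℝ × (Z × Z) => t.2.2)
    (ContinuousLinearMap.snd ℝ Z Z ∘L ContinuousLinearMap.snd ℝ ℝ (Z × Z)) t :=
    hasFDerivAt_snd.comp t hasFDerivAt_snd
  refine (((h1.const_sub 1).smul h2).add (h1.smul h3)).congr_fderiv ?_
  refine ContinuousLinearMap.ext fun u => ?_
  simp only [rotFstD_apply, _root_.add_apply, _root_.smul_apply, ContinuousLinearMap.comp_apply,
    ContinuousLinearMap.smulRight_apply, _root_.neg_apply, ContinuousLinearMap.coe_fst',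
    ContinuousLinearMap.coe_snd']
  module

theorem hasFDerivAt_rotSnd (t : ℝ × (Z × Z)) : HasFDerivAt rotSnd (rotSndD t) t := by
  have h1 : HasFDerivAt (fun t : ℝ × (Z × Z) => t.1) (ContinuousLinearMap.fst ℝ ℝ (Z × Z)) t :=
    hasFDerivAt_fst
  have h2 : HasFDerivAt (fun t : ℝ × (Z × Z) => t.2.1)
    (ContinuousLinearMap.fst ℝ Z Z ∘L ContinuousLinearMap.snd ℝ ℝ (Z × Z)) t :=
    hasFDerivAt_fst.comp t hasFDerivAt_snd
  have h3 : HasFDerivAt (fun t : ℝ × (Z × Z) => t.2.2)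
    (ContinuousLinearMap.snd ℝ Z Z ∘L ContinuousLinearMap.snd ℝ ℝ (Z × Z)) t :=
    hasFDerivAt_snd.comp t hasFDerivAt_snd
  refine (((h1.const_sub 1).smul h3).sub (h1.smul h2)).congr_fderiv ?_
  refine ContinuousLinearMap.ext fun u => ?_
  simp only [rotSndD_apply, _root_.add_apply, _root_.sub_apply, _root_.smul_apply,
    ContinuousLinearMap.comp_apply,
    ContinuousLinearMap.smulRight_apply, _root_.neg_apply, ContinuousLinearMap.coe_fst',
    ContinuousLinearMap.coe_snd']
  module

theorem temperate_rotFst : (rotFst : ℝ × (Z × Z) → Z).HasTemperateGrowth := by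
  unfold rotFst
  have h1 : (fun t : ℝ × (Z × Z) => t.1).HasTemperateGrowth :=
    (ContinuousLinearMap.fst ℝ ℝ (Z × Z)).hasTemperateGrowth
  have h2 : (fun t : ℝ × (Z × Z) => t.2.1).HasTemperateGrowth :=
    (ContinuousLinearMap.fst ℝ Z Z ∘L ContinuousLinearMap.snd ℝ ℝ (Z × Z)).hasTemperateGrowth
  have h3 : (fun t : ℝ × (Z × Z) => t.2.2).HasTemperateGrowth :=
    (ContinuousLinearMap.snd ℝ Z Z ∘L ContinuousLinearMap.snd ℝ ℝ (Z × Z)).hasTemperateGrowth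
  exact (((Function.HasTemperateGrowth.const 1).sub h1).smul h2).add (h1.smul h3)

theorem temperate_rotSnd : (rotSnd : ℝ × (Z × Z) → Z).HasTemperateGrowth := by
  unfold rotSnd
  have h1 : (fun t : ℝ × (Z × Z) => t.1).HasTemperateGrowth :=
    (ContinuousLinearMap.fst ℝ ℝ (Z × Z)).hasTemperateGrowth
  have h2 : (fun t : ℝ × (Z × Z) => t.2.1).HasTemperateGrowth :=
    (ContinuousLinearMap.fst ℝ Z Z ∘L ContinuousLinearMap.snd ℝ ℝ (Z × Z)).hasTemperateGrowth
  have h3 : (fun t : ℝ × (Z × Z) => t.2.2).HasTemperateGrowth :=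
    (ContinuousLinearMap.snd ℝ Z Z ∘L ContinuousLinearMap.snd ℝ ℝ (Z × Z)).hasTemperateGrowth
  exact (((Function.HasTemperateGrowth.const 1).sub h1).smul h3).sub (h1.smul h2)

theorem temperate_rotFstD (u : ℝ × (Z × Z)) :
    (fun t : ℝ × (Z × Z) => rotFstD t u).HasTemperateGrowth := by
  simp only [rotFstD_apply]
  have h1 : (fun t : ℝ × (Z × Z) => t.1).HasTemperateGrowth :=
    (ContinuousLinearMap.fst ℝ ℝ (Z × Z)).hasTemperateGrowth
  have h2 : (fun t : ℝ × (Z × Z) => t.2.1).HasTemperateGrowth :=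
    (ContinuousLinearMap.fst ℝ Z Z ∘L ContinuousLinearMap.snd ℝ ℝ (Z × Z)).hasTemperateGrowth
  have h3 : (fun t : ℝ × (Z × Z) => t.2.2).HasTemperateGrowth :=
    (ContinuousLinearMap.snd ℝ Z Z ∘L ContinuousLinearMap.snd ℝ ℝ (Z × Z)).hasTemperateGrowth
  exact ((((Function.HasTemperateGrowth.const 1).sub h1).smul (.const _)).add
    (h1.smul (.const _))).add ((Function.HasTemperateGrowth.const u.1).smul (h3.sub h2))

theorem temperate_rotSndD (u : ℝ × (Z × Z)) :
    (fun t : ℝ × (Z × Z) => rotSndD t u).HasTemperateGrowth := by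
  simp only [rotSndD_apply]
  have h1 : (fun t : ℝ × (Z × Z) => t.1).HasTemperateGrowth :=
    (ContinuousLinearMap.fst ℝ ℝ (Z × Z)).hasTemperateGrowth
  have h2 : (fun t : ℝ × (Z × Z) => t.2.1).HasTemperateGrowth :=
    (ContinuousLinearMap.fst ℝ Z Z ∘L ContinuousLinearMap.snd ℝ ℝ (Z × Z)).hasTemperateGrowth
  have h3 : (fun t : ℝ × (Z × Z) => t.2.2).HasTemperateGrowth :=
    (ContinuousLinearMap.snd ℝ Z Z ∘L ContinuousLinearMap.snd ℝ ℝ (Z × Z)).hasTemperateGrowth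
  exact ((((Function.HasTemperateGrowth.const 1).sub h1).smul (.const _)).sub
    (h1.smul (.const _))).sub ((Function.HasTemperateGrowth.const u.1).smul (h3.add h2))

/-- For `s ∈ [0, 1]` the map `(z, w) ↦ (rotFst, rotSnd)` is invertible with a bounded inverse. -/
theorem norm_le_of_rot {s : ℝ} (hs : s ∈ Set.Icc (0 : ℝ) 1) {z w : Z} {r : ℝ}
    (h1 : ‖rotFst (s, (z, w))‖ ≤ r) (h2 : ‖rotSnd (s, (z, w))‖ ≤ r) :
    ‖z‖ ≤ 2 * r ∧ ‖w‖ ≤ 2 * r := by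
  obtain ⟨hs0, hs1⟩ := hs
  set p := rotFst (s, (z, w)) with hp
  set q := rotSnd (s, (z, w)) with hq
  simp only [rotFst, rotSnd] at hp hq
  -- The determinant `(1 - s)² + s²` of the homotopy is at least `1 / 2`.
  have hd : 1 ≤ 2 * ((1 - s) ^ 2 + s ^ 2) := by nlinarith [sq_nonneg (1 - 2 * s)]
  have key : ∀ u : Z, ‖((1 - s) ^ 2 + s ^ 2) • u‖ ≤ r → ‖u‖ ≤ 2 * r := by
    intro u hu
    rw [norm_smul, Real.norm_of_nonneg (by positivity)] at hu
    nlinarith [norm_nonneg u]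
  constructor <;> apply key
  · have : ((1 - s) ^ 2 + s ^ 2) • z = (1 - s) • p - s • q := by
      rw [hp, hq]; module
    rw [this]
    calc _ ≤ ‖(1 - s) • p‖ + ‖s • q‖ := norm_sub_le _ _
      _ = (1 - s) * ‖p‖ + s * ‖q‖ := by
        rw [norm_smul, norm_smul, Real.norm_of_nonneg (by linarith), Real.norm_of_nonneg hs0]
      _ ≤ r := by nlinarith
  · have : ((1 - s) ^ 2 + s ^ 2) • w = s • p + (1 - s) • q := by
      rw [hp, hq]; module
    rw [this]
    calc _ ≤ ‖s • p‖ + ‖(1 - s) • q‖ := norm_add_le _ _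
      _ = s * ‖p‖ + (1 - s) * ‖q‖ := by
        rw [norm_smul, norm_smul, Real.norm_of_nonneg hs0, Real.norm_of_nonneg (by linarith)]
      _ ≤ r := by nlinarith

/-- The product of the pull-backs of `α` by `rotFst` and of `τ` by `rotSnd`. -/
def rotForm (α τ : Z → MForm Z) (t : ℝ × (Z × Z)) : MForm (ℝ × (Z × Z)) :=
  pull (rotFstD t) (α (rotFst t)) * pull (rotSndD t) (τ (rotSnd t))

/-- The supports of `α` and `τ` in a ball of radius `r` confine `rotForm α τ` to the pairs in a ball
of radius `2 r`. -/
theorem rotForm_eq_zero {α τ : Z → MForm Z} {r : ℝ} (hα : ∀ z, r < ‖z‖ → α z = 0)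
    (hτ : ∀ z, r < ‖z‖ → τ z = 0) {s : ℝ} (hs : s ∈ Set.Icc (0 : ℝ) 1) {z w : Z}
    (h : 2 * r < ‖z‖ ∨ 2 * r < ‖w‖) : rotForm α τ (s, (z, w)) = 0 := by
  rw [rotForm]
  rcases lt_or_ge r ‖rotFst (s, (z, w))‖ with h1 | h1
  · rw [hα _ h1, map_zero, zero_mul]
  rcases lt_or_ge r ‖rotSnd (s, (z, w))‖ with h2 | h2
  · rw [hτ _ h2, map_zero, mul_zero]
  obtain ⟨h3, h4⟩ := norm_le_of_rot hs h1 h2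
  rcases h with h | h <;> linarith

/-- The inclusion of the fibre direction, at a fixed value of the parameter. -/
def fibreDir (u : Z) : ℝ × (Z × Z) := (0, (0, u))

/-- The list of fibre directions given by a frame. -/
def fibreFrame {m : ℕ} (b : Fin m → Z) : List (ℝ × (Z × Z)) := List.ofFn fun j => fibreDir (b j)

/-- At `s = 0` the homotopy is the identity: the fibre integral will be `(∫ τ) α`. -/
theorem pull_contrs_rotForm_zero (α τ : Z → MForm Z) {m : ℕ} (hm : Even m) (b : Fin m → Z)
    (z w : Z) : pull (baseIncl Z) (contrs (fibreFrame b) (rotForm α τ (0, (z, w)))) =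
      τ w m b • α z := by
  have h1 : (rotFstD ((0 : ℝ), (z, w))).comp (baseIncl Z) = ContinuousLinearMap.id ℝ Z := by
    ext u
    simp [rotFstD_apply, baseIncl_apply]
  have h2 : (rotSndD ((0 : ℝ), (z, w))).comp (baseIncl Z) = 0 := by
    ext u
    simp [rotSndD_apply, baseIncl_apply]
  have h3 : (fibreFrame b).map (rotSndD ((0 : ℝ), (z, w))) = List.ofFn b := by
    rw [fibreFrame, List.map_ofFn]
    congr 1
    funext j
    simp [rotSndD_apply, fibreDir]
  rw [rotForm, contrs_mul_right _ (by simpa [fibreFrame] using hm), pull_mul, pull_pull, h1,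
    contrs_pull, pull_pull, h2, h3, pull_zero, contrs_apply_ofFn, pull_id, mul_smul_comm, mul_one]
  · simp [rotFst, rotSnd]
  · intro u hu
    obtain ⟨j, rfl⟩ := (List.mem_ofFn' _ _).1 hu
    exact contr_pull_eq_zero (by simp [rotFstD_apply, fibreDir]) _

/-- At `s = 1` the homotopy is `(z, w) ↦ (w, -z)`: the fibre integral will be `(∫ α) τ`, up to the
reflection `z ↦ -z`. -/
theorem pull_contrs_rotForm_one (α τ : Z → MForm Z) {m : ℕ} (b : Fin m → Z)
    (z w : Z) : pull (baseIncl Z) (contrs (fibreFrame b) (rotForm α τ (1, (z, w)))) =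
      α w m b • pull (-ContinuousLinearMap.id ℝ Z) (τ (-z)) := by
  have h1 : (rotFstD ((1 : ℝ), (z, w))).comp (baseIncl Z) = 0 := by
    ext u
    simp [rotFstD_apply, baseIncl_apply]
  have h2 : (rotSndD ((1 : ℝ), (z, w))).comp (baseIncl Z) = -ContinuousLinearMap.id ℝ Z := by
    ext u
    simp [rotSndD_apply, baseIncl_apply]
  have h3 : (fibreFrame b).map (rotFstD ((1 : ℝ), (z, w))) = List.ofFn b := by
    rw [fibreFrame, List.map_ofFn]
    congr 1
    funext j
    simp [rotFstD_apply, fibreDir]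
  rw [rotForm, contrs_mul_left, pull_mul, pull_pull, h2,
    contrs_pull, pull_pull, h1, h3, pull_zero, contrs_apply_ofFn, smul_mul_assoc, one_mul]
  · simp [rotFst, rotSnd]
  · intro u hu
    obtain ⟨j, rfl⟩ := (List.mem_ofFn' _ _).1 hu
    exact contr_pull_eq_zero (by simp [rotSndD_apply, fibreDir]) _

theorem span_fibreFrame {m : ℕ} {b : Fin m → Z} (hb : Submodule.span ℝ (Set.range b) = ⊤) (w : Z) :
    ((0, (0, w)) : ℝ × (Z × Z)) ∈ Submodule.span ℝ {v | v ∈ fibreFrame b} := by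
  let l : Z →ₗ[ℝ] ℝ × (Z × Z) := LinearMap.inr ℝ ℝ (Z × Z) ∘ₗ LinearMap.inr ℝ Z Z
  have h : l w ∈ (Submodule.span ℝ (Set.range b)).map l :=
    Submodule.mem_map_of_mem (hb ▸ Submodule.mem_top)
  rw [Submodule.map_span] at h
  refine Submodule.span_mono ?_ h
  rintro _ ⟨_, ⟨j, rfl⟩, rfl⟩
  exact (List.mem_ofFn' _ _).2 ⟨j, rfl⟩

end Rotation

section Homotopy

open MeasureTheory MForm

section RotInt

variable {Z : Type*} [NormedAddCommGroup Z] [NormedSpace ℝ Z] [MeasurableSpace Z] (μ : Measure Z)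

/-- The form on the base obtained by integrating `rotForm α τ` over the fibres of
`[0, 1] × base × fibre → base`. -/
def rotInt {m : ℕ} (b : Fin m → Z) (R : ℝ) (α τ : Z → MForm Z) (z : Z) : MForm Z :=
  slabInt μ R fun q =>
    pull (baseIncl Z) (contrs ((1, 0) :: fibreFrame b) (rotForm α τ (q.1, (z, q.2))))

theorem rotInt_eq_zero {m : ℕ} (b : Fin m → Z) {α τ : Z → MForm Z} {r : ℝ}
    (hα : ∀ z, r < ‖z‖ → α z = 0) (hτ : ∀ z, r < ‖z‖ → τ z = 0) (R : ℝ) {z : Z}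
    (hz : 2 * r < ‖z‖) : rotInt μ b R α τ z = 0 := by
  ext1 k
  rw [rotInt, slabInt_apply]
  refine setIntegral_eq_zero_of_forall_eq_zero fun q hq => ?_
  rw [rotForm_eq_zero hα hτ hq.1 (.inl hz), map_zero, map_zero]
  rfl

end RotInt

variable {Z : Type*} [NormedAddCommGroup Z] [NormedSpace ℝ Z] [FiniteDimensional ℝ Z]

theorem temperate_pull_rotFst {α : Z → MForm Z} (hα : Temperate α) :
    Temperate fun t => pull (rotFstD t) (α (rotFst t)) :=
  (hα.comp temperate_rotFst).pull temperate_rotFstD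

theorem temperate_pull_rotSnd {τ : Z → MForm Z} (hτ : Temperate τ) :
    Temperate fun t => pull (rotSndD t) (τ (rotSnd t)) :=
  (hτ.comp temperate_rotSnd).pull temperate_rotSndD

theorem smooth_rotForm {α τ : Z → MForm Z} (hα : Temperate α) (hτ : Temperate τ) :
    Smooth (rotForm α τ) :=
  (temperate_pull_rotFst hα).smooth.mul (temperate_pull_rotSnd hτ).smooth

/-- The rotation homotopy commutes with linear vector fields, so it pulls back closed forms to
closed forms. -/
theorem cartanD_rotForm {v : Z →ₗ[ℝ] Z} {α τ : Z → MForm Z} (hα : Temperate α) (hτ : Temperate τ)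
    (h : ∀ z, cartanD v α z = 0) (h' : ∀ z, cartanD v τ z = 0) (t : ℝ × (Z × Z)) :
    cartanD (fun t => (0, (v t.2.1, v t.2.2))) (rotForm α τ) t = 0 := by
  have e1 : ∀ t : ℝ × (Z × Z), fderiv ℝ rotFst t = rotFstD t :=
    fun t => (hasFDerivAt_rotFst t).fderiv
  have e2 : ∀ t : ℝ × (Z × Z), fderiv ℝ rotSnd t = rotSndD t :=
    fun t => (hasFDerivAt_rotSnd t).fderiv
  have c1 := cartanD_pull (v := v) (v' := fun t : ℝ × (Z × Z) => (0, (v t.2.1, v t.2.2)))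
    (f := rotFst) temperate_rotFst.1 (hα.smooth.diffAt (rotFst t))
    (by simp [e1, rotFstD_apply, rotFst])
  have c2 := cartanD_pull (v := v) (v' := fun t : ℝ × (Z × Z) => (0, (v t.2.1, v t.2.2)))
    (f := rotSnd) temperate_rotSnd.1 (hτ.smooth.diffAt (rotSnd t))
    (by simp [e2, rotSndD_apply, rotSnd])
  simp only [e1, e2, h, h', map_zero] at c1 c2
  have d1 := (temperate_pull_rotFst hα).smooth
  have d2 := (temperate_pull_rotSnd hτ).smooth
  have := cartanD_mul (fun t : ℝ × (Z × Z) => (0, (v t.2.1, v t.2.2))) (d1.diffAt t) (d2.diffAt t)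
  rw [c1, c2, zero_mul, mul_zero, add_zero] at this
  exact this

variable [MeasurableSpace Z] [BorelSpace Z] (μ : Measure Z) [μ.IsAddHaarMeasure]

/-- The form `rotInt` is a primitive for the difference of the two boundary terms, with the fibre
integrals as coefficients. -/
theorem cartanD_rotInt {m : ℕ} (hm : Even m) {b : Fin m → Z}
    (hb : Submodule.span ℝ (Set.range b) = ⊤) {v : Z →ₗ[ℝ] Z} {α τ : Z → MForm Z}
    (hα : Temperate α) (hτ : Temperate τ)
    (h : ∀ z, cartanD v α z = 0) (h' : ∀ z, cartanD v τ z = 0) {r : ℝ} (hr : 0 ≤ r)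
    (hα0 : ∀ z, r < ‖z‖ → α z = 0) (hτ0 : ∀ z, r < ‖z‖ → τ z = 0) (z : Z) :
    cartanD v (rotInt μ b (2 * r) α τ) z =
      (∫ w, α w m b ∂μ) • pull (-ContinuousLinearMap.id ℝ Z) (τ (-z)) -
      (∫ w, τ w m b ∂μ) • α z := by
  have hL : ∀ u ∈ fibreFrame b, ∃ w : Z, u = (0, (0, w)) := by
    intro u hu
    obtain ⟨j, rfl⟩ := (List.mem_ofFn' _ _).1 hu
    exact ⟨b j, rfl⟩
  ext1 k
  have key := cartanD_slabInt μ (2 * r) hL (span_fibreFrame hb) (by simpa [fibreFrame] using hm)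
    (smooth_rotForm hα hτ) (fun s hs z w hw => rotForm_eq_zero hα0 hτ0 hs (.inr hw))
    (v := v) (cartanD_rotForm hα hτ h h') z k
  refine key.trans ?_
  simp only [pull_contrs_rotForm_zero α τ hm, pull_contrs_rotForm_one]
  have i1 : ∀ {ξ : Z → MForm Z}, (∀ z, r < ‖z‖ → ξ z = 0) →
      ∫ w in Metric.closedBall (0 : Z) (2 * r), ξ w m b ∂μ = ∫ w, ξ w m b ∂μ := by
    intro ξ hξ
    refine setIntegral_eq_integral_of_forall_compl_eq_zero fun w hw => ?_
    have hw : 2 * r < ‖w‖ := by simpa using hw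
    rw [hξ w (by linarith)]
    rfl
  have i2 : ∀ {ξ : Z → MForm Z}, Temperate ξ → IntegrableOn (fun w => ξ w m b)
      (Metric.closedBall (0 : Z) (2 * r)) μ := by
    intro ξ hξ
    have : Continuous fun w => ξ w m b :=
      (temperate_apply (hξ m) fun i => .const (b i)).1.continuous
    exact this.continuousOn.integrableOn_compact (isCompact_closedBall _ _)
  change ∫ w in Metric.closedBall (0 : Z) (2 * r),
    (α w m b • pull (-ContinuousLinearMap.id ℝ Z) (τ (-z)) k - τ w m b • α z k) ∂μ =
    (∫ w, α w m b ∂μ) • pull (-ContinuousLinearMap.id ℝ Z) (τ (-z)) k -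
      (∫ w, τ w m b ∂μ) • α z k
  rw [integral_sub ((i2 hα).smul_const _) ((i2 hτ).smul_const _), integral_smul_const,
    integral_smul_const, i1 hα0, i1 hτ0]

/-- An isometry which preserves the measure, the two forms and the contraction with the frame also
preserves their `rotInt`. -/
theorem rotInt_invariant {m : ℕ} {b : Fin m → Z} {α τ : Z → MForm Z} (hα' : Temperate α)
    (hτ' : Temperate τ) (g : Z ≃ₗᵢ[ℝ] Z)
    (hμ : MeasurePreserving g μ μ)
    (hb : ∀ ξ : MForm (ℝ × (Z × Z)), contrs (fibreFrame fun j => g.symm (b j)) ξ =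
      contrs (fibreFrame b) ξ)
    (hα : ∀ z, pull (g : Z →L[ℝ] Z) (α (g z)) = α z)
    (hτ : ∀ z, pull (g : Z →L[ℝ] Z) (τ (g z)) = τ z) (R : ℝ) (z : Z) :
    pull (g : Z →L[ℝ] Z) (rotInt μ b R α τ (g z)) = rotInt μ b R α τ z := by
  let G : ℝ × (Z × Z) →L[ℝ] ℝ × (Z × Z) :=
    (ContinuousLinearMap.id ℝ ℝ).prodMap ((g : Z →L[ℝ] Z).prodMap (g : Z →L[ℝ] Z))
  have hG : ∀ t, G t = (t.1, (g t.2.1, g t.2.2)) := fun t => rfl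
  have hrot : ∀ t, pull G (rotForm α τ (G t)) = rotForm α τ t := by
    intro t
    have e1 : (rotFstD (G t)).comp G = (g : Z →L[ℝ] Z).comp (rotFstD t) := by
      refine ContinuousLinearMap.ext fun u => ?_
      change rotFstD (G t) (G u) = g (rotFstD t u)
      simp [rotFstD_apply, hG]
    have e2 : (rotSndD (G t)).comp G = (g : Z →L[ℝ] Z).comp (rotSndD t) := by
      refine ContinuousLinearMap.ext fun u => ?_
      change rotSndD (G t) (G u) = g (rotSndD t u)
      simp [rotSndD_apply, hG]
    have e3 : rotFst (G t) = g (rotFst t) := by simp [rotFst, hG]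
    have e4 : rotSnd (G t) = g (rotSnd t) := by simp [rotSnd, hG]
    rw [rotForm, pull_mul, pull_pull, pull_pull, e1, e2, e3, e4, ← pull_pull, ← pull_pull, hα, hτ,
      rotForm]
  have hpt : ∀ q : ℝ × Z, pull (g : Z →L[ℝ] Z) (pull (baseIncl Z)
      (contrs ((1, 0) :: fibreFrame b) (rotForm α τ (q.1, (g z, g q.2))))) =
      pull (baseIncl Z) (contrs ((1, 0) :: fibreFrame b) (rotForm α τ (q.1, (z, q.2)))) := by
    intro q
    have e1 : (baseIncl Z).comp (g : Z →L[ℝ] Z) = G.comp (baseIncl Z) := by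
      refine ContinuousLinearMap.ext fun u => ?_
      change baseIncl Z (g u) = G (baseIncl Z u)
      simp [baseIncl_apply, hG]
    have e2 : (1, 0) :: fibreFrame b = ((1, 0) :: fibreFrame fun j => g.symm (b j)).map G := by
      simp only [fibreFrame, List.map_cons, List.map_ofFn]
      congr 1
      · simp only [hG, Prod.fst_zero, Prod.snd_zero, map_zero]
        rfl
      · congr 1
        funext j
        simp [hG, fibreDir]
    have e3 : pull G (contrs ((1, 0) :: fibreFrame b) (rotForm α τ (q.1, (g z, g q.2)))) =
        contrs ((1, 0) :: fibreFrame b) (rotForm α τ (q.1, (z, q.2))) := by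
      conv_lhs => rw [e2]
      rw [← contrs_pull]
      have := hrot (q.1, (z, q.2))
      rw [hG] at this
      rw [this, contrs_cons, contrs_cons, hb]
    rw [pull_pull, e1, ← pull_pull, e3]
  have hs : Smooth fun q : ℝ × Z => pull (baseIncl Z)
      (contrs ((1, 0) :: fibreFrame b) (rotForm α τ (q.1, (g z, q.2)))) :=
    ((isDeg_pull _).comp (isDeg_contrs _)).smooth
      ((smooth_rotForm hα' hτ').comp (contDiff_fibre (g z)))
  rw [rotInt, IsDeg_slabInt μ R (isDeg_pull _) hs, rotInt]
  ext1 k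
  rw [slabInt_apply, slabInt_apply]
  have hmp : MeasurePreserving (Prod.map id g) ((volume : Measure ℝ).prod μ)
      ((volume : Measure ℝ).prod μ) := (MeasurePreserving.id _).prod hμ
  have hme : MeasurableEmbedding (Prod.map (id : ℝ → ℝ) g) :=
    ((Homeomorph.refl ℝ).prodCongr g.toHomeomorph).measurableEmbedding
  rw [← hmp.setIntegral_preimage_emb hme]
  have hset : Prod.map (id : ℝ → ℝ) g ⁻¹' (Set.Icc (0 : ℝ) 1 ×ˢ Metric.closedBall (0 : Z) R) =
      Set.Icc (0 : ℝ) 1 ×ˢ Metric.closedBall (0 : Z) R := by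
    ext q
    simp
  rw [hset]
  congr 1
  funext q
  exact congrFun (hpt q) k

/-- `rotInt` depends temperately on a parameter. -/
theorem temperate_rotInt {W : Type*} [NormedAddCommGroup W] [NormedSpace ℝ W]
    [FiniteDimensional ℝ W] {m : ℕ} (b : Fin m → Z) (R : ℝ) {α τ : W → Z → MForm Z}
    (hα : Temperate fun q : W × Z => α q.1 q.2) (hτ : Temperate fun q : W × Z => τ q.1 q.2) :
    Temperate fun q : W × Z => rotInt μ b R (α q.1) (τ q.1) q.2 := by
  let T : (W × Z) × (ℝ × Z) →L[ℝ] ℝ × (Z × Z) :=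
    (ContinuousLinearMap.fst ℝ ℝ Z ∘L .snd ℝ _ _).prod
      ((ContinuousLinearMap.snd ℝ W Z ∘L .fst ℝ _ _).prod
        (ContinuousLinearMap.snd ℝ ℝ Z ∘L .snd ℝ _ _))
  let p : (W × Z) × (ℝ × Z) →L[ℝ] W := ContinuousLinearMap.fst ℝ W Z ∘L .fst ℝ _ _
  have h1 : Temperate fun q => pull (rotFstD (T q)) (α (p q) (rotFst (T q))) :=
    (hα.comp (temperate_prodMk p.hasTemperateGrowth
      (temperate_rotFst.comp T.hasTemperateGrowth))).pull
      fun u => (temperate_rotFstD u).comp T.hasTemperateGrowth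
  have h2 : Temperate fun q => pull (rotSndD (T q)) (τ (p q) (rotSnd (T q))) :=
    (hτ.comp (temperate_prodMk p.hasTemperateGrowth
      (temperate_rotSnd.comp T.hasTemperateGrowth))).pull
      fun u => (temperate_rotSndD u).comp T.hasTemperateGrowth
  intro k
  exact temperate_setIntegral ((volume : Measure ℝ).prod μ)
    (((isDeg_pull (baseIncl Z)).comp (isDeg_contrs ((1, 0) :: fibreFrame b))).temperate
      (h1.mul h2) k) (isCompact_slab R)

end Homotopy

/-! ### The linear torus action and its Cartan complex -/

open MForm MeasureTheory

section Frame

variable {E : Type*} [NormedAddCommGroup E] [NormedSpace ℝ E]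

theorem contrs_flatten_congr {m : ℕ} {l l' : Fin m → List E}
    (h : ∀ i ξ, contrs (l i) ξ = contrs (l' i) ξ) (ξ : MForm E) :
    contrs (List.ofFn l).flatten ξ = contrs (List.ofFn l').flatten ξ := by
  induction m generalizing ξ with
  | zero => simp
  | succ m ih =>
    rw [List.ofFn_succ, List.ofFn_succ, List.flatten_cons, List.flatten_cons, contrs_append,
      contrs_append, h, ih fun i => h i.succ]

/-- Contraction with a pair of vectors depends only on their exterior product, here under a
rotation in the plane spanned by the pair. -/
theorem contrs_pair_rotate {a b : ℝ} (h : a ^ 2 + b ^ 2 = 1) (u v : E) (ξ : MForm E) :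
    contrs [a • u + b • v, a • v - b • u] ξ = contrs [u, v] ξ := by
  have h' : ((a : ℂ) ^ 2 + (b : ℂ) ^ 2) = 1 := by exact_mod_cast h
  have e : a • v - b • u = a • v + (-b) • u := by rw [neg_smul, sub_eq_add_neg]
  simp only [contrs_cons, contrs_nil, e, contr_add_vec, contr_smul_vec, map_add, map_smul,
    contr_contr_self, contr_anticomm u v, smul_zero, zero_add, add_zero]
  rw [smul_neg, smul_neg, ← sub_eq_add_neg, smul_smul, smul_smul, ← sub_smul]
  push_cast
  rw [show (a : ℂ) * a - b * -b = 1 by rw [← h']; ring, one_smul]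

variable {n : ℕ}

theorem realFrame_even (i : Fin n) (h : 2 * i.1 + (0 : Fin 2).1 < 2 * n) :
    realFrame n ⟨2 * i.1 + (0 : Fin 2).1, h⟩ = Pi.single i 1 := by
  have : (⟨(2 * i.1 + (0 : Fin 2).1) / 2, by omega⟩ : Fin n) = i := by
    apply Fin.ext; simp
  rw [realFrame, this, if_pos (by simp)]

theorem realFrame_odd (i : Fin n) (h : 2 * i.1 + (1 : Fin 2).1 < 2 * n) :
    realFrame n ⟨2 * i.1 + (1 : Fin 2).1, h⟩ = Pi.single i Complex.I := by
  have : (⟨(2 * i.1 + (1 : Fin 2).1) / 2, by omega⟩ : Fin n) = i := by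
    apply Fin.ext; simp only [Fin.val_one]; omega
  rw [realFrame, this, if_neg (by simp)]

theorem span_realFrame : Submodule.span ℝ (Set.range (realFrame n)) = ⊤ := by
  rw [eq_top_iff]
  intro z _
  have h1 : ∀ i : Fin n, (Pi.single i 1 : Fin n → ℂ) ∈
      Submodule.span ℝ (Set.range (realFrame n)) := fun i => by
    rw [← realFrame_even i (by have := i.2; simp)]
    exact Submodule.subset_span ⟨_, rfl⟩
  have h2 : ∀ i : Fin n, (Pi.single i Complex.I : Fin n → ℂ) ∈
      Submodule.span ℝ (Set.range (realFrame n)) := fun i => by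
    rw [← realFrame_odd i (by have := i.2; simp; omega)]
    exact Submodule.subset_span ⟨_, rfl⟩
  have : z = ∑ i, ((z i).re • (Pi.single i 1 : Fin n → ℂ) +
      (z i).im • (Pi.single i Complex.I : Fin n → ℂ)) := by
    conv_lhs => rw [← Finset.univ_sum_single z]
    refine Finset.sum_congr rfl fun i _ => ?_
    rw [← Pi.single_smul, ← Pi.single_smul, ← Pi.single_add]
    congr 1
    simp
  rw [this]
  exact Submodule.sum_mem _ fun i _ =>
    add_mem (Submodule.smul_mem _ _ (h1 i)) (Submodule.smul_mem _ _ (h2 i))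

end Frame

variable {V : Type*} [NormedAddCommGroup V] {Λ : Submodule ℤ V} {n : ℕ}

section Action

theorem act_apply (X : Fin n → Λ) (g : AddChar Λ Circle) (z : Fin n → ℂ) (i : Fin n) :
    act X g z i = (g (X i) : ℂ) * z i := by
  simp [act]

theorem act_single (X : Fin n → Λ) (g : AddChar Λ Circle) (i : Fin n) (c : ℂ) :
    act X g (Pi.single i c) = Pi.single i ((g (X i) : ℂ) * c) := by
  ext j
  rw [act_apply]
  rcases eq_or_ne j i with rfl | h
  · simp
  · simp [h]

/-- The action of an element of the torus as a linear isometry. -/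
def actIso (X : Fin n → Λ) (g : AddChar Λ Circle) : (Fin n → ℂ) ≃ₗᵢ[ℝ] (Fin n → ℂ) where
  toLinearEquiv := LinearEquiv.piCongrRight fun i => (rotation (g (X i))).toLinearEquiv
  norm_map' z := by
    simp only [Pi.norm_def]
    congr 2
    funext i
    ext
    simp [Circle.norm_coe]

theorem actIso_apply (X : Fin n → Λ) (g : AddChar Λ Circle) (z : Fin n → ℂ) :
    actIso X g z = act X g z := by
  ext i
  rw [act_apply]
  rfl

theorem actIso_symm (X : Fin n → Λ) (g : AddChar Λ Circle) (z : Fin n → ℂ) :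
    (actIso X g).symm z = act X g⁻¹ z := by
  rw [LinearIsometryEquiv.symm_apply_eq, actIso_apply]
  ext i
  rw [act_apply, act_apply, ← mul_assoc, AddChar.inv_apply', ← Circle.coe_mul]
  simp

theorem coe_actIso (X : Fin n → Λ) (g : AddChar Λ Circle) :
    ((actIso X g : (Fin n → ℂ) ≃L[ℝ] (Fin n → ℂ)) : (Fin n → ℂ) →L[ℝ] (Fin n → ℂ)) = act X g :=
  ContinuousLinearMap.ext (actIso_apply X g)

theorem measurePreserving_actIso (X : Fin n → Λ) (g : AddChar Λ Circle) :
    MeasurePreserving (actIso X g) volume volume :=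
  volume_preserving_pi fun i => (rotation (g (X i))).measurePreserving

/-- The action is unitary, so it rotates the two vectors of the frame in each coordinate plane and
contraction with the whole frame is invariant. -/
theorem contrs_act_realFrame {E : Type*} [NormedAddCommGroup E] [NormedSpace ℝ E]
    (l : (Fin n → ℂ) →ₗ[ℝ] E) (X : Fin n → Λ) (g : AddChar Λ Circle) (ξ : MForm E) :
    contrs (List.ofFn fun j => l (act X g (realFrame n j))) ξ =
      contrs (List.ofFn fun j => l (realFrame n j)) ξ := by
  rw [List.ofFn_mul', List.ofFn_mul']
  refine contrs_flatten_congr (fun i ξ => ?_) ξ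
  simp only [List.ofFn_succ, List.ofFn_zero, Fin.succ_zero_eq_one, realFrame_even, realFrame_odd,
    act_single]
  set c : ℂ := (g (X i) : ℂ) with hc
  have h : c.re ^ 2 + c.im ^ 2 = 1 := by
    have : Complex.normSq c = 1 := Circle.normSq_coe _
    rw [Complex.normSq_apply] at this
    linarith [sq c.re, sq c.im]
  have e1 : (Pi.single i (c * 1) : Fin n → ℂ) = c.re • (Pi.single i 1 : Fin n → ℂ) +
      c.im • (Pi.single i Complex.I : Fin n → ℂ) := by
    rw [← Pi.single_smul, ← Pi.single_smul, ← Pi.single_add]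
    congr 1
    apply Complex.ext <;> simp
  have e2 : (Pi.single i (c * Complex.I) : Fin n → ℂ) = c.re • (Pi.single i Complex.I : Fin n → ℂ) -
      c.im • (Pi.single i 1 : Fin n → ℂ) := by
    rw [← Pi.single_smul, ← Pi.single_smul, ← Pi.single_sub]
    congr 1
    apply Complex.ext <;> simp
  rw [e1, e2, map_add, map_sub, map_smul, map_smul, map_smul, map_smul]
  exact contrs_pair_rotate h _ _ ξ

variable [NormedSpace ℝ V]

theorem vecField_apply (X : Fin n → Λ) (x : StrongDual ℝ V) (z : Fin n → ℂ) (i : Fin n) :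
    vecField X x z i = -(Complex.I * ((x (X i : V) : ℝ) : ℂ) * z i) := by
  rw [vecField, lieAct, Pi.neg_apply, Matrix.mulVec_diagonal]

/-- The vector field `v_x`, as a linear map. -/
def vecLin (X : Fin n → Λ) (x : StrongDual ℝ V) : (Fin n → ℂ) →ₗ[ℝ] (Fin n → ℂ) where
  toFun := vecField X x
  map_add' z w := by ext i; simp only [vecField_apply, Pi.add_apply]; ring
  map_smul' c z := by
    ext i
    simp only [vecField_apply, Pi.smul_apply, Complex.real_smul, RingHom.id_apply]
    ring

end Action

variable [NormedSpace ℝ V]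

section Mix

/-- The form `α(x)` at the point `z`, as an element of the ring of forms of mixed degree. -/
def mix (α : EquivForm V n) (x : StrongDual ℝ V) (z : Fin n → ℂ) : MForm (Fin n → ℂ) :=
  fun k => α x k z

theorem mix_equivD (X : Fin n → Λ) (α : EquivForm V n) (x : StrongDual ℝ V) (z : Fin n → ℂ) :
    mix (equivD X α) x z = cartanD (vecLin X x) (mix α x) z := by
  ext1 k
  rcases k with _ | k
  · change -(α x 1 z).curryLeft (vecField X x z) = 0 - (α x 1 z).curryLeft (vecField X x z)
    rw [zero_sub]
  · rfl

theorem equivD_eq_iff {X : Fin n → Λ} {α β : EquivForm V n} : equivD X α = β ↔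
    ∀ x z, cartanD (vecLin X x) (mix α x) z = mix β x z := by
  refine ⟨fun h x z => by rw [← mix_equivD, h], fun h => ?_⟩
  funext x k z
  exact congrFun ((mix_equivD X α x z).trans (h x z)) k

theorem temperate_mix_slice {α : EquivForm V n}
    (h : Temperate fun q : StrongDual ℝ V × (Fin n → ℂ) => mix α q.1 q.2) (x : StrongDual ℝ V) :
    Temperate (mix α x) := by
  have : (fun z : Fin n → ℂ => (x, z)).HasTemperateGrowth :=
    temperate_prodMk (.const x) .id'
  exact h.comp this

/-- The value at the fixed point `0` of a form `D ν` has no component of degree `0`, since the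
vector field vanishes there. -/
theorem zeroPart_cartanD_zero {X : Fin n → Λ} {x : StrongDual ℝ V}
    (ξ : (Fin n → ℂ) → MForm (Fin n → ℂ)) : zeroPart (cartanD (vecLin X x) ξ 0) = 0 := by
  have : contr (0 : Fin n → ℂ) (ξ 0) = 0 := by
    have := contr_smul_vec 0 (0 : Fin n → ℂ) (ξ 0)
    simpa using this
  rw [cartanD, map_zero, this, sub_zero, zeroPart_extD]

end Mix

/-! ### Closed forms are determined by their integrals -/

section Core

variable {X : Fin n → Λ}

theorem exists_radius {α : EquivForm V n} (h : α ∈ moderateForms X) :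
    ∃ r, 0 ≤ r ∧ ∀ x z, r < ‖z‖ → mix α x z = 0 := by
  obtain ⟨-, ⟨K, hK, h0⟩, -⟩ := h
  obtain ⟨r, hr⟩ := hK.isBounded.exists_norm_le
  refine ⟨|r|, abs_nonneg r, fun x z hz => MForm.ext fun k => h0 x k z fun hzK => ?_⟩
  linarith [hr z hzK, le_abs_self r]

variable [FiniteDimensional ℝ V]

/-- The fibre integral of the rotation homotopy: `(∫ τ) α` and `(∫ α) τ`, the latter pulled back by
`-1`, differ by an exact form. The primitive keeps compact support and moderate growth. -/
theorem exists_rotation_primitive {α τ : EquivForm V n} (hα : α ∈ closedForms X)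
    (hτ : τ ∈ closedForms X) : ∃ ν ∈ moderateForms X, ∀ x z,
      cartanD (vecLin X x) (mix ν x) z =
        integralForm (α x (2 * n)) • pull (-ContinuousLinearMap.id ℝ _) (mix τ x (-z)) -
        integralForm (τ x (2 * n)) • mix α x z := by
  obtain ⟨r₁, h₁, hr₁⟩ := exists_radius hα.1
  obtain ⟨r₂, h₂, hr₂⟩ := exists_radius hτ.1
  set r := max r₁ r₂
  have hαr : ∀ x z, r < ‖z‖ → mix α x z = 0 := fun x z hz =>
    hr₁ x z ((le_max_left _ _).trans_lt hz)
  have hτr : ∀ x z, r < ‖z‖ → mix τ x z = 0 := fun x z hz =>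
    hr₂ x z ((le_max_right _ _).trans_lt hz)
  have hαT : Temperate fun q : StrongDual ℝ V × (Fin n → ℂ) => mix α q.1 q.2 := hα.1.1
  have hτT : Temperate fun q : StrongDual ℝ V × (Fin n → ℂ) => mix τ q.1 q.2 := hτ.1.1
  have hclosed : ∀ {β : EquivForm V n}, β ∈ closedForms X → ∀ x z,
      cartanD (vecLin X x) (mix β x) z = 0 := fun hβ x z => equivD_eq_iff.1 hβ.2 x z
  have hinv : ∀ {β : EquivForm V n}, β ∈ closedForms X → ∀ x g z,
      pull (act X g) (mix β x (act X g z)) = mix β x z :=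
    fun hβ x g z => MForm.ext fun k => hβ.1.2.2 g x k z
  let ν : EquivForm V n := fun x k z =>
    rotInt volume (realFrame n) (2 * r) (mix α x) (mix τ x) z k
  refine ⟨ν, ⟨fun k => ?_, ⟨Metric.closedBall 0 (2 * r), isCompact_closedBall _ _, ?_⟩, ?_⟩, ?_⟩
  · exact temperate_rotInt volume (realFrame n) (2 * r) (α := fun x z => mix α x z)
      (τ := fun x z => mix τ x z) hαT hτT k
  · intro x k z hz
    exact congrFun (rotInt_eq_zero volume (realFrame n) (hαr x) (hτr x) (2 * r)
      (by simpa using hz)) k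
  · intro g x k z
    have := rotInt_invariant volume (b := realFrame n) (temperate_mix_slice hαT x)
      (temperate_mix_slice hτT x) (actIso X g) (measurePreserving_actIso X g) (fun ξ => ?_)
      (fun z => ?_) (fun z => ?_) (2 * r) z
    · rw [coe_actIso, actIso_apply] at this
      exact congrFun this k
    · simp only [actIso_symm]
      exact contrs_act_realFrame (LinearMap.inr ℝ ℝ _ ∘ₗ LinearMap.inr ℝ _ _) X g⁻¹ ξ
    · rw [coe_actIso, actIso_apply, hinv hα]
    · rw [coe_actIso, actIso_apply, hinv hτ]
  · intro x z
    exact cartanD_rotInt volume (even_two_mul n) span_realFrame (temperate_mix_slice hαT x)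
      (temperate_mix_slice hτT x) (hclosed hα x) (hclosed hτ x) (h₁.trans (le_max_left _ _))
      (hαr x) (hτr x) z

/-- A closed form whose integral vanishes is exact: the rotation primitive for it and a Thom form
has only the boundary term `(∫ τ) α = α`. -/
theorem mem_exactForms_of_integral_eq_zero {α τ : EquivForm V n} (hα : α ∈ closedForms X)
    (hτ : τ ∈ closedForms X) (hτ1 : ∀ x, integralForm (τ x (2 * n)) = 1)
    (h : ∀ x, integralForm (α x (2 * n)) = 0) : α ∈ exactForms X := by
  obtain ⟨ν, hν, e⟩ := exists_rotation_primitive hα hτ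
  refine ⟨(-1 : ℂ) • ν, Submodule.smul_mem _ _ hν, ?_⟩
  rw [equivD_smul _ hν]
  have : equivD X ν = (-1 : ℂ) • α := equivD_eq_iff.2 fun x z => by
    rw [e, h, hτ1, zero_smul, zero_sub, one_smul]
    funext k
    exact (neg_one_smul ℂ (α x k z)).symm
  rw [this, smul_smul]
  norm_num

/-- Localization at the fixed point `0`: the component of degree `0` of a form `D ν` vanishes there,
so the values at `0` of two closed forms are proportional to their integrals. -/
theorem apply_zero_eq_integralForm_mul {α τ : EquivForm V n} (hα : α ∈ closedForms X)
    (hτ : τ ∈ closedForms X) (x : StrongDual ℝ V) :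
    integralForm (τ x (2 * n)) * zeroPart (mix α x 0) =
      integralForm (α x (2 * n)) * zeroPart (mix τ x 0) := by
  obtain ⟨ν, hν, e⟩ := exists_rotation_primitive hα hτ
  have := congrArg zeroPart (e x 0)
  rw [zeroPart_cartanD_zero, map_sub, map_smul, map_smul, zeroPart_pull, neg_zero, smul_eq_mul,
    smul_eq_mul] at this
  exact (sub_eq_zero.1 this.symm).symm

end Core

/-! ### Forms of degree one -/

open MForm MeasureTheory

section OneForm

variable {E : Type*} [NormedAddCommGroup E] [NormedSpace ℝ E]
variable {E' : Type*} [NormedAddCommGroup E'] [NormedSpace ℝ E']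

namespace MForm

/-- A form is determined by its component of degree `0` and its contractions. -/
theorem ext_contr {α β : MForm E} (h0 : zeroPart α = zeroPart β)
    (h : ∀ u, contr u α = contr u β) : α = β := by
  ext1 k
  rcases k with _ | k
  · exact apply_zero_eq_iff.2 h0
  · exact apply_succ_eq_iff.2 fun u => congrFun (h u) k

/-- A linear form, as a form of degree `1`. -/
def oneForm (l : E →L[ℝ] ℂ) : MForm E := fun k => match k with
  | 1 => ContinuousAlternatingMap.ofSubsingleton ℝ E ℂ (0 : Fin 1) l
  | _ => 0

theorem zeroPart_oneForm (l : E →L[ℝ] ℂ) : zeroPart (oneForm l) = 0 := rfl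

theorem contr_oneForm (u : E) (l : E →L[ℝ] ℂ) : contr u (oneForm l) = l u • 1 := by
  ext k w
  rcases k with _ | k
  · change l u = l u • (1 : ℂ)
    simp
  · change (0 : ℂ) = l u • (0 : ℂ)
    simp

theorem invol_oneForm (l : E →L[ℝ] ℂ) : invol (oneForm l) = -oneForm l := by
  refine ext_contr (by simp [zeroPart_invol, zeroPart_oneForm]) fun u => ?_
  rw [contr_invol, map_neg, contr_oneForm, map_smul, invol_one]

theorem oneForm_add (l l' : E →L[ℝ] ℂ) : oneForm (l + l') = oneForm l + oneForm l' := by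
  refine ext_contr (by simp [zeroPart_oneForm]) fun u => ?_
  simp [contr_oneForm, add_smul]

theorem oneForm_smul (c : ℂ) (l : E →L[ℝ] ℂ) : oneForm (c • l) = c • oneForm l := by
  refine ext_contr (by simp [zeroPart_oneForm]) fun u => ?_
  simp [contr_oneForm, mul_smul]

theorem pull_oneForm (f : E' →L[ℝ] E) (l : E →L[ℝ] ℂ) :
    pull f (oneForm l) = oneForm (l.comp f) := by
  refine ext_contr (by simp [zeroPart_pull, zeroPart_oneForm]) fun u => ?_
  simp [contr_pull, contr_oneForm, pull_one]

theorem oneForm_anticomm (l l' : E →L[ℝ] ℂ) :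
    oneForm l * oneForm l' = -(oneForm l' * oneForm l) := by
  rw [(graded_comm (oneForm l) (oneForm l')).2 (invol_oneForm l), invol_oneForm, neg_mul]

theorem oneForm_mul_self (l : E →L[ℝ] ℂ) : oneForm l * oneForm l = 0 := by
  have h := oneForm_anticomm l l
  rw [eq_neg_iff_add_eq_zero, ← two_smul ℂ] at h
  exact (smul_eq_zero_iff_right (two_ne_zero' ℂ)).1 h

/-- The exterior derivative of a multiple of a constant form. -/
theorem extD_smul_const [FiniteDimensional ℝ E] {f : E → ℂ} {z : E} (hf : DifferentiableAt ℝ f z)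
    (α : MForm E) : extD (fun y => f y • α) z = oneForm (fderiv ℝ f z) * α := by
  have h1 : extD (fun y => f y • (1 : MForm E)) z = oneForm (fderiv ℝ f z) := by
    refine ext_contr (by rw [zeroPart_extD, zeroPart_oneForm]) fun u => ?_
    have hd : DiffAt (fun y => f y • (1 : MForm E)) z := DiffAt.smul hf (DiffAt.const 1 z)
    rw [contr_extD hd, contr_oneForm]
    simp only [map_smul, contr_one, smul_zero, extD_const, sub_zero]
    ext1 k
    rw [pd_apply]
    have := (hf.hasFDerivAt.smul_const ((1 : MForm E) k)).fderiv
    exact congrArg (fun l => l u) this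
  have := extD_mul (ξ := fun y => f y • (1 : MForm E)) (η := fun _ => α) (z := z)
    (DiffAt.smul hf (DiffAt.const 1 z)) (DiffAt.const α z)
  simp only [smul_mul_assoc, one_mul] at this
  rw [this, h1, extD_const, mul_zero, add_zero]

end MForm

theorem smul_form_zero {k : ℕ} (c : ℂ) : c • (0 : E [⋀^Fin k]→L[ℝ] ℂ) = 0 := by
  ext
  simp

/-- Alternating forms of degree larger than the dimension vanish. -/
theorem form_eq_zero_of_finrank_lt [FiniteDimensional ℝ E] {k : ℕ}
    (h : Module.finrank ℝ E < k) (α : E [⋀^Fin k]→L[ℝ] ℂ) : α = 0 := by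
  ext v
  refine AlternatingMap.map_linearDependent α.toAlternatingMap v fun hv => ?_
  have := hv.fintype_card_le_finrank
  rw [Fintype.card_fin] at this
  omega

end OneForm

variable {V : Type*} [NormedAddCommGroup V] [NormedSpace ℝ V] {Λ : Submodule ℤ V} {n : ℕ}
  {X : Fin n → Λ}

/-! ### Thom forms have moderate growth -/

section ThomClosed

theorem temperate_eval [FiniteDimensional ℝ V] (P : MvPolynomial V ℂ) :
    (fun x : StrongDual ℝ V =>
      MvPolynomial.eval (fun v : V => ((x v : ℝ) : ℂ)) P).HasTemperateGrowth := by
  induction P using MvPolynomial.induction_on with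
  | C a =>
    simp only [MvPolynomial.eval_C]
    exact .const a
  | add P Q hP hQ =>
    simp only [map_add]
    exact hP.add hQ
  | mul_X P v hP =>
    simp only [map_mul, MvPolynomial.eval_X]
    exact hP.mul (Complex.ofRealCLM ∘L
      ContinuousLinearMap.apply ℝ ℝ v).hasTemperateGrowth

/-- A Thom form is polynomial on the Lie algebra with compactly supported coefficients, so it has
moderate growth. -/
theorem IsThomForm.mem_closedForms [FiniteDimensional ℝ V] {τ : EquivForm V n}
    (h : IsThomForm X τ) : τ ∈ closedForms X := by
  obtain ⟨m, P, β, hβ, e⟩ := h.polynomial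
  refine ⟨⟨fun k => ?_, ?_, h.invariant⟩, h.closed⟩
  · simp only [e]
    refine Function.HasTemperateGrowth.sum fun l _ => ?_
    have h1 := (temperate_eval (P l)).comp
      (ContinuousLinearMap.fst ℝ (StrongDual ℝ V) (Fin n → ℂ)).hasTemperateGrowth
    have h2 : (β l k).HasTemperateGrowth :=
      ((hβ l k).2.toSchwartzMap (hβ l k).1).hasTemperateGrowth
    exact h1.smul (h2.comp
      (ContinuousLinearMap.snd ℝ (StrongDual ℝ V) (Fin n → ℂ)).hasTemperateGrowth)
  · set N := Module.finrank ℝ (Fin n → ℂ)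
    refine ⟨⋃ q : Fin m × Fin (N + 1), tsupport (β q.1 q.2),
      isCompact_iUnion fun q => (hβ q.1 q.2).2.isCompact, fun x k z hz => ?_⟩
    rcases lt_or_ge N k with hk | hk
    · exact form_eq_zero_of_finrank_lt hk _
    · rw [e]
      refine Finset.sum_eq_zero fun l _ => ?_
      have : β l k z = 0 := image_eq_zero_of_notMem_tsupport fun hz' =>
        hz (Set.mem_iUnion.2 ⟨(l, ⟨k, by omega⟩), hz'⟩)
      rw [this, smul_form_zero]

/-- Closed forms may be multiplied with functions on the Lie algebra. -/
theorem smul_mem_closedForms [FiniteDimensional ℝ V] {f : StrongDual ℝ V → ℂ}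
    (hf : f.HasTemperateGrowth) {α : EquivForm V n} (hα : α ∈ closedForms X) :
    (fun x k z => f x • α x k z : EquivForm V n) ∈ closedForms X := by
  refine ⟨⟨fun k => ?_, ?_, fun g x k z => ?_⟩, ?_⟩
  · exact (hf.comp (ContinuousLinearMap.fst ℝ (StrongDual ℝ V)
      (Fin n → ℂ)).hasTemperateGrowth).smul (hα.1.1 k)
  · obtain ⟨K, hK, h0⟩ := hα.1.2.1
    exact ⟨K, hK, fun x k z hz => by
      change f x • α x k z = 0
      rw [h0 x k z hz, smul_form_zero]⟩
  · exact congrArg (f x • ·) (hα.1.2.2 g x k z)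
  · refine equivD_eq_iff.2 fun x z => ?_
    have h := equivD_eq_iff.1 hα.2 x z
    have hd : DiffAt (mix α x) z := (temperate_mix_slice hα.1.1 x).smooth.diffAt z
    change cartanD (vecLin X x) (fun z => f x • mix α x z) z = 0
    rw [cartanD, extD_smul _ hd, map_smul, ← smul_sub]
    change f x • cartanD (vecLin X x) (mix α x) z = 0
    rw [h]
    exact smul_zero _

theorem temperate_cexp_mul_I :
    (fun t : ℝ => Complex.exp (Complex.I * t)).HasTemperateGrowth := by
  have hd : ∀ (c : ℂ) (t : ℝ), HasDerivAt (fun t : ℝ => c * Complex.exp (Complex.I * t))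
      ((c * Complex.I) * Complex.exp (Complex.I * t)) t := by
    intro c t
    have h1 : HasDerivAt (fun t : ℝ => Complex.I * t) (Complex.I * 1) t :=
      (Complex.ofRealCLM.hasDerivAt (x := t)).const_mul Complex.I
    have := (h1.cexp).const_mul c
    refine this.congr_deriv ?_
    ring
  have hb : ∀ (m : ℕ) (c : ℂ) (t : ℝ),
      ‖iteratedDeriv m (fun t : ℝ => c * Complex.exp (Complex.I * t)) t‖ ≤ ‖c‖ := by
    intro m
    induction m with
    | zero =>
      intro c t
      rw [iteratedDeriv_zero, norm_mul, mul_comm Complex.I, Complex.norm_exp_ofReal_mul_I, mul_one]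
    | succ m ih =>
      intro c t
      rw [iteratedDeriv_succ']
      have : deriv (fun t : ℝ => c * Complex.exp (Complex.I * t)) =
          fun t : ℝ => (c * Complex.I) * Complex.exp (Complex.I * t) :=
        funext fun t => (hd c t).deriv
      rw [this]
      simpa using ih (c * Complex.I) t
  refine ⟨(contDiff_const.mul Complex.ofRealCLM.contDiff).cexp, fun m => ⟨0, 1, fun t => ?_⟩⟩
  rw [norm_iteratedFDeriv_eq_norm_iteratedDeriv]
  simpa using hb m 1 t

/-- As an average of characters, `expQuotient` is smooth also at `0`. -/
theorem expQuotient_eq_integral (θ : ℝ) :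
    expQuotient θ = ∫ s in Set.Icc (0 : ℝ) 1, Complex.exp (Complex.I * ((s * θ : ℝ) : ℂ)) := by
  rw [integral_Icc_eq_integral_Ioc, ← intervalIntegral.integral_of_le zero_le_one, expQuotient]
  split_ifs with h
  · simp [h]
  · have h0 : Complex.I * (θ : ℂ) ≠ 0 := mul_ne_zero Complex.I_ne_zero (by exact_mod_cast h)
    have : ∀ s : ℝ, Complex.exp (Complex.I * ((s * θ : ℝ) : ℂ)) =
        Complex.exp (Complex.I * θ * s) := by
      intro s; congr 1; push_cast; ring
    simp only [this]
    rw [integral_exp_mul_complex h0]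
    simp

theorem temperate_expQuotient : expQuotient.HasTemperateGrowth := by
  have h : (fun q : ℝ × ℝ => Complex.exp (Complex.I * ((q.2 * q.1 : ℝ) : ℂ))).HasTemperateGrowth :=
    temperate_cexp_mul_I.comp ((ContinuousLinearMap.snd ℝ ℝ ℝ).hasTemperateGrowth.mul
      (ContinuousLinearMap.fst ℝ ℝ ℝ).hasTemperateGrowth)
  have := temperate_setIntegral volume h (isCompact_Icc (a := (0 : ℝ)) (b := 1))
  simp only [← expQuotient_eq_integral] at this
  exact this

theorem bottThomForm_mem_closedForms [FiniteDimensional ℝ V] {τ : EquivForm V n}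
    (h : IsThomForm X τ) : bottThomForm X τ ∈ closedForms X := by
  refine smul_mem_closedForms ?_ h.mem_closedForms
  refine (Function.HasTemperateGrowth.const _).mul ?_
  have : ∀ s : Finset (Fin n), (fun x : StrongDual ℝ V =>
      ∏ a ∈ s, expQuotient (x (X a : V))).HasTemperateGrowth := by
    intro s
    induction s using Finset.induction_on with
    | empty =>
      simp only [Finset.prod_empty]
      exact .const 1
    | insert a s ha ih =>
      simp only [Finset.prod_insert ha]
      exact (temperate_expQuotient.comp
        (ContinuousLinearMap.apply ℝ ℝ (X a : V)).hasTemperateGrowth).mul ih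
  exact this Finset.univ

end ThomClosed

/-! ### The Thom form -/

open MForm MeasureTheory

section Profile

/-- The radial profile of the Thom form of `ℂ`, as a function of `|z|²`. -/
def profile (t : ℝ) : ℝ := -(2 * Real.pi)⁻¹ * Real.smoothTransition (1 - t)

theorem contDiff_profile : ContDiff ℝ ∞ profile :=
  contDiff_const.mul (Real.smoothTransition.contDiff.comp (contDiff_const.sub contDiff_id))

theorem profile_zero : profile 0 = -(2 * Real.pi)⁻¹ := by
  simp [profile]

theorem profile_eq_zero {t : ℝ} (h : 1 ≤ t) : profile t = 0 := by
  simp [profile, Real.smoothTransition.zero_of_nonpos (sub_nonpos.2 h)]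

theorem contDiff_deriv_profile : ContDiff ℝ ∞ (deriv profile) :=
  (contDiff_infty_iff_deriv.1 contDiff_profile).2

theorem deriv_profile_eq_zero {t : ℝ} (h : 1 < t) : deriv profile t = 0 := by
  have : profile =ᶠ[nhds t] fun _ => 0 :=
    (eventually_gt_nhds h).mono fun s hs => profile_eq_zero hs.le
  rw [this.deriv_eq, deriv_const]

/-- The integral over the fibre of the component of degree `2` of `planeThom`, in polar coordinates.
-/
theorem integral_deriv_profile : ∫ w : ℂ, 2 * deriv profile (‖w‖ ^ 2) = 1 := by
  rw [integral_fun_norm_addHaar volume fun r : ℝ => 2 * deriv profile (r ^ 2)]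
  have hv : (volume : Measure ℂ).real (Metric.ball 0 1) = Real.pi := by
    rw [Measure.real, Complex.volume_ball]
    simp
  have hI : ∫ y in Set.Ioi (0 : ℝ), deriv profile (y ^ 2) * (2 * y) = 0 - profile (0 ^ 2) := by
    have hd : ∀ y : ℝ, HasDerivAt (fun y => profile (y ^ 2))
        (deriv profile (y ^ 2) * (2 * y)) y := by
      intro y
      have h1 := ((contDiff_profile.differentiable (by simp)) (y ^ 2)).hasDerivAt
      have h2 : HasDerivAt (fun y : ℝ => y ^ 2) (2 * y) y := by simpa using hasDerivAt_pow 2 y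
      exact HasDerivAt.comp (h₂ := profile) y h1 h2
    refine integral_Ioi_of_hasDerivAt_of_tendsto (f := fun y => profile (y ^ 2))
      (hd 0).continuousAt.continuousWithinAt (fun y _ => hd y) ?_ ?_
    · have hc : Continuous fun y : ℝ => deriv profile (y ^ 2) * (2 * y) :=
        (contDiff_deriv_profile.continuous.comp (continuous_pow 2)).mul
          (continuous_const.mul continuous_id)
      refine (hc.integrable_of_hasCompactSupport ?_).integrableOn
      refine HasCompactSupport.of_support_subset_isCompact (isCompact_closedBall (0 : ℝ) 1) ?_
      intro y hy
      by_contra h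
      have h1 : 1 < |y| := by simpa using h
      refine hy ?_
      have h2 : 1 < y ^ 2 := by rw [← sq_abs]; nlinarith
      simp only [deriv_profile_eq_zero h2, zero_mul]
    · refine tendsto_const_nhds.congr' ?_
      filter_upwards [Filter.eventually_ge_atTop 1] with y hy
      rw [profile_eq_zero (by nlinarith)]
  have hI2 : ∫ y in Set.Ioi (0 : ℝ), y ^ (Module.finrank ℝ ℂ - 1) • (2 * deriv profile (y ^ 2)) =
      (2 * Real.pi)⁻¹ := by
    rw [Complex.finrank_real_complex]
    have : ∀ y : ℝ, y ^ (2 - 1) • (2 * deriv profile (y ^ 2)) =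
        deriv profile (y ^ 2) * (2 * y) := by
      intro y; simp; ring
    simp only [this]
    rw [hI]
    simp [profile_zero]
  rw [hI2, hv, Complex.finrank_real_complex]
  have := Real.pi_pos
  simp only [nsmul_eq_mul, smul_eq_mul]
  push_cast
  field_simp

end Profile

section PlaneThom

/-- The area form of `ℂ`. -/
def areaForm : MForm ℂ := oneForm (Complex.ofRealCLM ∘L Complex.reCLM) *
  oneForm (Complex.ofRealCLM ∘L Complex.imCLM)

theorem contr_areaForm (u : ℂ) : contr u areaForm =
    (u.re : ℂ) • oneForm (Complex.ofRealCLM ∘L Complex.imCLM) -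
      (u.im : ℂ) • oneForm (Complex.ofRealCLM ∘L Complex.reCLM) := by
  rw [areaForm, contr_mul, contr_oneForm, contr_oneForm, invol_oneForm]
  simp [sub_eq_add_neg]

theorem zeroPart_areaForm : zeroPart areaForm = 0 := by
  rw [areaForm, zeroPart_mul, zeroPart_oneForm, zero_mul]

theorem oneForm_mul_areaForm (l : ℂ →L[ℝ] ℂ) : oneForm l * areaForm = 0 := by
  have : l = l 1 • (Complex.ofRealCLM ∘L Complex.reCLM) +
      l Complex.I • (Complex.ofRealCLM ∘L Complex.imCLM) := by
    refine ContinuousLinearMap.ext fun w => ?_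
    have : w = w.re • (1 : ℂ) + w.im • Complex.I := by
      apply Complex.ext <;> simp
    conv_lhs => rw [this, map_add, map_smul, map_smul]
    simp [mul_comm]
  rw [this, oneForm_add, oneForm_smul, oneForm_smul, add_mul, smul_mul_assoc, smul_mul_assoc,
    areaForm, ← mul_assoc, oneForm_mul_self, zero_mul, smul_zero, zero_add,
    oneForm_anticomm, mul_neg, ← mul_assoc, oneForm_mul_self, zero_mul, neg_zero, smul_zero]

/-- The Thom form of the representation of weight `θ` on `ℂ`. -/
def planeThom (θ : ℝ) (w : ℂ) : MForm ℂ :=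
  (θ * profile (‖w‖ ^ 2) : ℂ) • 1 + (2 * deriv profile (‖w‖ ^ 2) : ℂ) • areaForm

theorem cartanD_planeThom (θ : ℝ) (w : ℂ) :
    cartanD (fun w => -(Complex.I * θ * w)) (planeThom θ) w = 0 := by
  have h1 : HasFDerivAt (fun w : ℂ => ‖w‖ ^ 2) (2 • innerSL ℝ w) w :=
    (hasStrictFDerivAt_norm_sq w).hasFDerivAt
  have h2 : HasFDerivAt (fun w : ℂ => (θ * profile (‖w‖ ^ 2) : ℂ))
      (((θ * deriv profile (‖w‖ ^ 2) : ℝ) : ℂ) • (Complex.ofRealCLM ∘L (2 • innerSL ℝ w))) w := by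
    have := (((contDiff_profile.differentiable (by simp)) (‖w‖ ^ 2)).hasDerivAt.comp_hasFDerivAt w
      h1).const_mul θ
    refine ((Complex.ofRealCLM.hasFDerivAt.comp w this).congr_fderiv ?_).congr_of_eventuallyEq ?_
    · refine ContinuousLinearMap.ext fun u => ?_
      simp [mul_assoc]
      ring
    · exact Filter.Eventually.of_forall fun w => by simp
  have h3 : DifferentiableAt ℝ (fun w : ℂ => (2 * deriv profile (‖w‖ ^ 2) : ℂ)) w := by
    have := ((contDiff_deriv_profile.differentiable (by simp)) (‖w‖ ^ 2)).comp w
      h1.differentiableAt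
    exact (Complex.ofRealCLM.differentiableAt.comp w this).const_mul 2
  rw [cartanD]
  unfold planeThom
  rw [extD_add (DiffAt.smul h2.differentiableAt (.const _ _)) (DiffAt.smul h3 (.const _ _)),
    extD_smul_const h2.differentiableAt, extD_smul_const h3, oneForm_mul_areaForm, h2.fderiv,
    map_add, map_smul, map_smul, contr_one, contr_areaForm, mul_one, add_zero, smul_zero, zero_add,
    sub_eq_zero]
  refine ext_contr (by simp [zeroPart_oneForm]) fun u => ?_
  simp only [map_smul, map_sub, contr_oneForm, smul_smul, ← sub_smul]
  congr 1
  simp [Complex.inner]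
  ring

theorem smooth_planeThom (θ : ℝ) : Smooth (planeThom θ) := by
  have h1 : ContDiff ℝ ∞ fun w : ℂ => ‖w‖ ^ 2 := contDiff_norm_sq ℝ
  refine (Smooth.smul ?_ (.const _)).add (Smooth.smul ?_ (.const _))
  · exact contDiff_const.mul (Complex.ofRealCLM.contDiff.comp (contDiff_profile.comp h1))
  · exact contDiff_const.mul (Complex.ofRealCLM.contDiff.comp (contDiff_deriv_profile.comp h1))

theorem pull_areaForm (c : Circle) :
    pull ((c : ℂ) • ContinuousLinearMap.id ℝ ℂ) areaForm = areaForm := by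
  have h : (c : ℂ).re * (c : ℂ).re + (c : ℂ).im * (c : ℂ).im = 1 := by
    rw [← Complex.normSq_apply]
    exact Circle.normSq_coe c
  have h' : ((c : ℂ).re * (c : ℂ).re + (c : ℂ).im * (c : ℂ).im : ℂ) = 1 := by exact_mod_cast h
  have e1 : (Complex.ofRealCLM ∘L Complex.reCLM).comp ((c : ℂ) • ContinuousLinearMap.id ℝ ℂ) =
      ((c : ℂ).re : ℂ) • (Complex.ofRealCLM ∘L Complex.reCLM) +
        (-(c : ℂ).im : ℂ) • (Complex.ofRealCLM ∘L Complex.imCLM) := by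
    refine ContinuousLinearMap.ext fun u => ?_
    simp [sub_eq_add_neg]
  have e2 : (Complex.ofRealCLM ∘L Complex.imCLM).comp ((c : ℂ) • ContinuousLinearMap.id ℝ ℂ) =
      ((c : ℂ).re : ℂ) • (Complex.ofRealCLM ∘L Complex.imCLM) +
        ((c : ℂ).im : ℂ) • (Complex.ofRealCLM ∘L Complex.reCLM) := by
    refine ContinuousLinearMap.ext fun u => ?_
    simp
  rw [areaForm, pull_mul, pull_oneForm, pull_oneForm, e1, e2]
  simp only [oneForm_add, oneForm_smul, mul_add, add_mul, smul_mul_assoc, mul_smul_comm,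
    oneForm_mul_self, oneForm_anticomm (Complex.ofRealCLM ∘L Complex.imCLM)
      (Complex.ofRealCLM ∘L Complex.reCLM), smul_zero, smul_neg]
  conv_rhs => rw [← one_smul ℂ (_ * _), ← h']
  module

theorem pull_planeThom (θ : ℝ) (c : Circle) (w : ℂ) :
    pull ((c : ℂ) • ContinuousLinearMap.id ℝ ℂ) (planeThom θ ((c : ℂ) * w)) = planeThom θ w := by
  rw [planeThom, map_add, map_smul, map_smul, pull_one, pull_areaForm, norm_mul, Circle.norm_coe,
    one_mul, planeThom]

theorem planeThom_eq_zero (θ : ℝ) {w : ℂ} (h : 1 < ‖w‖) : planeThom θ w = 0 := by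
  have h1 : 1 < ‖w‖ ^ 2 := by nlinarith
  rw [planeThom, profile_eq_zero h1.le, deriv_profile_eq_zero h1]
  simp

end PlaneThom

variable {V : Type*} [NormedAddCommGroup V] [NormedSpace ℝ V] {Λ : Submodule ℤ V} {n : ℕ}

section ProductThom

/-- The coordinates of `ℂⁿ` as real linear maps. -/
def coord (a : Fin n) : (Fin n → ℂ) →L[ℝ] ℂ := ContinuousLinearMap.proj a

theorem coord_apply (a : Fin n) (z : Fin n → ℂ) : coord a z = z a := rfl

/-- The Thom form of the summand `L_a` of `M_X`, pulled back to `M_X`. -/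
def coordThom (X : Fin n → Λ) (x : StrongDual ℝ V) (z : Fin n → ℂ) (a : Fin n) :
    MForm (Fin n → ℂ) :=
  pull (coord a) (planeThom (x (X a : V)) (z a))

/-- The product of the Thom forms of a list of summands. -/
def listThom (X : Fin n → Λ) (x : StrongDual ℝ V) (l : List (Fin n)) (z : Fin n → ℂ) :
    MForm (Fin n → ℂ) :=
  (l.map (coordThom X x z)).prod

theorem listThom_cons (X : Fin n → Λ) (x : StrongDual ℝ V) (a : Fin n) (l : List (Fin n))
    (z : Fin n → ℂ) : listThom X x (a :: l) z = coordThom X x z a * listThom X x l z := by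
  simp [listThom]

theorem smooth_coordThom (X : Fin n → Λ) (x : StrongDual ℝ V) (a : Fin n) :
    Smooth fun z => coordThom X x z a :=
  (isDeg_pull _).smooth ((smooth_planeThom _).comp (coord a).contDiff)

theorem cartanD_coordThom (X : Fin n → Λ) (x : StrongDual ℝ V) (a : Fin n) (z : Fin n → ℂ) :
    cartanD (vecLin X x) (fun z => coordThom X x z a) z = 0 := by
  have := cartanD_pull (v := fun w => -(Complex.I * (x (X a : V) : ℝ) * w)) (v' := vecLin X x)
    (f := coord a) (ξ := planeThom (x (X a : V))) (coord a).contDiff (z := z)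
    ((smooth_planeThom _).diffAt _) (by
      rw [ContinuousLinearMap.fderiv]
      exact vecField_apply X x z a)
  simp only [ContinuousLinearMap.fderiv, cartanD_planeThom, map_zero] at this
  exact this

theorem smooth_listThom (X : Fin n → Λ) (x : StrongDual ℝ V) (l : List (Fin n)) :
    Smooth (listThom X x l) := by
  induction l with
  | nil => exact Smooth.const 1
  | cons a l ih =>
    have := (smooth_coordThom X x a).mul ih
    simp only [← listThom_cons] at this
    exact this

theorem cartanD_listThom (X : Fin n → Λ) (x : StrongDual ℝ V) (l : List (Fin n)) (z : Fin n → ℂ) :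
    cartanD (vecLin X x) (listThom X x l) z = 0 := by
  induction l with
  | nil =>
    change cartanD (vecLin X x) (fun _ => 1) z = 0
    rw [cartanD, extD_const, contr_one, sub_zero]
  | cons a l ih =>
    have := cartanD_mul (vecLin X x) ((smooth_coordThom X x a).diffAt z)
      ((smooth_listThom X x l).diffAt z)
    simp only [← listThom_cons, ih, cartanD_coordThom, zero_mul, mul_zero, add_zero] at this
    exact this

theorem pull_listThom (X : Fin n → Λ) (x : StrongDual ℝ V) (g : AddChar Λ Circle)
    (l : List (Fin n)) (z : Fin n → ℂ) :
    pull (act X g) (listThom X x l (act X g z)) = listThom X x l z := by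
  induction l with
  | nil => exact pull_one _
  | cons a l ih =>
    rw [listThom_cons, listThom_cons, pull_mul, ih]
    congr 1
    have e : (coord a).comp (act X g) =
        ((g (X a) : ℂ) • ContinuousLinearMap.id ℝ ℂ).comp (coord a) := by
      refine ContinuousLinearMap.ext fun u => ?_
      exact act_apply X g u a
    rw [coordThom, pull_pull, e, ← pull_pull, act_apply, pull_planeThom, coordThom]

theorem zeroPart_listThom_zero (X : Fin n → Λ) (x : StrongDual ℝ V) (l : List (Fin n)) :
    zeroPart (listThom X x l 0) =
      (l.map fun a => -((x (X a : V) : ℝ) : ℂ) / (2 * Real.pi)).prod := by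
  induction l with
  | nil => exact zeroPart_one
  | cons a l ih =>
    rw [listThom_cons, zeroPart_mul, ih, List.map_cons, List.prod_cons]
    congr 1
    rw [coordThom, zeroPart_pull, planeThom]
    simp [zeroPart_areaForm, zeroPart_one, profile_zero]
    ring

theorem contr_prod_eq_zero {E : Type*} [NormedAddCommGroup E] [NormedSpace ℝ E] {u : E}
    {l : List (MForm E)} (h : ∀ α ∈ l, contr u α = 0) : contr u l.prod = 0 := by
  induction l with
  | nil => exact contr_one u
  | cons α l ih =>
    rw [List.prod_cons, contr_mul, h α (by simp), ih fun β hβ => h β (by simp [hβ]), zero_mul,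
      mul_zero, add_zero]

/-- The contraction of the product with the real frames of the same summands. -/
theorem contrs_listThom (X : Fin n → Λ) (x : StrongDual ℝ V) (z : Fin n → ℂ) {l : List (Fin n)}
    (hl : l.Nodup) :
    contrs (l.map fun i => [(Pi.single i 1 : Fin n → ℂ), Pi.single i Complex.I]).flatten
      (listThom X x l z) =
    ((l.map fun a => ((2 * deriv profile (‖z a‖ ^ 2) : ℝ) : ℂ)).prod) • 1 := by
  induction l with
  | nil => simp [listThom]
  | cons a l ih =>
    have hz : ∀ u ∈ [(Pi.single a 1 : Fin n → ℂ), Pi.single a Complex.I],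
        contr u (listThom X x l z) = 0 := by
      intro u hu
      refine contr_prod_eq_zero fun α hα => ?_
      obtain ⟨b, hb, rfl⟩ := List.mem_map.1 hα
      have hab : b ≠ a := fun h => (List.nodup_cons.1 hl).1 (h ▸ hb)
      refine contr_pull_eq_zero ?_ _
      rw [coord_apply]
      simp only [List.mem_cons, List.not_mem_nil, or_false] at hu
      rcases hu with rfl | rfl <;> simp [hab]
    rw [List.map_cons, List.flatten_cons, contrs_append, listThom_cons, contrs_mul_left hz,
      coordThom, contrs_pull]
    have : contrs ([(Pi.single a 1 : Fin n → ℂ), Pi.single a Complex.I].map (coord a))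
        (planeThom (x (X a : V)) (z a)) = (2 * deriv profile (‖z a‖ ^ 2) : ℂ) • 1 := by
      simp only [List.map_cons, List.map_nil, coord_apply, Pi.single_eq_same, contrs_cons,
        contrs_nil, planeThom, map_add, map_smul, contr_one, contr_areaForm, map_sub,
        contr_oneForm]
      simp
    rw [this, map_smul, pull_one, smul_mul_assoc, one_mul, map_smul, ih (List.nodup_cons.1 hl).2,
      smul_smul, List.map_cons, List.prod_cons]
    push_cast
    rfl

/-- The Thom form is polynomial on the Lie algebra, with coefficients supported in the unit
polydisc. -/
theorem listThom_polynomial (X : Fin n → Λ) (l : List (Fin n)) :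
    ∃ (ι : Type) (_ : Fintype ι) (P : ι → MvPolynomial V ℂ)
      (β : ι → (Fin n → ℂ) → MForm (Fin n → ℂ)), (∀ j, Smooth (β j)) ∧
      (∀ j z, (∃ a ∈ l, 1 < ‖z a‖) → β j z = 0) ∧ ∀ x z, listThom X x l z =
        ∑ j, MvPolynomial.eval (fun v : V => ((x v : ℝ) : ℂ)) (P j) • β j z := by
  induction l with
  | nil =>
    refine ⟨Unit, inferInstance, fun _ => 1, fun _ _ => 1, fun _ => .const 1, by simp,
      fun x z => ?_⟩
    simp [listThom]
  | cons a l ih =>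
    obtain ⟨ι, _, P, β, hβ, h0, e⟩ := ih
    -- `planeThom` is affine in `θ`: the index `true` stands for the coefficient of `θ` and `false`
    -- for the rest.
    let γ : Bool → (Fin n → ℂ) → MForm (Fin n → ℂ) := fun b z =>
      pull (coord a) (if b then (profile (‖z a‖ ^ 2) : ℂ) • 1 else planeThom 0 (z a))
    have hγ : ∀ b, Smooth (γ b) := by
      intro b
      refine (isDeg_pull _).smooth ?_
      cases b
      · exact (smooth_planeThom 0).comp (coord a).contDiff
      · have h1 : ContDiff ℝ ∞ fun w : ℂ => ‖w‖ ^ 2 := contDiff_norm_sq ℝ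
        exact Smooth.smul (Complex.ofRealCLM.contDiff.comp
          (contDiff_profile.comp (h1.comp (coord a).contDiff))) (.const _)
    have hγ0 : ∀ b z, 1 < ‖z a‖ → γ b z = 0 := by
      intro b z hz
      cases b
      · simp [γ, planeThom_eq_zero 0 hz]
      · have h1 : 1 ≤ ‖z a‖ ^ 2 := by nlinarith
        simp [γ, profile_eq_zero h1]
    refine ⟨Bool × ι, inferInstance,
      fun j => (if j.1 then MvPolynomial.X (X a : V) else 1) * P j.2,
      fun j z => γ j.1 z * β j.2 z, fun j => (hγ _).mul (hβ _), ?_, fun x z => ?_⟩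
    · rintro ⟨b, j⟩ z ⟨c, hc, hz⟩
      rcases List.mem_cons.1 hc with rfl | hc
      · simp only [hγ0 b z hz, zero_mul]
      · simp only [h0 j z ⟨c, hc, hz⟩, mul_zero]
    · have hT : coordThom X x z a = ((x (X a : V) : ℝ) : ℂ) • γ true z + γ false z := by
        simp only [coordThom, γ, planeThom, if_true, map_add, map_smul]
        simp [mul_smul]
      rw [listThom_cons, hT, e, Fintype.sum_prod_type, Fintype.sum_bool, add_mul,
        Finset.mul_sum, Finset.mul_sum]
      congr 1
      · refine Finset.sum_congr rfl fun j _ => ?_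
        simp only [if_true]
        rw [map_mul, MvPolynomial.eval_X, smul_mul_assoc, mul_smul_comm, smul_smul]
      · refine Finset.sum_congr rfl fun j _ => ?_
        simp

/-- The Thom form of `M_X`, the product of the Thom forms of its summands. -/
def thomForm (X : Fin n → Λ) : EquivForm V n := fun x k z => listThom X x (List.finRange n) z k

theorem isThomForm_thomForm (X : Fin n → Λ) : IsThomForm X (thomForm X) where
  polynomial := by
    obtain ⟨ι, _, P, β, hβ, h0, e⟩ := listThom_polynomial X (List.finRange n)
    let f := (Fintype.equivFin ι).symm
    refine ⟨Fintype.card ι, fun l => P (f l), fun l k z => β (f l) z k,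
      fun l k => ⟨hβ (f l) k, ?_⟩, fun x k z => ?_⟩
    · refine HasCompactSupport.of_support_subset_isCompact
        (isCompact_closedBall (0 : Fin n → ℂ) 1) fun z hz => ?_
      rw [mem_closedBall_zero_iff, pi_norm_le_iff_of_nonneg zero_le_one]
      by_contra! h
      obtain ⟨a, ha⟩ := h
      exact hz (congrFun (h0 (f l) z ⟨a, List.mem_finRange a, ha⟩) k)
    · have := congrFun (e x z) k
      rw [MForm.sum_apply] at this
      refine this.trans ?_
      exact (Equiv.sum_comp f fun j =>
        MvPolynomial.eval (fun v : V => ((x v : ℝ) : ℂ)) (P j) • β j z k).symm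
  invariant g x k z := congrFun (pull_listThom X x g (List.finRange n) z) k
  closed := equivD_eq_iff.2 fun x z => cartanD_listThom X x (List.finRange n) z
  integral_eq_one x := by
    have h : ∀ z, thomForm X x (2 * n) z (realFrame n) =
        ∏ a, ((2 * deriv profile (‖z a‖ ^ 2) : ℝ) : ℂ) := by
      intro z
      rw [thomForm, ← contrs_apply_ofFn, List.ofFn_mul']
      have : (List.ofFn fun i : Fin n => List.ofFn fun j : Fin 2 =>
          realFrame n ⟨2 * i.1 + j.1, by omega⟩) = (List.finRange n).map fun i =>
            [(Pi.single i 1 : Fin n → ℂ), Pi.single i Complex.I] := by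
        rw [List.ofFn_eq_map]
        simp only [List.ofFn_succ, List.ofFn_zero, Fin.succ_zero_eq_one, realFrame_even,
          realFrame_odd]
      rw [this, contrs_listThom X x z (List.nodup_finRange n), map_smul, zeroPart_one, smul_eq_mul,
        mul_one, ← List.ofFn_eq_map, List.prod_ofFn]
    rw [integralForm]
    simp only [h]
    rw [integral_fintype_prod_volume_eq_prod
      (fun (_ : Fin n) (w : ℂ) => ((2 * deriv profile (‖w‖ ^ 2) : ℝ) : ℂ))]
    refine Finset.prod_eq_one fun a _ => ?_
    rw [integral_complex_ofReal, integral_deriv_profile, Complex.ofReal_one]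

/-- The restriction of the Thom form to the origin is the equivariant Euler class `∏ a, -⟨a, x⟩ /
2π`. -/
theorem zeroPart_thomForm_zero (X : Fin n → Λ) (x : StrongDual ℝ V) :
    zeroPart (mix (thomForm X) x 0) = ∏ a, (-((x (X a : V) : ℝ) : ℂ) / (2 * Real.pi)) := by
  refine (zeroPart_listThom_zero X x (List.finRange n)).trans ?_
  rw [← List.ofFn_eq_map, List.prod_ofFn]

end ProductThom

/-! ### Exponentials in Banach algebras -/

open MeasureTheory NormedSpace

section ExpDeriv

variable {𝔸 : Type*} [NormedRing 𝔸]

theorem norm_pow_le_mul (a : 𝔸) (m : ℕ) : ‖a ^ m‖ ≤ ‖(1 : 𝔸)‖ * ‖a‖ ^ m := by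
  induction m with
  | zero => simp
  | succ m ih =>
    rw [pow_succ, pow_succ, ← mul_assoc]
    exact (norm_mul_le _ _).trans (mul_le_mul_of_nonneg_right ih (norm_nonneg _))

variable [NormedAlgebra ℝ 𝔸]

theorem differentiable_pow' (m : ℕ) : Differentiable ℝ (fun a : 𝔸 => a ^ m) :=
  fun _ => differentiableAt_id.pow m

/-- The factor `2 ^ m` is a crude bound for the factor `m` from the product rule. -/
theorem norm_fderiv_pow_le (m : ℕ) {a : 𝔸} {R : ℝ} (hR : 1 ≤ R) (ha : ‖a‖ ≤ R) :
    ‖fderiv ℝ (fun a : 𝔸 => a ^ m) a‖ ≤ ‖(1 : 𝔸)‖ * (2 * R) ^ m := by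
  induction m with
  | zero => simp
  | succ m ih =>
    refine ContinuousLinearMap.opNorm_le_bound _ (by positivity) fun b => ?_
    have h : HasFDerivAt (fun a : 𝔸 => a ^ m * a) _ a :=
      ((differentiable_pow' m a).hasFDerivAt).mul' (hasFDerivAt_id a)
    simp only [pow_succ]
    rw [h.fderiv]
    have h0 : ‖a ^ m‖ ≤ ‖(1 : 𝔸)‖ * R ^ m :=
      (norm_pow_le_mul a m).trans (by gcongr)
    have h1 : R ^ m ≤ (2 * R) ^ m * R := by
      calc R ^ m ≤ (2 * R) ^ m := by gcongr; linarith
        _ ≤ (2 * R) ^ m * R := le_mul_of_one_le_right (by positivity) hR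
    calc ‖a ^ m * b + fderiv ℝ (fun a : 𝔸 => a ^ m) a b * a‖
        ≤ ‖a ^ m‖ * ‖b‖ + ‖fderiv ℝ (fun a : 𝔸 => a ^ m) a‖ * ‖b‖ * ‖a‖ := by
          refine (norm_add_le _ _).trans (add_le_add (norm_mul_le _ _)
            ((norm_mul_le _ _).trans ?_))
          exact mul_le_mul_of_nonneg_right (ContinuousLinearMap.le_opNorm _ _) (norm_nonneg _)
      _ ≤ ‖(1 : 𝔸)‖ * R ^ m * ‖b‖ + ‖(1 : 𝔸)‖ * (2 * R) ^ m * ‖b‖ * R := by gcongr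
      _ ≤ ‖(1 : 𝔸)‖ * ((2 * R) ^ m * R) * ‖b‖ + ‖(1 : 𝔸)‖ * (2 * R) ^ m * ‖b‖ * R := by gcongr
      _ = ‖(1 : 𝔸)‖ * ((2 * R) ^ m * (2 * R)) * ‖b‖ := by ring

variable [CompleteSpace 𝔸]

/-- The derivative of the exponential is the sum of the derivatives of the terms of its series. -/
theorem hasFDerivAt_exp_tsum (a : 𝔸) :
    Summable (fun m : ℕ => (m.factorial : ℝ)⁻¹ • fderiv ℝ (fun a : 𝔸 => a ^ m) a) ∧
    HasFDerivAt (exp : 𝔸 → 𝔸)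
      (∑' m : ℕ, (m.factorial : ℝ)⁻¹ • fderiv ℝ (fun a : 𝔸 => a ^ m) a) a := by
  set R := ‖a‖ + 1
  have hu : Summable fun m : ℕ => ‖(1 : 𝔸)‖ * ((2 * R) ^ m / m.factorial) :=
    (Real.summable_pow_div_factorial (2 * R)).mul_left _
  have hb : ∀ (m : ℕ), ∀ b ∈ Metric.ball (0 : 𝔸) R,
      ‖(m.factorial : ℝ)⁻¹ • fderiv ℝ (fun a : 𝔸 => a ^ m) b‖ ≤
        ‖(1 : 𝔸)‖ * ((2 * R) ^ m / m.factorial) := by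
    intro m b hb
    have hR : 1 ≤ R := le_add_of_nonneg_left (norm_nonneg a)
    have := norm_fderiv_pow_le m hR (mem_ball_zero_iff.1 hb).le
    rw [norm_smul, norm_inv, Real.norm_natCast]
    calc _ ≤ (m.factorial : ℝ)⁻¹ * (‖(1 : 𝔸)‖ * (2 * R) ^ m) := by gcongr
      _ = _ := by ring
  have ha : a ∈ Metric.ball (0 : 𝔸) R := by simp [R]
  refine ⟨.of_norm_bounded hu fun m => hb m a ha, ?_⟩
  have h := hasFDerivAt_tsum_of_isPreconnected (f := fun (m : ℕ) (a : 𝔸) =>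
    (m.factorial : ℝ)⁻¹ • a ^ m) (x₀ := 0) (x := a) hu Metric.isOpen_ball
    (convex_ball (0 : 𝔸) R).isPreconnected
    (fun m b _ => ((differentiable_pow' m b).hasFDerivAt.const_smul (m.factorial : ℝ)⁻¹)) hb
    (by simp [R]; positivity) (exp_series_hasSum_exp' (𝕂 := ℝ) (0 : 𝔸)).summable ha
  rw [exp_eq_tsum ℝ]
  exact h

theorem contDiff_exp : ContDiff ℝ ∞ (exp : 𝔸 → 𝔸) :=
  contDiff_iff_contDiffAt.2 fun a => (exp_analytic (𝕂 := ℝ) a).contDiffAt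

theorem hasSum_fderiv_exp (a : 𝔸) :
    HasSum (fun m : ℕ => (m.factorial : ℝ)⁻¹ • fderiv ℝ (fun a : 𝔸 => a ^ m) a)
      (fderiv ℝ (exp : 𝔸 → 𝔸) a) := by
  obtain ⟨h1, h2⟩ := hasFDerivAt_exp_tsum a
  rw [h2.fderiv]
  exact h1.hasSum

theorem hasDerivAt_exp_smul (a : 𝔸) (t : ℝ) :
    HasDerivAt (fun s : ℝ => exp (s • a)) (a * exp (t • a)) t :=
  hasDerivAt_exp_smul_const' a t

theorem hasDerivAt_exp_one_sub_smul (a : 𝔸) (t : ℝ) :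
    HasDerivAt (fun s : ℝ => exp ((1 - s) • a)) (-(exp ((1 - t) • a) * a)) t := by
  have h1 : HasDerivAt (fun s : ℝ => 1 - s) (-1) t := by
    simpa using (hasDerivAt_id t).const_sub 1
  have : HasDerivAt (fun s : ℝ => exp ((1 - s) • a)) ((-1 : ℝ) • (exp ((1 - t) • a) * a)) t :=
    (hasDerivAt_exp_smul_const a (1 - t)).scomp t h1
  simpa using this

/-- Duhamel's formula for the difference of two exponentials. -/
theorem exp_sub_exp (a b : 𝔸) : exp b - exp a =
    ∫ s in (0 : ℝ)..1, exp ((1 - s) • a) * (b - a) * exp (s • b) := by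
  have hd : ∀ t : ℝ, HasDerivAt (fun s : ℝ => exp ((1 - s) • a) * exp (s • b))
      (exp ((1 - t) • a) * (b - a) * exp (t • b)) t := by
    intro t
    refine ((hasDerivAt_exp_one_sub_smul a t).mul (hasDerivAt_exp_smul b t)).congr_deriv ?_
    noncomm_ring
  rw [intervalIntegral.integral_eq_sub_of_hasDerivAt (fun t _ => hd t)]
  · simp
  · have : Continuous fun t : ℝ => exp ((1 - t) • a) * (b - a) * exp (t • b) := by
      have h1 : Continuous fun t : ℝ => exp ((1 - t) • a) :=
        contDiff_exp.continuous.comp (by fun_prop)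
      have h2 : Continuous fun t : ℝ => exp (t • b) := contDiff_exp.continuous.comp (by fun_prop)
      fun_prop
    exact this.intervalIntegrable _ _

/-- Duhamel's formula for the derivative of the exponential. -/
theorem fderiv_exp_apply (a b : 𝔸) : fderiv ℝ (exp : 𝔸 → 𝔸) a b =
    ∫ s in Set.Icc (0 : ℝ) 1, exp ((1 - s) • a) * b * exp (s • a) := by
  have h1 : HasDerivAt (fun t : ℝ => exp (a + t • b)) (fderiv ℝ (exp : 𝔸 → 𝔸) a b) 0 := by
    have := ((contDiff_exp (𝔸 := 𝔸)).differentiable (by simp) (a + (0 : ℝ) • b)).hasFDerivAt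
    have h2 : HasDerivAt (fun t : ℝ => a + t • b) b 0 := by
      simpa using ((hasDerivAt_id (0 : ℝ)).smul_const b).const_add a
    have h3 : HasDerivAt (fun t : ℝ => exp (a + t • b))
        (fderiv ℝ (exp : 𝔸 → 𝔸) (a + (0 : ℝ) • b) b) 0 := this.comp_hasDerivAt 0 h2
    simpa using h3
  have h2 : ∀ t : ℝ, exp (a + t • b) = exp a +
      t • ∫ s in Set.Icc (0 : ℝ) 1, exp ((1 - s) • a) * b * exp (s • (a + t • b)) := by
    intro t
    have := exp_sub_exp a (a + t • b)
    rw [add_sub_cancel_left, intervalIntegral.integral_of_le zero_le_one,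
      ← integral_Icc_eq_integral_Ioc] at this
    simp only [mul_smul_comm, smul_mul_assoc] at this
    rw [integral_smul] at this
    rw [← this, add_sub_cancel]
  have hg : ContDiff ℝ 1 fun q : ℝ × ℝ =>
      exp ((1 - q.2) • a) * b * exp (q.2 • (a + q.1 • b)) := by
    have := (contDiff_exp (𝔸 := 𝔸)).of_le (m := 1) (by simp)
    refine ((this.comp ?_).mul contDiff_const).mul (this.comp ?_) <;> fun_prop
  have h3 := (hasFDerivAt_setIntegral volume hg
    (isCompact_Icc (a := (0 : ℝ)) (b := 1)) 0).hasDerivAt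
  have h4 := (((hasDerivAt_id (0 : ℝ)).smul h3).const_add (exp a))
  simp only [id_eq, zero_smul, one_smul, zero_add] at h4
  have h5 := h4.congr_of_eventuallyEq (.of_forall h2 : (fun t : ℝ => exp (a + t • b)) =ᶠ[nhds 0] _)
  rw [h1.unique h5]
  simp

/-- An exponential of a perturbation of an element whose exponentials are bounded. -/
theorem norm_exp_add_le {J F : 𝔸} {M : ℝ} (h : ∀ s ∈ Set.Icc (-1 : ℝ) 1, ‖exp (s • J)‖ ≤ M)
    {s : ℝ} (hs : s ∈ Set.Icc (0 : ℝ) 1) :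
    ‖exp (s • (J + F))‖ ≤ M * (‖(1 : 𝔸)‖ * Real.exp (M ^ 2 * ‖F‖)) := by
  have hM : 0 ≤ M := (norm_nonneg _).trans (h 0 (by simp))
  -- Gronwall's inequality applies to `u = exp (-s J) exp (s (J + F))`, whose derivative does not
  -- involve `J` except through exponentials.
  set u : ℝ → 𝔸 := fun s => exp ((-s) • J) * exp (s • (J + F))
  let _ : NormedAlgebra ℚ 𝔸 := NormedAlgebra.restrictScalars ℚ ℝ 𝔸
  have hinv : ∀ s : ℝ, exp (s • J) * exp ((-s) • J) = 1 := by
    intro s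
    rw [← exp_add_of_commute (((Commute.refl J).smul_left s).smul_right (-s)), ← add_smul]
    simp
  have hd : ∀ t : ℝ, HasDerivAt u (exp ((-t) • J) * F * exp (t • J) * u t) t := by
    intro t
    have h1 : HasDerivAt (fun s : ℝ => exp ((-s) • J)) (-(exp ((-t) • J) * J)) t := by
      have : HasDerivAt (fun s : ℝ => exp ((-s) • J)) ((-1 : ℝ) • (exp ((-t) • J) * J)) t :=
        (hasDerivAt_exp_smul_const J (-t)).scomp t (hasDerivAt_neg t)
      rwa [neg_one_smul] at this
    refine (h1.mul (hasDerivAt_exp_smul (J + F) t)).congr_deriv ?_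
    simp only [u]
    have : exp ((-t) • J) * F * exp (t • J) * (exp ((-t) • J) * exp (t • (J + F))) =
        exp ((-t) • J) * F * (exp (t • J) * exp ((-t) • J)) * exp (t • (J + F)) := by
      noncomm_ring
    rw [this, hinv]
    noncomm_ring
  have hu : ‖u s‖ ≤ ‖(1 : 𝔸)‖ * Real.exp (M ^ 2 * ‖F‖) := by
    have hc : Continuous u := continuous_iff_continuousAt.2 fun t => (hd t).continuousAt
    have := norm_le_gronwallBound_of_norm_deriv_right_le (f := u) (δ := ‖(1 : 𝔸)‖)
      (K := M ^ 2 * ‖F‖) (ε := 0) (a := 0) (b := 1) hc.continuousOn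
      (fun t _ => (hd t).hasDerivWithinAt) (by simp [u]) (fun t ht => ?_) s hs
    · rw [gronwallBound_ε0, sub_zero] at this
      refine this.trans ?_
      have : M ^ 2 * ‖F‖ * s ≤ M ^ 2 * ‖F‖ := mul_le_of_le_one_right (by positivity) hs.2
      gcongr
    · have h1 := h (-t) ⟨by linarith [ht.2], by linarith [ht.1]⟩
      have h2 := h t ⟨by linarith [ht.1], ht.2.le⟩
      rw [add_zero]
      calc _ ≤ ‖exp ((-t) • J)‖ * ‖F‖ * ‖exp (t • J)‖ * ‖u t‖ := by
            refine (norm_mul_le _ _).trans ?_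
            gcongr
            refine (norm_mul_le _ _).trans ?_
            gcongr
            exact norm_mul_le _ _
        _ ≤ M * ‖F‖ * M * ‖u t‖ := by gcongr
        _ = _ := by ring
  have : exp (s • (J + F)) = exp (s • J) * u s := by
    simp only [u]
    rw [← mul_assoc, hinv, one_mul]
  rw [this]
  refine (norm_mul_le _ _).trans ?_
  exact mul_le_mul (h s ⟨by linarith [hs.1], hs.2⟩) hu (norm_nonneg _) hM

end ExpDeriv

/-! ### Polynomial bounds -/

section PolyBounded

variable {ι Q : Type*} [NormedAddCommGroup Q]

/-- Families of real numbers, indexed by `ι` and by the points of a normed space, which are bounded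
above by a polynomial in the norm, uniformly in the index, on a set. -/
def PolyBdd (J : Set (ι × Q)) (φ : ι × Q → ℝ) : Prop :=
  ∃ (k : ℕ) (C : ℝ), 0 ≤ C ∧ ∀ p ∈ J, φ p ≤ C * (1 + ‖p.2‖) ^ k

theorem PolyBdd.mono {J : Set (ι × Q)} {φ ψ : ι × Q → ℝ} (h : PolyBdd J ψ)
    (h' : ∀ p ∈ J, φ p ≤ ψ p) : PolyBdd J φ := by
  obtain ⟨k, C, hC, h⟩ := h
  exact ⟨k, C, hC, fun p hp => (h' p hp).trans (h p hp)⟩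

theorem PolyBdd.add {J : Set (ι × Q)} {φ ψ : ι × Q → ℝ} (h : PolyBdd J φ) (h' : PolyBdd J ψ) :
    PolyBdd J (fun p => φ p + ψ p) := by
  obtain ⟨k, C, hC, h⟩ := h
  obtain ⟨k', C', hC', h'⟩ := h'
  refine ⟨k + k', C + C', add_nonneg hC hC', fun p hp => ?_⟩
  have h1 : (1 : ℝ) ≤ 1 + ‖p.2‖ := le_add_of_nonneg_right (norm_nonneg _)
  calc φ p + ψ p ≤ C * (1 + ‖p.2‖) ^ k + C' * (1 + ‖p.2‖) ^ k' := add_le_add (h p hp) (h' p hp)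
    _ ≤ C * (1 + ‖p.2‖) ^ (k + k') + C' * (1 + ‖p.2‖) ^ (k + k') := by
      gcongr <;> first | exact h1 | omega
    _ = _ := by ring

theorem PolyBdd.mul {J : Set (ι × Q)} {φ ψ : ι × Q → ℝ} (h : PolyBdd J φ) (h' : PolyBdd J ψ)
    (h0 : ∀ p, 0 ≤ ψ p) : PolyBdd J (fun p => φ p * ψ p) := by
  obtain ⟨k, C, hC, h⟩ := h
  obtain ⟨k', C', hC', h'⟩ := h'
  refine ⟨k + k', C * C', mul_nonneg hC hC', fun p hp => ?_⟩
  calc φ p * ψ p ≤ (C * (1 + ‖p.2‖) ^ k) * (C' * (1 + ‖p.2‖) ^ k') :=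
        mul_le_mul (h p hp) (h' p hp) (h0 p) (by positivity)
    _ = _ := by ring

theorem PolyBdd.const (J : Set (ι × Q)) (c : ℝ) : PolyBdd J fun _ => c :=
  ⟨0, |c|, abs_nonneg c, fun p _ => by simpa using le_abs_self c⟩

theorem PolyBdd.sum {J : Set (ι × Q)} {κ : Type*} {s : Finset κ} {φ : κ → ι × Q → ℝ}
    (h : ∀ i ∈ s, PolyBdd J (φ i)) : PolyBdd J (fun p => ∑ i ∈ s, φ i p) := by
  classical
  induction s using Finset.induction_on with
  | empty =>
    simp only [Finset.sum_empty]
    exact .const J 0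
  | insert a s ha ih =>
    simp only [Finset.sum_insert ha]
    exact (h a (by simp)).add (ih fun i hi => h i (by simp [hi]))

variable [NormedSpace ℝ Q]
  {F G H : Type*} [NormedAddCommGroup F] [NormedSpace ℝ F] [NormedAddCommGroup G] [NormedSpace ℝ G]
  [NormedAddCommGroup H] [NormedSpace ℝ H]

theorem contDiff_bilinear (B : F →L[ℝ] G →L[ℝ] H) {f : Q → F} {g : Q → G}
    (hf : ContDiff ℝ ∞ f) (hg : ContDiff ℝ ∞ g) : ContDiff ℝ ∞ fun q => B (f q) (g q) :=
  B.isBoundedBilinearMap.contDiff.comp (hf.prodMk hg)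

theorem PolyBdd.bilinear {J : Set (ι × Q)} (B : F →L[ℝ] G →L[ℝ] H) {f : ι → Q → F} {g : ι → Q → G}
    (hf : ∀ i, ContDiff ℝ ∞ (f i)) (hg : ∀ i, ContDiff ℝ ∞ (g i)) {m : ℕ}
    (h : ∀ j ≤ m, PolyBdd J fun p => ‖iteratedFDeriv ℝ j (f p.1) p.2‖)
    (h' : ∀ j ≤ m, PolyBdd J fun p => ‖iteratedFDeriv ℝ j (g p.1) p.2‖) :
    PolyBdd J fun p => ‖iteratedFDeriv ℝ m (fun q => B (f p.1 q) (g p.1 q)) p.2‖ := by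
  refine PolyBdd.mono (ψ := fun p => ‖B‖ * ∑ j ∈ Finset.range (m + 1), (m.choose j : ℝ) *
    (‖iteratedFDeriv ℝ j (f p.1) p.2‖ * ‖iteratedFDeriv ℝ (m - j) (g p.1) p.2‖)) ?_ fun p _ => ?_
  · refine (PolyBdd.const J _).mul (PolyBdd.sum fun j hj => ?_) fun p => by positivity
    rw [Finset.mem_range] at hj
    exact (PolyBdd.const J _).mul ((h j (by omega)).mul (h' (m - j) (by omega))
      fun p => norm_nonneg _) fun p => by positivity
  · have := B.norm_iteratedFDeriv_le_of_bilinear (hf p.1) (hg p.1) p.2 (n := m) (by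
      exact_mod_cast le_top)
    simpa only [mul_assoc] using this

end PolyBounded

section ExpTemperate

variable {𝔸 : Type*} [NormedRing 𝔸] [NormedAlgebra ℝ 𝔸] [CompleteSpace 𝔸]
  {Q : Type*} [NormedAddCommGroup Q] [NormedSpace ℝ Q]

/-- The map `(a, b) ↦ (c ↦ a * c * b)`. -/
def sandwich (𝔸 : Type*) [NormedRing 𝔸] [NormedAlgebra ℝ 𝔸] : 𝔸 →L[ℝ] 𝔸 →L[ℝ] 𝔸 →L[ℝ] 𝔸 :=
  ContinuousLinearMap.mulLeftRight ℝ 𝔸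

theorem sandwich_apply {𝔸 : Type*} [NormedRing 𝔸] [NormedAlgebra ℝ 𝔸] (a b c : 𝔸) :
    sandwich 𝔸 a b c = a * c * b := rfl

/-- The integrand in Duhamel's formula for the derivative of `q ↦ exp (s • A q)`. -/
def duhamelTerm (A : Q → 𝔸) (s r : ℝ) (q : Q) : Q →L[ℝ] 𝔸 :=
  (sandwich 𝔸 (exp (((1 - r) * s) • A q)) (exp ((r * s) • A q))).comp
    (s • fderiv ℝ A q)

theorem contDiff_duhamelTerm {A : Q → 𝔸} (hA : ContDiff ℝ ∞ A) (s : ℝ) :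
    ContDiff ℝ ∞ fun t : Q × ℝ => duhamelTerm A s t.2 t.1 := by
  have hA' : ContDiff ℝ ∞ fun t : Q × ℝ => A t.1 := hA.comp contDiff_fst
  have h1 : ContDiff ℝ ∞ fun t : Q × ℝ => exp (((1 - t.2) * s) • A t.1) :=
    contDiff_exp.comp (((contDiff_const.sub contDiff_snd).mul contDiff_const).smul hA')
  have h2 : ContDiff ℝ ∞ fun t : Q × ℝ => exp ((t.2 * s) • A t.1) :=
    contDiff_exp.comp ((contDiff_snd.mul contDiff_const).smul hA')
  have h3 : ContDiff ℝ ∞ fun t : Q × ℝ => s • fderiv ℝ A t.1 :=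
    ((hA.fderiv_right (m := ∞) (by simp)).comp contDiff_fst).const_smul s
  exact (contDiff_bilinear (sandwich 𝔸) h1 h2).clm_comp h3

theorem setIntegral_slice_apply {E F : Type*} [NormedAddCommGroup E] [NormedSpace ℝ E]
    [NormedAddCommGroup F] [NormedSpace ℝ F] [CompleteSpace F] {g : Q × ℝ → E →L[ℝ] F}
    (hg : ContDiff ℝ ∞ g) (q : Q) (v : E) :
    (∫ r in Set.Icc (0 : ℝ) 1, g (q, r)) v = ∫ r in Set.Icc (0 : ℝ) 1, g (q, r) v := by
  have hc : Continuous fun r : ℝ => g (q, r) := hg.continuous.comp (Continuous.prodMk_right q)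
  exact ContinuousLinearMap.integral_apply
    (hc.continuousOn.integrableOn_compact isCompact_Icc) v

/-- Duhamel's formula along a map to the algebra. -/
theorem fderiv_exp_smul {A : Q → 𝔸} (hA : ContDiff ℝ ∞ A) (s : ℝ) (q : Q) :
    fderiv ℝ (fun q => exp (s • A q)) q = ∫ r in Set.Icc (0 : ℝ) 1, duhamelTerm A s r q := by
  refine ContinuousLinearMap.ext fun v => ?_
  rw [setIntegral_slice_apply (contDiff_duhamelTerm hA s)]
  have h1 : HasFDerivAt (fun q => s • A q) (s • fderiv ℝ A q) q :=
    (hA.differentiable (by simp) q).hasFDerivAt.const_smul s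
  have h2 := ((contDiff_exp (𝔸 := 𝔸)).differentiable (by simp) (s • A q)).hasFDerivAt.comp q h1
  have h3 : fderiv ℝ (fun q => exp (s • A q)) q =
      (fderiv ℝ (exp : 𝔸 → 𝔸) (s • A q)).comp (s • fderiv ℝ A q) := h2.fderiv
  rw [h3, ContinuousLinearMap.comp_apply, fderiv_exp_apply]
  simp only [smul_smul, duhamelTerm, ContinuousLinearMap.comp_apply, sandwich_apply]

variable [FiniteDimensional ℝ Q]

/-- If `A` has temperate growth and the exponentials `exp (s • A q)`, `s ∈ [0, 1]`, grow at most
polynomially on a set `S`, then so do all derivatives of `exp ∘ A`. -/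
theorem polyBdd_iteratedFDeriv_exp {A : Q → 𝔸} (hA : A.HasTemperateGrowth) {S : Set Q}
    (h : PolyBdd (Set.Icc (0 : ℝ) 1 ×ˢ S) fun p : ℝ × Q => ‖exp (p.1 • A p.2)‖) (m : ℕ) :
    PolyBdd (Set.Icc (0 : ℝ) 1 ×ˢ S)
      fun p : ℝ × Q => ‖iteratedFDeriv ℝ m (fun q => exp (p.1 • A q)) p.2‖ := by
  induction m using Nat.strong_induction_on with
  | _ m ih =>
  rcases m with _ | m
  · simpa only [norm_iteratedFDeriv_zero] using h
  have hE : ∀ c : ℝ, ContDiff ℝ ∞ fun q => exp (c • A q) := fun c =>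
    contDiff_exp.comp (hA.1.const_smul c)
  -- Duhamel's formula expresses a derivative of order `m + 1` of `exp (s A)` by derivatives of
  -- order at most `m` of `exp ((1 - r) s A)` and `exp (r s A)`, where `(1 - r) s` and `r s` are again in
  -- `[0, 1]`.
  set J : Set ((ℝ × ℝ) × Q) := (Set.Icc (0 : ℝ) 1 ×ˢ Set.Icc (0 : ℝ) 1) ×ˢ S
  have hsub : ∀ {c : ℝ × ℝ → ℝ}, (∀ i ∈ Set.Icc (0 : ℝ) 1 ×ˢ Set.Icc (0 : ℝ) 1,
      c i ∈ Set.Icc (0 : ℝ) 1) → ∀ j ≤ m, PolyBdd J fun p : (ℝ × ℝ) × Q =>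
        ‖iteratedFDeriv ℝ j (fun q => exp (c p.1 • A q)) p.2‖ := by
    intro c hc j hj
    obtain ⟨k, C, hC, hb⟩ := ih j (by omega)
    exact ⟨k, C, hC, fun p hp => hb (c p.1, p.2) ⟨hc p.1 hp.1, hp.2⟩⟩
  have e1 := hsub (c := fun i => (1 - i.2) * i.1) fun i hi =>
    ⟨mul_nonneg (by linarith [hi.2.2]) hi.1.1,
      mul_le_one₀ (by linarith [hi.2.1]) hi.1.1 hi.1.2⟩
  have e2 := hsub (c := fun i => i.2 * i.1) fun i hi =>
    ⟨mul_nonneg hi.2.1 hi.1.1, mul_le_one₀ hi.2.2 hi.1.1 hi.1.2⟩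
  have hA1 : ContDiff ℝ ∞ (fderiv ℝ A) := hA.1.fderiv_right (by simp)
  have e3 : ∀ j ≤ m, PolyBdd J fun p : (ℝ × ℝ) × Q =>
      ‖iteratedFDeriv ℝ j (fun q => p.1.1 • fderiv ℝ A q) p.2‖ := by
    intro j _
    obtain ⟨k, C, hb⟩ := hA.2 (j + 1)
    have hC : 0 ≤ C := by simpa using (norm_nonneg _).trans (hb 0)
    refine ⟨k, C, hC, fun p hp => ?_⟩
    dsimp only
    rw [iteratedFDeriv_const_smul_apply' (hA1.of_le (by exact_mod_cast le_top)).contDiffAt,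
      norm_smul, norm_iteratedFDeriv_fderiv, Real.norm_of_nonneg hp.1.1.1]
    exact (mul_le_of_le_one_left (norm_nonneg _) hp.1.1.2).trans (hb p.2)
  have e4 : ∀ j ≤ m, PolyBdd J fun p : (ℝ × ℝ) × Q => ‖iteratedFDeriv ℝ j (fun q =>
      sandwich 𝔸 (exp (((1 - p.1.2) * p.1.1) • A q))
        (exp ((p.1.2 * p.1.1) • A q))) p.2‖ := fun j hj =>
    PolyBdd.bilinear (ι := ℝ × ℝ) (sandwich 𝔸)
      (f := fun i q => exp (((1 - i.2) * i.1) • A q)) (g := fun i q => exp ((i.2 * i.1) • A q))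
      (fun _ => hE _) (fun _ => hE _) (fun i hi => e1 i (hi.trans hj))
      fun i hi => e2 i (hi.trans hj)
  have e5 := PolyBdd.bilinear (ι := ℝ × ℝ) (J := J) (ContinuousLinearMap.compL ℝ Q 𝔸 𝔸)
      (f := fun i q => sandwich 𝔸 (exp (((1 - i.2) * i.1) • A q))
        (exp ((i.2 * i.1) • A q))) (g := fun i q => i.1 • fderiv ℝ A q) (m := m)
      (fun _ => contDiff_bilinear (sandwich 𝔸) (hE _) (hE _))
      (fun i => hA1.const_smul i.1) e4 e3
  obtain ⟨k, C, hC, hb⟩ := e5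
  refine ⟨k, C, hC, fun p hp => ?_⟩
  dsimp only
  rw [← norm_iteratedFDeriv_fderiv]
  have hfd : fderiv ℝ (fun q => exp (p.1 • A q)) =
      fun q => ∫ r in Set.Icc (0 : ℝ) 1, duhamelTerm A p.1 r q :=
    funext fun q => fderiv_exp_smul hA.1 p.1 q
  rw [hfd]
  have := norm_iteratedFDeriv_setIntegral_le volume (contDiff_duhamelTerm hA.1 p.1)
    (isCompact_Icc (a := (0 : ℝ)) (b := 1)) m p.2 (C := C * (1 + ‖p.2‖) ^ k)
    fun r hr => hb ((p.1, r), p.2) ⟨⟨hp.1, hr⟩, hp.2⟩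
  simpa using this

end ExpTemperate

/-! ### Traces of exponentials of matrices of forms -/

open MeasureTheory NormedSpace MForm

section Rep

/-- The endomorphisms of the coordinate space of a finite dimensional algebra `A`, a Banach algebra
in which `A` embeds by its left multiplications. -/
def RepAlg (A : Type*) [Ring A] [Algebra ℂ A] : Type :=
  (Fin (Module.finrank ℂ A) → ℂ) →L[ℂ] (Fin (Module.finrank ℂ A) → ℂ)

variable (A : Type*) [Ring A] [Algebra ℂ A]

instance : NormedRing (RepAlg A) :=
  inferInstanceAs (NormedRing
    ((Fin (Module.finrank ℂ A) → ℂ) →L[ℂ] (Fin (Module.finrank ℂ A) → ℂ)))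

instance : NormedAlgebra ℂ (RepAlg A) :=
  inferInstanceAs (NormedAlgebra ℂ
    ((Fin (Module.finrank ℂ A) → ℂ) →L[ℂ] (Fin (Module.finrank ℂ A) → ℂ)))

instance : FiniteDimensional ℂ (RepAlg A) :=
  inferInstanceAs (FiniteDimensional ℂ
    ((Fin (Module.finrank ℂ A) → ℂ) →L[ℂ] (Fin (Module.finrank ℂ A) → ℂ)))

instance : FiniteDimensional ℝ (RepAlg A) := FiniteDimensional.complexToReal _

instance : CompleteSpace (RepAlg A) := FiniteDimensional.complete ℂ _

variable [FiniteDimensional ℂ A]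

/-- The embedding of a finite dimensional algebra in a Banach algebra. -/
def rep : A →ₐ[ℂ] RepAlg A :=
  ((Module.End.toContinuousLinearMap (Fin (Module.finrank ℂ A) → ℂ)).toAlgHom.comp
    ((Module.finBasis ℂ A).equivFun.conjAlgEquiv ℂ).toAlgHom).comp (Algebra.lmul ℂ A)

/-- A linear left inverse of `rep`. -/
def unrep : RepAlg A →ₗ[ℂ] A :=
  (Module.finBasis ℂ A).equivFun.symm.toLinearMap ∘ₗ
    (LinearMap.applyₗ ((Module.finBasis ℂ A).equivFun 1)) ∘ₗ
    (Module.End.toContinuousLinearMap (Fin (Module.finrank ℂ A) → ℂ)).symm.toLinearMap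

theorem unrep_rep (a : A) : unrep A (rep A a) = a := by
  change (Module.finBasis ℂ A).equivFun.symm ((Module.finBasis ℂ A).equivFun
    (a * (Module.finBasis ℂ A).equivFun.symm ((Module.finBasis ℂ A).equivFun 1))) = a
  rw [LinearEquiv.symm_apply_apply, LinearEquiv.symm_apply_apply, mul_one]

end Rep

section FormMatrix

variable {E : Type*} [NormedAddCommGroup E] [NormedSpace ℝ E]

namespace MForm

/-- The components of a homogeneous form. -/
def homogFun (k : ℕ) (α : E [⋀^Fin k]→L[ℝ] ℂ) : MForm E := fun l => if h : k = l then h ▸ α else 0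

theorem homogFun_self (k : ℕ) (α : E [⋀^Fin k]→L[ℝ] ℂ) : homogFun k α k = α := dif_pos rfl

theorem homogFun_of_ne {k l : ℕ} (h : l ≠ k) (α : E [⋀^Fin k]→L[ℝ] ℂ) : homogFun k α l = 0 :=
  dif_neg h.symm

/-- A homogeneous form, as a form of mixed degree. -/
def homog (k : ℕ) : (E [⋀^Fin k]→L[ℝ] ℂ) →ₗ[ℂ] MForm E where
  toFun := homogFun k
  map_add' α β := by
    ext1 l
    change _ = homogFun k α l + homogFun k β l
    rcases eq_or_ne l k with rfl | h
    · simp only [homogFun_self]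
    · simp only [homogFun_of_ne h, add_zero]
  map_smul' c α := by
    ext1 l
    change _ = c • homogFun k α l
    rcases eq_or_ne l k with rfl | h
    · simp only [homogFun_self]
    · simp only [homogFun_of_ne h]
      exact (smul_form_zero c).symm

theorem homog_apply_self (k : ℕ) (α : E [⋀^Fin k]→L[ℝ] ℂ) : homog k α k = α := homogFun_self k α

theorem homog_apply_of_ne {k l : ℕ} (h : l ≠ k) (α : E [⋀^Fin k]→L[ℝ] ℂ) : homog k α l = 0 :=
  homogFun_of_ne h α

variable [FiniteDimensional ℝ E]

theorem eq_sum_homog (α : MForm E) :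
    α = ∑ k ∈ Finset.range (Module.finrank ℝ E + 1), homog k (α k) := by
  ext1 l
  rw [sum_apply]
  rcases lt_or_ge (Module.finrank ℝ E) l with hl | hl
  · rw [form_eq_zero_of_finrank_lt hl (α l), form_eq_zero_of_finrank_lt hl (Finset.sum _ _)]
  · rw [Finset.sum_eq_single l, homog_apply_self]
    · exact fun k _ hk => homog_apply_of_ne hk.symm _
    · exact fun h => absurd (Finset.mem_range.2 (by omega)) h

instance (k : ℕ) : FiniteDimensional ℂ (E [⋀^Fin k]→L[ℝ] ℂ) :=
  Module.Finite.of_restrictScalars_finite ℝ ℂ _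

instance : FiniteDimensional ℂ (MForm E) := by
  let f : MForm E →ₗ[ℂ] ∀ k : Fin (Module.finrank ℝ E + 1), E [⋀^Fin k.1]→L[ℝ] ℂ :=
    LinearMap.pi fun k => evalHom k.1
  refine FiniteDimensional.of_injective f fun α β h => ?_
  rw [eq_sum_homog α, eq_sum_homog β]
  refine Finset.sum_congr rfl fun k hk => ?_
  have : α k = β k := congrFun h ⟨k, Finset.mem_range.1 hk⟩
  rw [this]

end MForm

variable [FiniteDimensional ℝ E] {p : Type*} [Fintype p] [DecidableEq p]

/-- The contribution of the component of degree `k` of the entry `(i, j)` to `rep`. -/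
def repEntry (i j : p) (k : ℕ) : (E [⋀^Fin k]→L[ℝ] ℂ) →L[ℝ] RepAlg (Matrix p p (MForm E)) :=
  LinearMap.toContinuousLinearMap (((rep (Matrix p p (MForm E))).toLinearMap ∘ₗ
    (Matrix.singleLinearMap ℂ i j) ∘ₗ homog k).restrictScalars ℝ)

theorem rep_eq_sum (M : Matrix p p (MForm E)) : rep _ M =
    ∑ i, ∑ j, ∑ k ∈ Finset.range (Module.finrank ℝ E + 1), repEntry i j k (M i j k) := by
  conv_lhs => rw [Matrix.matrix_eq_sum_single M]
  simp only [map_sum]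
  refine Finset.sum_congr rfl fun i _ => Finset.sum_congr rfl fun j _ => ?_
  change ((rep (Matrix p p (MForm E))).toLinearMap ∘ₗ Matrix.singleLinearMap ℂ i j) (M i j) = _
  conv_lhs => rw [eq_sum_homog (M i j)]
  rw [map_sum]
  rfl

variable {B : Type*} [NormedAddCommGroup B] [NormedSpace ℝ B]

theorem temperate_rep {Ω : B → Matrix p p (MForm E)} (h : ∀ i j, Temperate fun b => Ω b i j) :
    (fun b => rep _ (Ω b)).HasTemperateGrowth := by
  simp only [rep_eq_sum]
  refine .sum fun i _ => .sum fun j _ => .sum fun k _ => ?_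
  have h1 := (repEntry (E := E) i j k).hasTemperateGrowth
  exact h1.comp (h i j k)

theorem contDiff_rep {Ω : B → Matrix p p (MForm E)} (h : ∀ i j, Smooth fun b => Ω b i j) :
    ContDiff ℝ ∞ (fun b => rep _ (Ω b)) := by
  simp only [rep_eq_sum]
  refine .sum fun i _ => .sum fun j _ => .sum fun k _ => ?_
  have h1 := (repEntry (E := E) i j k).contDiff (n := ∞)
  exact h1.comp (h i j k)

/-- The component of degree `k` of the trace of a matrix of forms, as a function on `RepAlg`. -/
def traceRep (E p : Type*) [NormedAddCommGroup E] [NormedSpace ℝ E] [FiniteDimensional ℝ E]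
    [Fintype p] [DecidableEq p] (k : ℕ) :
    RepAlg (Matrix p p (MForm E)) →L[ℝ] E [⋀^Fin k]→L[ℝ] ℂ :=
  LinearMap.toContinuousLinearMap ((evalHom k ∘ₗ Matrix.traceLinearMap p ℂ (MForm E) ∘ₗ
    unrep _).restrictScalars ℝ)

theorem traceRep_rep (k : ℕ) (M : Matrix p p (MForm E)) :
    traceRep E p k (rep _ M) = M.trace k := by
  change (unrep _ (rep _ M)).trace k = _
  rw [unrep_rep]

/-- The trace of the exponential of a matrix of forms. -/
def trExp (M : Matrix p p (MForm E)) : MForm E := fun k => traceRep E p k (exp (rep _ M))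

theorem trExp_apply (M : Matrix p p (MForm E)) (k : ℕ) :
    trExp M k = traceRep E p k (exp (rep _ M)) := rfl

/-- The trace of the exponential is the sum of the traces of the powers, in each degree. -/
theorem hasSum_trExp (M : Matrix p p (MForm E)) (k : ℕ) :
    HasSum (fun m : ℕ => (m.factorial : ℝ)⁻¹ • (M ^ m).trace k) (trExp M k) := by
  have := (traceRep E p k).hasSum (exp_series_hasSum_exp' (𝕂 := ℝ) (rep _ M))
  refine this.congr_fun ?_
  intro m
  simp [← map_pow, traceRep_rep]

theorem trExp_congr {q : Type*} [Fintype q] [DecidableEq q] {M : Matrix p p (MForm E)}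
    {N : Matrix q q (MForm E)} (h : ∀ m, (M ^ m).trace = (N ^ m).trace) : trExp M = trExp N := by
  ext1 k
  refine (hasSum_trExp M k).unique ?_
  simp only [h]
  exact hasSum_trExp N k

theorem pull_trExp (f : E →L[ℝ] E) {M N : Matrix p p (MForm E)}
    (h : ∀ m, pull f (M ^ m).trace = (N ^ m).trace) : pull f (trExp M) = trExp N := by
  ext1 k
  have h1 := (ContinuousAlternatingMap.compContinuousLinearMapCLM (F := ℂ) (ι := Fin k)
    f).hasSum (hasSum_trExp M k)
  refine HasSum.unique h1 ?_
  refine (hasSum_trExp N k).congr_fun fun m => ?_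
  rw [← h]
  rfl

theorem hasSum_zeroPart_trExp (M : Matrix p p (MForm E)) :
    HasSum (fun m : ℕ => (m.factorial : ℝ)⁻¹ • ((zeroHom.mapMatrix M) ^ m).trace)
      (zeroPart (trExp M)) := by
  let l : (E [⋀^Fin 0]→L[ℝ] ℂ) →L[ℝ] ℂ :=
    (ContinuousAlternatingMap.constOfIsEmptyLIE ℝ E ℂ (Fin 0)).symm.toContinuousLinearEquiv
  have h := l.hasSum (hasSum_trExp M 0)
  refine h.congr_fun fun m => ?_
  have : ((zeroHom.mapMatrix M) ^ m).trace = zeroHom (M ^ m).trace := by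
    rw [← map_pow, AlgHom.mapMatrix_apply]
    exact (AddMonoidHom.map_trace (zeroHom (E := E)).toLinearMap.toAddMonoidHom (M ^ m)).symm
  rw [this]
  exact (map_smul l _ _).symm

theorem contDiff_trExp {Ω : B → Matrix p p (MForm E)} (h : ∀ i j, Smooth fun b => Ω b i j) :
    Smooth fun b => trExp (Ω b) := fun k =>
  (traceRep E p k).contDiff.comp (contDiff_exp.comp (contDiff_rep h))

theorem hasSum_fderiv_trExp {Ω : B → Matrix p p (MForm E)} (h : ∀ i j, Smooth fun b => Ω b i j)
    (b : B) (k : ℕ) :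
    HasSum (fun m : ℕ => (m.factorial : ℝ)⁻¹ • fderiv ℝ (fun b => (Ω b ^ m).trace k) b)
      (fderiv ℝ (fun b => trExp (Ω b) k) b) := by
  have hr : HasFDerivAt (fun b => rep _ (Ω b)) _ b :=
    ((contDiff_rep h).differentiable (by simp) b).hasFDerivAt
  set r' := fderiv ℝ (fun b => rep _ (Ω b)) b
  have h1 : ∀ m : ℕ, fderiv ℝ (fun b => (Ω b ^ m).trace k) b =
      (traceRep E p k).comp ((fderiv ℝ (fun a => a ^ m) (rep _ (Ω b))).comp r') := by
    intro m
    have h2 := ((differentiable_pow' m (rep _ (Ω b))).hasFDerivAt).comp b hr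
    have h3 := (traceRep E p k).hasFDerivAt.comp b h2
    refine HasFDerivAt.fderiv (h3.congr_of_eventuallyEq (.of_forall fun b => ?_))
    change _ = traceRep E p k (rep _ (Ω b) ^ m)
    rw [← map_pow, traceRep_rep]
  have h4 : fderiv ℝ (fun b => trExp (Ω b) k) b =
      (traceRep E p k).comp ((fderiv ℝ exp (rep _ (Ω b))).comp r') :=
    ((traceRep E p k).hasFDerivAt.comp b
      (((contDiff_exp.differentiable (by simp) (rep _ (Ω b))).hasFDerivAt).comp b hr)).fderiv
  rw [h4]
  have := ((ContinuousLinearMap.compL ℝ B _ _ (traceRep E p k)).comp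
    ((ContinuousLinearMap.compL ℝ B _ _).flip r')).hasSum (hasSum_fderiv_exp (rep _ (Ω b)))
  refine this.congr_fun fun m => ?_
  rw [h1]
  simp

/-- If the traces of all powers are closed, then so is the trace of the exponential. -/
theorem cartanD_trExp_eq_zero {Ω : E → Matrix p p (MForm E)} (h : ∀ i j, Smooth fun b => Ω b i j)
    {v : E → E} {z : E} (h0 : ∀ m, cartanD v (fun z => (Ω z ^ m).trace) z = 0) :
    cartanD v (fun z => trExp (Ω z)) z = 0 := by
  ext1 k
  have hc : HasSum (fun m : ℕ => (m.factorial : ℝ)⁻¹ • contr (v z) (Ω z ^ m).trace k)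
      (contr (v z) (trExp (Ω z)) k) := by
    have := ((contrL E k).flip (v z)).hasSum (hasSum_trExp (Ω z) (k + 1))
    refine this.congr_fun fun m => ?_
    rw [map_smul]
    rfl
  have hd : HasSum (fun m : ℕ => (m.factorial : ℝ)⁻¹ • extD (fun z => (Ω z ^ m).trace) z k)
      (extD (fun z => trExp (Ω z)) z k) := by
    rcases k with _ | k
    · simp only [extD_zero_apply]
      refine hasSum_zero.congr_fun fun m => ?_
      exact smul_form_zero _
    · have := (ContinuousAlternatingMap.alternatizeUncurryFinCLM (n := k) ℝ E ℂ).hasSum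
        (hasSum_fderiv_trExp h z k)
      refine this.congr_fun fun m => ?_
      rw [map_smul]
      rfl
  refine (hd.sub hc).unique ?_
  refine hasSum_zero.congr_fun fun m => ?_
  have h1 : extD (fun z => (Ω z ^ m).trace) z k = contr (v z) (Ω z ^ m).trace k :=
    sub_eq_zero.1 (congrFun (h0 m) k)
  exact sub_eq_zero.2 (congrArg (fun ξ => (m.factorial : ℝ)⁻¹ • ξ) h1)

end FormMatrix

section ChernForm

variable {n : ℕ} {p : Type*} [Fintype p] [DecidableEq p]

/-- A square array of mixed forms, as a matrix over the ring of forms. -/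
def formMat (Ω : p → p → MixedForm n) : Matrix p p (MForm (Fin n → ℂ)) := Matrix.of Ω

theorem formMatrixPow_eq (Ω : p → p → MixedForm n) (m : ℕ) (i j : p) :
    (formMatrixPow Ω m i j : MForm (Fin n → ℂ)) = (formMat Ω ^ m) i j := by
  induction m generalizing i j with
  | zero =>
    ext k v
    rw [pow_zero, Matrix.one_apply]
    rcases k with _ | k
    · change (if i = j then (1 : ℂ) else 0) = _
      split_ifs <;> rfl
    · change (0 : ℂ) = _
      split_ifs <;> rfl
  | succ m ih =>
    ext1 k
    rw [pow_succ', Matrix.mul_apply, MForm.sum_apply]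
    refine Finset.sum_congr rfl fun r _ => ?_
    rw [← ih]
    rfl

/-- The series `traceExp` is the exponential in the Banach algebra `RepAlg`; in particular it
converges. -/
theorem traceExp_eq (Ω : p → p → MixedForm n) :
    (traceExp Ω : MForm (Fin n → ℂ)) = trExp (formMat Ω) := by
  ext1 k
  rw [← (hasSum_trExp (formMat Ω) k).tsum_eq]
  refine tsum_congr fun m => ?_
  congr 1
  rw [Matrix.trace, MForm.sum_apply]
  exact Finset.sum_congr rfl fun i _ => congrFun (formMatrixPow_eq Ω m i i) k

end ChernForm

/-! ### Infinitesimal equivariance -/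

open MeasureTheory NormedSpace MForm

section Infinitesimal

theorem hasDerivAt_clm_curve {E F : Type*} [NormedAddCommGroup E] [NormedSpace ℝ E]
    [NormedAddCommGroup F] [NormedSpace ℝ F] {l : E → E →L[ℝ] F} {γ δ : ℝ → E} {u v : E}
    (hl : DifferentiableAt ℝ l (γ 0)) (hγ : HasDerivAt γ u 0) (hδ : HasDerivAt δ v 0) :
    HasDerivAt (fun t => l (γ t) (δ t)) (fderiv ℝ l (γ 0) u (δ 0) + l (γ 0) v) 0 :=
  (hl.hasFDerivAt.comp_hasDerivAt 0 hγ).clm_apply hδ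

theorem act_one {V : Type*} [NormedAddCommGroup V] {Λ : Submodule ℤ V} {n : ℕ} (X : Fin n → Λ)
    (z : Fin n → ℂ) : act X 1 z = z := by
  ext i
  simp [act_apply]

variable {V : Type*} [NormedAddCommGroup V] [NormedSpace ℝ V] {Λ : Submodule ℤ V} {n : ℕ}

/-- The element `exp x` of the torus: the character `a ↦ exp (i ⟨a, x⟩)`. -/
def torusExp (Λ : Submodule ℤ V) (x : StrongDual ℝ V) : AddChar Λ Circle where
  toFun a := Circle.exp (x (a : V))
  map_zero_eq_one' := by simp
  map_add_eq_mul' a b := by simp [Circle.exp_add]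

theorem torusExp_apply (x : StrongDual ℝ V) (a : Λ) :
    (torusExp Λ x a : ℂ) = Complex.exp (Complex.I * (x (a : V) : ℝ)) := by
  rw [torusExp, AddChar.coe_mk, Circle.coe_exp, mul_comm]

theorem hasDerivAt_torusExp (x : StrongDual ℝ V) (a : Λ) :
    HasDerivAt (fun t : ℝ => (torusExp Λ (t • x) a : ℂ)) (Complex.I * (x (a : V) : ℝ)) 0 := by
  have h : HasDerivAt (fun t : ℝ => Complex.I * ((t * x (a : V) : ℝ) : ℂ))
      (Complex.I * (x (a : V) : ℝ)) 0 := by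
    have := (((hasDerivAt_id (0 : ℝ)).mul_const (x (a : V))).ofReal_comp).const_mul Complex.I
    simpa using this
  have := h.cexp
  simp only [zero_mul, Complex.ofReal_zero, mul_zero, Complex.exp_zero, one_mul] at this
  refine this.congr_of_eventuallyEq (.of_forall fun t => ?_)
  refine (torusExp_apply (t • x) a).trans ?_
  simp

theorem torusExp_zero : torusExp Λ (0 : StrongDual ℝ V) = 1 := by
  ext a
  simp [torusExp]

/-- The vector field `v_x` is minus the velocity of the action of `exp (t x)`. -/
theorem hasDerivAt_act (X : Fin n → Λ) (x : StrongDual ℝ V) (z : Fin n → ℂ) :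
    HasDerivAt (fun t : ℝ => act X (torusExp Λ (t • x)) z) (-vecLin X x z) 0 := by
  rw [hasDerivAt_pi]
  intro i
  simp only [act_apply]
  have := (hasDerivAt_torusExp x (X i)).mul_const (z i)
  refine this.congr_deriv ?_
  change _ = -(vecField X x z i)
  rw [vecField_apply]
  ring

/-- The infinitesimal form of the equivariance of a function of weight `b`. -/
theorem fderiv_vecLin_of_weight (X : Fin n → Λ) {f : (Fin n → ℂ) → ℂ} {b : Λ}
    (h : ∀ g z, f (act X g z) = (g b : ℂ) * f z) {z : Fin n → ℂ} (hf : DifferentiableAt ℝ f z)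
    (x : StrongDual ℝ V) :
    fderiv ℝ f z (vecLin X x z) = -(Complex.I * (x (b : V) : ℝ) * f z) := by
  have hz : act X (torusExp Λ ((0 : ℝ) • x)) z = z := by rw [zero_smul, torusExp_zero, act_one]
  have hf' : HasFDerivAt f (fderiv ℝ f z) (act X (torusExp Λ ((0 : ℝ) • x)) z) := by
    rw [hz]; exact hf.hasFDerivAt
  have h1 := hf'.comp_hasDerivAt 0 (hasDerivAt_act X x z)
  have h2 := (hasDerivAt_torusExp x b).mul_const (f z)
  have h3 := h1.unique (h2.congr_of_eventuallyEq (.of_forall fun t => h _ z))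
  rw [map_neg] at h3
  rw [← h3, neg_neg]

/-- The infinitesimal form of the equivariance of a differential form of degree `1` and
weight `b`. -/
theorem fderiv_vecLin_form_of_weight (X : Fin n → Λ) {l : (Fin n → ℂ) → (Fin n → ℂ) →L[ℝ] ℂ}
    {b : Λ} (h : ∀ g z v, l (act X g z) (act X g v) = (g b : ℂ) * l z v) {z : Fin n → ℂ}
    (hf : DifferentiableAt ℝ l z) (x : StrongDual ℝ V) (v : Fin n → ℂ) :
    fderiv ℝ l z (vecLin X x z) v + l z (vecLin X x v) =
      -(Complex.I * (x (b : V) : ℝ) * l z v) := by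
  have hz : ∀ z, act X (torusExp Λ ((0 : ℝ) • x)) z = z := fun z => by
    rw [zero_smul, torusExp_zero, act_one]
  have hf' : DifferentiableAt ℝ l (act X (torusExp Λ ((0 : ℝ) • x)) z) := by rwa [hz]
  have h1 := hasDerivAt_clm_curve hf' (hasDerivAt_act X x z) (hasDerivAt_act X x v)
  have h2 := (hasDerivAt_torusExp x b).mul_const (l z v)
  have h3 := h1.unique (h2.congr_of_eventuallyEq (.of_forall fun t => h _ z v))
  rw [hz, hz, map_neg, map_neg, _root_.neg_apply] at h3
  rw [← h3]
  ring

end Infinitesimal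

/-! ### Matrices of forms -/

section MatrixForms

variable {E : Type*} [NormedAddCommGroup E] [NormedSpace ℝ E]

/-- A matrix of numbers, as a matrix of forms of degree `0`. -/
def scal (E : Type*) [NormedAddCommGroup E] [NormedSpace ℝ E] {q p : Type*} (S : Matrix q p ℂ) :
    Matrix q p (MForm E) :=
  S.map (algebraMap ℂ (MForm E))

theorem scal_apply {q p : Type*} (S : Matrix q p ℂ) (i : q) (j : p) :
    scal E S i j = S i j • 1 := by
  rw [scal, Matrix.map_apply, Algebra.algebraMap_eq_smul_one]

theorem scal_mul {r q p : Type*} [Fintype q] (S : Matrix r q ℂ) (T : Matrix q p ℂ) :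
    scal E (S * T) = scal E S * scal E T :=
  Matrix.map_mul

theorem scal_one {p : Type*} [DecidableEq p] : scal E (1 : Matrix p p ℂ) = 1 :=
  Matrix.map_one _ (map_zero _) (map_one _)

theorem trace_scal_mul {q p : Type*} [Fintype q] [Fintype p]
    (S : Matrix q p ℂ) (M : Matrix p q (MForm E)) :
    (scal E S * M).trace = (M * scal E S).trace := by
  simp only [Matrix.trace, Matrix.diag_apply, Matrix.mul_apply, scal, Matrix.map_apply]
  rw [Finset.sum_comm]
  exact Finset.sum_congr rfl fun i _ => Finset.sum_congr rfl fun j _ => Algebra.commutes _ _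

/-- Matrices of forms which are conjugate by an invertible matrix of numbers have powers with the
same trace. -/
theorem trace_pow_eq_of_intertwine {p q : Type*} [Fintype p] [Fintype q] [DecidableEq p]
    [DecidableEq q] {S : Matrix q p ℂ}
    {T : Matrix p q ℂ} (hST : S * T = 1) (hTS : T * S = 1) {M : Matrix p p (MForm E)}
    {N : Matrix q q (MForm E)} (h : N * scal E S = scal E S * M) (m : ℕ) :
    (N ^ m).trace = (M ^ m).trace := by
  have h1 : N ^ m * scal E S = scal E S * M ^ m := by
    induction m with
    | zero => rw [pow_zero, pow_zero, Matrix.one_mul, Matrix.mul_one]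
    | succ m ih => rw [pow_succ, pow_succ, Matrix.mul_assoc, h, ← Matrix.mul_assoc, ih,
        Matrix.mul_assoc]
  calc (N ^ m).trace = (N ^ m * scal E S * scal E T).trace := by
        rw [Matrix.mul_assoc, ← scal_mul, hST, scal_one, Matrix.mul_one]
    _ = (scal E S * (M ^ m * scal E T)).trace := by rw [h1, Matrix.mul_assoc]
    _ = (M ^ m).trace := by
        rw [trace_scal_mul, Matrix.mul_assoc, ← scal_mul, hTS, scal_one, Matrix.mul_one]

/-- The grading involution of matrices of forms. -/
def involM {q p : Type*} (M : Matrix q p (MForm E)) : Matrix q p (MForm E) := M.map involHom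

theorem involM_mul {r q p : Type*} [Fintype q] (M : Matrix r q (MForm E))
    (N : Matrix q p (MForm E)) :
    involM (M * N) = involM M * involM N := Matrix.map_mul

theorem involM_scal {q p : Type*} (S : Matrix q p ℂ) : involM (scal E S) = scal E S := by
  ext1 i j
  change invol (scal E S i j) = _
  rw [scal_apply, map_smul, invol_one]

/-- The Cartan differential of matrices of forms. -/
def cartanM {q p : Type*} (v : E → E) (M : E → Matrix q p (MForm E)) (z : E) :
    Matrix q p (MForm E) :=
  Matrix.of fun i j => cartanD v (fun y => M y i j) z

theorem cartanM_apply {q p : Type*} (v : E → E) (M : E → Matrix q p (MForm E)) (z : E) (i : q)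
    (j : p) : cartanM v M z i j = cartanD v (fun y => M y i j) z := rfl

theorem cartanD_sum (v : E → E) {ι : Type*} {s : Finset ι} {ξ : ι → E → MForm E} {z : E}
    (h : ∀ i ∈ s, DiffAt (ξ i) z) :
    cartanD v (fun y => ∑ i ∈ s, ξ i y) z = ∑ i ∈ s, cartanD v (ξ i) z := by
  rw [cartanD, extD_sum h, map_sum, ← Finset.sum_sub_distrib]
  rfl

theorem cartanD_add (v : E → E) {ξ η : E → MForm E} {z : E} (h : DiffAt ξ z) (h' : DiffAt η z) :
    cartanD v (fun y => ξ y + η y) z = cartanD v ξ z + cartanD v η z := by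
  rw [cartanD, extD_add h h', map_add, cartanD, cartanD]
  abel

theorem cartanD_congr (v : E → E) {ξ η : E → MForm E} {z : E} (h : ∀ᶠ y in nhds z, ξ y = η y) :
    cartanD v ξ z = cartanD v η z := by
  rw [cartanD, extD_congr h, h.self_of_nhds, cartanD]

theorem involM_pow {p : Type*} [Fintype p] [DecidableEq p] {M : Matrix p p (MForm E)}
    (h : involM M = M) (m : ℕ) :
    involM (M ^ m) = M ^ m := by
  induction m with
  | zero => rw [pow_zero, ← scal_one, involM_scal]
  | succ m ih => rw [pow_succ, involM_mul, ih, h]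

/-- Minus the Lie derivative along the vector field. -/
theorem cartanD_cartanD (v : E → E) {ξ : E → MForm E} (h : Smooth ξ) (hv : ContDiff ℝ ∞ v) (z : E) :
    cartanD v (cartanD v ξ) z =
      -(extD (fun y => contr (v y) (ξ y)) z + contr (v z) (extD ξ z)) := by
  have h1 : extD (cartanD v ξ) z = -extD (fun y => contr (v y) (ξ y)) z := by
    have := extD_sub (h.extD.diffAt z) ((h.contr hv).diffAt z)
    rw [extD_extD h, zero_sub] at this
    exact this
  rw [cartanD, h1, cartanD, map_sub, contr_contr_self]
  abel

variable [FiniteDimensional ℝ E]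

theorem cartanM_mul {r q p : Type*} [Fintype q] (v : E → E)
    {M : E → Matrix r q (MForm E)} {N : E → Matrix q p (MForm E)}
    {z : E} (hM : ∀ i j, DiffAt (fun y => M y i j) z) (hN : ∀ i j, DiffAt (fun y => N y i j) z) :
    cartanM v (fun y => M y * N y) z = cartanM v M z * N z + involM (M z) * cartanM v N z := by
  ext1 i j
  rw [cartanM_apply, Matrix.add_apply, Matrix.mul_apply, Matrix.mul_apply]
  simp only [Matrix.mul_apply]
  rw [cartanD_sum v fun k _ => (hM i k).mul (hN k j), ← Finset.sum_add_distrib]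
  exact Finset.sum_congr rfl fun k _ => cartanD_mul v (hM i k) (hN k j)

theorem smooth_pow_apply {p : Type*} [Fintype p] [DecidableEq p] {M : E → Matrix p p (MForm E)}
    (h : ∀ i j, Smooth fun y => M y i j)
    (m : ℕ) (i j : p) : Smooth fun y => (M y ^ m) i j := by
  induction m generalizing i j with
  | zero => simp only [pow_zero]; exact Smooth.const _
  | succ m ih =>
    simp only [pow_succ, Matrix.mul_apply]
    exact Smooth.sum fun k _ => (ih i k).mul (h k j)

/-- The Bianchi identity `D Ω = [Ω, a]` implies that the traces of the powers of `Ω` are closed. -/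
theorem cartanD_trace_pow {p : Type*} [Fintype p] [DecidableEq p] {v : E → E}
    {Ω : E → Matrix p p (MForm E)}
    (h : ∀ i j, Smooth fun y => Ω y i j) {z : E} (he : involM (Ω z) = Ω z)
    {a : Matrix p p (MForm E)} (hD : cartanM v Ω z = Ω z * a - a * Ω z) (m : ℕ) :
    cartanD v (fun y => (Ω y ^ m).trace) z = 0 := by
  have h1 : cartanM v (fun y => Ω y ^ m) z = Ω z ^ m * a - a * Ω z ^ m := by
    induction m with
    | zero =>
      ext1 i j
      simp only [pow_zero]
      rw [cartanM_apply, Matrix.one_mul, Matrix.mul_one, sub_self, cartanD, extD_const,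
        Matrix.one_apply]
      split_ifs <;> simp [contr_one]
    | succ m ih =>
      simp only [pow_succ]
      rw [cartanM_mul v (fun i j => (smooth_pow_apply h m i j).diffAt z)
        (fun i j => (h i j).diffAt z), ih, involM_pow he, hD]
      noncomm_ring
  have h2 : cartanD v (fun y => (Ω y ^ m).trace) z = (cartanM v (fun y => Ω y ^ m) z).trace :=
    cartanD_sum v fun i _ => (smooth_pow_apply h m i i).diffAt z
  rw [h2, h1, Matrix.trace_sub, sub_eq_zero]
  simp only [Matrix.trace, Matrix.diag_apply, Matrix.mul_apply]
  rw [Finset.sum_comm]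
  refine Finset.sum_congr rfl fun i _ => Finset.sum_congr rfl fun j _ => ?_
  refine commute_of_even ?_ _
  exact congrFun (congrFun (involM_pow he m) j) i

end MatrixForms

/-! ### The equivariant curvature -/

open MeasureTheory NormedSpace MForm

section OneFormCalculus

variable {E : Type*} [NormedAddCommGroup E] [NormedSpace ℝ E]

theorem oneForm_apply_of_ne {k : ℕ} (h : k ≠ 1) (l : E →L[ℝ] ℂ) : oneForm l k = 0 := by
  rcases k with _ | _ | k
  · rfl
  · exact absurd rfl h
  · rfl

theorem one_apply_of_ne {k : ℕ} (h : k ≠ 0) : (1 : MForm E) k = 0 := by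
  rcases k with _ | k
  · exact absurd rfl h
  · rfl

theorem smul_one_apply_of_ne {k : ℕ} (h : k ≠ 0) (c : ℂ) : (c • (1 : MForm E)) k = 0 := by
  change c • (1 : MForm E) k = 0
  rw [one_apply_of_ne h, smul_form_zero]

theorem extD_oneForm_apply_of_ne {l : E → E →L[ℝ] ℂ} {k : ℕ} (h : k ≠ 2) (z : E) :
    extD (fun y => oneForm (l y)) z k = 0 := by
  rcases k with _ | k
  · rfl
  · have h1 := congrFun (extD_const (0 : MForm E) z) (k + 1)
    rw [extD_succ] at h1 ⊢
    have : (fun y => oneForm (l y) k) = fun _ => (0 : MForm E) k :=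
      funext fun y => oneForm_apply_of_ne (by omega) (l y)
    rw [this]
    exact h1

theorem smooth_oneForm [FiniteDimensional ℝ E] {l : E → E →L[ℝ] ℂ} (hl : ContDiff ℝ ∞ l) :
    Smooth fun y => oneForm (l y) := fun k => contDiff_of_apply fun v => by
  by_cases h : k = 1
  · subst h
    exact hl.clm_apply contDiff_const
  · simp only [oneForm_apply_of_ne h]
    exact contDiff_const

theorem pd_smul_one {f : E → ℂ} {z : E} (hf : DifferentiableAt ℝ f z) (u : E) :
    pd (fun y => f y • (1 : MForm E)) z u = fderiv ℝ f z u • 1 := by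
  ext1 k
  rw [pd_apply]
  have := (hf.hasFDerivAt.smul_const ((1 : MForm E) k)).fderiv
  exact congrArg (fun l => l u) this

theorem fderiv_clm_apply_self {F : Type*} [NormedAddCommGroup F] [NormedSpace ℝ F]
    {l : E → E →L[ℝ] F} {z : E}
    (hl : DifferentiableAt ℝ l z) (v : E →L[ℝ] E) (u : E) :
    fderiv ℝ (fun y => l y (v y)) z u = fderiv ℝ l z u (v z) + l z (v u) := by
  rw [fderiv_clm_apply hl v.differentiableAt]
  simp [add_comm]

variable [FiniteDimensional ℝ E]

theorem oneForm_mul_oneForm_term {l l' : E →L[ℝ] ℂ} {m : ℕ} {q : ℕ × ℕ} (h : q.1 ≠ 1 ∨ q.2 ≠ 1) :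
    term (oneForm l) (oneForm l') m q = 0 := by
  rw [termL_apply]
  rcases h with h | h
  · rw [oneForm_apply_of_ne h, map_zero]
    rfl
  · rw [oneForm_apply_of_ne h, map_zero]

theorem oneForm_mul_oneForm_apply_two (l l' : E →L[ℝ] ℂ) : (oneForm l * oneForm l') 2 =
    extProd (by norm_num) (ContinuousAlternatingMap.ofSubsingleton ℝ E ℂ (0 : Fin 1) l)
      (ContinuousAlternatingMap.ofSubsingleton ℝ E ℂ (0 : Fin 1) l') := by
  rw [mul_apply, Finset.sum_eq_single (1, 1)]
  · rfl
  · intro q hq hne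
    have hq' := Finset.HasAntidiagonal.mem_antidiagonal.1 hq
    refine oneForm_mul_oneForm_term ?_
    by_contra! h
    exact hne (Prod.ext h.1 h.2)
  · intro h
    exact absurd (Finset.HasAntidiagonal.mem_antidiagonal.2 (by norm_num)) h

theorem oneForm_mul_oneForm_apply_of_ne (l l' : E →L[ℝ] ℂ) {k : ℕ} (hk : k ≠ 2) :
    (oneForm l * oneForm l') k = 0 := by
  rw [mul_apply]
  refine Finset.sum_eq_zero fun q hq => oneForm_mul_oneForm_term ?_
  have hq' := Finset.HasAntidiagonal.mem_antidiagonal.1 hq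
  omega

/-- Minus the Lie derivative along a linear vector field of a differential form of degree `1`. -/
theorem cartanD_cartanD_oneForm {l : E → E →L[ℝ] ℂ} (hl : ContDiff ℝ ∞ l) (v : E →L[ℝ] E) (z : E) :
    cartanD v (cartanD v fun y => oneForm (l y)) z =
      -oneForm (fderiv ℝ l z (v z) + (l z).comp v) := by
  have hs := smooth_oneForm hl
  have hd := hl.differentiable (by simp) z
  rw [cartanD_cartanD v hs v.contDiff]
  congr 1
  refine ext_contr ?_ fun u => ?_
  · rw [map_add, zeroPart_extD, zero_add, contr_extD (hs.diffAt z), zeroPart_oneForm, map_sub,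
      zeroPart_extD, sub_zero]
    change fderiv ℝ (fun _ => (0 : E [⋀^Fin 0]→L[ℝ] ℂ)) z (v z) 0 = 0
    simp
  · simp only [contr_oneForm]
    rw [contr_extD (hs.diffAt z), map_add, map_sub]
    have hc : ∀ w, DifferentiableAt ℝ (fun y => l y w) z := fun w =>
      hd.clm_apply (differentiableAt_const w)
    have hv : DifferentiableAt ℝ (fun y => l y (v y)) z := hd.clm_apply v.differentiableAt
    have e1 : ∀ w w', contr w (pd (fun y => oneForm (l y)) z w') = fderiv ℝ l z w' w • 1 := by
      intro w w'
      rw [← (isDeg_contr w).pd (hs.diffAt z)]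
      simp only [contr_oneForm]
      rw [pd_smul_one (hc w), fderiv_clm_apply hd (differentiableAt_const w)]
      simp
    have e2 : ∀ {f : E → ℂ}, DifferentiableAt ℝ f z →
        contr u (extD (fun y => f y • (1 : MForm E)) z) = fderiv ℝ f z u • 1 := by
      intro f hf
      rw [extD_smul_const hf, mul_one, contr_oneForm]
    rw [e1]
    simp only [contr_oneForm]
    rw [e2 hv, e2 (hc (v z)), fderiv_clm_apply_self hd,
      fderiv_clm_apply hd (differentiableAt_const _)]
    simp only [fderiv_fun_const, Pi.zero_apply, ContinuousLinearMap.comp_zero, zero_add,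
      ContinuousLinearMap.flip_apply, ← sub_smul, ← add_smul, _root_.add_apply,
      ContinuousLinearMap.comp_apply]
    congr 1
    ring

end OneFormCalculus

section Curvature

variable {V : Type*} [NormedAddCommGroup V] [NormedSpace ℝ V] {Λ : Submodule ℤ V} {n : ℕ}
variable {p : Type*}

/-- The entries of a connection form, as linear forms. -/
def connEntry (A : (Fin n → ℂ) → (Fin n → ℂ) →ₗ[ℝ] Matrix p p ℂ) (i j : p) (z : Fin n → ℂ) :
    (Fin n → ℂ) →L[ℝ] ℂ :=
  LinearMap.toContinuousLinearMap (Matrix.entryLinearMap ℝ ℂ i j ∘ₗ A z)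

theorem connEntry_apply (A : (Fin n → ℂ) → (Fin n → ℂ) →ₗ[ℝ] Matrix p p ℂ) (i j : p)
    (z v : Fin n → ℂ) : connEntry A i j z v = A z v i j := rfl

/-- A connection form, as a matrix of forms. -/
def connForm (A : (Fin n → ℂ) → (Fin n → ℂ) →ₗ[ℝ] Matrix p p ℂ) (z : Fin n → ℂ) :
    Matrix p p (MForm (Fin n → ℂ)) :=
  Matrix.of fun i j => oneForm (connEntry A i j z)

theorem connForm_apply (A : (Fin n → ℂ) → (Fin n → ℂ) →ₗ[ℝ] Matrix p p ℂ) (z : Fin n → ℂ)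
    (i j : p) : connForm A z i j = oneForm (connEntry A i j z) := rfl

/-- The vector field of `x`, as a continuous linear map. -/
def vecL (X : Fin n → Λ) (x : StrongDual ℝ V) : (Fin n → ℂ) →L[ℝ] (Fin n → ℂ) :=
  LinearMap.toContinuousLinearMap (vecLin X x)

variable {X : Fin n → Λ} {w : p → Λ} {A : (Fin n → ℂ) → (Fin n → ℂ) →ₗ[ℝ] Matrix p p ℂ}

theorem contDiff_connEntry (hA : ∀ v i j, ContDiff ℝ ∞ fun z => A z v i j) (i j : p) :
    ContDiff ℝ ∞ (connEntry A i j) :=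
  contDiff_clm_apply_iff.2 fun v => hA v i j

theorem smooth_connForm (hA : ∀ v i j, ContDiff ℝ ∞ fun z => A z v i j) (i j : p) :
    Smooth fun z => connForm A z i j := smooth_oneForm (contDiff_connEntry hA i j)

theorem smooth_cartanM {q : Type*} {M : (Fin n → ℂ) → Matrix q p (MForm (Fin n → ℂ))}
    (h : ∀ i j, Smooth fun z => M z i j) (x : StrongDual ℝ V) (i : q) (j : p) :
    Smooth fun z => cartanM (vecLin X x) M z i j :=
  (h i j).extD.sub ((h i j).contr (vecL X x).contDiff)

theorem involM_connForm (z : Fin n → ℂ) : involM (connForm A z) = -connForm A z := by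
  ext1 i j
  exact invol_oneForm _

theorem involM_cartanM_connForm (hA : ∀ v i j, ContDiff ℝ ∞ fun z => A z v i j)
    (x : StrongDual ℝ V) (z : Fin n → ℂ) :
    involM (cartanM (vecLin X x) (connForm A) z) = cartanM (vecLin X x) (connForm A) z := by
  ext1 i j
  change invol (extD (fun y => connForm A y i j) z -
    contr (vecLin X x z) (oneForm (connEntry A i j z))) = extD (fun y => connForm A y i j) z -
    contr (vecLin X x z) (oneForm (connEntry A i j z))
  have h1 : invol (extD (fun y => connForm A y i j) z) = extD (fun y => connForm A y i j) z := by
    have h2 := extD_invol ((smooth_connForm hA i j).diffAt z)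
    simp only [connForm_apply, invol_oneForm] at h2 ⊢
    rw [extD_neg ((smooth_oneForm (contDiff_connEntry hA i j)).diffAt z)] at h2
    exact (neg_injective h2).symm
  rw [map_sub, h1, contr_oneForm, map_smul, invol_one]

variable [Fintype p]

theorem smooth_matMul {E B : Type*} [NormedAddCommGroup E] [NormedSpace ℝ E]
    [FiniteDimensional ℝ E] [NormedAddCommGroup B] [NormedSpace ℝ B] {q r : Type*}
    {M : B → Matrix q p (MForm E)} {N : B → Matrix p r (MForm E)}
    (hM : ∀ i j, Smooth fun z => M z i j) (hN : ∀ i j, Smooth fun z => N z i j) (i : q) (j : r) :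
    Smooth fun z => (M z * N z) i j := by
  simp only [Matrix.mul_apply]
  exact Smooth.sum fun k _ => (hM i k).mul (hN k j)

variable [DecidableEq p]

theorem connEntry_act {V : Type*} [NormedAddCommGroup V] {Λ : Submodule ℤ V} {X : Fin n → Λ}
    {w : p → Λ} {A : (Fin n → ℂ) → (Fin n → ℂ) →ₗ[ℝ] Matrix p p ℂ}
    (hA : ∀ g z v, A (act X g z) (act X g v) * grpAct w g = grpAct w g * A z v)
    (i j : p) (g : AddChar Λ Circle) (z v : Fin n → ℂ) :
    connEntry A i j (act X g z) (act X g v) = (g (w i - w j) : ℂ) * connEntry A i j z v := by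
  have h := congrFun (congrFun (hA g z v) i) j
  rw [grpAct, Matrix.mul_diagonal, Matrix.diagonal_mul] at h
  rw [connEntry_apply, connEntry_apply, AddChar.map_sub_eq_div, Circle.coe_div, div_mul_eq_mul_div,
    ← h, mul_div_cancel_right₀ _ (Circle.coe_ne_zero _)]

/-- The equivariant curvature of `∇ = d + A`, as a matrix of forms. -/
def curvM (X : Fin n → Λ) (w : p → Λ) (A : (Fin n → ℂ) → (Fin n → ℂ) →ₗ[ℝ] Matrix p p ℂ)
    (x : StrongDual ℝ V) (z : Fin n → ℂ) : Matrix p p (MForm (Fin n → ℂ)) :=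
  formMat (equivCurvature X w A x z)

/-- The equivariant curvature is `x + D a + a²`, where `x` acts by its infinitesimal action on the
fibre and `a` is the connection form. -/
theorem curvM_eq (X : Fin n → Λ) (w : p → Λ) (A : (Fin n → ℂ) → (Fin n → ℂ) →ₗ[ℝ] Matrix p p ℂ)
    (x : StrongDual ℝ V) (z : Fin n → ℂ) : curvM X w A x z =
      scal (Fin n → ℂ) (lieAct w x) + cartanM (vecLin X x) (connForm A) z +
        connForm A z * connForm A z := by
  ext1 i j
  rw [Matrix.add_apply, Matrix.add_apply, Matrix.mul_apply, scal_apply, cartanM_apply]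
  simp only [connForm_apply]
  rw [cartanD, contr_oneForm]
  ext1 k
  rw [MForm.add_apply, MForm.add_apply, MForm.sum_apply]
  change equivCurvature X w A x z i j k = _ + (_ - _) + _
  rcases k with _ | _ | _ | k
  · refine (apply_zero_eq_iff (α := curvM X w A x z i j) (β := lieAct w x i j • 1 +
      (0 - connEntry A i j z (vecLin X x z) • 1) + 0)).2 ?_ |>.trans ?_
    · simp only [map_add, map_smul, zeroPart_one, smul_eq_mul, mul_one, zero_sub, add_zero, map_neg]
      change (lieAct w x - A z (vecField X x z)) i j = _
      rw [Matrix.sub_apply, sub_eq_add_neg]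
      rfl
    · rw [Finset.sum_eq_zero fun r _ => oneForm_mul_oneForm_apply_of_ne _ _ (by norm_num)]
      rfl
  · rw [Finset.sum_eq_zero fun r _ => oneForm_mul_oneForm_apply_of_ne _ _ (by norm_num),
      smul_one_apply_of_ne (by norm_num), smul_one_apply_of_ne (by norm_num),
      extD_oneForm_apply_of_ne (by norm_num)]
    exact (by simp : (0 : (Fin n → ℂ) [⋀^Fin 1]→L[ℝ] ℂ) = 0 + (0 - 0) + 0)
  · rw [smul_one_apply_of_ne (by norm_num), smul_one_apply_of_ne (by norm_num), zero_add, sub_zero]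
    rw [Finset.sum_congr rfl fun r _ => oneForm_mul_oneForm_apply_two _ _]
    refine Eq.trans ?_ (congrArg (· + _) (zero_add _).symm)
    rfl
  · rw [Finset.sum_eq_zero fun r _ => oneForm_mul_oneForm_apply_of_ne _ _ (by omega),
      smul_one_apply_of_ne (by omega), smul_one_apply_of_ne (by omega),
      extD_oneForm_apply_of_ne (by omega)]
    simp [equivCurvature]

theorem smooth_curvM (hA : ∀ v i j, ContDiff ℝ ∞ fun z => A z v i j) (x : StrongDual ℝ V)
    (i j : p) : Smooth fun z => curvM X w A x z i j := by
  simp only [curvM_eq, Matrix.add_apply]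
  exact ((Smooth.const _).add (smooth_cartanM (smooth_connForm hA) x i j)).add
    (smooth_matMul (smooth_connForm hA) (smooth_connForm hA) i j)

theorem involM_curvM (hA : ∀ v i j, ContDiff ℝ ∞ fun z => A z v i j)
    (x : StrongDual ℝ V) (z : Fin n → ℂ) : involM (curvM X w A x z) = curvM X w A x z := by
  have h : ∀ M N : Matrix p p (MForm (Fin n → ℂ)), involM (M + N) = involM M + involM N :=
    fun M N => Matrix.map_add _ (map_add _) M N
  rw [curvM_eq, h, h, involM_scal, involM_cartanM_connForm hA, involM_mul, involM_connForm,
    neg_mul_neg]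

/-- The Lie derivative of an invariant connection form is minus its commutator with the
infinitesimal action. -/
theorem cartanM_cartanM_connForm (hA : ∀ v i j, ContDiff ℝ ∞ fun z => A z v i j)
    (hinv : ∀ g z v, A (act X g z) (act X g v) * grpAct w g = grpAct w g * A z v)
    (x : StrongDual ℝ V) (z : Fin n → ℂ) :
    cartanM (vecLin X x) (cartanM (vecLin X x) (connForm A)) z =
      scal (Fin n → ℂ) (lieAct w x) * connForm A z -
        connForm A z * scal (Fin n → ℂ) (lieAct w x) := by
  ext1 i j
  have hs := contDiff_connEntry hA i j
  have h1 : fderiv ℝ (connEntry A i j) z (vecL X x z) + (connEntry A i j z).comp (vecL X x) =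
      -((Complex.I * (x (w i - w j : V) : ℝ)) • connEntry A i j z) := by
    ext v
    exact fderiv_vecLin_form_of_weight X (connEntry_act hinv i j)
      (hs.differentiable (by simp) z) x v
  have h2 : cartanM (vecLin X x) (cartanM (vecLin X x) (connForm A)) z i j =
      (Complex.I * (x (w i - w j : V) : ℝ)) • oneForm (connEntry A i j z) := by
    refine (cartanD_cartanD_oneForm hs (vecL X x) z).trans ?_
    rw [h1, ← oneForm_smul, ← neg_one_smul ℂ (oneForm _), ← oneForm_smul]
    congr 1
    ext v
    simp
  rw [h2, Matrix.sub_apply, scal, lieAct, Matrix.diagonal_map (map_zero _), Matrix.mul_diagonal,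
    Matrix.diagonal_mul, ← Algebra.commutes, connForm_apply, ← Algebra.smul_def, ← Algebra.smul_def,
    ← sub_smul]
  congr 1
  rw [map_sub]
  push_cast
  ring

/-- The Bianchi identity. -/
theorem cartanM_curvM (hA : ∀ v i j, ContDiff ℝ ∞ fun z => A z v i j)
    (hinv : ∀ g z v, A (act X g z) (act X g v) * grpAct w g = grpAct w g * A z v)
    (x : StrongDual ℝ V) (z : Fin n → ℂ) :
    cartanM (vecLin X x) (curvM X w A x) z =
      curvM X w A x z * connForm A z - connForm A z * curvM X w A x z := by
  have ha : ∀ i j, DiffAt (fun y => connForm A y i j) z := fun i j =>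
    (smooth_connForm hA i j).diffAt z
  have h1 : cartanM (vecLin X x) (curvM X w A x) z =
      cartanM (vecLin X x) (cartanM (vecLin X x) (connForm A)) z +
        cartanM (vecLin X x) (fun y => connForm A y * connForm A y) z := by
    ext1 i j
    rw [cartanM_apply, Matrix.add_apply, cartanM_apply, cartanM_apply]
    simp only [curvM_eq, Matrix.add_apply]
    have hc : DiffAt (fun _ => scal (Fin n → ℂ) (lieAct w x) i j) z := DiffAt.const _ z
    have hd : DiffAt (fun y => cartanM (vecLin X x) (connForm A) y i j) z :=
      (smooth_cartanM (smooth_connForm hA) x i j).diffAt z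
    have he : DiffAt (fun y => (connForm A y * connForm A y) i j) z :=
      (smooth_matMul (smooth_connForm hA) (smooth_connForm hA) i j).diffAt z
    rw [cartanD_add _ (hc.add hd) he, cartanD_add _ hc hd]
    congr 1
    rw [cartanD, extD_const, scal_apply, map_smul, contr_one, smul_zero, sub_zero, zero_add]
  rw [h1, cartanM_mul _ ha ha, cartanM_cartanM_connForm hA hinv, involM_connForm, curvM_eq]
  noncomm_ring

theorem mix_chernForm (x : StrongDual ℝ V) (z : Fin n → ℂ) :
    mix (chernForm X w A) x z = trExp (curvM X w A x z) := traceExp_eq _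

/-- The Chern character form of an invariant connection is equivariantly closed. -/
theorem equivD_chernForm (hA : ∀ v i j, ContDiff ℝ ∞ fun z => A z v i j)
    (hinv : ∀ g z v, A (act X g z) (act X g v) * grpAct w g = grpAct w g * A z v) :
    equivD X (chernForm X w A : EquivForm V n) = 0 := by
  refine equivD_eq_iff.2 fun x z => ?_
  have : mix (chernForm X w A) x = fun z => trExp (curvM X w A x z) :=
    funext fun z => mix_chernForm x z
  rw [this]
  exact cartanD_trExp_eq_zero (smooth_curvM hA x) fun m =>
    cartanD_trace_pow (smooth_curvM hA x) (involM_curvM hA x z) (cartanM_curvM hA hinv x z) m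

end Curvature

/-! ### Invariance of the curvature and parallel morphisms -/

open MeasureTheory NormedSpace MForm

section Invariance

variable {V : Type*} [NormedAddCommGroup V] [NormedSpace ℝ V] {Λ : Submodule ℤ V} {n : ℕ}

/-- The pull-back of forms as a homomorphism of algebras. -/
def pullHom {E E' : Type*} [NormedAddCommGroup E] [NormedSpace ℝ E] [NormedAddCommGroup E']
    [NormedSpace ℝ E'] (f : E' →L[ℝ] E) : MForm E →ₐ[ℂ] MForm E' :=
  AlgHom.ofLinearMap (pull f) (pull_one f) (pull_mul f)

theorem cartanD_pull_act (X : Fin n → Λ) (x : StrongDual ℝ V) (g : AddChar Λ Circle)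
    {ξ : (Fin n → ℂ) → MForm (Fin n → ℂ)} (hξ : Smooth ξ) (z : Fin n → ℂ) :
    pull (act X g) (cartanD (vecLin X x) ξ (act X g z)) =
      cartanD (vecLin X x) (fun y => pull (act X g) (ξ (act X g y))) z := by
  have h := cartanD_pull (v := vecLin X x) (v' := vecLin X x) (ξ := ξ) (f := act X g)
    (act X g).contDiff (z := z) (hξ.diffAt _) (by
      rw [ContinuousLinearMap.fderiv]
      ext i
      rw [act_apply]
      change (g (X i) : ℂ) * vecField X x z i = vecField X x (act X g z) i
      rw [vecField_apply, vecField_apply, act_apply]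
      ring)
  simp only [ContinuousLinearMap.fderiv] at h
  exact h.symm

theorem grpAct_mul_grpAct_inv {V : Type*} [NormedAddCommGroup V] {Λ : Submodule ℤ V} {p : Type*}
    [Fintype p] [DecidableEq p] (w : p → Λ) (g : AddChar Λ Circle) :
    grpAct w g * grpAct w g⁻¹ = 1 := by
  rw [grpAct, grpAct, Matrix.diagonal_mul_diagonal, ← Matrix.diagonal_one]
  congr 1
  funext i
  rw [AddChar.inv_apply', ← Circle.coe_mul, mul_inv_cancel, Circle.coe_one]

variable {p : Type*} [Fintype p] [DecidableEq p]
variable {X : Fin n → Λ} {w : p → Λ} {A : (Fin n → ℂ) → (Fin n → ℂ) →ₗ[ℝ] Matrix p p ℂ}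

theorem connForm_act {V : Type*} [NormedAddCommGroup V] {Λ : Submodule ℤ V} {X : Fin n → Λ}
    {w : p → Λ} {A : (Fin n → ℂ) → (Fin n → ℂ) →ₗ[ℝ] Matrix p p ℂ}
    (hinv : ∀ g z v, A (act X g z) (act X g v) * grpAct w g = grpAct w g * A z v)
    (g : AddChar Λ Circle) (z : Fin n → ℂ) (i j : p) :
    pull (act X g) (connForm A (act X g z) i j) = (g (w i - w j) : ℂ) • connForm A z i j := by
  rw [connForm_apply, connForm_apply, pull_oneForm, ← oneForm_smul]
  congr 1
  ext v
  exact connEntry_act hinv i j g z v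

theorem scal_grpAct_mul_apply {V : Type*} [NormedAddCommGroup V] {Λ : Submodule ℤ V} {w : p → Λ}
    (M : Matrix p p (MForm (Fin n → ℂ))) (g : AddChar Λ Circle) (i j : p) :
    (scal (Fin n → ℂ) (grpAct w g) * M) i j = (g (w i) : ℂ) • M i j := by
  rw [scal, grpAct, Matrix.diagonal_map (map_zero _), Matrix.diagonal_mul, ← Algebra.smul_def]

theorem mul_scal_grpAct_apply {V : Type*} [NormedAddCommGroup V] {Λ : Submodule ℤ V} {w : p → Λ}
    (M : Matrix p p (MForm (Fin n → ℂ))) (g : AddChar Λ Circle) (i j : p) :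
    (M * scal (Fin n → ℂ) (grpAct w g)) i j = (g (w j) : ℂ) • M i j := by
  rw [scal, grpAct, Matrix.diagonal_map (map_zero _), Matrix.mul_diagonal, ← Algebra.commutes,
    ← Algebra.smul_def]

theorem intertwine_of_weight {V : Type*} [NormedAddCommGroup V] {Λ : Submodule ℤ V} {w : p → Λ}
    {M N : Matrix p p (MForm (Fin n → ℂ))} {g : AddChar Λ Circle}
    (h : ∀ i j, N i j = (g (w i - w j) : ℂ) • M i j) :
    N * scal (Fin n → ℂ) (grpAct w g) = scal (Fin n → ℂ) (grpAct w g) * M := by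
  ext1 i j
  rw [scal_grpAct_mul_apply, mul_scal_grpAct_apply, h, smul_smul, AddChar.map_sub_eq_div,
    Circle.coe_div, mul_div_cancel₀ _ (Circle.coe_ne_zero _)]

/-- The equivariance of the equivariant curvature of an invariant connection. -/
theorem curvM_act (hA : ∀ v i j, ContDiff ℝ ∞ fun z => A z v i j)
    (hinv : ∀ g z v, A (act X g z) (act X g v) * grpAct w g = grpAct w g * A z v)
    (x : StrongDual ℝ V) (g : AddChar Λ Circle) (z : Fin n → ℂ) :
    (pullHom (act X g)).mapMatrix (curvM X w A x (act X g z)) * scal (Fin n → ℂ) (grpAct w g) =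
      scal (Fin n → ℂ) (grpAct w g) * curvM X w A x z := by
  have h1 : (pullHom (act X g)).mapMatrix (connForm A (act X g z)) * scal (Fin n → ℂ) (grpAct w g) =
      scal (Fin n → ℂ) (grpAct w g) * connForm A z := intertwine_of_weight (connForm_act hinv g z)
  have h2 : (pullHom (act X g)).mapMatrix (cartanM (vecLin X x) (connForm A) (act X g z)) *
      scal (Fin n → ℂ) (grpAct w g) =
        scal (Fin n → ℂ) (grpAct w g) * cartanM (vecLin X x) (connForm A) z := by
    refine intertwine_of_weight fun i j => ?_
    refine (cartanD_pull_act X x g (smooth_connForm hA i j) z).trans ?_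
    simp only [connForm_act hinv]
    rw [cartanD, extD_smul _ ((smooth_connForm hA i j).diffAt z), map_smul, ← smul_sub]
    rfl
  have h3 : (pullHom (act X g)).mapMatrix (scal (Fin n → ℂ) (lieAct w x)) *
      scal (Fin n → ℂ) (grpAct w g) =
      scal (Fin n → ℂ) (grpAct w g) * scal (Fin n → ℂ) (lieAct w x) := by
    have : (pullHom (act X g)).mapMatrix (scal (Fin n → ℂ) (lieAct w x)) =
        scal (Fin n → ℂ) (lieAct w x) := by
      ext1 i j
      exact (pullHom (act X g)).commutes _
    rw [this, ← scal_mul, ← scal_mul, lieAct, grpAct, Matrix.diagonal_mul_diagonal,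
      Matrix.diagonal_mul_diagonal]
    congr 2
    funext i
    exact mul_comm _ _
  rw [curvM_eq, curvM_eq, map_add, map_add, map_mul]
  rw [add_mul, add_mul, h2, h3, mul_assoc, h1, ← mul_assoc, h1]
  noncomm_ring

theorem isInvariant_chernForm (hA : ∀ v i j, ContDiff ℝ ∞ fun z => A z v i j)
    (hinv : ∀ g z v, A (act X g z) (act X g v) * grpAct w g = grpAct w g * A z v) :
    IsInvariant X (chernForm X w A : EquivForm V n) := by
  intro g x k z
  suffices h : pull (act X g) (mix (chernForm X w A) x (act X g z)) = mix (chernForm X w A) x z from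
    congrFun h k
  rw [mix_chernForm, mix_chernForm]
  refine pull_trExp _ fun m => ?_
  have h1 := trace_pow_eq_of_intertwine (grpAct_mul_grpAct_inv w g)
    (by simpa using grpAct_mul_grpAct_inv w g⁻¹) (curvM_act hA hinv x g z) m
  rw [← h1, ← map_pow]
  exact map_sum (pull (act X g)) _ _

end Invariance

section Intertwine

variable {V : Type*} [NormedAddCommGroup V] [NormedSpace ℝ V] {Λ : Submodule ℤ V} {n : ℕ}
variable {p q : Type*} [Fintype p] [DecidableEq p] [Fintype q] [DecidableEq q]
variable {X : Fin n → Λ} {w : p → Λ} {A : (Fin n → ℂ) → (Fin n → ℂ) →ₗ[ℝ] Matrix p p ℂ}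
variable {w' : q → Λ} {A' : (Fin n → ℂ) → (Fin n → ℂ) →ₗ[ℝ] Matrix q q ℂ}
variable {Sig : (Fin n → ℂ) → Matrix q p ℂ}

theorem oneForm_sum {E : Type*} [NormedAddCommGroup E] [NormedSpace ℝ E] {ι : Type*}
    (s : Finset ι) (l : ι → E →L[ℝ] ℂ) : oneForm (∑ i ∈ s, l i) = ∑ i ∈ s, oneForm (l i) :=
  map_sum (AddMonoidHom.mk' oneForm oneForm_add) l s

/-- A parallel equivariant morphism intertwines the equivariant curvatures. -/
theorem curvM_mul_scal (hA : ∀ v i j, ContDiff ℝ ∞ fun z => A z v i j)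
    (hA' : ∀ v i j, ContDiff ℝ ∞ fun z => A' z v i j)
    (hS : ∀ i j, ContDiff ℝ ∞ fun z => Sig z i j)
    (hinv : ∀ g z, Sig (act X g z) * grpAct w g = grpAct w' g * Sig z) {z : Fin n → ℂ}
    (hpar : ∀ᶠ y in nhds z, ∀ v, matDeriv Sig y v + A' y v * Sig y = Sig y * A y v)
    (x : StrongDual ℝ V) :
    curvM X w' A' x z * scal (Fin n → ℂ) (Sig z) = scal (Fin n → ℂ) (Sig z) * curvM X w A x z := by
  have hd : ∀ i j y, DifferentiableAt ℝ (fun z => Sig z i j) y := fun i j y =>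
    (hS i j).differentiable (by simp) y
  have hs : ∀ i j, Smooth fun y => scal (Fin n → ℂ) (Sig y) i j := fun i j => by
    simp only [scal_apply]
    exact Smooth.smul (hS i j) (Smooth.const _)
  have hDs : ∀ y i j, cartanM (vecLin X x) (fun y => scal (Fin n → ℂ) (Sig y)) y i j =
      oneForm (fderiv ℝ (fun y => Sig y i j) y) := fun y i j => by
    rw [cartanM_apply]
    simp only [scal_apply]
    rw [cartanD, extD_smul_const (hd i j y), map_smul, contr_one, smul_zero, sub_zero, mul_one]
  -- With `D` the Cartan differential, `DΣ + a' Σ = Σ a`. Applying `D` again and using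
  -- `D² Σ = x Σ - Σ x` gives `Ω' Σ = Σ Ω` for `Ω = x + D a + a²`.
  have h1 : ∀ᶠ y in nhds z, cartanM (vecLin X x) (fun y => scal (Fin n → ℂ) (Sig y)) y +
      connForm A' y * scal (Fin n → ℂ) (Sig y) = scal (Fin n → ℂ) (Sig y) * connForm A y := by
    filter_upwards [hpar] with y hy
    ext1 i j
    have e : fderiv ℝ (fun y => Sig y i j) y + ∑ k, Sig y k j • connEntry A' i k y =
        ∑ k, Sig y i k • connEntry A k j y := by
      ext v
      have := congrFun (congrFun (hy v) i) j
      rw [Matrix.add_apply, Matrix.mul_apply, Matrix.mul_apply] at this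
      simp only [_root_.add_apply, _root_.sum_apply, _root_.smul_apply,
        connEntry_apply, smul_eq_mul]
      rw [← this]
      exact congrArg₂ _ rfl (Finset.sum_congr rfl fun k _ => mul_comm _ _)
    rw [Matrix.add_apply, hDs, Matrix.mul_apply, Matrix.mul_apply]
    have e1 := congrArg oneForm e
    rw [oneForm_add, oneForm_sum, oneForm_sum] at e1
    simp only [oneForm_smul] at e1
    simp only [scal_apply, connForm_apply, mul_smul_comm, mul_one, smul_mul_assoc, one_mul]
    exact e1
  have h2 : cartanM (vecLin X x) (cartanM (vecLin X x) fun y => scal (Fin n → ℂ) (Sig y)) z =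
      scal (Fin n → ℂ) (lieAct w' x) * scal (Fin n → ℂ) (Sig z) -
        scal (Fin n → ℂ) (Sig z) * scal (Fin n → ℂ) (lieAct w x) := by
    ext1 i j
    have hw : ∀ g z, Sig (act X g z) i j = (g (w' i - w j) : ℂ) * Sig z i j := fun g z => by
      have h := congrFun (congrFun (hinv g z) i) j
      rw [grpAct, grpAct, Matrix.mul_diagonal, Matrix.diagonal_mul] at h
      rw [AddChar.map_sub_eq_div, Circle.coe_div, div_mul_eq_mul_div, ← h,
        mul_div_cancel_right₀ _ (Circle.coe_ne_zero _)]
    have hf := fderiv_vecLin_of_weight X hw (hd i j z) x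
    have e : cartanM (vecLin X x) (cartanM (vecLin X x) fun y => scal (Fin n → ℂ) (Sig y)) z i j =
        (Complex.I * (x (w' i - w j : V) : ℝ) * Sig z i j) • 1 := by
      have := cartanD_cartanD (vecL X x) (hs i j) (vecL X x).contDiff z
      refine this.trans ?_
      simp only [scal_apply, map_smul, contr_one, smul_zero]
      rw [extD_const, zero_add, extD_smul_const (hd i j z), mul_one, contr_oneForm]
      change -(fderiv ℝ (fun z => Sig z i j) z (vecLin X x z) • (1 : MForm (Fin n → ℂ))) = _
      have hc : ((w' i - w j : Λ) : V) = (w' i - w j : V) := rfl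
      rw [hf, hc, neg_smul, neg_neg]
    rw [e, ← scal_mul, ← scal_mul, Matrix.sub_apply, scal_apply, scal_apply, lieAct, lieAct,
      Matrix.mul_diagonal, Matrix.diagonal_mul, ← sub_smul]
    congr 1
    rw [map_sub]
    push_cast
    ring
  have h3 : cartanM (vecLin X x) (fun y =>
      cartanM (vecLin X x) (fun y => scal (Fin n → ℂ) (Sig y)) y +
      connForm A' y * scal (Fin n → ℂ) (Sig y)) z =
      cartanM (vecLin X x) (fun y => scal (Fin n → ℂ) (Sig y) * connForm A y) z := by
    ext1 i j
    exact cartanD_congr _ (h1.mono fun y hy => congrFun (congrFun hy i) j)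
  have ha : ∀ i j, DiffAt (fun y => connForm A y i j) z := fun i j =>
    (smooth_connForm hA i j).diffAt z
  have ha' : ∀ i j, DiffAt (fun y => connForm A' y i j) z := fun i j =>
    (smooth_connForm hA' i j).diffAt z
  have hs' : ∀ i j, DiffAt (fun y => scal (Fin n → ℂ) (Sig y) i j) z := fun i j =>
    (hs i j).diffAt z
  have h4 : cartanM (vecLin X x) (fun y =>
      cartanM (vecLin X x) (fun y => scal (Fin n → ℂ) (Sig y)) y +
      connForm A' y * scal (Fin n → ℂ) (Sig y)) z =
      cartanM (vecLin X x) (cartanM (vecLin X x) fun y => scal (Fin n → ℂ) (Sig y)) z +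
      cartanM (vecLin X x) (fun y => connForm A' y * scal (Fin n → ℂ) (Sig y)) z := by
    ext1 i j
    exact cartanD_add _ ((smooth_cartanM hs x i j).diffAt z)
      ((smooth_matMul (smooth_connForm hA') hs i j).diffAt z)
  rw [h4, h2, cartanM_mul _ ha' hs', cartanM_mul _ hs' ha, involM_connForm, involM_scal] at h3
  have h1' := eq_sub_of_add_eq h1.self_of_nhds
  rw [h1'] at h3
  rw [curvM_eq, curvM_eq]
  simp only [Matrix.add_mul, Matrix.mul_add, Matrix.neg_mul, Matrix.mul_sub, Matrix.sub_mul,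
    Matrix.mul_assoc] at h3 ⊢
  rw [← sub_eq_zero] at h3 ⊢
  rw [← h3]
  abel

theorem exists_inverse_of_bijective {S : Matrix q p ℂ} (h : Function.Bijective S.mulVec) :
    ∃ T : Matrix p q ℂ, S * T = 1 ∧ T * S = 1 := by
  let e := LinearEquiv.ofBijective S.mulVecLin h
  have he : LinearMap.toMatrix' (e : (p → ℂ) →ₗ[ℂ] (q → ℂ)) = S := LinearMap.toMatrix'_toLin' S
  refine ⟨LinearMap.toMatrix' (e.symm : (q → ℂ) →ₗ[ℂ] (p → ℂ)), ?_, ?_⟩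
  · conv_lhs => rw [← he]
    rw [← LinearMap.toMatrix'_comp]
    simp
  · conv_lhs => rw [← he]
    rw [← LinearMap.toMatrix'_comp]
    simp

/-- The Chern character form vanishes outside the closure of the neighborhood of the support. -/
theorem AdaptedPair.ch_eq_zero (P : AdaptedPair X w w' Sig)
    (hS : ∀ i j, ContDiff ℝ ∞ fun z => Sig z i j)
    (hinv : ∀ g z, Sig (act X g z) * grpAct w g = grpAct w' g * Sig z) {z : Fin n → ℂ}
    (hz : z ∉ closure P.U) (x : StrongDual ℝ V) (k : ℕ) : P.ch x k z = 0 := by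
  have hpar : ∀ᶠ y in nhds z, ∀ v, matDeriv Sig y v + P.conMinus.A y v * Sig y =
      Sig y * P.conPlus.A y v := by
    filter_upwards [isClosed_closure.isOpen_compl.mem_nhds hz] with y hy
    exact P.adapted y fun h => hy (subset_closure h)
  have hbij : Function.Bijective (Sig z).mulVec := by
    by_contra h
    exact hz (subset_closure (P.support_subset h))
  obtain ⟨T, hT1, hT2⟩ := exists_inverse_of_bijective hbij
  have h1 := curvM_mul_scal P.conPlus.smooth P.conMinus.smooth hS hinv hpar x
  have h2 : mix (chernForm X w P.conPlus.A) x z = mix (chernForm X w' P.conMinus.A) x z := by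
    rw [mix_chernForm, mix_chernForm]
    exact trExp_congr fun m => (trace_pow_eq_of_intertwine hT1 hT2 h1 m).symm
  exact sub_eq_zero.2 (congrFun h2 k)

end Intertwine

/-! ### Exponentials of skew-Hermitian matrices -/

open MeasureTheory NormedSpace MForm

section SkewExp

variable {p : Type*} [Fintype p] [DecidableEq p]

theorem map_exp_of_finiteDimensional {A B : Type*} [NormedRing A] [NormedAlgebra ℂ A]
    [FiniteDimensional ℂ A] [NormedRing B] [NormedAlgebra ℂ B] (f : A →ₐ[ℂ] B) (M : A) :
    f (exp M) = exp (f M) := by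
  let _ : Algebra ℚ B := Algebra.compHom B (algebraMap ℚ ℂ)
  let _ : NormedAlgebra ℚ A := NormedAlgebra.restrictScalars ℚ ℂ A
  have := FiniteDimensional.complete ℂ A
  exact map_exp f f.toLinearMap.continuous_of_finiteDimensional M

theorem map_matrix_exp {B : Type*} [NormedRing B] [NormedAlgebra ℂ B] (f : Matrix p p ℂ →ₐ[ℂ] B)
    (M : Matrix p p ℂ) : f (exp M) = exp (f M) :=
  -- Any of the norms on matrices serves, as the exponential depends on the topology only.
  @map_exp_of_finiteDimensional (Matrix p p ℂ) B Matrix.linftyOpNormedRing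
    Matrix.linftyOpNormedAlgebra _ _ _ f M

/-- The exponential of a matrix which is skew for a Hermitian structure is unitary. -/
theorem conjTranspose_exp_mul {h j : Matrix p p ℂ} (hu : IsUnit h) (hj : jᴴ * h + h * j = 0) :
    (exp j)ᴴ * h * exp j = h := by
  have hd : IsUnit h.det := (Matrix.isUnit_iff_isUnit_det h).1 hu
  have h1 : h * j * h⁻¹ = -jᴴ := by
    rw [eq_neg_of_add_eq_zero_right hj, Matrix.neg_mul, Matrix.mul_assoc,
      Matrix.mul_nonsing_inv _ hd, Matrix.mul_one]
  have h2 : exp (h * j * h⁻¹) = h * exp j * h⁻¹ := Matrix.exp_conj h j hu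
  have h4 : exp (-jᴴ) = (exp jᴴ)⁻¹ := Matrix.exp_neg jᴴ
  have h5 : exp jᴴ = (exp j)ᴴ := Matrix.exp_conjTranspose j
  have h6 : IsUnit (exp jᴴ) := Matrix.isUnit_exp _
  rw [h1, h4, h5] at h2
  rw [h5] at h6
  generalize exp j = T at h2 h6 ⊢
  have h3 : h * T = Tᴴ⁻¹ * h := by
    rw [h2, Matrix.mul_assoc, Matrix.nonsing_inv_mul _ hd, Matrix.mul_one]
  rw [Matrix.mul_assoc, h3, ← Matrix.mul_assoc,
    Matrix.mul_nonsing_inv _ ((Matrix.isUnit_iff_isUnit_det _).1 h6), Matrix.one_mul]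

/-- A linear map on matrices is bounded in terms of the entries. -/
theorem exists_bound_of_linear {B : Type*} [NormedAddCommGroup B] [NormedSpace ℂ B]
    (f : Matrix p p ℂ →ₗ[ℂ] B) :
    ∃ C, 0 ≤ C ∧ ∀ (M : Matrix p p ℂ) (b : ℝ), (∀ i j, ‖M i j‖ ≤ b) → ‖f M‖ ≤ C * b := by
  refine ⟨∑ i, ∑ j, ‖f (Matrix.single i j 1)‖, by positivity, fun M b hM => ?_⟩
  have : f M = ∑ i, ∑ j, M i j • f (Matrix.single i j 1) := by
    conv_lhs => rw [Matrix.matrix_eq_sum_single M]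
    simp only [map_sum]
    refine Finset.sum_congr rfl fun i _ => Finset.sum_congr rfl fun j _ => ?_
    rw [← map_smul, Matrix.smul_single, smul_eq_mul, mul_one]
  rw [this, Finset.sum_mul]
  refine norm_sum_le_of_le _ fun i _ => ?_
  rw [Finset.sum_mul]
  refine norm_sum_le_of_le _ fun j _ => ?_
  rw [norm_smul, mul_comm]
  exact mul_le_mul_of_nonneg_left (hM i j) (norm_nonneg _)

/-- A compact family of Hermitian structures is uniformly positive. -/
theorem exists_pos_mul_sq_le {p : Type*} [Fintype p] {Z : Type*} [TopologicalSpace Z] {K : Set Z}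
    (hK : IsCompact K) {h : Z → Matrix p p ℂ} (hc : ∀ i j, Continuous fun z => h z i j)
    (hp : ∀ z, (h z).PosDef) : ∃ c : ℝ, 0 < c ∧ ∀ z ∈ K, ∀ u : p → ℂ,
      c * ‖u‖ ^ 2 ≤ (star u ⬝ᵥ (h z *ᵥ u)).re := by
  let Q : Z × (p → ℂ) → ℝ := fun q => (star q.2 ⬝ᵥ (h q.1 *ᵥ q.2)).re
  have hQ : Continuous Q := by
    simp only [Q, dotProduct, Matrix.mulVec, Pi.star_apply]
    refine Complex.continuous_re.comp (continuous_finsetSum _ fun i _ => ?_)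
    refine Continuous.mul (by fun_prop) (continuous_finsetSum _ fun j _ => ?_)
    exact ((hc i j).comp continuous_fst).mul (by fun_prop)
  have hpos : ∀ z, ∀ u : p → ℂ, u ≠ 0 → 0 < Q (z, u) := fun z u hu =>
    (Complex.lt_def.1 ((hp z).dotProduct_mulVec_pos hu)).1
  have hscale : ∀ z, ∀ (t : ℝ) (u : p → ℂ), Q (z, t • u) = t ^ 2 * Q (z, u) := by
    intro z t u
    have e : star (t • u) ⬝ᵥ (h z *ᵥ (t • u)) = ((t ^ 2 : ℝ) : ℂ) * (star u ⬝ᵥ (h z *ᵥ u)) := by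
      rw [Matrix.mulVec_smul, star_smul, smul_dotProduct, dotProduct_smul]
      simp only [star_trivial, Complex.real_smul]
      push_cast
      ring
    simp only [Q]
    rw [e, Complex.re_ofReal_mul]
  rcases (K ×ˢ Metric.sphere (0 : p → ℂ) 1).eq_empty_or_nonempty with he | hne
  · refine ⟨1, one_pos, fun z hz u => ?_⟩
    rcases eq_or_ne u 0 with rfl | hu
    · simp
    · have h1 : (z, ‖u‖⁻¹ • u) ∈ K ×ˢ Metric.sphere (0 : p → ℂ) 1 :=
        Set.mem_prod.2 ⟨hz, by simp [norm_smul, hu]⟩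
      rw [he] at h1
      exact absurd h1 (Set.notMem_empty _)
  · obtain ⟨⟨z₀, u₀⟩, hm, hmin⟩ := (hK.prod (isCompact_sphere (0 : p → ℂ) 1)).exists_isMinOn hne
      hQ.continuousOn
    have hu₀ : u₀ ≠ 0 := by
      rintro rfl
      simpa using hm.2
    refine ⟨Q (z₀, u₀), hpos _ _ hu₀, fun z hz u => ?_⟩
    rcases eq_or_ne u 0 with rfl | hu
    · simp
    · have hu' : ‖u‖ ≠ 0 := norm_ne_zero_iff.2 hu
      have h1 : Q (z₀, u₀) ≤ Q (z, ‖u‖⁻¹ • u) :=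
        hmin (Set.mem_prod.2 ⟨hz, by simp [norm_smul, hu]⟩)
      rw [hscale, inv_pow, inv_mul_eq_div, le_div_iff₀ (by positivity)] at h1
      exact h1

/-- The matrices which are unitary for Hermitian structures in a compact family are uniformly
bounded. -/
theorem exists_bound_of_unitary {p : Type*} [Fintype p] {Z : Type*} [TopologicalSpace Z] {K : Set Z}
    (hK : IsCompact K) {h : Z → Matrix p p ℂ} (hc : ∀ i j, Continuous fun z => h z i j)
    (hp : ∀ z, (h z).PosDef) :
    ∃ C, ∀ z ∈ K, ∀ T : Matrix p p ℂ, Tᴴ * h z * T = h z → ∀ i j, ‖T i j‖ ≤ C := by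
  obtain ⟨c, hc0, hc1⟩ := exists_pos_mul_sq_le hK hc hp
  obtain ⟨b, hb⟩ : ∃ b : ℝ, ∀ z ∈ K, ∀ j, ‖h z j j‖ ≤ b := by
    have h1 : Continuous fun z => ∑ j, ‖h z j j‖ :=
      continuous_finsetSum _ fun j _ => (hc j j).norm
    obtain ⟨b, hb⟩ := hK.exists_bound_of_continuousOn h1.continuousOn
    refine ⟨b, fun z hz j => le_trans ?_ ((le_abs_self _).trans (hb z hz))⟩
    exact Finset.single_le_sum (f := fun j => ‖h z j j‖) (fun _ _ => norm_nonneg _)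
      (Finset.mem_univ j)
  refine ⟨Real.sqrt (b / c), fun z hz T hT i j => ?_⟩
  have h1 := hc1 z hz fun i => T i j
  have h2 : (star (fun i => T i j) ⬝ᵥ (h z *ᵥ fun i => T i j)).re = (h z j j).re := by
    have e := congrFun (congrFun hT j) j
    rw [Matrix.mul_assoc, Matrix.mul_apply] at e
    rw [← e]
    rfl
  rw [h2] at h1
  have h3 : c * ‖T i j‖ ^ 2 ≤ b := by
    have h4 : ‖T i j‖ ≤ ‖fun i => T i j‖ := norm_le_pi_norm (fun i => T i j) i
    calc c * ‖T i j‖ ^ 2 ≤ c * ‖fun i => T i j‖ ^ 2 := by gcongr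
      _ ≤ _ := h1.trans ((Complex.re_le_norm _).trans (hb z hz j))
  refine Real.le_sqrt_of_sq_le ?_
  rw [le_div_iff₀ hc0]
  linarith

end SkewExp

section Moment

variable {V : Type*} [NormedAddCommGroup V] [NormedSpace ℝ V] {Λ : Submodule ℤ V} {n : ℕ}
variable {p : Type*} [Fintype p] [DecidableEq p]
variable {X : Fin n → Λ} {w : p → Λ}

/-- The moment of a Hermitian connection is skew. -/
theorem moment_skew (h : InvMetric X w) (C : InvConnection X w h) (x : StrongDual ℝ V)
    (z : Fin n → ℂ) :
    (moment X w C.A x z)ᴴ * h.h z + h.h z * moment X w C.A x z = 0 := by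
  have h1 : (lieAct w x)ᴴ * h.h z + h.h z * lieAct w x = matDeriv h.h z (vecField X x z) := by
    ext i j
    have hw : ∀ g z, h.h (act X g z) i j = (g (w i - w j) : ℂ) * h.h z i j := fun g z => by
      have e := congrFun (congrFun (h.invariant g z) i) j
      rw [grpAct, Matrix.diagonal_conjTranspose, Matrix.mul_diagonal, Matrix.diagonal_mul] at e
      rw [← e, AddChar.map_sub_eq_div, Circle.coe_div]
      have e1 : (g (w i) : ℂ) * star (g (w i) : ℂ) = 1 := by
        have := Complex.mul_conj (g (w i) : ℂ)
        rw [Circle.normSq_coe, Complex.ofReal_one] at this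
        exact this
      have e2 := Circle.coe_ne_zero (g (w j))
      have e3 : star (fun i => (g (w i) : ℂ)) i = star (g (w i) : ℂ) := rfl
      rw [e3]
      field_simp
      linear_combination (-(h.h (act X g z) i j)) * e1
    have := fderiv_vecLin_of_weight X hw ((h.smooth i j).differentiable (by simp) z) x
    refine Eq.trans ?_ this.symm
    rw [Matrix.add_apply, lieAct, Matrix.diagonal_conjTranspose, Matrix.mul_diagonal,
      Matrix.diagonal_mul]
    have e3 : star (fun i => Complex.I * ((x (w i : V) : ℝ) : ℂ)) i =
      -(Complex.I * ((x (w i : V) : ℝ) : ℂ)) := by simp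
    have hc : ((w i - w j : Λ) : V) = (w i - w j : V) := rfl
    rw [e3, hc, map_sub]
    push_cast
    ring
  have h2 := C.hermitian z (vecField X x z)
  rw [moment, Matrix.conjTranspose_sub, Matrix.sub_mul, Matrix.mul_sub]
  rw [← h1] at h2
  rw [← sub_eq_zero] at h2
  rw [← h2]
  abel

end Moment

/-! ### Moderate growth of the Chern character form -/

open MeasureTheory NormedSpace MForm

section Curv2

variable {n : ℕ} {p : Type*} [Fintype p] {A : (Fin n → ℂ) → (Fin n → ℂ) →ₗ[ℝ] Matrix p p ℂ}

/-- The curvature of `∇ = d + A`, as a matrix of forms. -/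
def curv2 (A : (Fin n → ℂ) → (Fin n → ℂ) →ₗ[ℝ] Matrix p p ℂ) (z : Fin n → ℂ) :
    Matrix p p (MForm (Fin n → ℂ)) :=
  Matrix.of (fun i j => extD (fun y => connForm A y i j) z) + connForm A z * connForm A z

theorem smooth_curv2 (hA : ∀ v i j, ContDiff ℝ ∞ fun z => A z v i j) (i j : p) :
    Smooth fun z => curv2 A z i j :=
  (smooth_connForm hA i j).extD.add (smooth_matMul (smooth_connForm hA) (smooth_connForm hA) i j)

end Curv2

section Growth

variable {V : Type*} [NormedAddCommGroup V] [NormedSpace ℝ V] {Λ : Submodule ℤ V} {n : ℕ}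
variable {p : Type*} [Fintype p] [DecidableEq p]
variable {X : Fin n → Λ} {w : p → Λ} {A : (Fin n → ℂ) → (Fin n → ℂ) →ₗ[ℝ] Matrix p p ℂ}

theorem MForm.Temperate.add {B E : Type*} [NormedAddCommGroup B] [NormedSpace ℝ B]
    [NormedAddCommGroup E] [NormedSpace ℝ E] {ξ η : B → MForm E} (h : Temperate ξ)
    (h' : Temperate η) : Temperate fun b => ξ b + η b := fun k => (h k).add (h' k)

theorem MForm.Temperate.sub {B E : Type*} [NormedAddCommGroup B] [NormedSpace ℝ B]
    [NormedAddCommGroup E] [NormedSpace ℝ E] {ξ η : B → MForm E} (h : Temperate ξ)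
    (h' : Temperate η) : Temperate fun b => ξ b - η b := fun k => (h k).sub (h' k)

theorem hasTemperateGrowth_smul_of_hasCompactSupport {B F : Type*} [NormedAddCommGroup B]
    [NormedSpace ℝ B] [NormedAddCommGroup F] [NormedSpace ℝ F] [NormedSpace ℂ F]
    [IsScalarTower ℝ ℂ F] {χ : B → ℂ} (hχ : ContDiff ℝ ∞ χ) (hc : HasCompactSupport χ) {f : B → F}
    (h : ContDiff ℝ ∞ f) : (fun b => χ b • f b).HasTemperateGrowth := by
  have h1 : ContDiff ℝ ∞ fun b => χ b • f b := hχ.smul h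
  have h2 : HasCompactSupport fun b => χ b • f b := hc.mono fun b hb hb' => hb (by
    change χ b • f b = 0
    rw [show χ b = 0 from hb', zero_smul])
  exact (h2.toSchwartzMap h1).hasTemperateGrowth

theorem temperate_smul_of_hasCompactSupport {B E : Type*} [NormedAddCommGroup B] [NormedSpace ℝ B]
    [NormedAddCommGroup E] [NormedSpace ℝ E] {χ : B → ℂ} (hχ : ContDiff ℝ ∞ χ)
    (hc : HasCompactSupport χ) {ξ : B → MForm E} (h : Smooth ξ) :
    Temperate fun b => χ b • ξ b := fun k =>
  hasTemperateGrowth_smul_of_hasCompactSupport hχ hc (h k)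

theorem curvM_apply (x : StrongDual ℝ V) (z : Fin n → ℂ) (i j : p) :
    curvM X w A x z i j = lieAct w x i j • 1 -
      contr (vecLin X x z) (connForm A z i j) + curv2 A z i j := by
  rw [curvM_eq, Matrix.add_apply, Matrix.add_apply, scal_apply, curv2, Matrix.add_apply,
    Matrix.of_apply, cartanM_apply, cartanD]
  abel

/-- The equivariant curvature depends on `x` only through the moment, its component of degree `0`.
-/
theorem curvM_eq_moment (x : StrongDual ℝ V) (z : Fin n → ℂ) :
    curvM X w A x z = scal (Fin n → ℂ) (moment X w A x z) + curv2 A z := by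
  ext1 i j
  rw [curvM_apply, Matrix.add_apply, scal_apply, connForm_apply, contr_oneForm, moment,
    Matrix.sub_apply, sub_smul]
  rfl

theorem temperate_vecLin (X : Fin n → Λ) :
    (fun q : StrongDual ℝ V × (Fin n → ℂ) => vecLin X q.1 q.2).HasTemperateGrowth := by
  have e : (fun q : StrongDual ℝ V × (Fin n → ℂ) => vecLin X q.1 q.2) = fun q => ∑ i,
      ContinuousLinearMap.single ℝ (fun _ : Fin n => ℂ) i
        ((ContinuousLinearMap.apply ℝ ℝ (X i : V) q.1) • (-Complex.I * q.2 i)) := by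
    funext q
    ext i
    rw [Finset.sum_apply, Finset.sum_eq_single i]
    · simp only [ContinuousLinearMap.single_apply, Pi.single_eq_same]
      refine (vecField_apply X q.1 q.2 i).trans ?_
      simp
      ring
    · intro j _ hj
      simp [hj.symm]
    · simp
  rw [e]
  refine .sum fun i _ => ?_
  have h1 := ((ContinuousLinearMap.apply ℝ ℝ (X i : V)).hasTemperateGrowth).comp
    (ContinuousLinearMap.fst ℝ (StrongDual ℝ V) (Fin n → ℂ)).hasTemperateGrowth
  have h2 := (ContinuousLinearMap.proj (R := ℝ) (φ := fun _ : Fin n => ℂ) i).hasTemperateGrowth.comp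
    (ContinuousLinearMap.snd ℝ (StrongDual ℝ V) (Fin n → ℂ)).hasTemperateGrowth
  have h3 := h1.smul ((Function.HasTemperateGrowth.const (-Complex.I)).mul h2)
  exact (ContinuousLinearMap.single ℝ (fun _ : Fin n => ℂ) i).hasTemperateGrowth.comp h3

theorem temperate_lieAct {p : Type*} [DecidableEq p] {w : p → Λ} (i j : p) :
    (fun q : StrongDual ℝ V × (Fin n → ℂ) => lieAct w q.1 i j).HasTemperateGrowth := by
  rcases eq_or_ne i j with rfl | h
  · simp only [lieAct, Matrix.diagonal_apply_eq]
    have h1 := ((ContinuousLinearMap.apply ℝ ℝ (w i : V)).hasTemperateGrowth).comp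
      (ContinuousLinearMap.fst ℝ (StrongDual ℝ V) (Fin n → ℂ)).hasTemperateGrowth
    exact (Function.HasTemperateGrowth.const Complex.I).mul
      (Complex.ofRealCLM.hasTemperateGrowth.comp h1)
  · simp only [lieAct, Matrix.diagonal_apply_ne _ h]
    exact .const 0

/-- The equivariant curvature with its coefficients on `M_X` cut off by `χ`. It has temperate growth
and is the equivariant curvature where `χ = 1`. -/
def cutCurvM (X : Fin n → Λ) (w : p → Λ) (A : (Fin n → ℂ) → (Fin n → ℂ) →ₗ[ℝ] Matrix p p ℂ)
    (χ : (Fin n → ℂ) → ℂ) (q : StrongDual ℝ V × (Fin n → ℂ)) : Matrix p p (MForm (Fin n → ℂ)) :=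
  Matrix.of fun i j => lieAct w q.1 i j • 1 -
    contr (vecLin X q.1 q.2) (χ q.2 • connForm A q.2 i j) + χ q.2 • curv2 A q.2 i j

theorem cutCurvM_eq {χ : (Fin n → ℂ) → ℂ} {q : StrongDual ℝ V × (Fin n → ℂ)} (h : χ q.2 = 1) :
    cutCurvM X w A χ q = curvM X w A q.1 q.2 := by
  ext1 i j
  rw [cutCurvM, Matrix.of_apply, h, one_smul, one_smul, curvM_apply]

theorem temperate_cutCurvM (hA : ∀ v i j, ContDiff ℝ ∞ fun z => A z v i j)
    {χ : (Fin n → ℂ) → ℂ} (hχ : ContDiff ℝ ∞ χ) (hc : HasCompactSupport χ) (i j : p) :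
    Temperate fun q : StrongDual ℝ V × (Fin n → ℂ) => cutCurvM X w A χ q i j := by
  have hsnd := (ContinuousLinearMap.snd ℝ (StrongDual ℝ V) (Fin n → ℂ)).hasTemperateGrowth
  have h1 : Temperate fun q : StrongDual ℝ V × (Fin n → ℂ) =>
      lieAct w q.1 i j • (1 : MForm (Fin n → ℂ)) := fun k =>
    (temperate_lieAct i j).smul (.const _)
  have h2 := (temperate_smul_of_hasCompactSupport hχ hc (smooth_connForm hA i j)).comp hsnd
  have h3 := (temperate_smul_of_hasCompactSupport hχ hc (smooth_curv2 hA i j)).comp hsnd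
  exact (h1.sub (h2.contr (temperate_vecLin X))).add h3

/-- Matrices of numbers as elements of the algebra of matrices of forms. -/
def scalHom (n : ℕ) (p : Type*) [Fintype p] [DecidableEq p] :
    Matrix p p ℂ →ₐ[ℂ] Matrix p p (MForm (Fin n → ℂ)) :=
  (Algebra.ofId ℂ (MForm (Fin n → ℂ))).mapMatrix

theorem norm_exp_smul_map_le {B : Type*} [NormedRing B] [NormedAlgebra ℂ B]
    (f : Matrix p p ℂ →ₐ[ℂ] B) {c b s : ℝ}
    (hf : ∀ (M : Matrix p p ℂ) (b : ℝ), (∀ i j, ‖M i j‖ ≤ b) → ‖f M‖ ≤ c * b) {M : Matrix p p ℂ}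
    (h : ∀ i j, ‖exp ((s : ℂ) • M) i j‖ ≤ b) : ‖exp (s • f M)‖ ≤ c * b := by
  have e : exp (s • f M) = f (exp ((s : ℂ) • M)) := by
    rw [map_matrix_exp, map_smul]
    rfl
  rw [e]
  exact hf _ b h

theorem conjTranspose_exp_moment_mul (h : InvMetric X w) (C : InvConnection X w h)
    (x : StrongDual ℝ V) (z : Fin n → ℂ) (s : ℝ) :
    (exp ((s : ℂ) • moment X w C.A x z))ᴴ * h.h z * exp ((s : ℂ) • moment X w C.A x z) = h.h z := by
  refine conjTranspose_exp_mul (h.posDef z).isUnit ?_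
  have := moment_skew h C x z
  have hs : star (s : ℂ) = s := Complex.conj_ofReal s
  rw [Matrix.conjTranspose_smul, Matrix.smul_mul, Matrix.mul_smul, hs, ← smul_add, this, smul_zero]

/-- The exponentials of the equivariant curvature are bounded uniformly in `x`: those of the moment
are unitary for the metric, and the curvature, which does not depend on `x`, is a bounded
perturbation. -/
theorem norm_exp_curvM_le (h : InvMetric X w) (C : InvConnection X w h) {K : Set (Fin n → ℂ)}
    (hK : IsCompact K) : ∃ M, ∀ x : StrongDual ℝ V, ∀ z ∈ K, ∀ s ∈ Set.Icc (0 : ℝ) 1,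
      ‖exp (s • rep _ (curvM X w C.A x z))‖ ≤ M := by
  obtain ⟨b, hb⟩ := exists_bound_of_unitary hK (fun i j => (h.smooth i j).continuous) h.posDef
  let f : Matrix p p ℂ →ₐ[ℂ] RepAlg (Matrix p p (MForm (Fin n → ℂ))) :=
    (rep _).comp (scalHom n p)
  obtain ⟨c, hc, hf⟩ := exists_bound_of_linear f.toLinearMap
  have hF : Continuous fun z => rep (Matrix p p (MForm (Fin n → ℂ))) (curv2 C.A z) :=
    (contDiff_rep (smooth_curv2 C.smooth)).continuous
  obtain ⟨d, hd⟩ := hK.exists_bound_of_continuousOn hF.continuousOn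
  have hM : ∀ x : StrongDual ℝ V, ∀ z ∈ K, ∀ s ∈ Set.Icc (-1 : ℝ) 1,
      ‖exp (s • f (moment X w C.A x z))‖ ≤ c * b := by
    intro x z hz s _
    exact norm_exp_smul_map_le f hf
      (hb z hz _ (conjTranspose_exp_moment_mul h C x z s))
  refine ⟨c * b * (‖(1 : RepAlg (Matrix p p (MForm (Fin n → ℂ))))‖ * Real.exp ((c * b) ^ 2 * d)),
    fun x z hz s hs => ?_⟩
  have h0 : 0 ≤ c * b := (norm_nonneg _).trans (hM x z hz 0 (by simp))
  have e : rep _ (curvM X w C.A x z) = f (moment X w C.A x z) + rep _ (curv2 C.A z) := by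
    rw [curvM_eq_moment, map_add]
    rfl
  rw [e]
  refine (norm_exp_add_le (hM x z hz) hs).trans ?_
  have := hd z hz
  gcongr

theorem contDiff_chernForm (hA : ∀ v i j, ContDiff ℝ ∞ fun z => A z v i j) (k : ℕ) :
    ContDiff ℝ ∞ fun q : StrongDual ℝ V × (Fin n → ℂ) =>
      (chernForm X w A : EquivForm V n) q.1 k q.2 := by
  have e : (fun q : StrongDual ℝ V × (Fin n → ℂ) => (chernForm X w A : EquivForm V n) q.1 k q.2) =
      fun q => trExp (curvM X w A q.1 q.2) k :=
    funext fun q => congrFun (mix_chernForm q.1 q.2) k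
  rw [e]
  refine contDiff_trExp (fun i j => ?_) k
  have h1 : Smooth fun q : StrongDual ℝ V × (Fin n → ℂ) =>
      lieAct w q.1 i j • (1 : MForm (Fin n → ℂ)) := fun k =>
    (temperate_lieAct i j).1.smul contDiff_const
  have h2 := ((smooth_connForm hA i j).comp
    (contDiff_snd (E := StrongDual ℝ V))).contr (temperate_vecLin X).1
  have h3 := (smooth_curv2 hA i j).comp (contDiff_snd (E := StrongDual ℝ V))
  simp only [curvM_apply]
  exact (h1.sub h2).add h3

theorem norm_iteratedFDeriv_le_of_eventuallyEq_comp {B : Type*} [NormedAddCommGroup B]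
    [NormedSpace ℝ B]
    {F G : Type*} [NormedAddCommGroup F] [NormedSpace ℝ F] [NormedAddCommGroup G] [NormedSpace ℝ G]
    (L : F →L[ℝ] G) {f : B → F} {g : B → G} {b : B} (hf : ContDiff ℝ ∞ f)
    (h : ∀ᶠ y in nhds b, g y = L (f y)) (m : ℕ) :
    ‖iteratedFDeriv ℝ m g b‖ ≤ ‖L‖ * ‖iteratedFDeriv ℝ m f b‖ := by
  have e : iteratedFDeriv ℝ m g b = iteratedFDeriv ℝ m (L ∘ f) b :=
    (Filter.EventuallyEq.iteratedFDeriv (𝕜 := ℝ) (f₂ := L ∘ f) h m).eq_of_nhds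
  rw [e]
  exact L.norm_iteratedFDeriv_comp_left hf.contDiffAt (by exact_mod_cast le_top)

theorem norm_iteratedFDeriv_sub_le {B F : Type*} [NormedAddCommGroup B] [NormedSpace ℝ B]
    [NormedAddCommGroup F] [NormedSpace ℝ F] {f g : B → F} (hf : ContDiff ℝ ∞ f)
    (hg : ContDiff ℝ ∞ g) (m : ℕ) (b : B) :
    ‖iteratedFDeriv ℝ m (fun b => f b - g b) b‖ ≤
      ‖iteratedFDeriv ℝ m f b‖ + ‖iteratedFDeriv ℝ m g b‖ := by
  have e := iteratedFDeriv_sub_apply (𝕜 := ℝ) (i := m) (x := b)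
    (hf.of_le (by exact_mod_cast le_top)).contDiffAt
    (hg.of_le (by exact_mod_cast le_top)).contDiffAt
  exact le_trans (le_of_eq (congrArg norm e)) (norm_sub_le _ _)

theorem norm_iteratedFDeriv_eq_zero {B F : Type*} [NormedAddCommGroup B] [NormedSpace ℝ B]
    [NormedAddCommGroup F] [NormedSpace ℝ F] {f : B → F} {b : B} (h : ∀ᶠ y in nhds b, f y = 0)
    (m : ℕ) : ‖iteratedFDeriv ℝ m f b‖ = 0 := by
  have e := (Filter.EventuallyEq.iteratedFDeriv (𝕜 := ℝ) (f₂ := fun _ => 0) h m).eq_of_nhds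
  rw [e, iteratedFDeriv_fun_zero, Pi.zero_apply, norm_zero]

/-- The derivatives of the Chern character form of a Hermitian connection grow at most
polynomially, locally uniformly on `M_X`. -/
theorem exists_iteratedFDeriv_chernForm_le [FiniteDimensional ℝ V] (h : InvMetric X w)
    (C : InvConnection X w h) {K : Set (Fin n → ℂ)} (hK : IsCompact K) (k m : ℕ) :
    ∃ (N : ℕ) (c : ℝ), 0 ≤ c ∧ ∀ (x : StrongDual ℝ V), ∀ z ∈ K,
      ‖iteratedFDeriv ℝ m (fun q : StrongDual ℝ V × (Fin n → ℂ) =>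
        (chernForm X w C.A : EquivForm V n) q.1 k q.2) (x, z)‖ ≤ c * (1 + ‖(x, z)‖) ^ N := by
  -- The connection need not have temperate growth on `M_X`, so it is cut off away from `K`.
  obtain ⟨R, hR0, hR⟩ := hK.isBounded.exists_pos_norm_lt
  let bump : ContDiffBump (0 : Fin n → ℂ) := ⟨R, R + 1, hR0, by linarith⟩
  let χ : (Fin n → ℂ) → ℂ := fun z => (bump z : ℂ)
  have hχ : ContDiff ℝ ∞ χ := Complex.ofRealCLM.contDiff.comp bump.contDiff
  have hc : HasCompactSupport χ := bump.hasCompactSupport.comp_left Complex.ofReal_zero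
  have hχ1 : ∀ z, ‖z‖ < R → χ z = 1 := fun z hz => by
    have : bump z = 1 := bump.one_of_mem_closedBall (by
      rw [mem_closedBall_zero_iff]; exact hz.le)
    simp only [χ, this, Complex.ofReal_one]
  have hA : (fun q : StrongDual ℝ V × (Fin n → ℂ) =>
      rep _ (cutCurvM X w C.A χ q)).HasTemperateGrowth :=
    temperate_rep (temperate_cutCurvM C.smooth hχ hc)
  obtain ⟨M, hM⟩ := norm_exp_curvM_le (V := V) h C hK
  have hb : PolyBdd (Set.Icc (0 : ℝ) 1 ×ˢ {q : StrongDual ℝ V × (Fin n → ℂ) | q.2 ∈ K})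
      fun r => ‖exp (r.1 • rep _ (cutCurvM X w C.A χ r.2))‖ := by
    refine (PolyBdd.const _ M).mono fun r hr => ?_
    rw [cutCurvM_eq (hχ1 _ (hR _ hr.2))]
    exact hM _ _ hr.2 _ hr.1
  obtain ⟨N, c, hc0, hN⟩ := polyBdd_iteratedFDeriv_exp hA hb m
  refine ⟨N, ‖traceRep (Fin n → ℂ) p k‖ * c, by positivity, fun x z hz => ?_⟩
  have h1 := hN (1, (x, z)) ⟨by simp, hz⟩
  simp only [one_smul] at h1
  refine (norm_iteratedFDeriv_le_of_eventuallyEq_comp (traceRep (Fin n → ℂ) p k)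
    (f := fun q => exp (rep _ (cutCurvM X w C.A χ q))) (contDiff_exp.comp hA.1) ?_ m).trans ?_
  · have hev : ∀ᶠ q : StrongDual ℝ V × (Fin n → ℂ) in nhds (x, z), ‖q.2‖ < R :=
      (continuous_snd.norm).continuousAt.eventually_lt_const (hR z hz)
    filter_upwards [hev] with q hq
    rw [cutCurvM_eq (hχ1 _ hq), ← trExp_apply]
    exact congrFun (mix_chernForm q.1 q.2) k
  · rw [mul_assoc]
    exact mul_le_mul_of_nonneg_left h1 (norm_nonneg _)

end Growth

section Closed

variable {V : Type*} [NormedAddCommGroup V] [NormedSpace ℝ V] [FiniteDimensional ℝ V]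
  {Λ : Submodule ℤ V} {n : ℕ}
variable {p q : Type*} [Fintype p] [DecidableEq p] [Fintype q] [DecidableEq q]
variable {X : Fin n → Λ} {w : p → Λ} {w' : q → Λ} {Sig : (Fin n → ℂ) → Matrix q p ℂ}

theorem AdaptedPair.hasTemperateGrowth_ch (P : AdaptedPair X w w' Sig)
    (hS : ∀ i j, ContDiff ℝ ∞ fun z => Sig z i j)
    (hinv : ∀ g z, Sig (act X g z) * grpAct w g = grpAct w' g * Sig z) (k : ℕ) :
    (fun q : StrongDual ℝ V × (Fin n → ℂ) => P.ch q.1 k q.2).HasTemperateGrowth := by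
  have h1 := contDiff_chernForm (V := V) (X := X) (w := w) P.conPlus.smooth k
  have h2 := contDiff_chernForm (V := V) (X := X) (w := w') P.conMinus.smooth k
  refine ⟨h1.sub h2, fun m => ?_⟩
  obtain ⟨N, c, hc, hN⟩ := exists_iteratedFDeriv_chernForm_le (V := V) P.hPlus P.conPlus
    P.isCompact k m
  obtain ⟨N', c', hc', hN'⟩ := exists_iteratedFDeriv_chernForm_le (V := V) P.hMinus P.conMinus
    P.isCompact k m
  refine ⟨N + N', c + c', fun r => ?_⟩
  obtain ⟨x, z⟩ := r
  have hle : (1 : ℝ) ≤ 1 + ‖(x, z)‖ := le_add_of_nonneg_right (norm_nonneg _)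
  by_cases hz : z ∈ closure P.U
  · refine (norm_iteratedFDeriv_sub_le h1 h2 m (x, z)).trans ?_
    rw [add_mul]
    refine add_le_add ((hN x z hz).trans ?_) ((hN' x z hz).trans ?_)
    · exact mul_le_mul_of_nonneg_left (pow_le_pow_right₀ hle (Nat.le_add_right _ _)) hc
    · exact mul_le_mul_of_nonneg_left (pow_le_pow_right₀ hle (Nat.le_add_left _ _)) hc'
  · have hev : ∀ᶠ r : StrongDual ℝ V × (Fin n → ℂ) in nhds (x, z), P.ch r.1 k r.2 = 0 := by
      have : ∀ᶠ r : StrongDual ℝ V × (Fin n → ℂ) in nhds (x, z), r.2 ∈ (closure P.U)ᶜ :=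
        continuous_snd.continuousAt.eventually_mem (isClosed_closure.isOpen_compl.mem_nhds hz)
      filter_upwards [this] with r hr
      exact P.ch_eq_zero hS hinv hr r.1 k
    rw [norm_iteratedFDeriv_eq_zero hev m]
    positivity

/-- The Chern character form of an equivariant morphism with compact support is a closed form of
moderate growth with compact support. -/
theorem AdaptedPair.ch_mem_closedForms (P : AdaptedPair X w w' Sig)
    (hS : ∀ i j, ContDiff ℝ ∞ fun z => Sig z i j)
    (hinv : ∀ g z, Sig (act X g z) * grpAct w g = grpAct w' g * Sig z) :
    P.ch ∈ closedForms X := by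
  refine ⟨⟨P.hasTemperateGrowth_ch hS hinv, ⟨closure P.U, P.isCompact, fun x k z hz =>
    P.ch_eq_zero hS hinv hz x k⟩, fun g x k z => ?_⟩, ?_⟩
  · have h1 := isInvariant_chernForm (V := V) (X := X) (w := w) P.conPlus.smooth
      P.conPlus.invariant g x k z
    have h2 := isInvariant_chernForm (V := V) (X := X) (w := w') P.conMinus.smooth
      P.conMinus.invariant g x k z
    exact congrArg₂ (· - ·) h1 h2
  · refine equivD_eq_iff.2 fun x z => ?_
    have h1 := equivD_eq_iff.1 (equivD_chernForm (V := V) (X := X) (w := w) P.conPlus.smooth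
      P.conPlus.invariant) x z
    have h2 := equivD_eq_iff.1 (equivD_chernForm (V := V) (X := X) (w := w') P.conMinus.smooth
      P.conMinus.invariant) x z
    have hd1 : DiffAt (mix (chernForm X w P.conPlus.A) x) z := fun k =>
      ((contDiff_chernForm (V := V) (X := X) (w := w) P.conPlus.smooth k).comp
        (contDiff_const.prodMk contDiff_id)).differentiable (by simp) z
    have hd2 : DiffAt (mix (chernForm X w' P.conMinus.A) x) z := fun k =>
      ((contDiff_chernForm (V := V) (X := X) (w := w') P.conMinus.smooth k).comp
        (contDiff_const.prodMk contDiff_id)).differentiable (by simp) z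
    have e : cartanD (vecLin X x) (mix P.ch x) z =
        cartanD (vecLin X x) (mix (chernForm X w P.conPlus.A) x) z -
        cartanD (vecLin X x) (mix (chernForm X w' P.conMinus.A) x) z := by
      have e1 := extD_sub hd1 hd2
      have e2 := map_sub (contr (vecLin X x z)) (mix (chernForm X w P.conPlus.A) x z)
        (mix (chernForm X w' P.conMinus.A) x z)
      refine (congrArg₂ (· - ·) e1 e2).trans ?_
      rw [cartanD, cartanD]
      abel
    rw [e, h1, h2]
    exact sub_self _

end Closed

/-! ### The value of the Chern character at the origin -/

open MeasureTheory NormedSpace MForm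

section ValueAtZero

variable {V : Type*} [NormedAddCommGroup V] [NormedSpace ℝ V] {Λ : Submodule ℤ V} {n : ℕ}
variable {p : Type*} [Fintype p] [DecidableEq p]
variable {X : Fin n → Λ} {w : p → Λ} {A : (Fin n → ℂ) → (Fin n → ℂ) →ₗ[ℝ] Matrix p p ℂ}

/-- At the fixed point `0`, the Chern character form is the character of the fibre. -/
theorem zeroPart_chernForm_zero (x : StrongDual ℝ V) :
    zeroPart (mix (chernForm X w A) x 0) = ∑ i, Complex.exp (Complex.I * (x (w i : V) : ℝ)) := by
  rw [mix_chernForm]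
  refine (hasSum_zeroPart_trExp (curvM X w A x 0)).unique ?_
  have h0 : (zeroHom (E := Fin n → ℂ)).mapMatrix (curvM X w A x 0) = lieAct w x := by
    ext i j
    rw [AlgHom.mapMatrix_apply, Matrix.map_apply, zeroHom_apply]
    have hv : vecField X x (0 : Fin n → ℂ) = 0 := by simp [vecField]
    change moment X w A x 0 i j = _
    rw [moment, hv, map_zero, sub_zero]
  have h1 : ∀ m : ℕ, ((zeroHom (E := Fin n → ℂ)).mapMatrix (curvM X w A x 0) ^ m).trace =
      ∑ i, (Complex.I * (x (w i : V) : ℝ)) ^ m := fun m => by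
    rw [h0, lieAct, Matrix.diagonal_pow, Matrix.trace_diagonal]
    rfl
  simp only [h1, Finset.smul_sum]
  refine hasSum_sum fun i _ => ?_
  rw [Complex.exp_eq_exp_ℂ]
  exact exp_series_hasSum_exp' (𝕂 := ℝ) (Complex.I * ((x (w i : V) : ℝ) : ℂ))

theorem sum_even_sub_sum_odd (f : Fin n → ℂ) :
    ∑ S : EvenIdx n, ∏ i ∈ S.1, f i - ∑ S : OddIdx n, ∏ i ∈ S.1, f i = ∏ i, (1 - f i) := by
  classical
  simp only [sub_eq_add_neg, Finset.prod_one_add]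
  rw [← Finset.sum_neg_distrib]
  have h1 := Fintype.sum_subtype_add_sum_subtype (fun S : Finset (Fin n) => Even S.card)
    (fun S => ∏ i ∈ S, -f i)
  rw [Finset.powerset_univ, ← h1]
  congr 1
  · refine Finset.sum_congr rfl fun S _ => ?_
    rw [Finset.prod_neg, S.2.neg_one_pow, one_mul]
  · refine Fintype.sum_equiv (Equiv.subtypeEquivRight fun S => Nat.not_even_iff_odd.symm) _ _
      fun S => ?_
    change _ = ∏ i ∈ S.1, -f i
    rw [Finset.prod_neg, S.2.neg_one_pow, neg_one_mul]

/-- At the origin the Chern character of the Bott symbol is the supertrace of `exp x` on the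
exterior algebra of `M_X`. -/
theorem zeroPart_ch_zero {Sig : (Fin n → ℂ) → Matrix (OddIdx n) (EvenIdx n) ℂ}
    (P : AdaptedPair X (evenWeight X) (oddWeight X) Sig) (x : StrongDual ℝ V) :
    zeroPart (mix P.ch x 0) = ∏ a, (1 - Complex.exp (Complex.I * (x (X a : V) : ℝ))) := by
  have h : zeroPart (mix P.ch x 0) = zeroPart (mix (chernForm X (evenWeight X) P.conPlus.A) x 0) -
      zeroPart (mix (chernForm X (oddWeight X) P.conMinus.A) x 0) := map_sub zeroPart _ _
  have e : ∀ S : Finset (Fin n), Complex.exp (Complex.I * (x ((∑ i ∈ S, X i : Λ) : V) : ℝ)) =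
      ∏ i ∈ S, Complex.exp (Complex.I * (x (X i : V) : ℝ)) := fun S => by
    rw [← Complex.exp_sum, ← Finset.mul_sum]
    congr 2
    rw [AddSubmonoidClass.coe_finsetSum, map_sum]
    push_cast
    rfl
  rw [h, zeroPart_chernForm_zero, zeroPart_chernForm_zero, ← sum_even_sub_sum_odd]
  simp only [evenWeight, oddWeight, e]

end ValueAtZero

/-! ### Clifford multiplication -/

section Clifford

variable {n : ℕ}

/-- The sign of the exterior product of `e_i` with `e_S`. -/
def extSign (i : Fin n) (S : Finset (Fin n)) : ℂ := (-1) ^ (S.filter (· < i)).card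

theorem extSign_mul_self (i : Fin n) (S : Finset (Fin n)) : extSign i S * extSign i S = 1 := by
  rw [extSign, ← mul_pow]
  simp

theorem extSign_insert_self (i : Fin n) (S : Finset (Fin n)) :
    extSign i (insert i S) = extSign i S := by
  rw [extSign, extSign, Finset.filter_insert, if_neg (lt_irrefl i)]

theorem extSign_insert {i j : Fin n} {S : Finset (Fin n)} (hj : j ∉ S) :
    extSign i (insert j S) = (if j < i then -1 else 1) * extSign i S := by
  rw [extSign, extSign, Finset.filter_insert]
  split_ifs with h
  · rw [Finset.card_insert_of_notMem (by simp [hj]), pow_succ, mul_comm]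
  · rw [one_mul]

theorem extSign_erase {i j : Fin n} {S : Finset (Fin n)} (hj : j ∈ S) :
    extSign i (S.erase j) = (if j < i then -1 else 1) * extSign i S := by
  have h := extSign_insert (i := i) (Finset.notMem_erase j S)
  rw [Finset.insert_erase hj] at h
  rw [h, ← mul_assoc]
  split_ifs <;> simp

/-- Exterior multiplication with a basis vector. -/
def creation (i : Fin n) : Matrix (Finset (Fin n)) (Finset (Fin n)) ℂ :=
  Matrix.of fun T S => if i ∉ S ∧ T = insert i S then extSign i S else 0

/-- Contraction with a vector of the dual basis. -/
def annihilation (i : Fin n) : Matrix (Finset (Fin n)) (Finset (Fin n)) ℂ :=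
  Matrix.of fun T S => if i ∈ S ∧ T = S.erase i then extSign i S else 0

theorem extMul_eq_sum (z : Fin n → ℂ) : extMul z = ∑ i, z i • creation i := by
  ext T S
  rw [extMul, Matrix.of_apply, Matrix.sum_apply]
  refine Finset.sum_congr rfl fun i _ => ?_
  rw [Matrix.smul_apply, creation, Matrix.of_apply, smul_eq_mul, mul_ite, mul_zero, mul_comm]
  rfl

theorem intMul_eq_sum (φ : Fin n → ℂ) : intMul φ = ∑ i, φ i • annihilation i := by
  ext T S
  rw [intMul, Matrix.of_apply, Matrix.sum_apply]
  refine Finset.sum_congr rfl fun i _ => ?_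
  rw [Matrix.smul_apply, annihilation, Matrix.of_apply, smul_eq_mul, mul_ite, mul_zero, mul_comm]
  rfl

theorem mul_creation_apply (M : Matrix (Finset (Fin n)) (Finset (Fin n)) ℂ) (i : Fin n)
    (T S : Finset (Fin n)) :
    (M * creation i) T S = if i ∈ S then 0 else extSign i S * M T (insert i S) := by
  rw [Matrix.mul_apply]
  split_ifs with h
  · exact Finset.sum_eq_zero fun R _ => by simp [creation, h]
  · rw [Finset.sum_eq_single (insert i S)]
    · simp [creation, h, mul_comm]
    · intro R _ hR
      simp [creation, hR]
    · simp

theorem mul_annihilation_apply (M : Matrix (Finset (Fin n)) (Finset (Fin n)) ℂ) (i : Fin n)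
    (T S : Finset (Fin n)) :
    (M * annihilation i) T S = if i ∈ S then extSign i S * M T (S.erase i) else 0 := by
  rw [Matrix.mul_apply]
  split_ifs with h
  · rw [Finset.sum_eq_single (S.erase i)]
    · simp [annihilation, h, mul_comm]
    · intro R _ hR
      simp [annihilation, hR]
    · simp
  · exact Finset.sum_eq_zero fun R _ => by simp [annihilation, h]

/-- The two signs which result from the two orders of insertion of `i` and `j` are opposite. -/
theorem sign_lt_add_sign_lt {i j : Fin n} (h : i ≠ j) :
    (if j < i then (-1 : ℂ) else 1) + (if i < j then -1 else 1) = 0 := by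
  rcases lt_or_gt_of_ne h with h' | h'
  · rw [if_neg h'.not_gt, if_pos h']; ring
  · rw [if_pos h', if_neg h'.not_gt]; ring

theorem creation_anticomm (i j : Fin n) :
    creation i * creation j + creation j * creation i = 0 := by
  ext T S
  rw [Matrix.add_apply, mul_creation_apply, mul_creation_apply, Matrix.zero_apply]
  rcases eq_or_ne i j with rfl | hij
  · simp [creation]
  · by_cases hi : i ∈ S <;> by_cases hj : j ∈ S <;>
      simp only [hi, hj, if_true, if_false, creation, Matrix.of_apply, Finset.mem_insert, hij,
        hij.symm, or_self, or_true, not_true, not_false_eq_true, false_and, true_and, mul_zero,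
        add_zero]
    rw [Finset.insert_comm j i S]
    split_ifs with hT
    · rw [extSign_insert hi, extSign_insert hj]
      linear_combination (extSign j S * extSign i S) * sign_lt_add_sign_lt hij
    · ring

theorem annihilation_anticomm (i j : Fin n) :
    annihilation i * annihilation j + annihilation j * annihilation i = 0 := by
  ext T S
  rw [Matrix.add_apply, mul_annihilation_apply, mul_annihilation_apply, Matrix.zero_apply]
  rcases eq_or_ne i j with rfl | hij
  · simp [annihilation]
  · by_cases hi : i ∈ S <;> by_cases hj : j ∈ S <;>
      simp only [hi, hj, if_true, if_false, annihilation, Matrix.of_apply, Finset.mem_erase, hij,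
        hij.symm, ne_eq, and_self, and_false, not_false_eq_true, false_and, true_and, mul_zero,
        add_zero]
    rw [Finset.erase_right_comm (a := j) (b := i)]
    split_ifs with hT
    · rw [extSign_erase hi, extSign_erase hj]
      linear_combination (extSign j S * extSign i S) * sign_lt_add_sign_lt hij
    · ring

theorem creation_annihilation (i j : Fin n) :
    creation i * annihilation j + annihilation j * creation i = if i = j then 1 else 0 := by
  ext T S
  rw [Matrix.add_apply, mul_creation_apply, mul_annihilation_apply]
  rcases eq_or_ne i j with rfl | hij
  · rw [if_pos rfl, Matrix.one_apply]
    by_cases hi : i ∈ S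
    · simp only [hi, if_true, creation, Matrix.of_apply, Finset.mem_erase, ne_eq, not_true,
        false_and, not_false_eq_true, true_and, add_zero, Finset.insert_erase hi]
      have := extSign_erase (i := i) hi
      rw [if_neg (lt_irrefl i), one_mul] at this
      rw [this]
      split_ifs <;> simp [extSign_mul_self]
    · simp only [hi, if_false, annihilation, Matrix.of_apply, Finset.mem_insert, true_or, true_and,
        zero_add, Finset.erase_insert hi, extSign_insert_self]
      split_ifs <;> simp [extSign_mul_self]
  · rw [if_neg hij, Matrix.zero_apply]
    by_cases hi : i ∈ S <;> by_cases hj : j ∈ S <;>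
      simp only [hi, hj, if_true, if_false, creation, annihilation, Matrix.of_apply,
        Finset.mem_erase, Finset.mem_insert, hij, hij.symm, ne_eq, and_self, and_false, not_true,
        not_false_eq_true, false_and, true_and, mul_zero, add_zero, or_self, or_true]
    rw [Finset.erase_insert_of_ne hij]
    split_ifs with hT
    · rw [extSign_erase hj, extSign_insert hi]
      linear_combination (extSign j S * extSign i S) * sign_lt_add_sign_lt hij
    · ring

/-- The Clifford relation. -/
theorem clifford_mul_self (H : Matrix (Fin n) (Fin n) ℂ) (z : Fin n → ℂ) :
    clifford H z * clifford H z = -(star z ⬝ᵥ (H *ᵥ z)) • 1 := by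
  set φ := star z ᵥ* H with hφ
  have h1 : extMul z * extMul z = 0 := by
    have h : extMul z * extMul z + extMul z * extMul z = 0 := by
      conv_lhs => rw [extMul_eq_sum]
      rw [Finset.sum_mul_sum]
      conv_lhs => enter [2]; rw [Finset.sum_comm]
      rw [← Finset.sum_add_distrib]
      refine Finset.sum_eq_zero fun i _ => ?_
      rw [← Finset.sum_add_distrib]
      refine Finset.sum_eq_zero fun j _ => ?_
      rw [smul_mul_smul_comm, smul_mul_smul_comm, mul_comm (z j), ← smul_add, creation_anticomm,
        smul_zero]
    rwa [← two_smul ℂ, smul_eq_zero_iff_right (two_ne_zero' ℂ)] at h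
  have h2 : intMul φ * intMul φ = 0 := by
    have h : intMul φ * intMul φ + intMul φ * intMul φ = 0 := by
      conv_lhs => rw [intMul_eq_sum]
      rw [Finset.sum_mul_sum]
      conv_lhs => enter [2]; rw [Finset.sum_comm]
      rw [← Finset.sum_add_distrib]
      refine Finset.sum_eq_zero fun i _ => ?_
      rw [← Finset.sum_add_distrib]
      refine Finset.sum_eq_zero fun j _ => ?_
      rw [smul_mul_smul_comm, smul_mul_smul_comm, mul_comm (φ j), ← smul_add,
        annihilation_anticomm, smul_zero]
    rwa [← two_smul ℂ, smul_eq_zero_iff_right (two_ne_zero' ℂ)] at h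
  have h3 : extMul z * intMul φ + intMul φ * extMul z = (φ ⬝ᵥ z) • 1 := by
    rw [extMul_eq_sum, intMul_eq_sum, Finset.sum_mul_sum, Finset.sum_mul_sum]
    conv_lhs => enter [2]; rw [Finset.sum_comm]
    rw [← Finset.sum_add_distrib, dotProduct, Finset.sum_smul]
    refine Finset.sum_congr rfl fun i _ => ?_
    rw [← Finset.sum_add_distrib, Finset.sum_eq_single i]
    · rw [smul_mul_smul_comm, smul_mul_smul_comm, mul_comm (φ i), ← smul_add,
        creation_annihilation, if_pos rfl]
    · intro j _ hj
      rw [smul_mul_smul_comm, smul_mul_smul_comm, mul_comm (φ j), ← smul_add,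
        creation_annihilation, if_neg hj.symm, smul_zero]
    · simp
  rw [clifford, ← hφ, Matrix.dotProduct_mulVec, ← hφ, sub_mul, mul_sub, mul_sub, h1, h2, neg_smul,
    ← h3]
  abel

theorem clifford_apply_eq_zero (H : Matrix (Fin n) (Fin n) ℂ) (z : Fin n → ℂ)
    {T S : Finset (Fin n)} (h : Even T.card ↔ Even S.card) : clifford H z T S = 0 := by
  rw [clifford, Matrix.sub_apply, extMul, intMul, Matrix.of_apply, Matrix.of_apply,
    Finset.sum_eq_zero, Finset.sum_eq_zero, sub_zero]
  · intro i _
    refine if_neg fun hi => ?_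
    obtain ⟨hi, rfl⟩ := hi
    rw [← Finset.card_erase_add_one hi, Nat.even_add_one] at h
    tauto
  · intro i _
    refine if_neg fun hi => ?_
    obtain ⟨hi, rfl⟩ := hi
    rw [Finset.card_insert_of_notMem hi, Nat.even_add_one] at h
    tauto

/-- Clifford multiplication from the odd to the even part of the exterior algebra. -/
def bottDual (H : Matrix (Fin n) (Fin n) ℂ) (z : Fin n → ℂ) : Matrix (EvenIdx n) (OddIdx n) ℂ :=
  (clifford H z).submatrix Subtype.val Subtype.val

theorem bottSymbol_mul_bottDual (H : Matrix (Fin n) (Fin n) ℂ) (z : Fin n → ℂ) :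
    bottSymbol H z * bottDual H z = -(star z ⬝ᵥ (H *ᵥ z)) • 1 := by
  ext T S
  have h := congrFun (congrFun (clifford_mul_self H z) T.1) S.1
  rw [Matrix.mul_apply,
    ← Fintype.sum_subtype_add_sum_subtype (fun R : Finset (Fin n) => Even R.card),
    Fintype.sum_eq_zero (f := fun R : {R : Finset (Fin n) // ¬Even R.card} =>
      clifford H z T.1 R.1 * clifford H z R.1 S.1) fun R => by
        rw [clifford_apply_eq_zero H z (iff_of_false (Nat.not_even_iff_odd.2 T.2) R.2), zero_mul],
    add_zero, Matrix.smul_apply, Matrix.one_apply] at h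
  rw [Matrix.mul_apply, Matrix.smul_apply, Matrix.one_apply]
  simp only [Subtype.ext_iff]
  exact h

theorem bottDual_mul_bottSymbol (H : Matrix (Fin n) (Fin n) ℂ) (z : Fin n → ℂ) :
    bottDual H z * bottSymbol H z = -(star z ⬝ᵥ (H *ᵥ z)) • 1 := by
  ext T S
  have h := congrFun (congrFun (clifford_mul_self H z) T.1) S.1
  rw [Matrix.mul_apply,
    ← Fintype.sum_subtype_add_sum_subtype (fun R : Finset (Fin n) => Odd R.card),
    Fintype.sum_eq_zero (f := fun R : {R : Finset (Fin n) // ¬Odd R.card} =>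
      clifford H z T.1 R.1 * clifford H z R.1 S.1) fun R => by
        rw [clifford_apply_eq_zero H z (iff_of_true T.2 (Nat.not_odd_iff_even.1 R.2)), zero_mul],
    add_zero, Matrix.smul_apply, Matrix.one_apply] at h
  rw [Matrix.mul_apply, Matrix.smul_apply, Matrix.one_apply]
  simp only [Subtype.ext_iff]
  exact h

theorem bottSymbol_bijective {H : Matrix (Fin n) (Fin n) ℂ} (hH : H.PosDef) {z : Fin n → ℂ}
    (hz : z ≠ 0) : Function.Bijective (bottSymbol H z).mulVec := by
  have hc : -(star z ⬝ᵥ (H *ᵥ z)) ≠ 0 := neg_ne_zero.2 (hH.dotProduct_mulVec_pos hz).ne'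
  set c := -(star z ⬝ᵥ (H *ᵥ z)) with hcdef
  refine Function.bijective_iff_has_inverse.2 ⟨(c⁻¹ • bottDual H z).mulVec,
    fun u => ?_, fun u => ?_⟩
  · rw [Matrix.mulVec_mulVec, Matrix.smul_mul, bottDual_mul_bottSymbol, ← hcdef, smul_smul,
      inv_mul_cancel₀ hc, one_smul, Matrix.one_mulVec]
  · rw [Matrix.mulVec_mulVec, Matrix.mul_smul, bottSymbol_mul_bottDual, ← hcdef, smul_smul,
      inv_mul_cancel₀ hc, one_smul, Matrix.one_mulVec]

theorem contDiff_bottSymbol (H : Matrix (Fin n) (Fin n) ℂ) (T : OddIdx n) (S : EvenIdx n) :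
    ContDiff ℝ ∞ fun z => bottSymbol H z T S := by
  have h1 : ∀ i, ContDiff ℝ ∞ fun z : Fin n → ℂ => z i := fun i => contDiff_apply ℝ ℂ i
  have h2 : ∀ i, ContDiff ℝ ∞ fun z : Fin n → ℂ => (star z ᵥ* H) i := fun i => by
    simp only [Matrix.vecMul, dotProduct, Pi.star_apply]
    refine ContDiff.sum fun j _ => ContDiff.mul ?_ contDiff_const
    exact Complex.conjCLE.contDiff.comp (h1 j)
  simp only [bottSymbol, Matrix.submatrix_apply, clifford, Matrix.sub_apply, extMul, intMul,
    Matrix.of_apply]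
  refine ContDiff.sub (ContDiff.sum fun i _ => ?_) (ContDiff.sum fun i _ => ?_)
  · split_ifs
    · exact contDiff_const.mul (h1 i)
    · exact contDiff_const
  · split_ifs
    · exact contDiff_const.mul (h2 i)
    · exact contDiff_const

/-- The Bott symbol is equivariant. -/
theorem bottSymbol_act {V : Type*} [NormedAddCommGroup V] {Λ : Submodule ℤ V} (X : Fin n → Λ)
    {H : Matrix (Fin n) (Fin n) ℂ} (hH : ∀ g : AddChar Λ Circle, (grpAct X g)ᴴ * H * grpAct X g = H)
    (g : AddChar Λ Circle) (z : Fin n → ℂ) :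
    bottSymbol H (act X g z) * grpAct (evenWeight X) g =
      grpAct (oddWeight X) g * bottSymbol H z := by
  ext T S
  rw [grpAct, grpAct, Matrix.mul_diagonal, Matrix.diagonal_mul]
  change (∑ i : Fin n, _ - ∑ i : Fin n, _) * (g (∑ i ∈ S.1, X i) : ℂ) =
    (g (∑ i ∈ T.1, X i) : ℂ) * (∑ i : Fin n, _ - ∑ i : Fin n, _)
  rw [sub_mul, mul_sub, Finset.sum_mul, Finset.sum_mul, Finset.mul_sum, Finset.mul_sum]
  congr 1
  · refine Finset.sum_congr rfl fun i _ => ?_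
    split_ifs with h
    · rw [h.2, Finset.sum_insert h.1, AddChar.map_add_eq_mul, Circle.coe_mul, act_apply]
      ring
    · rw [zero_mul, mul_zero]
  · refine Finset.sum_congr rfl fun i _ => ?_
    split_ifs with h
    · have e : (star (act X g z) ᵥ* H) i * (g (X i) : ℂ) = (star z ᵥ* H) i := by
        simp only [Matrix.vecMul, dotProduct, Pi.star_apply, act_apply]
        rw [Finset.sum_mul]
        refine Finset.sum_congr rfl fun j _ => ?_
        have hj := congrFun (congrFun (hH g) j) i
        rw [grpAct, Matrix.diagonal_conjTranspose, Matrix.mul_diagonal, Matrix.diagonal_mul] at hj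
        have hs : star (fun i => (g (X i) : ℂ)) j = star (g (X j) : ℂ) := rfl
        rw [hs] at hj
        rw [star_mul']
        linear_combination star (z j) * hj
      rw [h.2, ← Finset.add_sum_erase _ _ h.1, AddChar.map_add_eq_mul, Circle.coe_mul, ← e]
      ring
    · rw [zero_mul, mul_zero]

end Clifford

/-! ### Existence of adapted metrics and connections -/

section MatDeriv

variable {n : ℕ} {p q r : Type*}

theorem matDeriv_add_right (f : (Fin n → ℂ) → Matrix p q ℂ) (z v v' : Fin n → ℂ) :
    matDeriv f z (v + v') = matDeriv f z v + matDeriv f z v' := by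
  ext i j
  exact map_add (fderiv ℝ (fun y => f y i j) z) v v'

theorem matDeriv_smul_right (f : (Fin n → ℂ) → Matrix p q ℂ) (z : Fin n → ℂ) (c : ℝ)
    (v : Fin n → ℂ) : matDeriv f z (c • v) = c • matDeriv f z v := by
  ext i j
  exact map_smul (fderiv ℝ (fun y => f y i j) z) c v

theorem matDeriv_congr {f f' : (Fin n → ℂ) → Matrix p q ℂ} {z : Fin n → ℂ}
    (h : f =ᶠ[nhds z] f') (v : Fin n → ℂ) : matDeriv f z v = matDeriv f' z v := by
  ext i j
  have e : (fun y => f y i j) =ᶠ[nhds z] fun y => f' y i j := h.mono fun y hy => by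
    change f y i j = f' y i j
    rw [hy]
  change fderiv ℝ _ z v = fderiv ℝ _ z v
  rw [e.fderiv_eq]

theorem matDeriv_const (M : Matrix p q ℂ) (z v : Fin n → ℂ) :
    matDeriv (fun _ => M) z v = 0 := by
  ext i j
  change fderiv ℝ (fun _ => M i j) z v = 0
  rw [fderiv_fun_const]
  rfl

theorem matDeriv_conjTranspose {f : (Fin n → ℂ) → Matrix p q ℂ}
    (hf : ∀ i j, ContDiff ℝ ∞ fun z => f z i j) (z v : Fin n → ℂ) :
    matDeriv (fun y => (f y)ᴴ) z v = (matDeriv f z v)ᴴ := by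
  ext i j
  have h : HasFDerivAt (fun y => f y j i) (fderiv ℝ (fun y => f y j i) z) z :=
    ((hf j i).differentiable (by simp) z).hasFDerivAt
  have h' := (Complex.conjCLE.hasFDerivAt (x := f z j i)).comp z h
  exact congrArg (fun l => l v) h'.fderiv

theorem matDeriv_mul [Fintype q] {f : (Fin n → ℂ) → Matrix p q ℂ}
    {k : (Fin n → ℂ) → Matrix q r ℂ} (hf : ∀ i j, ContDiff ℝ ∞ fun z => f z i j)
    (hk : ∀ i j, ContDiff ℝ ∞ fun z => k z i j) (z v : Fin n → ℂ) :
    matDeriv (fun y => f y * k y) z v = matDeriv f z v * k z + f z * matDeriv k z v := by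
  ext i j
  have h : HasFDerivAt (fun y => (f y * k y) i j)
      (∑ s, (f z i s • fderiv ℝ (fun y => k y s j) z + k z s j • fderiv ℝ (fun y => f y i s) z))
      z := by
    simp only [Matrix.mul_apply]
    exact HasFDerivAt.fun_sum fun s _ => HasFDerivAt.mul
      ((hf i s).differentiable (by simp) z).hasFDerivAt
      ((hk s j).differentiable (by simp) z).hasFDerivAt
  change fderiv ℝ (fun y => (f y * k y) i j) z v = _
  rw [h.fderiv, Matrix.add_apply, Matrix.mul_apply, Matrix.mul_apply, _root_.sum_apply,
    ← Finset.sum_add_distrib]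
  refine Finset.sum_congr rfl fun s _ => ?_
  change f z i s * fderiv ℝ (fun y => k y s j) z v + k z s j * fderiv ℝ (fun y => f y i s) z v =
    fderiv ℝ (fun y => f y i s) z v * k z s j + f z i s * fderiv ℝ (fun y => k y s j) z v
  ring

theorem matDeriv_comp_act {V : Type*} [NormedAddCommGroup V] {Λ : Submodule ℤ V} (X : Fin n → Λ)
    {f : (Fin n → ℂ) → Matrix p q ℂ} (hf : ∀ i j, ContDiff ℝ ∞ fun z => f z i j)
    (g : AddChar Λ Circle) (z v : Fin n → ℂ) :
    matDeriv (fun y => f (act X g y)) z v = matDeriv f (act X g z) (act X g v) := by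
  ext i j
  have h : HasFDerivAt (fun y => f y i j) (fderiv ℝ (fun y => f y i j) (act X g z)) (act X g z) :=
    ((hf i j).differentiable (by simp) _).hasFDerivAt
  have h' := h.comp z (act X g).hasFDerivAt
  exact congrArg (fun l => l v) h'.fderiv

/-- The derivative of an equivariant matrix valued function is equivariant. -/
theorem matDeriv_act [Fintype p] [Fintype q] {V : Type*} [NormedAddCommGroup V]
    {Λ : Submodule ℤ V} (X : Fin n → Λ)
    {f : (Fin n → ℂ) → Matrix p q ℂ} (hf : ∀ i j, ContDiff ℝ ∞ fun z => f z i j)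
    {g : AddChar Λ Circle} {G' : Matrix p p ℂ} {G : Matrix q q ℂ}
    (h : ∀ z, f (act X g z) * G = G' * f z) (z v : Fin n → ℂ) :
    matDeriv f (act X g z) (act X g v) * G = G' * matDeriv f z v := by
  have h1 : ∀ i j, ContDiff ℝ ∞ fun z => f (act X g z) i j := fun i j =>
    (hf i j).comp (act X g).contDiff
  have e1 := matDeriv_mul h1 (k := fun _ => G) (fun i j => contDiff_const) z v
  have e2 := matDeriv_mul (f := fun _ => G') (fun i j => contDiff_const) hf z v
  rw [matDeriv_const, Matrix.mul_zero, add_zero, matDeriv_comp_act X hf] at e1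
  rw [matDeriv_const, Matrix.zero_mul, zero_add] at e2
  rw [← e1, ← e2]
  simp only [h]

theorem contDiff_matDeriv {f : (Fin n → ℂ) → Matrix p q ℂ}
    (hf : ∀ i j, ContDiff ℝ ∞ fun z => f z i j) (v : Fin n → ℂ) (i : p) (j : q) :
    ContDiff ℝ ∞ fun z => matDeriv f z v i j :=
  ((hf i j).fderiv_right (m := ∞) (by simp)).clm_apply contDiff_const

theorem contDiff_mul_apply [Fintype q] {f : (Fin n → ℂ) → Matrix r q ℂ}
    {k : (Fin n → ℂ) → Matrix q p ℂ} (hf : ∀ i j, ContDiff ℝ ∞ fun z => f z i j)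
    (hk : ∀ i j, ContDiff ℝ ∞ fun z => k z i j) (i : r) (j : p) :
    ContDiff ℝ ∞ fun z => (f z * k z) i j := by
  simp only [Matrix.mul_apply]
  exact ContDiff.sum fun s _ => (hf i s).mul (hk s j)

theorem contDiff_conjTranspose_apply {f : (Fin n → ℂ) → Matrix q p ℂ}
    (hf : ∀ i j, ContDiff ℝ ∞ fun z => f z i j) (i : p) (j : q) :
    ContDiff ℝ ∞ fun z => (f z)ᴴ i j :=
  Complex.conjCLE.contDiff.comp (hf j i)

end MatDeriv

section Adapted

variable {V : Type*} [NormedAddCommGroup V] {Λ : Submodule ℤ V} {n : ℕ}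
  {p q : Type*} [Fintype p] [DecidableEq p] [Fintype q] [DecidableEq q]
  {X : Fin n → Λ} {w : p → Λ} {w' : q → Λ} {Sig : (Fin n → ℂ) → Matrix q p ℂ}

theorem grpAct_mul_conjTranspose (w : p → Λ) (g : AddChar Λ Circle) :
    grpAct w g * (grpAct w g)ᴴ = 1 := by
  rw [grpAct, Matrix.diagonal_conjTranspose, Matrix.diagonal_mul_diagonal, ← Matrix.diagonal_one]
  congr 1
  funext i
  change (g (w i) : ℂ) * (starRingEnd ℂ) (g (w i) : ℂ) = 1
  rw [Complex.mul_conj, Circle.normSq_coe, Complex.ofReal_one]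

theorem conjTranspose_mul_grpAct (w : p → Λ) (g : AddChar Λ Circle) :
    (grpAct w g)ᴴ * grpAct w g = 1 :=
  mul_eq_one_comm.1 (grpAct_mul_conjTranspose w g)

/-- The adjoint of an equivariant matrix is equivariant. -/
theorem conjTranspose_mul_grpAct_of_intertwine {S S' : Matrix q p ℂ} {g : AddChar Λ Circle}
    (h : S' * grpAct w g = grpAct w' g * S) : S'ᴴ * grpAct w' g = grpAct w g * Sᴴ := by
  have e := congrArg Matrix.conjTranspose h
  rw [Matrix.conjTranspose_mul, Matrix.conjTranspose_mul] at e
  calc S'ᴴ * grpAct w' g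
      = grpAct w g * ((grpAct w g)ᴴ * S'ᴴ) * grpAct w' g := by
        rw [← Matrix.mul_assoc, grpAct_mul_conjTranspose, Matrix.one_mul]
    _ = grpAct w g * Sᴴ := by
        rw [e, Matrix.mul_assoc, Matrix.mul_assoc, conjTranspose_mul_grpAct, Matrix.mul_one]

/-- The trivial metric `⟨u, u'⟩ = uᴴ u'`. -/
def stdMetric (X : Fin n → Λ) (w : p → Λ) : InvMetric X w where
  h _ := 1
  smooth _ _ := contDiff_const
  posDef _ := Matrix.PosDef.one
  invariant g _ := by rw [Matrix.mul_one, conjTranspose_mul_grpAct]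

/-- The trivial connection `d`, which is Hermitian for the trivial metric. -/
def stdConnection (X : Fin n → Λ) (w : p → Λ) : InvConnection X w (stdMetric X w) where
  A _ := 0
  smooth _ _ _ := contDiff_const
  invariant g _ _ := by
    rw [LinearMap.zero_apply, LinearMap.zero_apply, Matrix.zero_mul, Matrix.mul_zero]
  hermitian z v := by
    rw [LinearMap.zero_apply, Matrix.mul_zero, Matrix.conjTranspose_zero, Matrix.zero_mul,
      add_zero]
    exact matDeriv_const 1 z v

/-- The metric `Σᴴ Σ + χ`, where `χ ≥ 0` is an invariant function which is positive where `Σ` is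
not invertible. Where `χ` vanishes it is the pullback by `Σ` of the trivial metric. -/
def pullbackMetric (hS : ∀ i j, ContDiff ℝ ∞ fun z => Sig z i j)
    (hinv : ∀ g z, Sig (act X g z) * grpAct w g = grpAct w' g * Sig z)
    {χ : (Fin n → ℂ) → ℝ} (hχ : ContDiff ℝ ∞ χ) (hχ0 : ∀ z, 0 ≤ χ z)
    (hχinv : ∀ (g : AddChar Λ Circle) z, χ (act X g z) = χ z)
    (hb : ∀ z, χ z = 0 → Function.Bijective (Sig z).mulVec) : InvMetric X w where
  h z := (Sig z)ᴴ * Sig z + (χ z : ℂ) • 1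
  smooth i j := by
    have e : (fun z => ((Sig z)ᴴ * Sig z + (χ z : ℂ) • (1 : Matrix p p ℂ)) i j) = fun z =>
        ∑ s, Complex.conjCLE (Sig z s i) * Sig z s j + (χ z : ℂ) * (1 : Matrix p p ℂ) i j := rfl
    rw [e]
    refine ContDiff.add (ContDiff.sum fun s _ => ContDiff.mul ?_ (hS s j))
      (ContDiff.mul ?_ contDiff_const)
    · exact Complex.conjCLE.contDiff.comp (hS s i)
    · exact Complex.ofRealCLM.contDiff.comp hχ
  posDef z := by
    rcases (hχ0 z).eq_or_lt with h | h
    · rw [← h, Complex.ofReal_zero, zero_smul, add_zero]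
      exact Matrix.PosDef.conjTranspose_mul_self _ (hb z h.symm).1
    · refine Matrix.PosDef.posSemidef_add (Matrix.posSemidef_conjTranspose_mul_self _) ?_
      exact Matrix.PosDef.one.smul (by exact_mod_cast h)
  invariant g z := by
    rw [Matrix.mul_add, Matrix.add_mul, hχinv, Matrix.mul_smul, Matrix.smul_mul, Matrix.mul_one,
      conjTranspose_mul_grpAct]
    congr 1
    have e : (grpAct w g)ᴴ * ((Sig (act X g z))ᴴ * Sig (act X g z)) * grpAct w g =
        (Sig (act X g z) * grpAct w g)ᴴ * (Sig (act X g z) * grpAct w g) := by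
      rw [Matrix.conjTranspose_mul]
      simp only [Matrix.mul_assoc]
    rw [e, hinv, Matrix.conjTranspose_mul, Matrix.mul_assoc, ← Matrix.mul_assoc _ _ (Sig z),
      conjTranspose_mul_grpAct, Matrix.one_mul]

theorem InvMetric.isUnit_det (h : InvMetric X w) (z : Fin n → ℂ) : IsUnit (h.h z).det :=
  isUnit_iff_ne_zero.2 (h.posDef z).det_pos.ne'

theorem InvMetric.mul_grpAct (h : InvMetric X w) (g : AddChar Λ Circle) (z : Fin n → ℂ) :
    h.h (act X g z) * grpAct w g = grpAct w g * h.h z := by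
  rw [← h.invariant g z, ← Matrix.mul_assoc, ← Matrix.mul_assoc, grpAct_mul_conjTranspose,
    Matrix.one_mul]

/-- The coefficients of the inverse of a smooth invertible matrix are smooth. -/
theorem contDiff_inv_apply {f : (Fin n → ℂ) → Matrix p p ℂ}
    (hf : ∀ i j, ContDiff ℝ ∞ fun z => f z i j) (hu : ∀ z, IsUnit (f z).det) (i j : p) :
    ContDiff ℝ ∞ fun z => (f z)⁻¹ i j := by
  have hdet : ∀ k : (Fin n → ℂ) → Matrix p p ℂ, (∀ i j, ContDiff ℝ ∞ fun z => k z i j) →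
      ContDiff ℝ ∞ fun z => (k z).det := fun k hk => by
    simp only [Matrix.det_apply]
    exact ContDiff.sum fun s _ => ContDiff.const_smul _ (contDiff_prod fun a _ => hk _ _)
  have e : (fun z => (f z)⁻¹ i j) = fun z =>
      (f z).det⁻¹ * ((f z).updateRow j (Pi.single i 1)).det := by
    funext z
    rw [Matrix.inv_def, Matrix.smul_apply, Matrix.adjugate_apply, Ring.inverse_eq_inv',
      smul_eq_mul]
  rw [e]
  refine ContDiff.mul ((hdet f hf).inv fun z => (hu z).ne_zero) (hdet _ fun a b => ?_)
  by_cases h : a = j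
  · subst h
    simp only [Matrix.updateRow_self]
    exact contDiff_const
  · simp only [Matrix.updateRow_ne h]
    exact hf a b

theorem InvMetric.matDeriv_conjTranspose (h : InvMetric X w) (z v : Fin n → ℂ) :
    (matDeriv h.h z v)ᴴ = matDeriv h.h z v := by
  rw [← EquivCoh.matDeriv_conjTranspose h.smooth]
  congr 1
  funext y
  exact (h.posDef y).1

/-- Twice the matrices `h A` for the connection `d + A` with
`A = ½ h⁻¹ (dh + Σᴴ dΣ - (dΣ)ᴴ Σ)`: the term `dh` makes it compatible with `h`, and the
skew-Hermitian rest makes it the pullback by `Σ` of the trivial connection where `h = Σᴴ Σ`. -/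
def adaptedNumerator (h : InvMetric X w) (Sig : (Fin n → ℂ) → Matrix q p ℂ)
    (z v : Fin n → ℂ) : Matrix p p ℂ :=
  matDeriv h.h z v + ((Sig z)ᴴ * matDeriv Sig z v - (matDeriv Sig z v)ᴴ * Sig z)

theorem adaptedNumerator_act (h : InvMetric X w) (hS : ∀ i j, ContDiff ℝ ∞ fun z => Sig z i j)
    {g : AddChar Λ Circle} (hinv : ∀ z, Sig (act X g z) * grpAct w g = grpAct w' g * Sig z)
    (z v : Fin n → ℂ) :
    adaptedNumerator h Sig (act X g z) (act X g v) * grpAct w g =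
      grpAct w g * adaptedNumerator h Sig z v := by
  have h1 := matDeriv_act X h.smooth (fun z => h.mul_grpAct g z) z v
  have h2 := matDeriv_act X hS hinv z v
  rw [adaptedNumerator, adaptedNumerator, Matrix.add_mul, Matrix.sub_mul, h1, Matrix.mul_assoc, h2,
    Matrix.mul_assoc _ (Sig (act X g z)), hinv, ← Matrix.mul_assoc,
    conjTranspose_mul_grpAct_of_intertwine (hinv z), ← Matrix.mul_assoc (matDeriv Sig _ _)ᴴ,
    conjTranspose_mul_grpAct_of_intertwine h2, Matrix.mul_add, Matrix.mul_sub, Matrix.mul_assoc,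
    Matrix.mul_assoc]

/-- The connection `d + ½ h⁻¹ (dh + Σᴴ dΣ - (dΣ)ᴴ Σ)`. -/
def adaptedConnection (h : InvMetric X w) (hS : ∀ i j, ContDiff ℝ ∞ fun z => Sig z i j)
    (hinv : ∀ g z, Sig (act X g z) * grpAct w g = grpAct w' g * Sig z) :
    InvConnection X w h where
  A z :=
    { toFun := fun v => (1 / 2 : ℝ) • ((h.h z)⁻¹ * adaptedNumerator h Sig z v)
      map_add' := fun v v' => by
        rw [← smul_add, ← Matrix.mul_add]
        congr 2
        simp only [adaptedNumerator, matDeriv_add_right, Matrix.mul_add, Matrix.conjTranspose_add,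
          Matrix.add_mul]
        abel
      map_smul' := fun c v => by
        have e : adaptedNumerator h Sig z (c • v) = c • adaptedNumerator h Sig z v := by
          simp only [adaptedNumerator, matDeriv_smul_right, Matrix.conjTranspose_smul,
            Matrix.smul_mul, Matrix.mul_smul, smul_add, smul_sub, star_trivial]
        rw [e, Matrix.mul_smul, smul_comm, RingHom.id_apply] }
  smooth v i j := by
    refine ContDiff.const_smul (1 / 2 : ℝ) (contDiff_mul_apply
      (contDiff_inv_apply h.smooth h.isUnit_det) (fun i j => ?_) i j)
    exact (contDiff_matDeriv h.smooth v i j).add (ContDiff.sub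
      (contDiff_mul_apply (contDiff_conjTranspose_apply hS) (contDiff_matDeriv hS v) i j)
      (contDiff_mul_apply (contDiff_conjTranspose_apply (contDiff_matDeriv hS v)) hS i j))
  invariant g z v := by
    change ((1 / 2 : ℝ) • ((h.h (act X g z))⁻¹ * adaptedNumerator h Sig (act X g z) (act X g v))) *
      grpAct w g = grpAct w g * ((1 / 2 : ℝ) • ((h.h z)⁻¹ * adaptedNumerator h Sig z v))
    rw [Matrix.smul_mul, Matrix.mul_smul, Matrix.mul_assoc, adaptedNumerator_act h hS (hinv g),
      ← Matrix.mul_assoc, ← Matrix.mul_assoc]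
    congr 2
    calc (h.h (act X g z))⁻¹ * grpAct w g
        = (h.h (act X g z))⁻¹ * (grpAct w g * h.h z) * (h.h z)⁻¹ := by
          rw [Matrix.mul_assoc, Matrix.mul_assoc, Matrix.mul_nonsing_inv _ (h.isUnit_det z),
            Matrix.mul_one]
      _ = grpAct w g * (h.h z)⁻¹ := by
          rw [← h.mul_grpAct, ← Matrix.mul_assoc, Matrix.nonsing_inv_mul _ (h.isUnit_det _),
            Matrix.one_mul]
  hermitian z v := by
    change _ = ((1 / 2 : ℝ) • ((h.h z)⁻¹ * adaptedNumerator h Sig z v))ᴴ * h.h z +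
      h.h z * ((1 / 2 : ℝ) • ((h.h z)⁻¹ * adaptedNumerator h Sig z v))
    have hz : (h.h z)ᴴ = h.h z := (h.posDef z).1
    rw [Matrix.conjTranspose_smul, Matrix.smul_mul, Matrix.mul_smul, Matrix.conjTranspose_mul,
      Matrix.conjTranspose_nonsing_inv, hz, Matrix.mul_assoc,
      Matrix.nonsing_inv_mul _ (h.isUnit_det z), Matrix.mul_one, ← Matrix.mul_assoc,
      Matrix.mul_nonsing_inv _ (h.isUnit_det z), Matrix.one_mul, star_trivial, adaptedNumerator]
    simp only [Matrix.conjTranspose_add, Matrix.conjTranspose_sub, Matrix.conjTranspose_mul,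
      Matrix.conjTranspose_conjTranspose, h.matDeriv_conjTranspose]
    module

/-- An equivariant morphism which is invertible outside a compact set has adapted metrics and
connections. Here `χ` is an invariant cutoff function supported in a relatively compact open set,
and `Σ` is invertible where `χ` vanishes. -/
theorem nonempty_adaptedPair (hS : ∀ i j, ContDiff ℝ ∞ fun z => Sig z i j)
    (hinv : ∀ g z, Sig (act X g z) * grpAct w g = grpAct w' g * Sig z)
    {χ : (Fin n → ℂ) → ℝ} (hχ : ContDiff ℝ ∞ χ) (hχ0 : ∀ z, 0 ≤ χ z)
    (hχinv : ∀ (g : AddChar Λ Circle) z, χ (act X g z) = χ z)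
    (hb : ∀ z, χ z = 0 → Function.Bijective (Sig z).mulVec)
    {U : Set (Fin n → ℂ)} (hU : IsOpen U) (hUc : IsCompact (closure U))
    (hχU : ∀ z ∉ U, ∀ᶠ y in nhds z, χ y = 0) : Nonempty (AdaptedPair X w w' Sig) := by
  have hiso : ∀ z, χ z = 0 →
      (pullbackMetric hS hinv hχ hχ0 hχinv hb).h z = (Sig z)ᴴ * Sig z := fun z hz => by
    change (Sig z)ᴴ * Sig z + (χ z : ℂ) • 1 = _
    rw [hz, Complex.ofReal_zero, zero_smul, add_zero]
  set h := pullbackMetric hS hinv hχ hχ0 hχinv hb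
  refine ⟨⟨U, hU, fun z hz => ?_, hUc, h, stdMetric X w', fun z hz => ?_,
    adaptedConnection h hS hinv, stdConnection X w', fun z hz v => ?_⟩⟩
  · by_contra hzU
    exact hz (hb z (hχU z hzU).self_of_nhds)
  · rw [hiso z (hχU z hz).self_of_nhds]
    change (Sig z)ᴴ * 1 * Sig z = _
    rw [Matrix.mul_one]
  · have hdh : matDeriv h.h z v = (matDeriv Sig z v)ᴴ * Sig z + (Sig z)ᴴ * matDeriv Sig z v := by
      rw [matDeriv_congr (f' := fun y => (Sig y)ᴴ * Sig y) ((hχU z hz).mono fun y hy => hiso y hy),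
        matDeriv_mul (contDiff_conjTranspose_apply hS) hS, matDeriv_conjTranspose hS]
    have hA : adaptedNumerator h Sig z v = (2 : ℝ) • ((Sig z)ᴴ * matDeriv Sig z v) := by
      rw [adaptedNumerator, hdh, two_smul]
      abel
    obtain ⟨T, hT, -⟩ := exists_inverse_of_bijective (hb z (hχU z hz).self_of_nhds)
    have hT' : Tᴴ * (Sig z)ᴴ = 1 := by
      rw [← Matrix.conjTranspose_mul, hT, Matrix.conjTranspose_one]
    change matDeriv Sig z v + 0 * Sig z =
      Sig z * ((1 / 2 : ℝ) • ((h.h z)⁻¹ * adaptedNumerator h Sig z v))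
    rw [Matrix.zero_mul, add_zero, hA, Matrix.mul_smul, Matrix.mul_smul, Matrix.mul_smul, smul_smul,
      one_div, inv_mul_cancel₀ (two_ne_zero' ℝ), one_smul]
    have hmul : (Sig z)ᴴ * (Sig z * ((h.h z)⁻¹ * ((Sig z)ᴴ * matDeriv Sig z v))) =
        (Sig z)ᴴ * matDeriv Sig z v := by
      rw [← Matrix.mul_assoc, ← hiso z (hχU z hz).self_of_nhds, ← Matrix.mul_assoc,
        Matrix.mul_nonsing_inv _ (h.isUnit_det z), Matrix.one_mul]
    calc matDeriv Sig z v = Tᴴ * ((Sig z)ᴴ * matDeriv Sig z v) := by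
          rw [← Matrix.mul_assoc, hT', Matrix.one_mul]
      _ = Tᴴ * ((Sig z)ᴴ * (Sig z * ((h.h z)⁻¹ * ((Sig z)ᴴ * matDeriv Sig z v)))) := by rw [hmul]
      _ = Sig z * ((h.h z)⁻¹ * ((Sig z)ᴴ * matDeriv Sig z v)) := by
          rw [← Matrix.mul_assoc, hT', Matrix.one_mul]

end Adapted

section Bott

variable {V : Type*} [NormedAddCommGroup V] {Λ : Submodule ℤ V} {n : ℕ}

/-- The Bott symbol has adapted metrics and connections, the cutoff being a function of the
squared norm of `z`. -/
theorem nonempty_bottPair (X : Fin n → Λ) {H : Matrix (Fin n) (Fin n) ℂ} (hH : H.PosDef)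
    (hHinv : ∀ g : AddChar Λ Circle, (grpAct X g)ᴴ * H * grpAct X g = H) :
    Nonempty (BottPair X H) := by
  -- The cutoff is `1` at the origin and vanishes for `Q ≥ 1 / 2`, hence near the complement of `U`.
  set Q : (Fin n → ℂ) → ℝ := fun z => (star z ⬝ᵥ (H *ᵥ z)).re with hQdef
  have hQ : ContDiff ℝ ∞ Q := by
    refine Complex.reCLM.contDiff.comp ?_
    simp only [dotProduct, Matrix.mulVec, Pi.star_apply]
    refine ContDiff.sum fun i _ => ContDiff.mul ?_ (ContDiff.sum fun j _ =>
      contDiff_const.mul (contDiff_apply ℝ ℂ j))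
    exact Complex.conjCLE.contDiff.comp (contDiff_apply ℝ ℂ i)
  have hQinv : ∀ (g : AddChar Λ Circle) z, Q (act X g z) = Q z := fun g z => by
    have e : act X g z = grpAct X g *ᵥ z := by
      funext i
      rw [act_apply, grpAct, Matrix.mulVec_diagonal]
    rw [hQdef]
    simp only
    rw [e, Matrix.star_mulVec, Matrix.dotProduct_mulVec, Matrix.vecMul_vecMul,
      ← Matrix.dotProduct_mulVec, Matrix.mulVec_mulVec, hHinv]
  have hQ0 : Q 0 = 0 := by simp [hQdef]
  obtain ⟨c, hc, hcb⟩ := exists_pos_mul_sq_le (K := {(0 : ℝ)}) (h := fun _ => H)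
    isCompact_singleton (fun _ _ => continuous_const) fun _ => hH
  refine nonempty_adaptedPair (contDiff_bottSymbol H) (fun g z => bottSymbol_act X hHinv g z)
    (χ := fun z => Real.smoothTransition (1 - 2 * Q z))
    (Real.smoothTransition.contDiff.comp (contDiff_const.sub (contDiff_const.mul hQ)))
    (fun z => Real.smoothTransition.nonneg _) (fun g z => by rw [hQinv])
    (fun z hz => ?_) (U := {z | Q z < 1}) (isOpen_lt hQ.continuous continuous_const) ?_
    (fun z hz => ?_)
  · refine bottSymbol_bijective hH ?_
    rintro rfl
    simp only [hQ0, mul_zero, sub_zero, Real.smoothTransition.one] at hz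
    exact one_ne_zero hz
  · refine Metric.isCompact_of_isClosed_isBounded isClosed_closure (Bornology.IsBounded.closure
      (isBounded_iff_forall_norm_le.2 ⟨1 / c + 1, fun z hz => ?_⟩))
    have h1 : c * ‖z‖ ^ 2 ≤ Q z := hcb 0 rfl z
    have h2 : ‖z‖ ^ 2 ≤ 1 / c := by
      rw [le_div_iff₀ hc]
      have : Q z < 1 := hz
      linarith
    nlinarith [norm_nonneg z, sq_nonneg (‖z‖ - 1)]
  · have hz' : 1 / 2 < Q z := lt_of_lt_of_le (by norm_num) (not_lt.1 hz)
    filter_upwards [(isOpen_lt continuous_const hQ.continuous).mem_nhds hz'] with y hy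
    exact Real.smoothTransition.zero_of_nonpos (by linarith [show 1 / 2 < Q y from hy])

end Bott

/-! ### Comparison of the integrals -/

section Comparison

open MeasureTheory

variable {V : Type*} [NormedAddCommGroup V] [NormedSpace ℝ V] {Λ : Submodule ℤ V} {n : ℕ}
  {X : Fin n → Λ}

theorem continuous_topCoeff {α : EquivForm V n} (h : α ∈ moderateForms X) :
    Continuous fun q : StrongDual ℝ V × (Fin n → ℂ) => α q.1 (2 * n) q.2 (realFrame n) := by
  have h1 := (h.1 (2 * n)).1.continuous
  exact (ContinuousAlternatingMap.apply ℝ (Fin n → ℂ) ℂ (realFrame n)).continuous.comp h1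

theorem continuous_integralForm [FiniteDimensional ℝ V] {α : EquivForm V n}
    (h : α ∈ moderateForms X) : Continuous fun x => integralForm (α x (2 * n)) := by
  obtain ⟨K, hK, h0⟩ := h.2.1
  have e : (fun x => integralForm (α x (2 * n))) =
      fun x => ∫ z in K, α x (2 * n) z (realFrame n) := by
    funext x
    refine (setIntegral_eq_integral_of_forall_compl_eq_zero fun z hz => ?_).symm
    rw [h0 x _ z hz]
    rfl
  rw [e]
  have := FiniteDimensional.proper ℝ (StrongDual ℝ V)
  exact continuous_parametric_integral_of_continuous (continuous_topCoeff h) hK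

theorem integrable_topCoeff {α : EquivForm V n} (h : α ∈ moderateForms X) (x : StrongDual ℝ V) :
    Integrable fun z => α x (2 * n) z (realFrame n) := by
  obtain ⟨K, hK, h0⟩ := h.2.1
  refine ((continuous_topCoeff h).comp (Continuous.prodMk_right x)).integrable_of_hasCompactSupport
    (HasCompactSupport.intro hK fun z hz => ?_)
  change α x (2 * n) z (realFrame n) = 0
  rw [h0 x _ z hz]
  rfl

theorem integralForm_sub {α β : EquivForm V n} (hα : α ∈ moderateForms X)
    (hβ : β ∈ moderateForms X) (x : StrongDual ℝ V) :
    integralForm ((α - β) x (2 * n)) = integralForm (α x (2 * n)) - integralForm (β x (2 * n)) :=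
  integral_sub (integrable_topCoeff hα x) (integrable_topCoeff hβ x)

theorem integralForm_bottThomForm {τ : EquivForm V n} (hτ : IsThomForm X τ)
    (x : StrongDual ℝ V) : integralForm (bottThomForm X τ x (2 * n)) =
      (2 * Complex.I * Real.pi) ^ n * ∏ a, expQuotient (x (X a : V)) := by
  have e := integral_const_mul (μ := (volume : Measure (Fin n → ℂ)))
    ((2 * Complex.I * Real.pi) ^ n * ∏ a, expQuotient (x (X a : V)))
    fun z => τ x (2 * n) z (realFrame n)
  refine e.trans ?_
  rw [show ∫ z, τ x (2 * n) z (realFrame n) = 1 from hτ.integral_eq_one x, mul_one]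

/-- The factor of the Chern class for one weight times the Euler class of that weight; for `θ = 0`
both sides vanish. -/
theorem expQuotient_mul (θ : ℝ) : 2 * Complex.I * Real.pi * expQuotient θ *
    (-(θ : ℂ) / (2 * Real.pi)) = 1 - Complex.exp (Complex.I * θ) := by
  have hπ : (Real.pi : ℂ) ≠ 0 := by exact_mod_cast Real.pi_ne_zero
  rw [expQuotient]
  split_ifs with h
  · simp [h]
  · have hθ : (θ : ℂ) ≠ 0 := by exact_mod_cast h
    field_simp
    ring

/-- The points of the Lie algebra at which no weight vanishes are dense. -/
theorem dense_regular [FiniteDimensional ℝ V] (hX : ∀ a, X a ≠ 0) :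
    Dense {x : StrongDual ℝ V | ∀ a, x (X a : V) ≠ 0} := by
  have e : {x : StrongDual ℝ V | ∀ a, x (X a : V) ≠ 0} = ⋂ a, {x | x (X a : V) ≠ 0} := by
    ext x
    simp
  have hc : ∀ a, Continuous fun x : StrongDual ℝ V => x (X a : V) := fun a =>
    (ContinuousLinearMap.apply ℝ ℝ (X a : V)).continuous
  rw [e]
  refine dense_iInter_of_isOpen (fun a => isOpen_ne_fun (hc a) continuous_const) fun a => ?_
  set W : Submodule ℝ (StrongDual ℝ V) :=
    LinearMap.ker (ContinuousLinearMap.apply ℝ ℝ (X a : V)).toLinearMap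
  have hW : {x : StrongDual ℝ V | x (X a : V) ≠ 0} = (W : Set (StrongDual ℝ V))ᶜ := rfl
  rw [hW, ← interior_eq_empty_iff_dense_compl]
  by_contra hne
  have htop := W.eq_top_of_nonempty_interior' (Set.nonempty_iff_ne_empty.2 hne)
  obtain ⟨x, hx⟩ := SeparatingDual.exists_ne_zero (R := ℝ)
    (show (X a : V) ≠ 0 from fun h => hX a (Subtype.ext h))
  exact hx (show x ∈ W from htop ▸ Submodule.mem_top)

/-- The integral of the Chern character of the Bott symbol: localization at the origin determines
it where no weight vanishes, and the rest is continuity. -/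
theorem integralForm_ch [FiniteDimensional ℝ V] (hX : ∀ a, X a ≠ 0)
    {H : Matrix (Fin n) (Fin n) ℂ} (P : BottPair X H) (hP : P.ch ∈ closedForms X)
    (x : StrongDual ℝ V) : integralForm (P.ch x (2 * n)) =
      (2 * Complex.I * Real.pi) ^ n * ∏ a, expQuotient (x (X a : V)) := by
  have hτ := isThomForm_thomForm (V := V) X
  have hB := bottThomForm_mem_closedForms hτ
  have hc := continuous_integralForm hB.1
  simp only [integralForm_bottThomForm hτ] at hc
  refine congrFun ((continuous_integralForm hP.1).ext_on (dense_regular hX) hc fun x hx => ?_) x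
  have hloc := apply_zero_eq_integralForm_mul hP hτ.mem_closedForms x
  rw [hτ.integral_eq_one, one_mul, zeroPart_ch_zero, zeroPart_thomForm_zero] at hloc
  refine mul_right_cancel₀ (b := ∏ a, (-((x (X a : V) : ℝ) : ℂ) / (2 * Real.pi)))
    (Finset.prod_ne_zero_iff.2 fun a _ => div_ne_zero
      (neg_ne_zero.2 (by exact_mod_cast hx a))
      (mul_ne_zero two_ne_zero (by exact_mod_cast Real.pi_ne_zero))) (hloc.symm.trans ?_)
  have hcard : (2 * Complex.I * Real.pi : ℂ) ^ n = ∏ _a : Fin n, (2 * Complex.I * Real.pi : ℂ) := by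
    rw [Finset.prod_const, Finset.card_univ, Fintype.card_fin]
  rw [hcard, ← Finset.prod_mul_distrib, ← Finset.prod_mul_distrib]
  exact Finset.prod_congr rfl fun a _ => (expQuotient_mul _).symm

end Comparison

end EquivCoh
end

open EquivCoh

theorem mainTheorem10 {V : Type*} [NormedAddCommGroup V] [NormedSpace ℝ V] [FiniteDimensional ℝ V]
    (Λ : Submodule ℤ V) [DiscreteTopology Λ] [IsZLattice ℝ Λ]
    {n : ℕ} (X : Fin n → Λ) (hX : ∀ a, X a ≠ 0)
    (H : Matrix (Fin n) (Fin n) ℂ) (hH : H.PosDef)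
    (hHinv : ∀ g : AddChar Λ Circle, (grpAct X g)ᴴ * H * grpAct X g = H) :
    Nonempty (BottPair X H) ∧ (∃ τ : EquivForm V n, IsThomForm X τ) ∧
    ∀ (P : BottPair X H) (τ : EquivForm V n), IsThomForm X τ →
      ∃ (h₁ : P.ch ∈ closedForms X) (h₂ : bottThomForm X τ ∈ closedForms X),
        cohClass X P.ch h₁ = cohClass X (bottThomForm X τ) h₂ := by
  refine ⟨nonempty_bottPair X hH hHinv, ⟨thomForm X, isThomForm_thomForm X⟩, fun P τ hτ => ?_⟩
  have h₁ : P.ch ∈ closedForms X :=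
    P.ch_mem_closedForms (contDiff_bottSymbol H) fun g z => bottSymbol_act X hHinv g z
  have h₂ := bottThomForm_mem_closedForms hτ
  refine ⟨h₁, h₂, (Submodule.Quotient.eq _).2 ?_⟩
  change P.ch - bottThomForm X τ ∈ exactForms X
  refine mem_exactForms_of_integral_eq_zero (sub_mem h₁ h₂) hτ.mem_closedForms
    hτ.integral_eq_one fun x => ?_
  rw [integralForm_sub h₁.1 h₂.1, integralForm_ch hX P h₁, integralForm_bottThomForm hτ, sub_self]
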